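/- Let $\alpha,\beta,\gamma,\delta\in\mathbb{R}$ with $\gamma\neq 0$ and $T>0$. Let $\mathcal{H}$ be the Hilbert transform on $L^2(\mathbb{R})$ (Fourier multiplier $-i\,\mathrm{sgn}\,\xi$), and let $u$ be a classical solution on $[0,T]\times\mathbb{R}$ of the Benjamin equation $$u_t=-\partial_x\bigl(\alpha u+\beta\mathcal{H}[u_x]-\gamma u_{xx}+\delta u^2\bigr),\qquad u(0)=u_0 .$$ *The scheme.* Fix $\ell>0$ and $n=2p-1$, $p\in\mathbb{N}$. For $k\ge 0$ let $\phi_{2k}$ and $\phi_{2k+1}$ be $\sqrt2$ times the real and the imaginary part of $\sqrt{2\ell/\pi}\,(\ell+2ix)^k/(\ell-2ix)^{k+1}$ (the Malmquist–Takenaka–Christov functions, orthonormal in $L^2(\mathbb{R})$). Put $\mathbb{P}_n=\mathrm{span}\{\phi_0,\dots,\phi_n\}$; let $\mathcal{P}_n$ be the $L^2$-orthogonal projection onto $\mathbb{P}_n$, let $\mathcal{J}_n=-\mathcal{P}_n\partial_x\mathcal{P}_n$, and let $\mathcal{I}_n[f]\in\mathbb{P}_n$ be the interpolant of $f$ at the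 nodes $x_i=\frac{\ell}{2}\tan\frac{\pi(2i+1-2p)}{4p}$, $0\le i\le 2p-1$. The numerical solution $\bar u:[0,T]\to\mathbb{P}_n$ is the solution of $$\bar u_t=\mathcal{J}_n\nabla\mathcal{G}_n(\bar u),\quad \bar u(0)=\mathcal{I}_n[u_0],\qquad \mathcal{G}_n(\bar u)=\tfrac12\int_{\mathbb{R}}\Bigl(\alpha|\bar u|^2-\beta\bar u\,\mathcal{H}[\mathcal{J}_n\bar u]+\gamma|\mathcal{J}_n\bar u|^2+\tfrac{2\delta}{3}\bar u\,\mathcal{I}_n[\bar u^2]\Bigr)dx,$$ where $\nabla$ is the gradient on $\mathbb{P}_n$ with respect to the $L^2(\mathbb{R})$ inner product. *The spaces.* $H^s_{r}(\mathbb{R})$ is the weighted Sobolev space with norm $\|(1+x^2)^{r/2}w\|_{H^s(\mathbb{R})}$. The result holds both with $X^s=H^s_{2s}(\mathbb{R})$ and with the larger space $X^s$ in which the same regularity is imposed on positive and on negative frequencies separately, i.e. with $\|f\|_{X^s}=\inf\bigl(\|w_1\|_{H^s_{2s}}+\|w_2\|_{H^s_{2s}}\bigr)$ over all $w_1,w_2$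 with $\hat w_1=\hat f$ on $(0,\infty)$ and $\hat w_2=\hat f$ on $(-\infty,0)$. (i) Let $s>\frac{11}{4}$ and $\epsilon>0$. For every $M$ there is a constant $c>0$, depending only on $T,\alpha,\beta,\gamma,\delta,s,\epsilon$ and $M$, and for every $\ell>0$ there is an $N$, depending on these and on $\ell$, such that for all $p\ge N$, $n=2p-1$, and every $u$ with $\|u\|_{L^\infty([0,T],X^s)}\le M$ and $\|u_t\|_{L^\infty([0,T],X^s)}\le M$, the numerical solution $\bar u$ exists on $[0,T]$ and $$\|u-\bar u\|_{L^\infty([0,T],L^2(\mathbb{R}))}\le c\Bigl(\frac{\ell n}{2}\Bigr)^{\frac52+\epsilon-s}\Bigl(\|u_0\|_{X^s}+\|u_0\|_{X^s}^{5/3}+\|u\|_{H^1([0,T],X^s)}\Bigr).$$ (ii) If $u,u_t\in L^\infty([0,T],X^s)$ for every $s>\frac{11}{4}$, then for each fixed $\ell>0$ the convergence is spectral: $n^k\,\|u-\bar u\|_{L^\infty([0,T],L^2(\mathbb{R}))}\to 0$ as $n=2p-1\to\infty$, for every $k\in\mathbb{N}$. -/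

import Mathlib

open MeasureTheory Set Filter Topology
open scoped ENNReal FourierTransform

noncomputable section

namespace Benjamin

/-! ### Fourier transform on `L²(ℝ)`, Hilbert transform, weighted Sobolev norms -/

open scoped Classical in
/-- (A representative of) the Fourier–Plancherel transform of `f ∈ L²(ℝ)`, with the kernel
`exp (-2 π i x ξ)`; it is set to zero if `f ∉ L²(ℝ)`. -/
def fourierL2 (f : ℝ → ℂ) : ℝ → ℂ :=
  if h : MemLp f 2 volume then ⇑(𝓕 (h.toLp f) : Lp ℂ 2 (volume : Measure ℝ)) else 0

open scoped Classical in
/-- (A representative of) the inverse Fourier–Plancherel transform of `f ∈ L²(ℝ)`; it is set to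
zero if `f ∉ L²(ℝ)`. -/
def fourierInvL2 (f : ℝ → ℂ) : ℝ → ℂ :=
  if h : MemLp f 2 volume then ⇑(𝓕⁻ (h.toLp f) : Lp ℂ 2 (volume : Measure ℝ)) else 0

/-- (A representative of) the Hilbert transform of a real function `f ∈ L²(ℝ)`: the Fourier
multiplier with symbol `-i sgn ξ`. It maps real functions to real functions. -/
def hilbert (f : ℝ → ℝ) : ℝ → ℝ := fun x =>
  (fourierInvL2 (fun ξ => -Complex.I * ((Real.sign ξ : ℝ) : ℂ) *
    fourierL2 (fun y => ((f y : ℝ) : ℂ)) ξ) x).re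

/-- `h` is a representative of the Hilbert transform of `f ∈ L²(ℝ)`. -/
def IsHilbertTransform (f h : ℝ → ℝ) : Prop :=
  MemLp f 2 volume ∧ h =ᵐ[volume] hilbert f

open scoped Classical in
/-- The norm of `H^s(ℝ)`, `‖(1 - ∂ₓ²)^{s/2} g‖_{L²}`, with the value `∞` outside `L²(ℝ)`. -/
def sobolevNorm (s : ℝ) (g : ℝ → ℂ) : ℝ≥0∞ :=
  if MemLp g 2 volume then
    (∫⁻ ξ : ℝ, ENNReal.ofReal ((1 + (2 * Real.pi * ξ) ^ 2) ^ s) * ‖fourierL2 g ξ‖ₑ ^ 2)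
      ^ (1 / 2 : ℝ)
  else ⊤

/-- The weighted Sobolev norm `‖(1 + x²)^{r/2} w‖_{H^s(ℝ)}` of a complex function. -/
def weightedSobolevNormC (s r : ℝ) (w : ℝ → ℂ) : ℝ≥0∞ :=
  sobolevNorm s (fun x => (((1 + x ^ 2) ^ (r / 2) : ℝ) : ℂ) * w x)

/-- The norm of the weighted Sobolev space `H^s_r(ℝ)`: `s` derivatives, weight `(1 + x²)^{r/2}`. -/
def weightedSobolevNorm (s r : ℝ) (f : ℝ → ℝ) : ℝ≥0∞ :=
  weightedSobolevNormC s r (fun x => ((f x : ℝ) : ℂ))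

/-- The same norm imposed separately on the positive and on the negative frequencies, as a
restriction (quotient) norm: the infimum of `‖w₁‖ + ‖w₂‖` (norms of `H^s_r(ℝ)`) over all `w₁`,
`w₂` whose Fourier transforms agree with that of `f` on `(0, ∞)` and on `(-∞, 0)`, respectively.
It never exceeds twice the norm of `H^s_r(ℝ)` (take `w₁ = w₂ = f`), and it does not require the
Fourier transform of `f` to be smooth across the origin. -/
def hardyWeightedSobolevNorm (s r : ℝ) (f : ℝ → ℝ) : ℝ≥0∞ :=
  ⨅ (w₁ : ℝ → ℂ) (w₂ : ℝ → ℂ)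
    (_ : MemLp f 2 volume ∧ ∀ᵐ ξ : ℝ,
      (0 < ξ → fourierL2 (fun x => ((f x : ℝ) : ℂ)) ξ = fourierL2 w₁ ξ) ∧
      (ξ < 0 → fourierL2 (fun x => ((f x : ℝ) : ℂ)) ξ = fourierL2 w₂ ξ)),
    weightedSobolevNormC s r w₁ + weightedSobolevNormC s r w₂

/-! ### Norms of functions of time and space

`X` is the (extended-valued) norm in the space variable; `u t x` is the value at time `t`. -/

/-- The norm of `L^∞([0,T], X)`. -/
def normLinfty (T : ℝ) (X : (ℝ → ℝ) → ℝ≥0∞) (u : ℝ → ℝ → ℝ) : ℝ≥0∞ :=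
  essSup (fun t => X (u t)) (volume.restrict (Icc 0 T))

/-- The norm of `H¹([0,T], X)` of a function `u` with time derivative `v`. -/
def normH1 (T : ℝ) (X : (ℝ → ℝ) → ℝ≥0∞) (u v : ℝ → ℝ → ℝ) : ℝ≥0∞ :=
  (∫⁻ t in Icc 0 T, (X (u t) ^ 2 + X (v t) ^ 2)) ^ (1 / 2 : ℝ)

/-- The norm of `L²(ℝ)`. -/
def normL2 (f : ℝ → ℝ) : ℝ≥0∞ := eLpNorm f 2 volume

/-! ### The Benjamin equation -/

/-- `u` is a classical solution on `[0,T]`, with time derivative `v = u_t`, of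
`u_t = -∂ₓ (α u + β H[u_x] - γ u_xx + δ u²)`. The expression in brackets is the `L²`-gradient of
`½ ∫ (α u² + β u H[u_x] + γ u_x² + (2δ/3) u³) dx`. -/
structure IsClassicalSolution (α β γ δ T : ℝ) (u v : ℝ → ℝ → ℝ) : Prop where
  contDiff : ∀ t ∈ Icc 0 T, ContDiff ℝ 2 (u t)
  time_deriv : ∀ t ∈ Icc 0 T, ∀ x,
    HasDerivWithinAt (fun τ => u τ x) (v t x) (Icc 0 T) t
  equation : ∀ t ∈ Icc 0 T, ∃ h : ℝ → ℝ, IsHilbertTransform (deriv (u t)) h ∧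
    ∀ x, HasDerivAt
      (fun y => α * u t y + β * h y - γ * deriv (deriv (u t)) y + δ * (u t y) ^ 2)
      (-(v t x)) x

/-! ### Malmquist–Takenaka–Christov functions and the collocation scheme

Throughout `ℓ > 0` is the scaling parameter and `n = 2 p - 1`, so that the indices `0, …, n` are
the natural numbers below `2 p`. -/

/-- The complex Malmquist–Takenaka functions. -/
def mtcComplex (ℓ : ℝ) (k : ℕ) (x : ℝ) : ℂ :=
  ((Real.sqrt (2 * ℓ / Real.pi) : ℝ) : ℂ) *
    ((ℓ : ℂ) + 2 * Complex.I * (x : ℂ)) ^ k / ((ℓ : ℂ) - 2 * Complex.I * (x : ℂ)) ^ (k + 1)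

/-- The real MTC (Christov) functions `φ_{2k}` and `φ_{2k+1}`, orthonormal in `L²(ℝ)`. -/
def mtc (ℓ : ℝ) (m : ℕ) (x : ℝ) : ℝ :=
  Real.sqrt 2 *
    (if Even m then (mtcComplex ℓ (m / 2) x).re else (mtcComplex ℓ (m / 2) x).im)

/-- The space `ℙ_n = span {φ_0, …, φ_n}`, `n = 2 p - 1`. -/
def mtcSpace (ℓ : ℝ) (p : ℕ) : Submodule ℝ (ℝ → ℝ) :=
  Submodule.span ℝ (range fun k : Fin (2 * p) => mtc ℓ (k : ℕ))

/-- The inner product of `L²(ℝ)`. -/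
def innerL2 (f g : ℝ → ℝ) : ℝ := ∫ x, f x * g x

/-- The orthogonal projection `𝒫_n` onto `ℙ_n`. -/
def proj (ℓ : ℝ) (p : ℕ) (f : ℝ → ℝ) : ℝ → ℝ := fun x =>
  ∑ k ∈ Finset.range (2 * p), innerL2 f (mtc ℓ k) * mtc ℓ k x

/-- The collocation nodes `x_i`, `0 ≤ i ≤ 2 p - 1`: images of `2 p` equally spaced points of the
circle under `θ ↦ (ℓ/2) tan (θ/2)`. -/
def node (ℓ : ℝ) (p : ℕ) (i : Fin (2 * p)) : ℝ :=
  ℓ / 2 * Real.tan (Real.pi * (2 * ((i : ℕ) : ℝ) + 1 - 2 * (p : ℝ)) / (4 * (p : ℝ)))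

/-- The interpolation operator `ℐ_n`: the element of `ℙ_n` that agrees with `f` at all nodes. -/
def interp (ℓ : ℝ) (p : ℕ) (f : ℝ → ℝ) : ℝ → ℝ :=
  Classical.epsilon fun g : ℝ → ℝ =>
    g ∈ mtcSpace ℓ p ∧ ∀ i : Fin (2 * p), g (node ℓ p i) = f (node ℓ p i)

/-- `𝒥_n = -𝒫_n ∂ₓ 𝒫_n`. -/
def discreteJ (ℓ : ℝ) (p : ℕ) (w : ℝ → ℝ) : ℝ → ℝ :=
  -proj ℓ p (deriv (proj ℓ p w))

/-- The semi-discrete Hamiltonian `𝒢_n`. -/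
def discreteG (ℓ : ℝ) (p : ℕ) (α β γ δ : ℝ) (w : ℝ → ℝ) : ℝ :=
  1 / 2 * ∫ x, (α * (w x) ^ 2 - β * w x * hilbert (discreteJ ℓ p w) x
    + γ * (discreteJ ℓ p w x) ^ 2
    + 2 * δ / 3 * w x * interp ℓ p (fun y => (w y) ^ 2) x)

/-- `g` is the gradient at `w` of a functional `G` on `ℙ_n`, with respect to the inner product of
`L²(ℝ)`. -/
def IsGradientAt (ℓ : ℝ) (p : ℕ) (G : (ℝ → ℝ) → ℝ) (w g : ℝ → ℝ) : Prop :=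
  g ∈ mtcSpace ℓ p ∧ ∀ z ∈ mtcSpace ℓ p,
    HasDerivAt (fun τ : ℝ => G (w + τ • z)) (innerL2 g z) 0

/-- `ubar : [0,T] → ℙ_n` solves `ubar_t = 𝒥_n ∇𝒢_n(ubar)`, `ubar(0) = ℐ_n[u₀]`. -/
structure IsCollocationSolution (ℓ : ℝ) (p : ℕ) (α β γ δ T : ℝ) (u₀ : ℝ → ℝ)
    (ubar : ℝ → ℝ → ℝ) : Prop where
  mem : ∀ t ∈ Icc 0 T, ubar t ∈ mtcSpace ℓ p
  initial : ubar 0 = interp ℓ p u₀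
  equation : ∀ t ∈ Icc 0 T, ∃ g : ℝ → ℝ,
    IsGradientAt ℓ p (discreteG ℓ p α β γ δ) (ubar t) g ∧
    ∀ x, HasDerivWithinAt (fun τ => ubar τ x) (discreteJ ℓ p g x) (Icc 0 T) t

end Benjamin

end

/-! The substitution x = (ℓ/2) tan(θ/2) turns the functions `psi` into the characters e^{ikθ} times
one fixed factor. Everything about the basis follows from this: Parseval's identity, products that
involve only two indices (`psi_mul_psi`), a derivative that is a tridiagonal skew matrix with
entries of size k (`dseq`), and exact quadrature at the nodes, which are equally spaced in θ
(`sum_qweight_psi`). For k ≥ 0 the function ψ_k has only positive frequencies, and conjugation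
exchanges k and -k-1. So a real function is encoded by its coefficients with k ≥ 0, on which the
Hilbert transform is multiplication by -i (`rcoef_hilbert`). The scheme thus becomes a Hamiltonian
ordinary differential equation in ℂ^p (`hamSystem`, `isGradientAt_iff`), and the Benjamin equation
an infinite system of the same shape (`rcoef_eq_neg_dseq_flux`).

Decay. The generator of the rotations in θ is a first order operator whose leading coefficient grows
like 1 + x², and it multiplies the k-th coefficient by i(k+1). One power of k therefore costs one
derivative and the weight 1 + x². For integer s this bounds Σ (1+k)^{2s}|a_k|² by the squared norm
of H^s_{2s}; for real s it follows by complex interpolation with the three lines theorem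
(`exists_sum_coef_le`). Only positive frequencies enter, which admits the larger space
(`exists_sum_rcoef_le`).

Stability. Let w be a cutoff of the exact coefficients at an index of order m, with m comparable to
p, let y be the numerical solution and e = y - w. The increment of the Hamiltonian at w, with its
linear part removed, is a relative energy. It controls ‖De‖² once a multiple of ‖e‖² is added,
because γ ≠ 0, and skewness of D removes the dangerous terms from its time derivative. Gronwall
bounds e by the initial error and the residual, both measured together with one application of D
(`HamSystem.error_le`). The cubic term forces e to stay in a ball of radius of order p^{-1/2}; a
continuity argument keeps it there and also gives existence.

Consistency. The cutoff is so low that squaring it causes no aliasing (`bmul_tr`), so the residual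
consists of commutators of D with the cutoff function. First and second commutators are bounded
because the differences of the cutoff are of order 1/m and 1/m². The worst term contains the second
derivative of the solution in a window of indices of order m. A direct estimate would lose m²; a
local energy estimate uses the equation itself and the bound on u_t to lose only m
(`exists_local_bound`). Hence the residual is of order m^{1-s} (`exists_residual_bound`), as is the
initial interpolation error (`norm_ic_sub_cutoff_le`), and with the extra D the total error is of
order p^{2-s} (`exists_error_bound`). The ball condition needs m^{2-s} ≪ p^{-1/2}, that is s > 5/2.
The claimed rate is weaker by the factor p^{1/2+ε}, which absorbs every constant that depends on ℓ,
on the coefficients or on M. -/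

noncomputable section

namespace Benjamin

open scoped ComplexConjugate
open Complex (I)

/-! ### The complex Malmquist–Takenaka basis -/

/-- The Cayley transform of the real line onto the unit circle. -/
def cayley (ℓ x : ℝ) : ℂ := ((ℓ : ℂ) + 2 * I * (x : ℂ)) / ((ℓ : ℂ) - 2 * I * (x : ℂ))

/-- The normalizing constant of the basis. -/
def psiConst (ℓ : ℝ) : ℝ := Real.sqrt (2 * ℓ / Real.pi)

/-- The Malmquist–Takenaka functions, indexed by all integers. -/
def psi (ℓ : ℝ) (k : ℤ) (x : ℝ) : ℂ :=
  (psiConst ℓ : ℂ) * cayley ℓ x ^ k / ((ℓ : ℂ) - 2 * I * (x : ℂ))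

/-- The coefficients of a function in the Malmquist–Takenaka basis. -/
def coef (ℓ : ℝ) (f : ℝ → ℂ) (k : ℤ) : ℂ := ∫ x, f x * conj (psi ℓ k x)

section basic

variable {ℓ : ℝ}

lemma psiConst_pos (hℓ : 0 < ℓ) : 0 < psiConst ℓ := Real.sqrt_pos.2 (by positivity)

lemma psiConst_sq (hℓ : 0 < ℓ) : psiConst ℓ ^ 2 = 2 * ℓ / Real.pi := Real.sq_sqrt (by positivity)

lemma sub_two_I_ne_zero (hℓ : 0 < ℓ) (x : ℝ) : (ℓ : ℂ) - 2 * I * (x : ℂ) ≠ 0 := by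
  intro h
  have := congrArg Complex.re h
  simp at this
  exact hℓ.ne' this

lemma add_two_I_ne_zero (hℓ : 0 < ℓ) (x : ℝ) : (ℓ : ℂ) + 2 * I * (x : ℂ) ≠ 0 := by
  intro h
  have := congrArg Complex.re h
  simp at this
  exact hℓ.ne' this

lemma cayley_ne_zero (hℓ : 0 < ℓ) (x : ℝ) : cayley ℓ x ≠ 0 :=
  div_ne_zero (add_two_I_ne_zero hℓ x) (sub_two_I_ne_zero hℓ x)

lemma conj_sub_two_I (x : ℝ) :
    conj ((ℓ : ℂ) - 2 * I * (x : ℂ)) = (ℓ : ℂ) + 2 * I * (x : ℂ) := by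
  rw [map_sub, map_mul, map_mul, Complex.conj_ofReal, Complex.conj_ofReal, Complex.conj_I,
    Complex.conj_ofNat]
  ring

lemma conj_add_two_I (x : ℝ) :
    conj ((ℓ : ℂ) + 2 * I * (x : ℂ)) = (ℓ : ℂ) - 2 * I * (x : ℂ) := by
  rw [map_add, map_mul, map_mul, Complex.conj_ofReal, Complex.conj_ofReal, Complex.conj_I,
    Complex.conj_ofNat]
  ring

lemma conj_cayley (x : ℝ) : conj (cayley ℓ x) = (cayley ℓ x)⁻¹ := by
  rw [cayley, map_div₀, conj_sub_two_I, conj_add_two_I, inv_div]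

lemma normSq_sub_two_I (x : ℝ) : ‖(ℓ : ℂ) - 2 * I * (x : ℂ)‖ ^ 2 = ℓ ^ 2 + 4 * x ^ 2 := by
  rw [← Complex.normSq_eq_norm_sq, Complex.normSq_apply]
  simp
  ring

lemma sub_mul_add_two_I (x : ℝ) : ((ℓ : ℂ) - 2 * I * (x : ℂ)) * ((ℓ : ℂ) + 2 * I * (x : ℂ))
    = ((ℓ ^ 2 + 4 * x ^ 2 : ℝ) : ℂ) := by
  push_cast
  linear_combination (-4 * (x : ℂ) ^ 2) * Complex.I_sq

lemma norm_cayley (hℓ : 0 < ℓ) (x : ℝ) : ‖cayley ℓ x‖ = 1 := by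
  rw [cayley, norm_div, ← conj_sub_two_I, Complex.norm_conj, div_self]
  exact norm_ne_zero_iff.2 (sub_two_I_ne_zero hℓ x)

lemma norm_psi_eq (hℓ : 0 < ℓ) (k : ℤ) (x : ℝ) :
    ‖psi ℓ k x‖ = psiConst ℓ / ‖(ℓ : ℂ) - 2 * I * (x : ℂ)‖ := by
  rw [psi, norm_div, norm_mul, norm_zpow, norm_cayley hℓ, one_zpow, mul_one, Complex.norm_real,
    Real.norm_of_nonneg (psiConst_pos hℓ).le]

lemma norm_psi_sq (hℓ : 0 < ℓ) (k : ℤ) (x : ℝ) :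
    ‖psi ℓ k x‖ ^ 2 = 2 * ℓ / Real.pi / (ℓ ^ 2 + 4 * x ^ 2) := by
  rw [norm_psi_eq hℓ, div_pow, psiConst_sq hℓ, normSq_sub_two_I]

lemma norm_psi_le (hℓ : 0 < ℓ) (k : ℤ) (x : ℝ) : ‖psi ℓ k x‖ ≤ psiConst ℓ / ℓ := by
  rw [norm_psi_eq hℓ]
  have : ℓ ≤ ‖(ℓ : ℂ) - 2 * I * (x : ℂ)‖ := by
    refine le_trans ?_ (Complex.re_le_norm _)
    simp
  exact div_le_div_of_nonneg_left (psiConst_pos hℓ).le hℓ this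

/-- On the real line the conjugate of `cayley` is its inverse. The reflection k ↦ -k-1 has no fixed
integer, so for a real function the indices k ≥ 0 carry exactly half of the coefficients and
determine the rest. -/
lemma conj_psi (hℓ : 0 < ℓ) (k : ℤ) (x : ℝ) : conj (psi ℓ k x) = psi ℓ (-k - 1) x := by
  have h1 := sub_two_I_ne_zero hℓ x
  have h2 := add_two_I_ne_zero hℓ x
  rw [psi, psi, map_div₀, map_mul, map_zpow₀, conj_cayley, conj_sub_two_I, Complex.conj_ofReal,
    inv_zpow, ← zpow_neg, zpow_sub₀ (cayley_ne_zero hℓ x), zpow_one]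
  rw [cayley]
  field_simp

lemma mtcComplex_eq_psi (hℓ : 0 < ℓ) (k : ℕ) (x : ℝ) : mtcComplex ℓ k x = psi ℓ k x := by
  have h1 := sub_two_I_ne_zero hℓ x
  rw [mtcComplex, psi, cayley, psiConst, zpow_natCast, div_pow, pow_succ]
  field_simp

lemma one_add_cayley (hℓ : 0 < ℓ) (x : ℝ) : 1 + cayley ℓ x = 2 * ℓ / ((ℓ : ℂ) - 2 * I * (x : ℂ)) := by
  have h1 := sub_two_I_ne_zero hℓ x
  rw [cayley]
  field_simp
  ring

/-- The product has the denominator twice; by `one_add_cayley` one copy of 1/(ℓ - 2ix) is (1 +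
`cayley`)/(2ℓ), which splits into two neighbouring powers. -/
lemma psi_mul_psi (hℓ : 0 < ℓ) (j k : ℤ) (x : ℝ) : psi ℓ j x * psi ℓ k x =
    ((psiConst ℓ / (2 * ℓ) : ℝ) : ℂ) * (psi ℓ (j + k) x + psi ℓ (j + k + 1) x) := by
  have h1 := sub_two_I_ne_zero hℓ x
  have h2 : (ℓ : ℂ) ≠ 0 := by exact_mod_cast hℓ.ne'
  have h3 := one_add_cayley hℓ x
  have hc := cayley_ne_zero hℓ x
  simp only [psi]
  rw [zpow_add₀ hc, zpow_add₀ hc, zpow_add₀ hc, zpow_one]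
  have : (ℓ : ℂ) - 2 * I * (x : ℂ) = 2 * ℓ / (1 + cayley ℓ x) := by
    rw [h3]; field_simp
  have h4 : (1 + cayley ℓ x) ≠ 0 := by rw [h3]; exact div_ne_zero (mul_ne_zero two_ne_zero h2) h1
  rw [this]
  push_cast
  field_simp

lemma hasDerivAt_cayley (hℓ : 0 < ℓ) (x : ℝ) :
    HasDerivAt (cayley ℓ) (4 * I * ℓ / ((ℓ : ℂ) - 2 * I * (x : ℂ)) ^ 2) x := by
  have h1 := sub_two_I_ne_zero hℓ x
  have hx : HasDerivAt (fun y : ℝ => (y : ℂ)) 1 x := Complex.ofRealCLM.hasDerivAt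
  have hn : HasDerivAt (fun y : ℝ => (ℓ : ℂ) + 2 * I * (y : ℂ)) (2 * I) x := by
    simpa using (hx.const_mul (2 * I)).const_add (ℓ : ℂ)
  have hd : HasDerivAt (fun y : ℝ => (ℓ : ℂ) - 2 * I * (y : ℂ)) (-(2 * I)) x := by
    simpa using (hx.const_mul (2 * I)).const_sub (ℓ : ℂ)
  refine (hn.div hd h1).congr_deriv ?_
  congr 1
  ring

/-- In the angle, ∂ₓ is multiplication by a trigonometric polynomial of degree one composed with
∂_θ; hence three neighbouring indices. The coefficients of ψ_{k+1} and ψ_{k-1} vanish at k = -1 and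
k = 0, so nonnegative and negative indices do not mix. -/
lemma hasDerivAt_psi (hℓ : 0 < ℓ) (k : ℤ) (x : ℝ) : HasDerivAt (psi ℓ k)
    (I / ℓ * ((2 * k + 1) * psi ℓ k x + (k + 1) * psi ℓ (k + 1) x + k * psi ℓ (k - 1) x)) x := by
  have h1 := sub_two_I_ne_zero hℓ x
  have h1' := add_two_I_ne_zero hℓ x
  have h2 : (ℓ : ℂ) ≠ 0 := by exact_mod_cast hℓ.ne'
  have hx : HasDerivAt (fun y : ℝ => (y : ℂ)) 1 x := Complex.ofRealCLM.hasDerivAt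
  have hd : HasDerivAt (fun y : ℝ => (ℓ : ℂ) - 2 * I * (y : ℂ)) (-(2 * I)) x := by
    simpa using (hx.const_mul (2 * I)).const_sub (ℓ : ℂ)
  have hc := cayley_ne_zero hℓ x
  have hz : HasDerivAt (fun y => cayley ℓ y ^ k)
      (k * cayley ℓ x ^ (k - 1) * (4 * I * ℓ / ((ℓ : ℂ) - 2 * I * (x : ℂ)) ^ 2)) x :=
    (hasDerivAt_zpow k (cayley ℓ x) (Or.inl hc)).comp x (hasDerivAt_cayley hℓ x)
  refine ((hz.const_mul (psiConst ℓ : ℂ)).div hd h1).congr_deriv ?_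
  have e1 : cayley ℓ x ^ k = cayley ℓ x ^ (k - 1) * cayley ℓ x := by
    rw [← zpow_add_one₀ hc]; congr 1; ring
  have e2 : cayley ℓ x ^ (k + 1) = cayley ℓ x ^ (k - 1) * cayley ℓ x ^ 2 := by
    rw [← zpow_natCast, ← zpow_add₀ hc]; congr 1; push_cast; ring
  simp only [psi]
  rw [e1, e2]
  generalize cayley ℓ x ^ (k - 1) = Z
  rw [cayley]
  field_simp
  ring

lemma continuous_psi (hℓ : 0 < ℓ) (k : ℤ) : Continuous (psi ℓ k) :=
  continuous_iff_continuousAt.2 fun x => (hasDerivAt_psi hℓ k x).continuousAt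

lemma integrable_norm_psi_sq (hℓ : 0 < ℓ) (k : ℤ) : Integrable fun x => ‖psi ℓ k x‖ ^ 2 := by
  have h : Integrable fun x : ℝ => (1 + ((2 / ℓ) * x) ^ 2)⁻¹ :=
    integrable_inv_one_add_sq.comp_mul_left' (by positivity)
  refine (h.const_mul (2 / (Real.pi * ℓ))).congr (ae_of_all _ fun x => ?_)
  simp only [norm_psi_sq hℓ]
  have : ℓ ^ 2 + 4 * x ^ 2 ≠ 0 := by positivity
  have : 1 + ((2 / ℓ) * x) ^ 2 ≠ 0 := by positivity
  field_simp
  ring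

lemma memLp_psi (hℓ : 0 < ℓ) (k : ℤ) : MemLp (psi ℓ k) 2 volume :=
  (memLp_two_iff_integrable_sq_norm (continuous_psi hℓ k).aestronglyMeasurable).2
    (integrable_norm_psi_sq hℓ k)

lemma memLp_conj_psi (hℓ : 0 < ℓ) (k : ℤ) : MemLp (fun x => conj (psi ℓ k x)) 2 volume := by
  simpa only [conj_psi hℓ] using memLp_psi hℓ (-k - 1)

lemma integrable_mul_conj_psi (hℓ : 0 < ℓ) {f : ℝ → ℂ} (hf : MemLp f 2 volume) (k : ℤ) :
    Integrable fun x => f x * conj (psi ℓ k x) :=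
  hf.integrable_mul (memLp_conj_psi hℓ k)

end basic

/-! ### Parseval's identity -/

section parseval

variable {ℓ : ℝ}

/-- The parametrization of the line by the angle on the circle. -/
def lineOfAngle (ℓ θ : ℝ) : ℝ := ℓ / 2 * Real.tan (θ / 2)


lemma cos_half_pos {θ : ℝ} (h : θ ∈ Ioo (-Real.pi) Real.pi) : 0 < Real.cos (θ / 2) :=
  Real.cos_pos_of_mem_Ioo ⟨by linarith [h.1], by linarith [h.2]⟩

lemma weight_lineOfAngle {θ : ℝ} (h : Real.cos (θ / 2) ≠ 0) :
    ℓ ^ 2 + 4 * lineOfAngle ℓ θ ^ 2 = ℓ ^ 2 / Real.cos (θ / 2) ^ 2 := by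
  rw [lineOfAngle, Real.tan_eq_sin_div_cos]
  field_simp
  nlinarith [Real.sin_sq_add_cos_sq (θ / 2)]

lemma hasDerivAt_lineOfAngle (hℓ : 0 < ℓ) {θ : ℝ} (h : Real.cos (θ / 2) ≠ 0) :
    HasDerivAt (lineOfAngle ℓ) ((ℓ ^ 2 + 4 * lineOfAngle ℓ θ ^ 2) / (4 * ℓ)) θ := by
  have h1 : HasDerivAt (fun t : ℝ => t / 2) (1 / 2) θ := (hasDerivAt_id θ).div_const 2
  have := ((Real.hasDerivAt_tan h).comp θ h1).const_mul (ℓ / 2)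
  rw [weight_lineOfAngle h]
  refine this.congr_deriv ?_
  field_simp
  norm_num

/-- Up to the common factor ℓ / cos(θ/2), the numerator and the denominator of `cayley` are e^{iθ/2}
and e^{-iθ/2}. -/
lemma cayley_lineOfAngle (hℓ : 0 < ℓ) {θ : ℝ} (h : Real.cos (θ / 2) ≠ 0) :
    cayley ℓ (lineOfAngle ℓ θ) = Complex.exp (θ * I) := by
  have h1 := sub_two_I_ne_zero hℓ (lineOfAngle ℓ θ)
  have hl : (ℓ : ℂ) ≠ 0 := by exact_mod_cast hℓ.ne'
  have hc : Complex.cos (θ / 2) ≠ 0 := by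
    have : ((Real.cos (θ / 2) : ℝ) : ℂ) ≠ 0 := by exact_mod_cast h
    simpa using this
  have e : Complex.exp (θ * I) = Complex.exp ((θ / 2 : ℂ) * I) / Complex.exp (-(θ / 2 : ℂ) * I) := by
    rw [← Complex.exp_sub]; congr 1; ring
  have h2 : Complex.exp (-(θ / 2 : ℂ) * I) ≠ 0 := Complex.exp_ne_zero _
  rw [cayley, e, div_eq_div_iff h1 h2, Complex.exp_mul_I, Complex.exp_mul_I, lineOfAngle,
    Real.tan_eq_sin_div_cos]
  push_cast
  rw [Complex.cos_neg, Complex.sin_neg]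
  field_simp
  ring

lemma injOn_lineOfAngle (hℓ : 0 < ℓ) : InjOn (lineOfAngle ℓ) (Ioo (-Real.pi) Real.pi) := by
  intro a ha b hb hab
  have : Real.tan (a / 2) = Real.tan (b / 2) := mul_left_cancel₀ (by positivity) hab
  have := Real.injOn_tan ⟨by linarith [ha.1], by linarith [ha.2]⟩
    ⟨by linarith [hb.1], by linarith [hb.2]⟩ this
  linarith

lemma image_lineOfAngle (hℓ : 0 < ℓ) : lineOfAngle ℓ '' Ioo (-Real.pi) Real.pi = univ := by
  refine eq_univ_of_forall fun y => ⟨2 * Real.arctan (2 / ℓ * y), ⟨?_, ?_⟩, ?_⟩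
  · linarith [Real.neg_pi_div_two_lt_arctan (2 / ℓ * y)]
  · linarith [Real.arctan_lt_pi_div_two (2 / ℓ * y)]
  · rw [lineOfAngle, mul_div_cancel_left₀ _ two_ne_zero, Real.tan_arctan]
    field_simp

lemma integral_eq_integral_angle (hℓ : 0 < ℓ) {F : Type*} [NormedAddCommGroup F] [NormedSpace ℝ F] (g : ℝ → F) :
    ∫ x, g x = ∫ θ in Ioo (-Real.pi) Real.pi,
      ((ℓ ^ 2 + 4 * lineOfAngle ℓ θ ^ 2) / (4 * ℓ)) • g (lineOfAngle ℓ θ) := by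
  have := integral_image_eq_integral_abs_deriv_smul measurableSet_Ioo
    (fun θ hθ => (hasDerivAt_lineOfAngle hℓ (cos_half_pos hθ).ne').hasDerivWithinAt)
    (injOn_lineOfAngle hℓ) g
  rw [image_lineOfAngle hℓ, setIntegral_univ] at this
  rw [this]
  congr 1
  ext θ
  rw [abs_of_nonneg (by positivity)]

lemma integrable_iff_integrableOn_angle (hℓ : 0 < ℓ) {F : Type*} [NormedAddCommGroup F] [NormedSpace ℝ F]
    (g : ℝ → F) : Integrable g ↔ IntegrableOn (fun θ =>
      ((ℓ ^ 2 + 4 * lineOfAngle ℓ θ ^ 2) / (4 * ℓ)) • g (lineOfAngle ℓ θ))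
        (Ioo (-Real.pi) Real.pi) := by
  have := integrableOn_image_iff_integrableOn_abs_deriv_smul measurableSet_Ioo
    (fun θ hθ => (hasDerivAt_lineOfAngle hℓ (cos_half_pos hθ).ne').hasDerivWithinAt)
    (injOn_lineOfAngle hℓ) g
  rw [image_lineOfAngle hℓ, integrableOn_univ] at this
  rw [this]
  have e : ∀ θ : ℝ, |(ℓ ^ 2 + 4 * lineOfAngle ℓ θ ^ 2) / (4 * ℓ)|
      = (ℓ ^ 2 + 4 * lineOfAngle ℓ θ ^ 2) / (4 * ℓ) := fun θ => abs_of_nonneg (by positivity)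
  simp only [e]

/-- Parseval's identity for the Malmquist–Takenaka basis. -/
theorem hasSum_norm_sq_coef (hℓ : 0 < ℓ) {f : ℝ → ℂ} (hf : MemLp f 2 volume) :
    HasSum (fun k => ‖coef ℓ f k‖ ^ 2) (∫ x, ‖f x‖ ^ 2) := by
  have hpi : -Real.pi < Real.pi := by linarith [Real.pi_pos]
  -- Since conj ψ_k = e^{-ikθ} conj ψ_0, the k-th coefficient of f is 2π times the k-th Fourier
  -- coefficient of G, the Jacobian times f conj ψ_0. The modulus of ψ_0 is such that |G|² dθ is
  -- |f|² dx / (2π), which reduces the claim to Parseval on the circle.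
  set g : ℝ → ℂ := fun x => f x * conj (psi ℓ 0 x) with hg
  set G : ℝ → ℂ := fun θ =>
    ((ℓ ^ 2 + 4 * lineOfAngle ℓ θ ^ 2) / (4 * ℓ)) • g (lineOfAngle ℓ θ) with hG
  have hGi : IntegrableOn G (Ioo (-Real.pi) Real.pi) :=
    (integrable_iff_integrableOn_angle hℓ g).1 (integrable_mul_conj_psi hℓ hf 0)
  have hsq : ∀ θ, ‖G θ‖ ^ 2 = (1 / (2 * Real.pi)) *
      (((ℓ ^ 2 + 4 * lineOfAngle ℓ θ ^ 2) / (4 * ℓ)) • ‖f (lineOfAngle ℓ θ)‖ ^ 2) := by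
    intro θ
    have h0 : ℓ ^ 2 + 4 * lineOfAngle ℓ θ ^ 2 ≠ 0 := by positivity
    simp only [hG, hg]
    rw [norm_smul, norm_mul, Complex.norm_conj, mul_pow, mul_pow, norm_psi_sq hℓ,
      Real.norm_of_nonneg (by positivity), smul_eq_mul]
    field_simp
    ring
  have hGi2 : IntegrableOn (fun θ => ‖G θ‖ ^ 2) (Ioo (-Real.pi) Real.pi) := by
    have := (integrable_iff_integrableOn_angle hℓ (fun x => ‖f x‖ ^ 2)).1
      ((memLp_two_iff_integrable_sq_norm hf.1).1 hf)
    simp only [hsq]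
    exact this.const_mul _
  have hmem : MemLp G 2 (volume.restrict (Ioc (-Real.pi) Real.pi)) := by
    rw [← restrict_Ioo_eq_restrict_Ioc]
    exact (memLp_two_iff_integrable_sq_norm hGi.aestronglyMeasurable).2 hGi2
  have hsum := (hasSum_sq_fourierCoeffOn hpi hmem).mul_left ((2 * Real.pi) ^ 2)
  have hco : ∀ k : ℤ, coef ℓ f k = (2 * Real.pi : ℝ) • fourierCoeffOn hpi G k := by
    intro k
    rw [fourierCoeffOn_eq_integral, smul_smul, sub_neg_eq_add, ← two_mul,
      mul_one_div_cancel (by positivity), one_smul, intervalIntegral.integral_of_le hpi.le,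
      ← restrict_Ioo_eq_restrict_Ioc, coef, integral_eq_integral_angle hℓ]
    refine setIntegral_congr_fun measurableSet_Ioo fun θ hθ => ?_
    simp only [hG, hg, fourier_coe_apply, smul_eq_mul, mul_smul_comm]
    congr 1
    rw [conj_psi hℓ, conj_psi hℓ, psi, psi, cayley_lineOfAngle hℓ (cos_half_pos hθ).ne',
      ← Complex.exp_int_mul, ← Complex.exp_int_mul]
    have : Complex.exp (((-k - 1 : ℤ) : ℂ) * (θ * I)) =
        Complex.exp (2 * Real.pi * I * ((-k : ℤ) : ℂ) * θ / ((Real.pi - -Real.pi : ℝ) : ℂ)) *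
        Complex.exp (((-0 - 1 : ℤ) : ℂ) * (θ * I)) := by
      rw [← Complex.exp_add]
      congr 1
      have : (Real.pi : ℂ) ≠ 0 := by exact_mod_cast Real.pi_ne_zero
      push_cast
      field_simp
      ring
    rw [this]
    ring_nf
  have e1 : (fun k => ‖coef ℓ f k‖ ^ 2)
      = fun k => (2 * Real.pi) ^ 2 * ‖fourierCoeffOn hpi G k‖ ^ 2 := by
    ext k
    rw [hco, norm_smul, mul_pow, Real.norm_of_nonneg (by positivity)]
  have e2 : ∫ x, ‖f x‖ ^ 2 = (2 * Real.pi) ^ 2 *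
      (Real.pi - -Real.pi)⁻¹ • ∫ x in -Real.pi..Real.pi, ‖G x‖ ^ 2 := by
    rw [intervalIntegral.integral_of_le hpi.le, ← restrict_Ioo_eq_restrict_Ioc,
      integral_eq_integral_angle hℓ]
    simp only [hsq]
    rw [integral_const_mul, smul_eq_mul]
    field_simp
    ring
  rw [e1, e2]
  exact hsum

end parseval

end Benjamin
end

noncomputable section

namespace Benjamin

open scoped ComplexConjugate
open Complex (I)

/-! ### Expansions in the Malmquist–Takenaka basis -/

section expansion

variable {ℓ : ℝ}

lemma coef_psi (hℓ : 0 < ℓ) (j k : ℤ) : coef ℓ (psi ℓ j) k = if j = k then 1 else 0 := by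
  have hpi : -Real.pi < Real.pi := by linarith [Real.pi_pos]
  have hpi0 : (Real.pi : ℂ) ≠ 0 := by exact_mod_cast Real.pi_ne_zero
  have key : coef ℓ (psi ℓ j) k
      = ∫ θ in -Real.pi..Real.pi, (1 / (2 * Real.pi) : ℂ) * Complex.exp ((I * (j - k : ℤ)) * θ) := by
    rw [intervalIntegral.integral_of_le hpi.le, ← restrict_Ioo_eq_restrict_Ioc, coef,
      integral_eq_integral_angle hℓ]
    refine setIntegral_congr_fun measurableSet_Ioo fun θ hθ => ?_
    have hc := cayley_ne_zero hℓ (lineOfAngle ℓ θ)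
    have h0 : ((ℓ ^ 2 + 4 * lineOfAngle ℓ θ ^ 2 : ℝ) : ℂ) ≠ 0 := by
      have : 0 < ℓ ^ 2 + 4 * lineOfAngle ℓ θ ^ 2 := by positivity
      exact_mod_cast this.ne'
    have h1 := sub_mul_add_two_I (ℓ := ℓ) (lineOfAngle ℓ θ)
    have h2 := sub_two_I_ne_zero hℓ (lineOfAngle ℓ θ)
    have h3 := add_two_I_ne_zero hℓ (lineOfAngle ℓ θ)
    have hl : (ℓ : ℂ) ≠ 0 := by exact_mod_cast hℓ.ne'
    have hcs : (psiConst ℓ : ℂ) ^ 2 = 2 * ℓ / Real.pi := by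
      rw [← Complex.ofReal_pow, psiConst_sq hℓ]; push_cast; ring
    have hexp : Complex.exp ((I * (j - k : ℤ)) * θ)
        = cayley ℓ (lineOfAngle ℓ θ) ^ j * (cayley ℓ (lineOfAngle ℓ θ))⁻¹ ^ k := by
      rw [inv_zpow, ← zpow_neg, ← zpow_add₀ hc, cayley_lineOfAngle hℓ (cos_half_pos hθ).ne',
        ← Complex.exp_int_mul]
      congr 1
      push_cast
      ring
    simp only [psi, map_div₀, map_mul, map_zpow₀, conj_cayley, conj_sub_two_I,
      Complex.conj_ofReal]
    rw [hexp, Complex.real_smul]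
    have e : ∀ A B : ℂ, ((psiConst ℓ : ℂ) * A / ((ℓ : ℂ) - 2 * I * (lineOfAngle ℓ θ : ℂ))) *
        ((psiConst ℓ : ℂ) * B / ((ℓ : ℂ) + 2 * I * (lineOfAngle ℓ θ : ℂ)))
        = (psiConst ℓ : ℂ) ^ 2 * (A * B) / ((ℓ ^ 2 + 4 * lineOfAngle ℓ θ ^ 2 : ℝ) : ℂ) := by
      intro A B
      rw [← h1]
      field_simp
    rw [e, hcs]
    push_cast at h0 ⊢
    field_simp
    norm_num
  rw [key, intervalIntegral.integral_const_mul]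
  split_ifs with h
  · subst h
    simp
    field_simp
    norm_num
  · have hne : (I * ((j - k : ℤ) : ℂ)) ≠ 0 :=
      mul_ne_zero Complex.I_ne_zero (by exact_mod_cast sub_ne_zero.2 h)
    rw [integral_exp_mul_complex hne]
    have : Complex.exp (I * ((j - k : ℤ) : ℂ) * (Real.pi : ℂ))
        = Complex.exp (I * ((j - k : ℤ) : ℂ) * ((-Real.pi : ℝ) : ℂ)) := by
      rw [Complex.exp_eq_exp_iff_exists_int]
      refine ⟨j - k, ?_⟩
      push_cast
      ring
    rw [this, sub_self, zero_div, mul_zero]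

lemma coef_add (hℓ : 0 < ℓ) {f g : ℝ → ℂ} (hf : MemLp f 2 volume) (hg : MemLp g 2 volume) (k : ℤ) :
    coef ℓ (fun x => f x + g x) k = coef ℓ f k + coef ℓ g k := by
  simp only [coef, add_mul]
  exact integral_add (integrable_mul_conj_psi hℓ hf k) (integrable_mul_conj_psi hℓ hg k)

lemma coef_sub (hℓ : 0 < ℓ) {f g : ℝ → ℂ} (hf : MemLp f 2 volume) (hg : MemLp g 2 volume) (k : ℤ) :
    coef ℓ (fun x => f x - g x) k = coef ℓ f k - coef ℓ g k := by
  simp only [coef, sub_mul]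
  exact integral_sub (integrable_mul_conj_psi hℓ hf k) (integrable_mul_conj_psi hℓ hg k)

lemma coef_const_mul (c : ℂ) (f : ℝ → ℂ) (k : ℤ) :
    coef ℓ (fun x => c * f x) k = c * coef ℓ f k := by
  simp only [coef, mul_assoc]
  exact integral_const_mul _ _

lemma coef_conj (hℓ : 0 < ℓ) (f : ℝ → ℂ) (k : ℤ) :
    coef ℓ (fun x => conj (f x)) k = conj (coef ℓ f (-k - 1)) := by
  rw [coef, coef, ← integral_conj]
  congr 1
  ext x
  rw [map_mul, conj_psi hℓ (-k - 1)]
  congr 3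
  ring

lemma coef_congr_ae {f g : ℝ → ℂ} (h : f =ᵐ[volume] g) (k : ℤ) : coef ℓ f k = coef ℓ g k := by
  refine integral_congr_ae ?_
  filter_upwards [h] with x hx
  rw [hx]

/-- The nonnegative coefficients of a real function. -/
def rcoef (ℓ : ℝ) (f : ℝ → ℝ) (k : ℕ) : ℂ := coef ℓ (fun x => (f x : ℂ)) k

/-- The real function with prescribed nonnegative coefficients. -/
def synth (ℓ : ℝ) (a : ℕ → ℂ) (x : ℝ) : ℝ := 2 * (∑' k : ℕ, a k * psi ℓ k x).re

lemma memLp_ofReal {f : ℝ → ℝ} (hf : MemLp f 2 volume) :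
    MemLp (fun x => (f x : ℂ)) 2 volume := hf.ofReal

lemma coef_ofReal_neg (hℓ : 0 < ℓ) (f : ℝ → ℝ) (k : ℤ) :
    coef ℓ (fun x => (f x : ℂ)) (-k - 1) = conj (coef ℓ (fun x => (f x : ℂ)) k) := by
  have := coef_conj hℓ (fun x => (f x : ℂ)) (-k - 1)
  simp only [Complex.conj_ofReal] at this
  rw [this]
  congr 2
  ring

lemma rcoef_add (hℓ : 0 < ℓ) {f g : ℝ → ℝ} (hf : MemLp f 2 volume) (hg : MemLp g 2 volume)
    (k : ℕ) : rcoef ℓ (fun x => f x + g x) k = rcoef ℓ f k + rcoef ℓ g k := by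
  simp only [rcoef, Complex.ofReal_add]
  exact coef_add hℓ hf.ofReal hg.ofReal k

lemma rcoef_sub (hℓ : 0 < ℓ) {f g : ℝ → ℝ} (hf : MemLp f 2 volume) (hg : MemLp g 2 volume)
    (k : ℕ) : rcoef ℓ (fun x => f x - g x) k = rcoef ℓ f k - rcoef ℓ g k := by
  simp only [rcoef, Complex.ofReal_sub]
  exact coef_sub hℓ hf.ofReal hg.ofReal k

lemma rcoef_const_mul (c : ℝ) (f : ℝ → ℝ) (k : ℕ) :
    rcoef ℓ (fun x => c * f x) k = c * rcoef ℓ f k := by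
  simp only [rcoef, Complex.ofReal_mul]
  exact coef_const_mul _ _ k

/-- Parseval's identity for real functions. -/
lemma hasSum_norm_sq_rcoef (hℓ : 0 < ℓ) {f : ℝ → ℝ} (hf : MemLp f 2 volume) :
    HasSum (fun k : ℕ => 2 * ‖rcoef ℓ f k‖ ^ 2) (∫ x, f x ^ 2) := by
  have h := hasSum_norm_sq_coef hℓ hf.ofReal
  have h2 := h.nat_add_neg_add_one
  have e1 : (∫ x, ‖((f x : ℝ) : ℂ)‖ ^ 2) = ∫ x, f x ^ 2 := by simp
  simp only [RCLike.ofReal_eq_complex_ofReal] at h2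
  rw [e1] at h2
  refine h2.congr_fun fun k => ?_
  have : (-((k : ℤ) + 1)) = -(k : ℤ) - 1 := by ring
  rw [this, coef_ofReal_neg hℓ, Complex.norm_conj, rcoef, two_mul]

lemma norm_psi_eq_zero_index (hℓ : 0 < ℓ) (k : ℤ) (x : ℝ) : ‖psi ℓ k x‖ = ‖psi ℓ 0 x‖ := by
  rw [norm_psi_eq hℓ, norm_psi_eq hℓ]

lemma summable_mul_psi (hℓ : 0 < ℓ) {a : ℕ → ℂ} (ha : Summable fun k => ‖a k‖) (x : ℝ) :
    Summable fun k : ℕ => a k * psi ℓ k x := by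
  refine Summable.of_norm ?_
  simp only [norm_mul, norm_psi_eq_zero_index hℓ]
  exact ha.mul_right _

lemma norm_tsum_mul_psi_le (hℓ : 0 < ℓ) {a : ℕ → ℂ} (ha : Summable fun k => ‖a k‖) (x : ℝ) :
    ‖∑' k : ℕ, a k * psi ℓ k x‖ ≤ (∑' k, ‖a k‖) * ‖psi ℓ 0 x‖ := by
  rw [← tsum_mul_right]
  refine tsum_of_norm_bounded (ha.mul_right _).hasSum fun k => ?_
  rw [norm_mul, norm_psi_eq_zero_index hℓ]

lemma abs_synth_le (hℓ : 0 < ℓ) {a : ℕ → ℂ} (ha : Summable fun k => ‖a k‖) (x : ℝ) :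
    |synth ℓ a x| ≤ 2 * (∑' k, ‖a k‖) * ‖psi ℓ 0 x‖ := by
  rw [synth, abs_mul, abs_two, mul_assoc]
  gcongr
  exact (Complex.abs_re_le_norm _).trans (norm_tsum_mul_psi_le hℓ ha x)

lemma continuous_tsum_mul_psi (hℓ : 0 < ℓ) {a : ℕ → ℂ} (ha : Summable fun k => ‖a k‖) :
    Continuous fun x => ∑' k : ℕ, a k * psi ℓ k x := by
  refine continuous_tsum (u := fun k => ‖a k‖ * (psiConst ℓ / ℓ))
    (fun k => continuous_const.mul (continuous_psi hℓ k)) (ha.mul_right _) fun k x => ?_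
  rw [norm_mul]
  exact mul_le_mul_of_nonneg_left (norm_psi_le hℓ _ _) (norm_nonneg _)

lemma continuous_synth (hℓ : 0 < ℓ) {a : ℕ → ℂ} (ha : Summable fun k => ‖a k‖) :
    Continuous (synth ℓ a) :=
  continuous_const.mul (Complex.continuous_re.comp (continuous_tsum_mul_psi hℓ ha))

lemma memLp_tsum_mul_psi (hℓ : 0 < ℓ) {a : ℕ → ℂ} (ha : Summable fun k => ‖a k‖) :
    MemLp (fun x => ∑' k : ℕ, a k * psi ℓ k x) 2 volume := by
  refine MemLp.of_le_mul (c := ∑' k, ‖a k‖) (memLp_psi hℓ 0)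
    (continuous_tsum_mul_psi hℓ ha).aestronglyMeasurable (ae_of_all _ fun x => ?_)
  exact norm_tsum_mul_psi_le hℓ ha x

lemma memLp_synth (hℓ : 0 < ℓ) {a : ℕ → ℂ} (ha : Summable fun k => ‖a k‖) :
    MemLp (synth ℓ a) 2 volume :=
  (memLp_tsum_mul_psi hℓ ha).re.const_mul 2

lemma coef_tsum_mul_psi (hℓ : 0 < ℓ) {a : ℕ → ℂ} (ha : Summable fun k => ‖a k‖) (j : ℤ) :
    coef ℓ (fun x => ∑' k : ℕ, a k * psi ℓ k x) j = if 0 ≤ j then a j.toNat else 0 := by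
  have hi : ∀ k : ℕ, Integrable fun x => a k * psi ℓ k x * conj (psi ℓ j x) := fun k => by
    simpa only [mul_assoc] using
      (integrable_mul_conj_psi hℓ (memLp_psi hℓ k) j).const_mul (a k)
  have hs : Summable fun k : ℕ => ∫ x, ‖a k * psi ℓ k x * conj (psi ℓ j x)‖ := by
    have : ∀ k : ℕ, (∫ x, ‖a k * psi ℓ k x * conj (psi ℓ j x)‖)
        = ‖a k‖ * ∫ x, ‖psi ℓ 0 x‖ ^ 2 := fun k => by
      rw [← integral_const_mul]
      congr 1
      ext x
      rw [norm_mul, norm_mul, Complex.norm_conj, norm_psi_eq_zero_index hℓ,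
        norm_psi_eq_zero_index hℓ j]
      ring
    simp only [this]
    exact ha.mul_right _
  have h := hasSum_integral_of_summable_integral_norm hi hs
  have e : ∀ k : ℕ, (∫ x, a k * psi ℓ k x * conj (psi ℓ j x))
      = if (k : ℤ) = j then a k else 0 := fun k => by
    have := coef_const_mul (ℓ := ℓ) (a k) (psi ℓ k) j
    rw [coef_psi hℓ] at this
    rw [← coef, this]
    split_ifs <;> simp
  simp only [e] at h
  have h3 : coef ℓ (fun x => ∑' k : ℕ, a k * psi ℓ k x) j
      = ∫ x, ∑' k : ℕ, a k * psi ℓ k x * conj (psi ℓ j x) := by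
    rw [coef]
    congr 1
    ext x
    rw [tsum_mul_right]
  rw [h3, ← h.tsum_eq]
  split_ifs with hj
  · rw [tsum_eq_single j.toNat]
    · simp [hj]
    · intro k hk
      rw [if_neg]
      omega
  · have : ∀ k : ℕ, (k : ℤ) ≠ j := fun k => by omega
    simp [this]

lemma rcoef_synth (hℓ : 0 < ℓ) {a : ℕ → ℂ} (ha : Summable fun k => ‖a k‖) (j : ℕ) :
    rcoef ℓ (synth ℓ a) j = a j := by
  set H : ℝ → ℂ := fun x => ∑' k : ℕ, a k * psi ℓ k x with hH
  have hm : MemLp H 2 volume := memLp_tsum_mul_psi hℓ ha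
  have hm' : MemLp (fun x => conj (H x)) 2 volume := hm.star
  have e : (fun x => ((synth ℓ a x : ℝ) : ℂ)) = fun x => H x + conj (H x) := by
    ext x
    rw [Complex.add_conj, synth]
  rw [rcoef, e, coef_add hℓ hm hm', coef_conj hℓ, coef_tsum_mul_psi hℓ ha, coef_tsum_mul_psi hℓ ha,
    if_pos (by positivity), if_neg (by omega)]
  simp

/-- Completeness of the basis in the form used later: Parseval's identity for the difference. -/
lemma ae_eq_of_rcoef_eq (hℓ : 0 < ℓ) {f g : ℝ → ℝ} (hf : MemLp f 2 volume)
    (hg : MemLp g 2 volume) (h : ∀ k, rcoef ℓ f k = rcoef ℓ g k) : f =ᵐ[volume] g := by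
  have hs := hasSum_norm_sq_rcoef hℓ (hf.sub hg)
  have e : ∀ k, rcoef ℓ (f - g) k = 0 := fun k => by
    have := rcoef_sub hℓ hf hg k
    rw [h, sub_self] at this
    exact this
  simp only [e, norm_zero, ne_eq, OfNat.ofNat_ne_zero, not_false_eq_true, zero_pow, mul_zero] at hs
  have h0 := hs.unique hasSum_zero
  have hi : Integrable fun x => (f - g) x ^ 2 := (hf.sub hg).integrable_sq
  rw [integral_eq_zero_iff_of_nonneg (fun x => sq_nonneg _) hi] at h0
  filter_upwards [h0] with x hx
  have : f x - g x = 0 := by simpa using hx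
  linarith

lemma ae_eq_synth_rcoef (hℓ : 0 < ℓ) {f : ℝ → ℝ} (hf : MemLp f 2 volume)
    (h : Summable fun k => ‖rcoef ℓ f k‖) : f =ᵐ[volume] synth ℓ (rcoef ℓ f) :=
  ae_eq_of_rcoef_eq hℓ hf (memLp_synth hℓ h) fun k => (rcoef_synth hℓ h k).symm

lemma eq_synth_rcoef (hℓ : 0 < ℓ) {f : ℝ → ℝ} (hc : Continuous f) (hf : MemLp f 2 volume)
    (h : Summable fun k => ‖rcoef ℓ f k‖) : f = synth ℓ (rcoef ℓ f) :=
  (Continuous.ae_eq_iff_eq volume hc (continuous_synth hℓ h)).1 (ae_eq_synth_rcoef hℓ hf h)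

lemma synth_sub (hℓ : 0 < ℓ) {a b : ℕ → ℂ} (ha : Summable fun k => ‖a k‖)
    (hb : Summable fun k => ‖b k‖) (x : ℝ) :
    synth ℓ (fun k => a k - b k) x = synth ℓ a x - synth ℓ b x := by
  simp only [synth, sub_mul]
  rw [(summable_mul_psi hℓ ha x).tsum_sub (summable_mul_psi hℓ hb x), Complex.sub_re]
  ring

/-- The action of `∂ₓ` on coefficients. -/
def dseq (ℓ : ℝ) (a : ℕ → ℂ) (k : ℕ) : ℂ :=
  I / ℓ * ((2 * k + 1) * a k + k * a (k - 1) + (k + 1) * a (k + 1))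

lemma summable_norm_of_support {a : ℕ → ℂ} {K : ℕ} (h : ∀ k, K ≤ k → a k = 0) :
    Summable fun k => ‖a k‖ :=
  summable_of_ne_finset_zero (s := Finset.range K) fun k hk => by
    rw [h k (by simpa using hk), norm_zero]

lemma synth_eq_sum {a : ℕ → ℂ} {K : ℕ} (h : ∀ k, K ≤ k → a k = 0) (x : ℝ) :
    synth ℓ a x = 2 * (∑ k ∈ Finset.range K, a k * psi ℓ k x).re := by
  rw [synth, tsum_eq_sum (s := Finset.range K)]
  intro k hk
  rw [h k (by simpa using hk), zero_mul]

lemma dseq_eq_zero {a : ℕ → ℂ} {K : ℕ} (h : ∀ k, K ≤ k → a k = 0) (k : ℕ) (hk : K + 1 ≤ k) :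
    dseq ℓ a k = 0 := by
  rw [dseq, h k (by omega), h (k - 1) (by omega), h (k + 1) (by omega)]
  simp

/-- The half-line of indices k ≥ 0 is invariant under ∂ₓ, so the derivative can be read off from the
coefficients with k ≥ 0 alone. -/
lemma hasDerivAt_synth (hℓ : 0 < ℓ) {a : ℕ → ℂ} {K : ℕ} (h : ∀ k, K ≤ k → a k = 0) (x : ℝ) :
    HasDerivAt (synth ℓ a) (synth ℓ (dseq ℓ a) x) x := by
  have e : synth ℓ a = fun x => 2 * (∑ k ∈ Finset.range K, a k * psi ℓ k x).re :=
    funext fun x => synth_eq_sum h x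
  rw [e, synth_eq_sum (dseq_eq_zero h)]
  have h1 : HasDerivAt (fun x => ∑ k ∈ Finset.range K, a k * psi ℓ k x)
      (∑ k ∈ Finset.range K, a k * (I / ℓ * ((2 * k + 1) * psi ℓ k x
        + (k + 1) * psi ℓ (k + 1 : ℕ) x + k * psi ℓ ((k : ℤ) - 1) x))) x := by
    refine HasDerivAt.fun_sum fun k _ => ((hasDerivAt_psi hℓ k x).const_mul (a k)).congr_deriv ?_
    push_cast
    ring
  have h2 : HasDerivAt (fun x => (∑ k ∈ Finset.range K, a k * psi ℓ k x).re) _ x :=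
    Complex.reCLM.hasFDerivAt.comp_hasDerivAt x h1
  refine (h2.const_mul 2).congr_deriv ?_
  rw [Complex.reCLM_apply]
  congr 2
  simp only [dseq]
  -- At k = 0 the truncated subtraction gives the junk value `a 0`, but it is multiplied by k = 0.
  have s1 : ∑ k ∈ Finset.range (K + 1), (k : ℂ) * a (k - 1) * psi ℓ k x
      = ∑ k ∈ Finset.range K, ((k : ℂ) + 1) * a k * psi ℓ (k + 1 : ℕ) x := by
    rw [Finset.sum_range_succ']
    simp
  have s2 : ∑ k ∈ Finset.range (K + 1), ((k : ℂ) + 1) * a (k + 1) * psi ℓ k x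
      = ∑ k ∈ Finset.range K, (k : ℂ) * a k * psi ℓ ((k : ℤ) - 1) x := by
    have := Finset.sum_range_succ' (fun k : ℕ => (k : ℂ) * a k * psi ℓ ((k : ℤ) - 1) x) (K + 1)
    rw [Finset.sum_range_succ, Finset.sum_range_succ, h K le_rfl, h (K + 1) (by omega)] at this
    simp only [mul_zero, zero_mul, add_zero, Nat.cast_zero] at this
    rw [this]
    refine Finset.sum_congr rfl fun k _ => ?_
    push_cast
    simp
  have s3 : ∑ k ∈ Finset.range (K + 1), (2 * (k : ℂ) + 1) * a k * psi ℓ k x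
      = ∑ k ∈ Finset.range K, (2 * (k : ℂ) + 1) * a k * psi ℓ k x := by
    rw [Finset.sum_range_succ, h K le_rfl]
    simp
  calc _ = I / ℓ * (∑ k ∈ Finset.range K, (2 * (k : ℂ) + 1) * a k * psi ℓ k x
        + ∑ k ∈ Finset.range K, ((k : ℂ) + 1) * a k * psi ℓ (k + 1 : ℕ) x
        + ∑ k ∈ Finset.range K, (k : ℂ) * a k * psi ℓ ((k : ℤ) - 1) x) := by
        rw [← Finset.sum_add_distrib, ← Finset.sum_add_distrib, Finset.mul_sum]
        exact Finset.sum_congr rfl fun k _ => by ring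
    _ = _ := by
        rw [← s1, ← s2, ← s3, ← Finset.sum_add_distrib, ← Finset.sum_add_distrib, Finset.mul_sum]
        exact Finset.sum_congr rfl fun k _ => by ring

/-- The product of two finite expansions has a finite expansion. -/
lemma rcoef_synth_mul_synth (hℓ : 0 < ℓ) {a b : ℕ → ℂ} {K : ℕ} (ha : ∀ k, K ≤ k → a k = 0)
    (hb : ∀ k, K ≤ k → b k = 0) (k : ℕ) (hk : 2 * K ≤ k) :
    rcoef ℓ (fun x => synth ℓ a x * synth ℓ b x) k = 0 := by
  -- A real function is written as a sum over the symmetric range -K ≤ j < K. By `psi_mul_psi` a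
  -- product of two such sums has indices at most 2(K-1)+1 = 2K-1, which is where the threshold 2K
  -- comes from.
  have e1 : ∀ {a : ℕ → ℂ}, (∀ k, K ≤ k → a k = 0) → ∃ c : ℤ → ℂ, ∀ x, ((synth ℓ a x : ℝ) : ℂ)
      = ∑ j ∈ Finset.Ico (-(K : ℤ)) K, c j * psi ℓ j x := by
    intro a ha
    refine ⟨fun j => if 0 ≤ j then a j.toNat else conj (a (-j - 1).toNat), fun x => ?_⟩
    have hs : Finset.Ico (-(K : ℤ)) K = Finset.Ico (-(K : ℤ)) 0 ∪ Finset.Ico 0 (K : ℤ) := by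
      ext j; simp; omega
    rw [hs, Finset.sum_union (by
      rw [Finset.disjoint_left]; intro j; simp; omega)]
    have h1 : ∑ j ∈ Finset.Ico 0 (K : ℤ), (if 0 ≤ j then a j.toNat else conj (a (-j - 1).toNat)) *
        psi ℓ j x = ∑ k ∈ Finset.range K, a k * psi ℓ k x := by
      symm
      refine Finset.sum_bij (fun k _ => (k : ℤ)) (by simp) (by simp) ?_ ?_
      · intro j hj
        simp at hj
        exact ⟨j.toNat, by simp; omega, by omega⟩
      · intro k _
        simp
    have h2 : ∑ j ∈ Finset.Ico (-(K : ℤ)) 0,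
        (if 0 ≤ j then a j.toNat else conj (a (-j - 1).toNat)) *
        psi ℓ j x = conj (∑ k ∈ Finset.range K, a k * psi ℓ k x) := by
      rw [map_sum]
      symm
      refine Finset.sum_bij (fun k _ => -(k : ℤ) - 1) ?_ ?_ ?_ ?_
      · intro k hk; simp at hk ⊢; omega
      · intro k _ k' _ h; omega
      · intro j hj
        simp at hj
        exact ⟨(-j - 1).toNat, by simp; omega, by omega⟩
      · intro k _
        rw [if_neg (by omega), map_mul, conj_psi hℓ]
        congr 3
        omega
    rw [h1, h2, synth_eq_sum ha, add_comm, Complex.add_conj]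
  obtain ⟨c, hc⟩ := e1 ha
  obtain ⟨d, hd⟩ := e1 hb
  have e2 : (fun x => ((synth ℓ a x * synth ℓ b x : ℝ) : ℂ)) = fun x =>
      ∑ i ∈ Finset.Ico (-(K : ℤ)) K, ∑ j ∈ Finset.Ico (-(K : ℤ)) K,
        (c i * d j * ((psiConst ℓ / (2 * ℓ) : ℝ) : ℂ)) * (psi ℓ (i + j) x + psi ℓ (i + j + 1) x) := by
    ext x
    rw [Complex.ofReal_mul, hc, hd, Finset.sum_mul_sum]
    refine Finset.sum_congr rfl fun i _ => Finset.sum_congr rfl fun j _ => ?_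
    have := psi_mul_psi hℓ i j x
    linear_combination c i * d j * this
  rw [rcoef, e2, coef]
  simp only [Finset.sum_mul]
  have hint : ∀ i j : ℤ, Integrable fun x => (c i * d j * ((psiConst ℓ / (2 * ℓ) : ℝ) : ℂ)) *
      (psi ℓ (i + j) x + psi ℓ (i + j + 1) x) * conj (psi ℓ k x) := fun i j =>
    integrable_mul_conj_psi hℓ (((memLp_psi hℓ _).add (memLp_psi hℓ _)).const_mul _) k
  rw [integral_finsetSum _ fun i _ => integrable_finsetSum _ fun j _ => hint i j]
  refine Finset.sum_eq_zero fun i hi => ?_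
  rw [integral_finsetSum _ fun j _ => hint i j]
  refine Finset.sum_eq_zero fun j hj => ?_
  simp at hi hj
  have := coef_const_mul (ℓ := ℓ) (c i * d j * ((psiConst ℓ / (2 * ℓ) : ℝ) : ℂ))
    (fun x => psi ℓ (i + j) x + psi ℓ (i + j + 1) x) k
  rw [coef_add hℓ (memLp_psi hℓ _) (memLp_psi hℓ _), coef_psi hℓ, coef_psi hℓ, if_neg (by omega),
    if_neg (by omega), add_zero, mul_zero] at this
  exact this

end expansion

end Benjamin
end

noncomputable section

namespace Benjamin

open scoped ComplexConjugate
open Complex (I)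

/-! ### The Fourier transform on `L¹ ∩ L²` -/

section fourier

lemma integral_conj_fourier_mul {f g : ℝ → ℂ} (hf : Integrable f) (hg : Integrable g) :
    ∫ ξ, conj (𝓕 f ξ) * g ξ = ∫ x, conj (f x) * 𝓕⁻ g x := by
  have h := VectorFourier.integral_sesq_fourierIntegral_eq_neg_flip (μ := volume) (ν := volume)
    (innerSL ℂ (E := ℂ)) (L := innerₗ ℝ) Real.continuous_fourierChar continuous_inner hf hg
  simp only [innerSL_apply_apply, RCLike.inner_apply, flip_innerₗ] at h
  simp only [mul_comm (conj _)]
  exact h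

lemma continuous_fourierInv {φ : ℝ → ℂ} (h : Integrable φ) : Continuous (𝓕⁻ φ) := by
  have : 𝓕⁻ φ = fun x => 𝓕 φ (-x) := funext fun x => Real.fourierInv_eq_fourier_neg φ x
  rw [this]
  exact (VectorFourier.fourierIntegral_continuous Real.continuous_fourierChar
    (L := innerₗ ℝ) continuous_inner h).comp continuous_neg

lemma inner_toLp_eq {f g : ℝ → ℂ} (hf : MemLp f 2 volume) (hg : MemLp g 2 volume) :
    inner ℂ (hf.toLp f) (hg.toLp g) = ∫ x, conj (f x) * g x := by
  rw [L2.inner_def]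
  refine integral_congr_ae ?_
  filter_upwards [hf.coeFn_toLp, hg.coeFn_toLp] with x h1 h2
  rw [h1, h2, RCLike.inner_apply, mul_comm]

/-- On `L¹ ∩ L²` the Plancherel transform is given by the Fourier integral. -/
theorem fourierInv_toLp_ae_eq {φ : ℝ → ℂ} (h1 : Integrable φ) (h2 : MemLp φ 2 volume) :
    ⇑(𝓕⁻ (h2.toLp φ) : Lp ℂ 2 (volume : Measure ℝ)) =ᵐ[volume] 𝓕⁻ φ := by
  have hL : MemLp (⇑(𝓕⁻ (h2.toLp φ) : Lp ℂ 2 (volume : Measure ℝ))) 2 volume := Lp.memLp _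
  refine ae_eq_of_integral_contDiff_smul_eq (hL.locallyIntegrable (by norm_num))
    (continuous_fourierInv h1).locallyIntegrable fun g hg hgc => ?_
  have hgc' : HasCompactSupport (fun x => (g x : ℂ)) := hgc.comp_left (g := fun x : ℝ => (x : ℂ)) rfl
  have hg' : ContDiff ℝ (⊤ : ℕ∞) (fun x => (g x : ℂ)) := Complex.ofRealCLM.contDiff.comp hg
  -- Both candidates are compared by testing against smooth compactly supported functions. On the
  -- test function the Plancherel transform is known to be the Fourier integral, and in each pairing
  -- the transform can be moved onto it.
  set η := hgc'.toSchwartzMap hg' with hη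
  have hηx : ∀ x, η x = g x := fun x => rfl
  have e1 : inner ℂ (η.toLp 2) (𝓕⁻ (h2.toLp φ) : Lp ℂ 2 (volume : Measure ℝ))
      = inner ℂ (𝓕 (η.toLp 2 : Lp ℂ 2 (volume : Measure ℝ))) (h2.toLp φ) := by
    rw [← Lp.inner_fourier_eq, FourierTransform.fourier_fourierInv_eq]
  rw [SchwartzMap.toLp_fourier_eq, L2.inner_def, L2.inner_def] at e1
  have e2 : ∫ x, g x • (𝓕⁻ (h2.toLp φ) : Lp ℂ 2 (volume : Measure ℝ)) x
      = ∫ x, inner ℂ ((η.toLp 2 : Lp ℂ 2 (volume : Measure ℝ)) x)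
        ((𝓕⁻ (h2.toLp φ) : Lp ℂ 2 (volume : Measure ℝ)) x) := by
    refine integral_congr_ae ?_
    filter_upwards [η.coeFn_toLp 2 volume] with x hx
    rw [hx, RCLike.inner_apply, hηx, Complex.conj_ofReal, Complex.real_smul, mul_comm]
  have e3 : ∫ x, inner ℂ (((𝓕 η).toLp 2 : Lp ℂ 2 (volume : Measure ℝ)) x) (h2.toLp φ x)
      = ∫ x, conj (𝓕 (η : ℝ → ℂ) x) * φ x := by
    refine integral_congr_ae ?_
    filter_upwards [(𝓕 η).coeFn_toLp 2 volume, h2.coeFn_toLp] with x hx hx'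
    rw [hx, hx', RCLike.inner_apply, SchwartzMap.fourier_coe, mul_comm]
  rw [e2, e1, e3, integral_conj_fourier_mul η.integrable h1]
  congr 1
  ext x
  rw [hηx, Complex.conj_ofReal, Complex.real_smul]

lemma memLp_fourierInv {φ : ℝ → ℂ} (h1 : Integrable φ) (h2 : MemLp φ 2 volume) :
    MemLp (𝓕⁻ φ) 2 volume :=
  (memLp_congr_ae (fourierInv_toLp_ae_eq h1 h2)).1 (Lp.memLp _)

lemma toLp_fourierInv {φ : ℝ → ℂ} (h1 : Integrable φ) (h2 : MemLp φ 2 volume) :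
    (memLp_fourierInv h1 h2).toLp (𝓕⁻ φ) = 𝓕⁻ (h2.toLp φ) := by
  rw [Lp.ext_iff]
  exact (MemLp.coeFn_toLp _).trans (fourierInv_toLp_ae_eq h1 h2).symm

/-- Plancherel's identity for the inverse Fourier integral. -/
lemma integral_norm_sq_fourierInv {φ : ℝ → ℂ} (h1 : Integrable φ) (h2 : MemLp φ 2 volume) :
    ∫ x, ‖𝓕⁻ φ x‖ ^ 2 = ∫ ξ, ‖φ ξ‖ ^ 2 := by
  have key : ∀ {f : ℝ → ℂ} (hf : MemLp f 2 volume),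
      ((∫ x, ‖f x‖ ^ 2 : ℝ) : ℂ) = inner ℂ (hf.toLp f) (hf.toLp f) := by
    intro f hf
    rw [inner_toLp_eq, ← integral_complex_ofReal]
    congr 1
    ext x
    rw [mul_comm, Complex.mul_conj, Complex.normSq_eq_norm_sq]
  have : ((∫ x, ‖𝓕⁻ φ x‖ ^ 2 : ℝ) : ℂ) = ((∫ ξ, ‖φ ξ‖ ^ 2 : ℝ) : ℂ) := by
    rw [key (memLp_fourierInv h1 h2), key h2, toLp_fourierInv h1, ← Lp.inner_fourier_eq,
      FourierTransform.fourier_fourierInv_eq]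
  exact_mod_cast this

lemma fourierL2_eq {f : ℝ → ℂ} (hf : MemLp f 2 volume) :
    fourierL2 f = ⇑(𝓕 (hf.toLp f) : Lp ℂ 2 (volume : Measure ℝ)) := by
  rw [fourierL2, dif_pos hf]

lemma fourierInvL2_eq {f : ℝ → ℂ} (hf : MemLp f 2 volume) :
    fourierInvL2 f = ⇑(𝓕⁻ (hf.toLp f) : Lp ℂ 2 (volume : Measure ℝ)) := by
  rw [fourierInvL2, dif_pos hf]

lemma memLp_fourierL2 {f : ℝ → ℂ} (hf : MemLp f 2 volume) : MemLp (fourierL2 f) 2 volume := by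
  rw [fourierL2_eq hf]
  exact Lp.memLp _

lemma memLp_fourierInvL2 {f : ℝ → ℂ} (hf : MemLp f 2 volume) :
    MemLp (fourierInvL2 f) 2 volume := by
  rw [fourierInvL2_eq hf]
  exact Lp.memLp _

lemma fourierL2_fourierInvL2 {f : ℝ → ℂ} (hf : MemLp f 2 volume) :
    fourierL2 (fourierInvL2 f) =ᵐ[volume] f := by
  rw [fourierL2_eq (memLp_fourierInvL2 hf)]
  have : (memLp_fourierInvL2 hf).toLp (fourierInvL2 f) = 𝓕⁻ (hf.toLp f) := by
    rw [Lp.ext_iff]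
    refine (MemLp.coeFn_toLp _).trans ?_
    rw [fourierInvL2_eq hf]
  rw [this, FourierTransform.fourier_fourierInv_eq]
  exact hf.coeFn_toLp

lemma integral_conj_fourierInv_mul {φ f : ℝ → ℂ} (h1 : Integrable φ) (h2 : MemLp φ 2 volume)
    (hf : MemLp f 2 volume) :
    ∫ x, conj (𝓕⁻ φ x) * f x = ∫ ξ, conj (φ ξ) * fourierL2 f ξ := by
  have e : (memLp_fourierL2 hf).toLp (fourierL2 f) = 𝓕 (hf.toLp f) := by
    rw [Lp.ext_iff]
    refine (MemLp.coeFn_toLp _).trans ?_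
    rw [fourierL2_eq hf]
  rw [← inner_toLp_eq (memLp_fourierInv h1 h2) hf, ← inner_toLp_eq h2 (memLp_fourierL2 hf),
    toLp_fourierInv h1, e, ← Lp.inner_fourier_eq, FourierTransform.fourier_fourierInv_eq]

/-- `f` is the inverse Fourier transform of a nice function supported on the positive half-line. -/
def IsHardy (f : ℝ → ℂ) : Prop :=
  ∃ φ : ℝ → ℂ, Integrable φ ∧ MemLp φ 2 volume ∧ (∀ ξ ≤ 0, φ ξ = 0) ∧ 𝓕⁻ φ = f

lemma fourierInv_apply_eq (φ : ℝ → ℂ) (x : ℝ) :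
    𝓕⁻ φ x = ∫ ξ : ℝ, Complex.exp (2 * Real.pi * I * ξ * x) * φ ξ := by
  rw [Real.fourierInv_eq']
  congr 1
  ext ξ
  simp only [smul_eq_mul, RCLike.inner_apply, conj_trivial]
  congr 2
  push_cast
  ring

lemma integrable_exp_mul {φ : ℝ → ℂ} (h : Integrable φ) (x : ℝ) :
    Integrable fun ξ : ℝ => Complex.exp (2 * Real.pi * I * ξ * x) * φ ξ := by
  refine h.bdd_mul (c := 1) (by fun_prop) (ae_of_all _ fun ξ => ?_)
  rw [Complex.norm_exp]
  simp

lemma IsHardy.add {f g : ℝ → ℂ} (hf : IsHardy f) (hg : IsHardy g) :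
    IsHardy fun x => f x + g x := by
  obtain ⟨φ, a1, a2, a3, rfl⟩ := hf
  obtain ⟨χ, b1, b2, b3, rfl⟩ := hg
  refine ⟨φ + χ, a1.add b1, a2.add b2, fun ξ h => by simp [a3 ξ h, b3 ξ h], ?_⟩
  ext x
  simp only [fourierInv_apply_eq, Pi.add_apply, mul_add]
  exact integral_add (integrable_exp_mul a1 x) (integrable_exp_mul b1 x)

lemma IsHardy.const_mul {f : ℝ → ℂ} (hf : IsHardy f) (c : ℂ) : IsHardy fun x => c * f x := by
  obtain ⟨φ, a1, a2, a3, rfl⟩ := hf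
  refine ⟨fun ξ => c * φ ξ, a1.const_mul c, a2.const_mul c, fun ξ h => by simp [a3 ξ h], ?_⟩
  ext x
  simp only [fourierInv_apply_eq, ← integral_const_mul]
  congr 1
  ext ξ
  ring

lemma IsHardy.zero : IsHardy fun _ => 0 :=
  ⟨0, integrable_zero _ _ _, MemLp.zero, fun _ _ => rfl, by
    ext x; simp [fourierInv_apply_eq]⟩

lemma IsHardy.sum {ι : Type*} (s : Finset ι) {f : ι → ℝ → ℂ} (h : ∀ i ∈ s, IsHardy (f i)) :
    IsHardy fun x => ∑ i ∈ s, f i x := by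
  classical
  induction s using Finset.induction_on with
  | empty => simpa using IsHardy.zero
  | insert i s hi ih =>
    simp only [Finset.sum_insert hi]
    exact (h i (by simp)).add (ih fun j hj => h j (by simp [hj]))

/-- The functions `ξ ^ j exp (-π ℓ ξ)` on the positive half-line. -/
def laguerreWeight (ℓ : ℝ) (j : ℕ) : ℝ → ℂ :=
  (Ioi (0 : ℝ)).indicator fun ξ : ℝ => (ξ : ℂ) ^ j * Complex.exp (-(Real.pi * ℓ : ℝ) * ξ)

lemma laguerreWeight_integrable {ℓ : ℝ} (hℓ : 0 < ℓ) (j : ℕ) :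
    Integrable (laguerreWeight ℓ j) ∧ MemLp (laguerreWeight ℓ j) 2 volume := by
  set g : ℝ → ℂ := fun ξ => (ξ : ℂ) ^ j * Complex.exp (-(Real.pi * ℓ : ℝ) * ξ) with hg
  have hcont : Continuous g := by fun_prop
  have hb : 0 < Real.pi * ℓ := by positivity
  have hint : ∀ (b : ℝ), 0 < b → ∀ m : ℕ,
      IntegrableOn (fun ξ : ℝ => ξ ^ m * Real.exp (-b * ξ)) (Ioi 0) := by
    intro b hb m
    have := integrableOn_rpow_mul_exp_neg_mul_rpow (p := 1) (s := (m : ℝ)) (b := b)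
      (by have : (0 : ℝ) ≤ m := by positivity
          linarith) one_pos hb
    refine this.congr_fun (fun ξ hξ => ?_) measurableSet_Ioi
    simp
  have hnorm : ∀ ξ ∈ Ioi (0 : ℝ), ‖g ξ‖ = ξ ^ j * Real.exp (-(Real.pi * ℓ) * ξ) := by
    intro ξ hξ
    have hξ' : 0 < ξ := hξ
    simp only [hg, norm_mul, norm_pow, Complex.norm_real, Complex.norm_exp]
    rw [Real.norm_of_nonneg hξ'.le]
    simp
  constructor
  · refine (integrable_indicator_iff measurableSet_Ioi).2
      ((integrable_norm_iff hcont.aestronglyMeasurable).1 ?_)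
    exact (hint _ hb j).congr_fun (fun ξ hξ => (hnorm ξ hξ).symm) measurableSet_Ioi
  · refine (memLp_indicator_iff_restrict measurableSet_Ioi).2
      ((memLp_two_iff_integrable_sq_norm hcont.aestronglyMeasurable).2 ?_)
    refine IntegrableOn.congr_fun (hint _ (by positivity : 0 < 2 * (Real.pi * ℓ)) (2 * j))
      (fun ξ hξ => ?_) measurableSet_Ioi
    simp only [hnorm ξ hξ]
    rw [mul_pow, ← pow_mul, ← Real.exp_nat_mul]
    congr 2
    · ring
    · push_cast
      ring

/-- Induction on j: an extra factor ξ in the density is a derivative in x of the transform, and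
differentiating (ℓ - 2ix)^{-(j+1)} raises the power by one. The base case is the integral of an
exponential over the half-line. -/
lemma fourierInv_laguerreWeight {ℓ : ℝ} (hℓ : 0 < ℓ) (j : ℕ) (x : ℝ) :
    𝓕⁻ (laguerreWeight ℓ j) x
      = (j.factorial / (Real.pi : ℂ) ^ (j + 1)) * (((ℓ : ℂ) - 2 * I * (x : ℂ)) ^ (j + 1))⁻¹ := by
  have hpi : (Real.pi : ℂ) ≠ 0 := by exact_mod_cast Real.pi_ne_zero
  induction j generalizing x with
  | zero =>
    have h1 := sub_two_I_ne_zero hℓ x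
    rw [fourierInv_apply_eq]
    have e : (fun ξ : ℝ => Complex.exp (2 * Real.pi * I * ξ * x) * laguerreWeight ℓ 0 ξ)
        = (Ioi (0 : ℝ)).indicator
          (fun ξ : ℝ => Complex.exp ((-Real.pi * ((ℓ : ℂ) - 2 * I * (x : ℂ))) * ξ)) := by
      ext ξ
      by_cases h : ξ ∈ Ioi (0 : ℝ)
      · simp only [laguerreWeight, h, indicator_of_mem, pow_zero, one_mul]
        rw [← Complex.exp_add]
        congr 1
        push_cast
        ring
      · simp [laguerreWeight, h]
    rw [e, integral_indicator measurableSet_Ioi, integral_exp_mul_complex_Ioi (by simp; positivity)]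
    simp
    field_simp
  | succ j ih =>
    have h1 := sub_two_I_ne_zero hℓ x
    obtain ⟨hi, -⟩ := laguerreWeight_integrable hℓ j
    have hsucc : ∀ ξ : ℝ, laguerreWeight ℓ (j + 1) ξ = (ξ : ℂ) * laguerreWeight ℓ j ξ := fun ξ => by
      by_cases h : ξ ∈ Ioi (0 : ℝ) <;> simp [laguerreWeight, h, pow_succ]
      ring
    have hi' : Integrable fun ξ : ℝ => ξ • laguerreWeight ℓ j ξ :=
      (laguerreWeight_integrable hℓ (j + 1)).1.congr
        (ae_of_all _ fun ξ => by simp only [hsucc, Complex.real_smul])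
    have hd := (Real.hasDerivAt_fourier hi hi' (-x)).scomp x (hasDerivAt_neg x)
    have e1 : (𝓕 (laguerreWeight ℓ j)) ∘ Neg.neg = fun y : ℝ =>
        (j.factorial / (Real.pi : ℂ) ^ (j + 1)) * (((ℓ : ℂ) - 2 * I * (y : ℂ)) ^ (j + 1))⁻¹ := by
      ext y
      rw [← ih y, Real.fourierInv_eq_fourier_neg]
      rfl
    have hx : HasDerivAt (fun y : ℝ => (y : ℂ)) 1 x := Complex.ofRealCLM.hasDerivAt
    have hden : HasDerivAt (fun y : ℝ => (ℓ : ℂ) - 2 * I * (y : ℂ)) (-(2 * I)) x := by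
      simpa using (hx.const_mul (2 * I)).const_sub (ℓ : ℂ)
    have hd2 := ((hden.fun_pow (j + 1)).fun_inv (pow_ne_zero _ h1)).const_mul
      (j.factorial / (Real.pi : ℂ) ^ (j + 1))
    rw [e1] at hd
    have h3 := hd.unique hd2
    have e2 : 𝓕 (fun ξ : ℝ => (-2 * Real.pi * I * ξ : ℂ) • laguerreWeight ℓ j ξ) (-x)
        = -2 * Real.pi * I * 𝓕⁻ (laguerreWeight ℓ (j + 1)) x := by
      rw [← Real.fourierInv_eq_fourier_neg, fourierInv_apply_eq, fourierInv_apply_eq,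
        ← integral_const_mul]
      congr 1
      ext ξ
      rw [hsucc, smul_eq_mul]
      ring
    rw [e2] at h3
    have hI : I ≠ 0 := Complex.I_ne_zero
    rw [Nat.factorial_succ]
    have h4 : (2 * Real.pi * I) * 𝓕⁻ (laguerreWeight ℓ (j + 1)) x
        = (j.factorial / (Real.pi : ℂ) ^ (j + 1)) *
          (((j : ℂ) + 1) * ((ℓ : ℂ) - 2 * I * x) ^ j * (2 * I) /
            (((ℓ : ℂ) - 2 * I * x) ^ (j + 1)) ^ 2) := by
      simp at h3
      linear_combination h3
    have h5 : (2 * Real.pi * I : ℂ) ≠ 0 := by simp [hpi]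
    apply mul_left_cancel₀ h5
    rw [h4]
    push_cast
    field_simp
    try ring

lemma isHardy_pow_inv {ℓ : ℝ} (hℓ : 0 < ℓ) (j : ℕ) :
    IsHardy fun x => (((ℓ : ℂ) - 2 * I * (x : ℂ)) ^ (j + 1))⁻¹ := by
  obtain ⟨hi1, hi2⟩ := laguerreWeight_integrable hℓ j
  have hH : IsHardy (𝓕⁻ (laguerreWeight ℓ j)) :=
    ⟨_, hi1, hi2, fun ξ h => by simp [laguerreWeight, h], rfl⟩
  have := hH.const_mul (j.factorial / (Real.pi : ℂ) ^ (j + 1))⁻¹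
  refine (congrArg IsHardy (funext fun x => ?_)).mp this
  have h0 : (j.factorial / (Real.pi : ℂ) ^ (j + 1)) ≠ 0 :=
    div_ne_zero (by exact_mod_cast j.factorial_ne_zero)
      (pow_ne_zero _ (by exact_mod_cast Real.pi_ne_zero))
  rw [fourierInv_laguerreWeight hℓ, inv_mul_cancel_left₀ h0]

/-- With `cayley` = 2ℓ/(ℓ - 2ix) - 1, the binomial theorem makes ψ_k a combination of negative
powers of ℓ - 2ix, each the transform of a density on ξ > 0. This uses k ≥ 0. -/
lemma isHardy_psi {ℓ : ℝ} (hℓ : 0 < ℓ) (k : ℕ) : IsHardy (psi ℓ k) := by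
  have e : psi ℓ k = fun x : ℝ => ∑ m ∈ Finset.range (k + 1),
      ((psiConst ℓ : ℂ) * (2 * ℓ) ^ m * (-1) ^ (k - m) * k.choose m) *
        (((ℓ : ℂ) - 2 * I * (x : ℂ)) ^ (m + 1))⁻¹ := by
    ext x
    have h1 := sub_two_I_ne_zero hℓ x
    have : cayley ℓ x = 2 * ℓ / ((ℓ : ℂ) - 2 * I * (x : ℂ)) + (-1) := by
      rw [← one_add_cayley hℓ]; ring
    rw [psi, this, zpow_natCast, add_pow, Finset.mul_sum, Finset.sum_div]
    refine Finset.sum_congr rfl fun m _ => ?_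
    rw [div_pow, pow_succ]
    field_simp
  rw [e]
  exact IsHardy.sum _ fun m _ => (isHardy_pow_inv hℓ m).const_mul _

/-- The coefficients of nonnegative index only depend on the positive frequencies. -/
lemma exists_coef_eq_integral {ℓ : ℝ} (hℓ : 0 < ℓ) (k : ℕ) :
    ∃ φ : ℝ → ℂ, (∀ ξ ≤ 0, φ ξ = 0) ∧ ∀ f : ℝ → ℂ, MemLp f 2 volume →
      coef ℓ f k = ∫ ξ, conj (φ ξ) * fourierL2 f ξ := by
  obtain ⟨φ, h1, h2, h3, h4⟩ := isHardy_psi hℓ k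
  refine ⟨φ, h3, fun f hf => ?_⟩
  rw [← integral_conj_fourierInv_mul h1 h2 hf, h4, coef]
  congr 1
  ext x
  ring

/-- By `conj_psi` the function ψ_{-k-1} is the conjugate of ψ_k, and conjugation reflects the
frequency, so the density of ψ_k is reflected and conjugated. -/
lemma exists_coef_neg_eq_integral {ℓ : ℝ} (hℓ : 0 < ℓ) (k : ℕ) :
    ∃ φ : ℝ → ℂ, (∀ ξ, 0 ≤ ξ → φ ξ = 0) ∧ ∀ f : ℝ → ℂ, MemLp f 2 volume →
      coef ℓ f (-k - 1) = ∫ ξ, conj (φ ξ) * fourierL2 f ξ := by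
  obtain ⟨φ, h1, h2, h3, h4⟩ := isHardy_psi hℓ k
  have hφ1 : Integrable fun ξ => conj (φ (-ξ)) :=
    (Complex.conjLIE.integrable_comp_iff (φ := fun ξ => φ (-ξ))).2 h1.comp_neg
  have hφ2 : MemLp (fun ξ => conj (φ (-ξ))) 2 volume := by
    have : MemLp (fun ξ => φ (-ξ)) 2 volume :=
      h2.comp_measurePreserving (Measure.measurePreserving_neg volume)
    exact this.star
  refine ⟨fun ξ => conj (φ (-ξ)), fun ξ h => by simp [h3 (-ξ) (by linarith)], fun f hf => ?_⟩
  rw [← integral_conj_fourierInv_mul hφ1 hφ2 hf, coef]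
  congr 1
  ext x
  rw [← conj_psi hℓ, ← h4, mul_comm]
  congr 2
  rw [fourierInv_apply_eq, fourierInv_apply_eq, ← integral_conj, ← integral_neg_eq_self]
  congr 1
  ext ξ
  rw [map_mul, ← Complex.exp_conj]
  congr 2
  simp only [map_mul, Complex.conj_ofReal, Complex.conj_I, Complex.conj_ofNat, Complex.ofReal_neg,
    map_neg]
  ring

end fourier

/-! ### The Hilbert transform -/

section hilbert

variable {ℓ : ℝ}

lemma memLp_sign_mul {g : ℝ → ℂ} (hg : MemLp g 2 volume) :
    MemLp (fun ξ => -I * ((Real.sign ξ : ℝ) : ℂ) * g ξ) 2 volume := by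
  have hs : Measurable Real.sign := by
    unfold Real.sign
    exact Measurable.ite measurableSet_Iio measurable_const
      (Measurable.ite measurableSet_Ioi measurable_const measurable_const)
  have hm : Measurable fun ξ : ℝ => -I * ((Real.sign ξ : ℝ) : ℂ) :=
    measurable_const.mul (Complex.measurable_ofReal.comp hs)
  refine hg.of_le_mul (c := 1) (hm.aestronglyMeasurable.mul hg.1) (ae_of_all _ fun ξ => ?_)
  rw [norm_mul]
  gcongr
  rcases Real.sign_apply_eq ξ with h | h | h <;> simp [h]

lemma memLp_hilbert {f : ℝ → ℝ} (hf : MemLp f 2 volume) : MemLp (hilbert f) 2 volume :=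
  (memLp_fourierInvL2 (memLp_sign_mul (memLp_fourierL2 (memLp_ofReal hf)))).re

/-- The Hilbert transform acts on coefficients as multiplication by `-i`. -/
theorem rcoef_hilbert (hℓ : 0 < ℓ) {f : ℝ → ℝ} (hf : MemLp f 2 volume) (k : ℕ) :
    rcoef ℓ (hilbert f) k = -I * rcoef ℓ f k := by
  set fc : ℝ → ℂ := fun x => (f x : ℂ) with hfc
  have hfc2 : MemLp fc 2 volume := memLp_ofReal hf
  have hm := memLp_sign_mul (memLp_fourierL2 hfc2)
  set G : ℝ → ℂ := fourierInvL2 (fun ξ => -I * ((Real.sign ξ : ℝ) : ℂ) * fourierL2 fc ξ) with hG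
  have hG2 : MemLp G 2 volume := memLp_fourierInvL2 hm
  have hFG : fourierL2 G =ᵐ[volume] _ := fourierL2_fourierInvL2 hm
  -- `hilbert` takes a real part, so the coefficients of both G and its conjugate enter, and by
  -- `coef_conj` the latter are those of G at the negative indices.
  have e : (fun x => ((hilbert f x : ℝ) : ℂ)) = fun x => (1 / 2 : ℂ) * (G x + conj (G x)) := by
    ext x
    rw [Complex.add_conj, hilbert]
    push_cast
    ring
  -- The multiplier is discontinuous only at ξ = 0. The density of ψ_k lives on ξ > 0, where the
  -- multiplier is the constant -i; for negative indices it is the constant i.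
  have hpos : coef ℓ G k = -I * coef ℓ fc k := by
    obtain ⟨φ, h3, h4⟩ := exists_coef_eq_integral hℓ k
    rw [h4 G hG2, h4 fc hfc2, ← integral_const_mul]
    refine integral_congr_ae ?_
    filter_upwards [hFG] with ξ hξ
    rw [hξ]
    rcases le_or_gt ξ 0 with h | h
    · simp [h3 ξ h]
    · rw [Real.sign_of_pos h]
      push_cast
      ring
  have hneg : coef ℓ G (-k - 1) = I * coef ℓ fc (-k - 1) := by
    obtain ⟨φ, h3, h4⟩ := exists_coef_neg_eq_integral hℓ k
    rw [h4 G hG2, h4 fc hfc2, ← integral_const_mul]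
    refine integral_congr_ae ?_
    filter_upwards [hFG] with ξ hξ
    rw [hξ]
    rcases le_or_gt 0 ξ with h | h
    · simp [h3 ξ h]
    · rw [Real.sign_of_neg h]
      push_cast
      ring
  have hG' : MemLp (fun x => conj (G x)) 2 volume := hG2.star
  rw [rcoef, rcoef, e, coef_const_mul, coef_add hℓ hG2 hG', coef_conj hℓ, hpos, hneg,
    coef_ofReal_neg hℓ]
  simp only [map_mul, Complex.conj_I, Complex.conj_conj]
  ring

end hilbert

end Benjamin
end

noncomputable section

namespace Benjamin

open scoped ComplexConjugate
open Complex (I)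

/-! ### The norm of `L²` as a real number -/

section l2norm

/-- The real-valued norm of `L²(ℝ)`. -/
def l2n (f : ℝ → ℂ) : ℝ := (eLpNorm f 2 volume).toReal

lemma l2n_nonneg (f : ℝ → ℂ) : 0 ≤ l2n f := ENNReal.toReal_nonneg

lemma l2n_sq {f : ℝ → ℂ} (hf : MemLp f 2 volume) : l2n f ^ 2 = ∫ x, ‖f x‖ ^ 2 := by
  rw [l2n, hf.eLpNorm_eq_integral_rpow_norm (by norm_num) (by norm_num), ENNReal.toReal_ofReal
    (by positivity), ← Real.rpow_natCast, ← Real.rpow_mul (by positivity)]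
  norm_num

lemma l2n_add_le {f g : ℝ → ℂ} (hf : MemLp f 2 volume) (hg : MemLp g 2 volume) :
    l2n (fun x => f x + g x) ≤ l2n f + l2n g := by
  rw [l2n, l2n, l2n, ← ENNReal.toReal_add hf.2.ne hg.2.ne]
  exact ENNReal.toReal_mono (ENNReal.add_ne_top.2 ⟨hf.2.ne, hg.2.ne⟩)
    (eLpNorm_add_le hf.1 hg.1 (by norm_num))

lemma l2n_le_mul {f g : ℝ → ℂ} {C : ℝ} (hg : MemLp g 2 volume) (hC : 0 ≤ C)
    (h : ∀ x, ‖f x‖ ≤ C * ‖g x‖) : l2n f ≤ C * l2n g := by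
  have := eLpNorm_le_mul_eLpNorm_of_ae_le_mul (μ := volume) (ae_of_all _ h) 2
  rw [l2n, l2n, ← ENNReal.toReal_ofReal hC, ← ENNReal.toReal_mul]
  exact ENNReal.toReal_mono (ENNReal.mul_ne_top ENNReal.ofReal_ne_top hg.2.ne) this

lemma sum_norm_sq_coef_le {ℓ : ℝ} (hℓ : 0 < ℓ) {f : ℝ → ℂ} (hf : MemLp f 2 volume) (K : ℕ) :
    ∑ k ∈ Finset.range K, ‖coef ℓ f k‖ ^ 2 ≤ l2n f ^ 2 := by
  rw [l2n_sq hf]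
  have h := hasSum_norm_sq_coef hℓ hf
  have := sum_le_hasSum ((Finset.range K).map Nat.castEmbedding)
    (fun k _ => sq_nonneg ‖coef ℓ f k‖) h
  rwa [Finset.sum_map] at this

end l2norm

/-! ### Bounded coefficient functions -/

section multipliers

/-- The algebra generated by `1 / (1 + x²)` and `x / (1 + x²)`. -/
inductive BddAlg : (ℝ → ℂ) → Prop
  | const (c : ℂ) : BddAlg fun _ => c
  | invSq : BddAlg fun x => 1 / (1 + (x : ℂ) ^ 2)
  | idInvSq : BddAlg fun x => (x : ℂ) / (1 + (x : ℂ) ^ 2)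
  | add {f g : ℝ → ℂ} : BddAlg f → BddAlg g → BddAlg fun x => f x + g x
  | mul {f g : ℝ → ℂ} : BddAlg f → BddAlg g → BddAlg fun x => f x * g x

lemma one_add_sq_ne_zero (x : ℝ) : (1 + (x : ℂ) ^ 2) ≠ 0 := by
  have : (1 + x ^ 2 : ℝ) ≠ 0 := by positivity
  exact_mod_cast this

lemma norm_one_add_sq (x : ℝ) : ‖(1 + (x : ℂ) ^ 2)‖ = 1 + x ^ 2 := by
  have : (1 + (x : ℂ) ^ 2) = ((1 + x ^ 2 : ℝ) : ℂ) := by push_cast; ring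
  rw [this, Complex.norm_real, Real.norm_of_nonneg (by positivity)]

lemma BddAlg.bounded {r : ℝ → ℂ} (h : BddAlg r) : ∃ C, 0 ≤ C ∧ ∀ x, ‖r x‖ ≤ C := by
  induction h with
  | const c => exact ⟨‖c‖, norm_nonneg _, fun _ => le_rfl⟩
  | invSq =>
    refine ⟨1, zero_le_one, fun x => ?_⟩
    rw [norm_div, norm_one_add_sq, norm_one, div_le_one (by positivity)]
    nlinarith [sq_nonneg x]
  | idInvSq =>
    refine ⟨1, zero_le_one, fun x => ?_⟩
    rw [norm_div, norm_one_add_sq, Complex.norm_real, div_le_one (by positivity), Real.norm_eq_abs]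
    nlinarith [sq_nonneg (|x| - 1), sq_abs x, abs_nonneg x]
  | add _ _ hf hg =>
    obtain ⟨C, hC, h1⟩ := hf
    obtain ⟨D, hD, h2⟩ := hg
    exact ⟨C + D, by positivity, fun x => (norm_add_le _ _).trans (add_le_add (h1 x) (h2 x))⟩
  | mul _ _ hf hg =>
    obtain ⟨C, hC, h1⟩ := hf
    obtain ⟨D, hD, h2⟩ := hg
    refine ⟨C * D, by positivity, fun x => ?_⟩
    rw [norm_mul]
    exact mul_le_mul (h1 x) (h2 x) (norm_nonneg _) hC

/-- The algebra is closed under differentiation and its generators are bounded, so multiplication by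
any member is bounded on every order of derivatives. All coefficients of the conjugated generator
belong to it. -/
lemma BddAlg.exists_deriv {r : ℝ → ℂ} (h : BddAlg r) :
    ∃ r', BddAlg r' ∧ ∀ x, HasDerivAt r (r' x) x := by
  have hx : ∀ x : ℝ, HasDerivAt (fun y : ℝ => (y : ℂ)) 1 x := fun x =>
    Complex.ofRealCLM.hasDerivAt
  have hq : ∀ x : ℝ, HasDerivAt (fun y : ℝ => 1 + (y : ℂ) ^ 2) (2 * (x : ℂ)) x := fun x => by
    simpa using ((hx x).fun_pow 2).const_add (1 : ℂ)
  induction h with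
  | const c => exact ⟨fun _ => 0, .const 0, fun x => hasDerivAt_const x c⟩
  | invSq =>
    refine ⟨_, (BddAlg.const (-2)).mul (BddAlg.invSq.mul .idInvSq), fun x => ?_⟩
    have h0 := one_add_sq_ne_zero x
    refine ((hasDerivAt_const x (1 : ℂ)).div (hq x) h0).congr_deriv ?_
    field_simp
    ring
  | idInvSq =>
    refine ⟨_, BddAlg.invSq.add ((BddAlg.const (-2)).mul (BddAlg.idInvSq.mul .idInvSq)),
      fun x => ?_⟩
    have h0 := one_add_sq_ne_zero x
    refine ((hx x).div (hq x) h0).congr_deriv ?_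
    field_simp
    ring
  | add _ _ hf hg =>
    obtain ⟨f', h1, h2⟩ := hf
    obtain ⟨g', h3, h4⟩ := hg
    exact ⟨_, h1.add h3, fun x => (h2 x).add (h4 x)⟩
  | mul a b hf hg =>
    obtain ⟨f', h1, h2⟩ := hf
    obtain ⟨g', h3, h4⟩ := hg
    exact ⟨_, (h1.mul b).add (a.mul h3), fun x => (h2 x).mul (h4 x)⟩

lemma BddAlg.contDiff {r : ℝ → ℂ} (h : BddAlg r) : ContDiff ℝ (⊤ : ℕ∞) r := by
  rw [contDiff_infty]
  intro n
  induction n generalizing r with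
  | zero =>
    obtain ⟨r', _, h2⟩ := h.exists_deriv
    exact contDiff_zero.2 (continuous_iff_continuousAt.2 fun x => (h2 x).continuousAt)
  | succ n ih =>
    obtain ⟨r', h1, h2⟩ := h.exists_deriv
    have hd : deriv r = r' := funext fun x => (h2 x).deriv
    rw [Nat.cast_add, Nat.cast_one, contDiff_succ_iff_deriv]
    refine ⟨fun x => (h2 x).differentiableAt, by simp, ?_⟩
    rw [hd]
    exact ih h1

end multipliers

/-! ### Smooth functions with square integrable derivatives -/

section hinf

/-- Smooth functions all of whose derivatives are square integrable. -/
def HInf (g : ℝ → ℂ) : Prop :=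
  ContDiff ℝ (⊤ : ℕ∞) g ∧ ∀ i, MemLp (iteratedDeriv i g) 2 volume

/-- The sum of the norms of the derivatives up to order `j`. -/
def sobN (j : ℕ) (g : ℝ → ℂ) : ℝ := ∑ i ∈ Finset.range (j + 1), l2n (iteratedDeriv i g)

lemma HInf.memLp {g : ℝ → ℂ} (h : HInf g) : MemLp g 2 volume := by
  simpa using h.2 0

lemma HInf.deriv {g : ℝ → ℂ} (h : HInf g) : HInf (deriv g) := by
  refine ⟨(contDiff_infty_iff_deriv.1 h.1).2, fun i => ?_⟩
  rw [← iteratedDeriv_succ']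
  exact h.2 (i + 1)

lemma HInf.hasDerivAt {g : ℝ → ℂ} (h : HInf g) (x : ℝ) : HasDerivAt g (_root_.deriv g x) x :=
  ((contDiff_infty_iff_deriv.1 h.1).1 x).hasDerivAt

lemma iteratedDeriv_add_of_smooth {f g : ℝ → ℂ} (hf : ContDiff ℝ (⊤ : ℕ∞) f)
    (hg : ContDiff ℝ (⊤ : ℕ∞) g) (i : ℕ) :
    iteratedDeriv i (fun x => f x + g x) = fun x => iteratedDeriv i f x + iteratedDeriv i g x := by
  ext x
  exact iteratedDeriv_fun_add (hf.of_le (by exact_mod_cast le_top)).contDiffAt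
    (hg.of_le (by exact_mod_cast le_top)).contDiffAt

lemma HInf.add {f g : ℝ → ℂ} (hf : HInf f) (hg : HInf g) : HInf fun x => f x + g x := by
  refine ⟨hf.1.add hg.1, fun i => ?_⟩
  rw [iteratedDeriv_add_of_smooth hf.1 hg.1]
  exact (hf.2 i).add (hg.2 i)

lemma sobN_nonneg (j : ℕ) (g : ℝ → ℂ) : 0 ≤ sobN j g :=
  Finset.sum_nonneg fun _ _ => l2n_nonneg _

lemma sobN_succ (j : ℕ) (g : ℝ → ℂ) : sobN (j + 1) g = l2n g + sobN j (deriv g) := by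
  rw [sobN, sobN, Finset.sum_range_succ', add_comm, iteratedDeriv_zero]
  simp only [iteratedDeriv_succ']

lemma sobN_zero (g : ℝ → ℂ) : sobN 0 g = l2n g := by simp [sobN]

lemma sobN_add_le {f g : ℝ → ℂ} (hf : HInf f) (hg : HInf g) (j : ℕ) :
    sobN j (fun x => f x + g x) ≤ sobN j f + sobN j g := by
  rw [sobN, sobN, sobN, ← Finset.sum_add_distrib]
  refine Finset.sum_le_sum fun i _ => ?_
  rw [iteratedDeriv_add_of_smooth hf.1 hg.1]
  exact l2n_add_le (hf.2 i) (hg.2 i)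

lemma sobN_mono (j : ℕ) (g : ℝ → ℂ) : sobN j g ≤ sobN (j + 1) g := by
  rw [sobN, sobN, Finset.sum_range_succ _ (j + 1)]
  linarith [l2n_nonneg (iteratedDeriv (j + 1) g)]

lemma sobN_deriv_le (j : ℕ) (g : ℝ → ℂ) : sobN j (deriv g) ≤ sobN (j + 1) g := by
  rw [sobN_succ]
  linarith [l2n_nonneg g]

lemma deriv_mul_eq {r r' g : ℝ → ℂ} (hr : ∀ x, HasDerivAt r (r' x) x) (hg : HInf g) :
    deriv (fun x => r x * g x) = fun x => r' x * g x + r x * deriv g x :=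
  funext fun x => ((hr x).mul (hg.hasDerivAt x)).deriv

lemma memLp_bdd_mul {r g : ℝ → ℂ} (hr : BddAlg r) (hg : MemLp g 2 volume) :
    MemLp (fun x => r x * g x) 2 volume := by
  obtain ⟨C, _, h⟩ := hr.bounded
  refine hg.of_le_mul (c := C) (hr.contDiff.continuous.aestronglyMeasurable.mul hg.1)
    (ae_of_all _ fun x => ?_)
  rw [norm_mul]
  exact mul_le_mul_of_nonneg_right (h x) (norm_nonneg _)

lemma HInf.bdd_mul {r g : ℝ → ℂ} (hr : BddAlg r) (hg : HInf g) : HInf fun x => r x * g x := by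
  refine ⟨hr.contDiff.mul hg.1, fun i => ?_⟩
  induction i generalizing r g with
  | zero => simpa using memLp_bdd_mul hr hg.memLp
  | succ i ih =>
    obtain ⟨r', h1, h2⟩ := hr.exists_deriv
    rw [iteratedDeriv_succ', deriv_mul_eq h2 hg, iteratedDeriv_add_of_smooth
      (h1.contDiff.mul hg.1) (hr.contDiff.mul hg.deriv.1)]
    exact (ih h1 hg).add (ih hr hg.deriv)

/-- Induction with one use of the Leibniz rule, applied both to r and to its derivative; hence the
induction runs over all members of the algebra at once. -/
lemma exists_sobN_bdd_mul_le (j : ℕ) {r : ℝ → ℂ} (hr : BddAlg r) :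
    ∃ C, 0 ≤ C ∧ ∀ g, HInf g → sobN j (fun x => r x * g x) ≤ C * sobN j g := by
  induction j generalizing r with
  | zero =>
    obtain ⟨C, hC, h⟩ := hr.bounded
    refine ⟨C, hC, fun g hg => ?_⟩
    rw [sobN_zero, sobN_zero]
    refine l2n_le_mul hg.memLp hC fun x => ?_
    rw [norm_mul]
    exact mul_le_mul_of_nonneg_right (h x) (norm_nonneg _)
  | succ j ih =>
    obtain ⟨C, hC, h⟩ := hr.bounded
    obtain ⟨r', h1, h2⟩ := hr.exists_deriv
    obtain ⟨C1, hC1, k1⟩ := ih h1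
    obtain ⟨C2, hC2, k2⟩ := ih hr
    refine ⟨C + C1 + C2, by positivity, fun g hg => ?_⟩
    rw [sobN_succ, deriv_mul_eq h2 hg]
    have a1 : l2n (fun x => r x * g x) ≤ C * l2n g := by
      refine l2n_le_mul hg.memLp hC fun x => ?_
      rw [norm_mul]
      exact mul_le_mul_of_nonneg_right (h x) (norm_nonneg _)
    have a2 := sobN_add_le (hg.bdd_mul h1) (hg.deriv.bdd_mul hr) j
    have a3 := k1 g hg
    have a4 := k2 _ hg.deriv
    have b1 : l2n g ≤ sobN (j + 1) g := by
      rw [sobN_succ]; linarith [sobN_nonneg j (deriv g)]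
    have b2 := sobN_mono j g
    have b3 := sobN_deriv_le j g
    nlinarith [mul_le_mul_of_nonneg_left b1 hC, mul_le_mul_of_nonneg_left b2 hC1,
      mul_le_mul_of_nonneg_left b3 hC2]

end hinf

end Benjamin
end

noncomputable section

namespace Benjamin

open scoped ComplexConjugate
open Complex (I)

/-! ### Decay of coefficients of weighted smooth functions -/

section weights

variable {ℓ : ℝ}

/-- The complex power `(1 + x²)^{-z}` of the weight. -/
def wt (z : ℂ) (x : ℝ) : ℂ := ((1 + x ^ 2 : ℝ) : ℂ) ^ (-z)

lemma norm_wt (z : ℂ) (x : ℝ) : ‖wt z x‖ = (1 + x ^ 2) ^ (-z.re) := by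
  rw [wt, Complex.norm_cpow_eq_rpow_re_of_pos (by positivity), Complex.neg_re]

lemma norm_wt_le_one {z : ℂ} (hz : 0 ≤ z.re) (x : ℝ) : ‖wt z x‖ ≤ 1 := by
  rw [norm_wt]
  exact Real.rpow_le_one_of_one_le_of_nonpos (by nlinarith [sq_nonneg x]) (by linarith)

lemma wt_sub_one (z : ℂ) (x : ℝ) : wt (z - 1) x = (1 + (x : ℂ) ^ 2) * wt z x := by
  have h0 : ((1 + x ^ 2 : ℝ) : ℂ) ≠ 0 := by
    have : (1 + x ^ 2 : ℝ) ≠ 0 := by positivity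
    exact_mod_cast this
  rw [wt, wt, neg_sub, sub_eq_add_neg, Complex.cpow_add _ _ h0, Complex.cpow_one]
  push_cast
  ring

lemma hasDerivAt_wt (z : ℂ) (x : ℝ) :
    HasDerivAt (wt z) (-2 * z * (x / (1 + (x : ℂ) ^ 2)) * wt z x) x := by
  have hx : HasDerivAt (fun y : ℝ => (y : ℂ)) 1 x := Complex.ofRealCLM.hasDerivAt
  have hq : HasDerivAt (fun y : ℝ => ((1 + y ^ 2 : ℝ) : ℂ)) (2 * (x : ℂ)) x := by
    have := (hx.fun_pow 2).const_add (1 : ℂ)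
    refine (this.congr_deriv (by simp)).congr_of_eventuallyEq (Eventually.of_forall fun _ => ?_)
    push_cast
    rfl
  have h0 := one_add_sq_ne_zero x
  have hs : ((1 + x ^ 2 : ℝ) : ℂ) ∈ Complex.slitPlane :=
    Complex.ofReal_mem_slitPlane.2 (by positivity)
  have h := ((hasDerivAt_id ((1 + x ^ 2 : ℝ) : ℂ)).cpow_const (c := -z) hs).comp x hq
  refine h.congr_deriv ?_
  have h0' : ((1 + x ^ 2 : ℝ) : ℂ) ≠ 0 := by push_cast; exact h0
  rw [wt, id_eq, Complex.cpow_sub _ _ h0', Complex.cpow_one]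
  push_cast
  field_simp

lemma continuous_wt (z : ℂ) : Continuous (wt z) :=
  continuous_iff_continuousAt.2 fun x => (hasDerivAt_wt z x).continuousAt

lemma memLp_wt_mul {z : ℂ} (hz : 0 ≤ z.re) {g : ℝ → ℂ} (hg : MemLp g 2 volume) :
    MemLp (fun x => wt z x * g x) 2 volume := by
  refine hg.of_le_mul (c := 1) ((continuous_wt z).aestronglyMeasurable.mul hg.1)
    (ae_of_all _ fun x => ?_)
  rw [norm_mul]
  exact mul_le_mul_of_nonneg_right (norm_wt_le_one hz x) (norm_nonneg _)

lemma l2n_wt_mul_le {z : ℂ} (hz : 0 ≤ z.re) {g : ℝ → ℂ} (hg : MemLp g 2 volume) :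
    l2n (fun x => wt z x * g x) ≤ l2n g := by
  rw [← one_mul (l2n g)]
  refine l2n_le_mul hg zero_le_one fun x => ?_
  rw [norm_mul]
  exact mul_le_mul_of_nonneg_right (norm_wt_le_one hz x) (norm_nonneg _)

/-- The leading coefficient of the generator of the rotations, divided by `1 + x²`. -/
def genCoeff (ℓ : ℝ) (x : ℝ) : ℂ :=
  1 / ℓ + (((ℓ : ℂ) ^ 2 / 4 - 1) / ℓ) * (1 / (1 + (x : ℂ) ^ 2))

/-- The generator of the rotations of the circle, conjugated by the weight `(1 + x²)^{-z}`. -/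
def genOp (ℓ : ℝ) (z : ℂ) (g : ℝ → ℂ) (x : ℝ) : ℂ :=
  genCoeff ℓ x * deriv g x +
    (-2 * z * (genCoeff ℓ x * (x / (1 + (x : ℂ) ^ 2))) +
      (I / 2 * (1 / (1 + (x : ℂ) ^ 2)) + 1 / ℓ * (x / (1 + (x : ℂ) ^ 2)))) * g x

lemma bddAlg_genCoeff (ℓ : ℝ) : BddAlg (genCoeff ℓ) :=
  (BddAlg.const _).add ((BddAlg.const _).mul .invSq)

lemma bddAlg_genOp_lower (ℓ : ℝ) :
    BddAlg fun x => I / 2 * (1 / (1 + (x : ℂ) ^ 2)) + 1 / ℓ * (x / (1 + (x : ℂ) ^ 2)) :=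
  ((BddAlg.const _).mul .invSq).add ((BddAlg.const _).mul .idInvSq)

lemma genOp_eq (ℓ : ℝ) (z : ℂ) (g : ℝ → ℂ) : genOp ℓ z g = fun x =>
    genCoeff ℓ x * deriv g x +
    ((-2 * z) * ((genCoeff ℓ x * (x / (1 + (x : ℂ) ^ 2))) * g x) +
      (I / 2 * (1 / (1 + (x : ℂ) ^ 2)) + 1 / ℓ * (x / (1 + (x : ℂ) ^ 2))) * g x) := by
  ext x
  rw [genOp]
  ring

lemma hInf_genOp (ℓ : ℝ) (z : ℂ) {g : ℝ → ℂ} (hg : HInf g) : HInf (genOp ℓ z g) := by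
  rw [genOp_eq]
  exact (hg.deriv.bdd_mul (bddAlg_genCoeff ℓ)).add
    (((hg.bdd_mul ((bddAlg_genCoeff ℓ).mul .idInvSq)).bdd_mul (.const (-2 * z))).add
      (hg.bdd_mul (bddAlg_genOp_lower ℓ)))

lemma l2n_const_mul_le (c : ℂ) {g : ℝ → ℂ} (hg : MemLp g 2 volume) :
    l2n (fun x => c * g x) ≤ ‖c‖ * l2n g :=
  l2n_le_mul hg (norm_nonneg _) fun _ => (norm_mul _ _).le

lemma sobN_const_mul_le (j : ℕ) (c : ℂ) {g : ℝ → ℂ} (hg : HInf g) :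
    sobN j (fun x => c * g x) ≤ ‖c‖ * sobN j g := by
  induction j generalizing g with
  | zero =>
    rw [sobN_zero, sobN_zero]
    exact l2n_const_mul_le c hg.memLp
  | succ j ih =>
    have e : deriv (fun x => c * g x) = fun x => c * deriv g x :=
      funext fun x => ((hg.hasDerivAt x).const_mul c).deriv
    rw [sobN_succ, sobN_succ, e, mul_add]
    exact add_le_add (l2n_const_mul_le c hg.memLp) (ih hg.deriv)

/-- The dependence on z is tracked because the bound is used along the line Re z = m: growth linear
in ‖z‖ for one step means polynomial growth for m steps, which a Gaussian factor can absorb. -/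
lemma exists_sobN_genOp_le (ℓ : ℝ) (j : ℕ) : ∃ C, 0 ≤ C ∧ ∀ z g, HInf g →
    sobN j (genOp ℓ z g) ≤ C * (1 + ‖z‖) * sobN (j + 1) g := by
  obtain ⟨C1, h1, k1⟩ := exists_sobN_bdd_mul_le j (bddAlg_genCoeff ℓ)
  obtain ⟨C2, h2, k2⟩ := exists_sobN_bdd_mul_le j ((bddAlg_genCoeff ℓ).mul .idInvSq)
  obtain ⟨C3, h3, k3⟩ := exists_sobN_bdd_mul_le j (bddAlg_genOp_lower ℓ)
  refine ⟨C1 + 2 * C2 + C3, by positivity, fun z g hg => ?_⟩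
  rw [genOp_eq]
  have hA := hg.deriv.bdd_mul (bddAlg_genCoeff ℓ)
  have hB0 := hg.bdd_mul ((bddAlg_genCoeff ℓ).mul .idInvSq)
  have hB := hB0.bdd_mul (.const (-2 * z))
  have hC := hg.bdd_mul (bddAlg_genOp_lower ℓ)
  refine (sobN_add_le hA (hB.add hC) j).trans ?_
  have a0 := sobN_add_le hB hC j
  have a1 := k1 _ hg.deriv
  have a2 := (sobN_const_mul_le j (-2 * z) hB0).trans
    (mul_le_mul_of_nonneg_left (k2 g hg) (norm_nonneg _))
  have a3 := k3 g hg
  have b1 := sobN_mono j g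
  have b2 := sobN_deriv_le j g
  have hz : ‖-2 * z‖ = 2 * ‖z‖ := by simp
  rw [hz] at a2
  set S := sobN (j + 1) g
  have hS : 0 ≤ S := sobN_nonneg _ _
  have hz0 := norm_nonneg z
  have c1 : C1 * sobN j (deriv g) ≤ C1 * S := mul_le_mul_of_nonneg_left b2 h1
  have c2 : 2 * ‖z‖ * (C2 * sobN j g) ≤ 2 * ‖z‖ * (C2 * S) := by gcongr
  have c3 : C3 * sobN j g ≤ C3 * S := mul_le_mul_of_nonneg_left b1 h3
  have d1 : 0 ≤ C1 * ‖z‖ * S := by positivity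
  have d2 : 0 ≤ C2 * S := by positivity
  have d3 : 0 ≤ C3 * ‖z‖ * S := by positivity
  nlinarith

/-- The factor (ℓ² + 4x²)/(4ℓ) is dx/dθ, so the left side is ∂_θ ψ_j: the character contributes ij
and the common factor of all ψ_j contributes i/2 - x/ℓ. -/
lemma mul_deriv_psi_eq (hℓ : 0 < ℓ) (j : ℤ) (x : ℝ) :
    ((ℓ : ℂ) ^ 2 + 4 * (x : ℂ) ^ 2) / (4 * ℓ) * (I / ℓ * ((2 * j + 1) * psi ℓ j x
      + (j + 1) * psi ℓ (j + 1) x + j * psi ℓ (j - 1) x))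
      = (I * j + I / 2 - x / ℓ) * psi ℓ j x := by
  have hl : (ℓ : ℂ) ≠ 0 := by exact_mod_cast hℓ.ne'
  have h1 := sub_two_I_ne_zero hℓ x
  have h2 := add_two_I_ne_zero hℓ x
  have hc := cayley_ne_zero hℓ x
  have e1 : psi ℓ (j + 1) x = cayley ℓ x * psi ℓ j x := by
    rw [psi, psi, zpow_add_one₀ hc]; ring
  have e2 : psi ℓ (j - 1) x = (cayley ℓ x)⁻¹ * psi ℓ j x := by
    rw [psi, psi, zpow_sub_one₀ hc]; ring
  have e3 : (ℓ : ℂ) ^ 2 + 4 * (x : ℂ) ^ 2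
      = ((ℓ : ℂ) - 2 * I * x) * ((ℓ : ℂ) + 2 * I * x) := by
    rw [sub_mul_add_two_I]; push_cast; ring
  have e4 : I * j + I / 2 - x / ℓ = I * j + I * ((ℓ : ℂ) + 2 * I * x) / (2 * ℓ) := by
    field_simp
    linear_combination (-2 * (x : ℂ)) * Complex.I_sq
  have e5 : (ℓ : ℂ) = (((ℓ : ℂ) - 2 * I * x) + ((ℓ : ℂ) + 2 * I * x)) / 2 := by ring
  rw [e1, e2, e3, e4, cayley, inv_div]
  generalize psi ℓ j x = P
  have hl' := hl
  rw [e5] at hl'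
  have key : ∀ d n : ℂ, d ≠ 0 → n ≠ 0 → (d + n) / 2 ≠ 0 → d * n / (4 * ((d + n) / 2)) *
      (I / ((d + n) / 2) * ((2 * j + 1) * P + (j + 1) * (n / d * P) + j * (d / n * P)))
      = (I * j + I * n / (2 * ((d + n) / 2))) * P := by
    intro d n hd hn hs
    have hs' : d + n ≠ 0 := fun h => hs (by rw [h]; simp)
    field_simp
    ring
  have := key _ _ h1 h2 hl'
  rw [← e5] at this
  exact this

/-- One rotation generator costs one power of the weight. -/
lemma coef_wt_genOp (hℓ : 0 < ℓ) {z : ℂ} (hz : 1 ≤ z.re) {g : ℝ → ℂ} (hg : HInf g) (k : ℤ) :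
    coef ℓ (fun x => wt (z - 1) x * genOp ℓ z g x) k
      = I * (k + 1) * coef ℓ (fun x => wt z x * g x) k := by
  have hl : (ℓ : ℂ) ≠ 0 := by exact_mod_cast hℓ.ne'
  set q : ℝ → ℂ := fun x => ((ℓ : ℂ) ^ 2 + 4 * (x : ℂ) ^ 2) / (4 * ℓ) with hq
  have hqκ : ∀ x : ℝ, q x = (1 + (x : ℂ) ^ 2) * genCoeff ℓ x := fun x => by
    have := one_add_sq_ne_zero x
    simp only [hq, genCoeff]
    field_simp
    ring
  have hx : ∀ x : ℝ, HasDerivAt (fun y : ℝ => (y : ℂ)) 1 x := fun x =>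
    Complex.ofRealCLM.hasDerivAt
  have hqd : ∀ x : ℝ, HasDerivAt q (2 * x / ℓ) x := fun x => by
    refine ((((hx x).fun_pow 2).const_mul 4).const_add ((ℓ : ℂ) ^ 2)).div_const (4 * ℓ)
      |>.congr_deriv ?_
    simp
    field_simp
  set f : ℝ → ℂ := fun x => wt z x * g x with hf
  set f' : ℝ → ℂ := fun x => (-2 * z * (x / (1 + (x : ℂ) ^ 2)) * wt z x) * g x + wt z x * deriv g x
    with hf'
  have hfd : ∀ x, HasDerivAt f (f' x) x := fun x => (hasDerivAt_wt z x).mul (hg.hasDerivAt x)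
  -- the test function `q ψ̄_k` and its derivative
  set w : ℝ → ℂ := fun x => q x * psi ℓ (-k - 1) x with hw
  set w' : ℝ → ℂ := fun x => (x / ℓ - I * k - I / 2) * psi ℓ (-k - 1) x with hw'
  have hwd : ∀ x, HasDerivAt w (w' x) x := fun x => by
    refine ((hqd x).mul (hasDerivAt_psi hℓ (-k - 1) x)).congr_deriv ?_
    have h1 := mul_deriv_psi_eq hℓ (-k - 1) x
    simp only [hw', hq]
    rw [h1]
    push_cast
    field_simp
    ring
  have hκ := bddAlg_genCoeff ℓ
  -- The coefficient q grows like 1 + x² and consumes one power of the weight, leaving `wt (z - 1)`,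
  -- which is bounded because Re z ≥ 1. All integrands of the integration by parts have this form.
  have hm : ∀ {r h : ℝ → ℂ}, BddAlg r → MemLp h 2 volume →
      Integrable fun x => wt (z - 1) x * (r x * h x) * psi ℓ (-k - 1) x := fun hr hh =>
    (memLp_wt_mul (by simpa using hz) (memLp_bdd_mul hr hh)).integrable_mul (memLp_psi hℓ _)
  have hz0 : 0 ≤ z.re := by linarith
  have i1 : Integrable fun x => f x * w x := by
    refine (hm hκ hg.memLp).congr (ae_of_all _ fun x => ?_)
    simp only [hf, hw, wt_sub_one, hqκ]
    ring
  have i2 : Integrable fun x => f' x * w x := by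
    refine ((hm hκ hg.deriv.memLp).add (hm ((BddAlg.const (-2 * z)).mul (hκ.mul .idInvSq))
      hg.memLp)).congr (ae_of_all _ fun x => ?_)
    simp only [hf', hw, wt_sub_one, hqκ, Pi.add_apply]
    ring
  have i3 : Integrable fun x => f x * w' x := by
    refine (hm (((BddAlg.const (1 / ℓ)).mul .idInvSq).add
      ((BddAlg.const (-I * k - I / 2)).mul .invSq)) hg.memLp).congr (ae_of_all _ fun x => ?_)
    have := one_add_sq_ne_zero x
    simp only [hf, hw', wt_sub_one]
    field_simp
    ring
  have hparts := integral_mul_deriv_eq_deriv_mul_of_integrable (fun x _ => hfd x) (fun x _ => hwd x)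
    i3 i2 i1
  have i4 : Integrable fun x => wt z x * g x * psi ℓ (-k - 1) x :=
    (memLp_wt_mul hz0 hg.memLp).integrable_mul (memLp_psi hℓ _)
  rw [coef, coef]
  simp only [conj_psi hℓ]
  rw [← integral_const_mul]
  -- The zeroth order part i/2 + x/ℓ of the generator is chosen so that the x/ℓ cancels against w'
  -- and the eigenvalue becomes i(k+1), which does not vanish for k ≥ 0.
  have e : ∀ x, wt (z - 1) x * genOp ℓ z g x * psi ℓ (-k - 1) x = (f' x * w x + f x * w' x)
      + I * (k + 1) * (wt z x * g x * psi ℓ (-k - 1) x) := fun x => by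
    have := one_add_sq_ne_zero x
    simp only [hf, hf', hw, hw', wt_sub_one, hqκ, genOp]
    field_simp
    ring
  have i23 : Integrable fun x => f' x * w x + f x * w' x := i2.add i3
  simp only [e]
  rw [integral_add i23 (i4.const_mul _), integral_add i2 i3, hparts]
  ring

/-- Iterating the rotation generator. -/
lemma exists_coef_wt_eq (hℓ : 0 < ℓ) (m : ℕ) : ∀ j : ℕ, ∃ C, 0 ≤ C ∧ ∀ z : ℂ, (m : ℝ) ≤ z.re →
    ∀ g, HInf g → ∃ h, HInf h ∧ sobN j h ≤ C * (1 + ‖z‖) ^ m * sobN (j + m) g ∧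
      ∀ k : ℤ, coef ℓ (fun x => wt (z - m) x * h x) k
        = (I * (k + 1)) ^ m * coef ℓ (fun x => wt z x * g x) k := by
  induction m with
  | zero =>
    exact fun j => ⟨1, zero_le_one, fun z _ g hg => ⟨g, hg, by simp, fun k => by simp⟩⟩
  | succ m ih =>
    intro j
    obtain ⟨C1, hC1, h1⟩ := ih (j + 1)
    obtain ⟨C2, hC2, h2⟩ := exists_sobN_genOp_le ℓ j
    refine ⟨C2 * (1 + m) * C1, by positivity, fun z hz g hg => ?_⟩
    push_cast at hz
    obtain ⟨h, a1, a2, a3⟩ := h1 z (by linarith) g hg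
    refine ⟨genOp ℓ (z - m) h, hInf_genOp ℓ _ a1, ?_, fun k => ?_⟩
    · have b1 := h2 (z - m) h a1
      have b2 : 1 + ‖z - m‖ ≤ (1 + m) * (1 + ‖z‖) := by
        have := norm_sub_le z m
        rw [Complex.norm_natCast] at this
        have : (0 : ℝ) ≤ m * ‖z‖ := by positivity
        linarith
      calc _ ≤ C2 * (1 + ‖z - m‖) * sobN (j + 1) h := b1
        _ ≤ C2 * ((1 + m) * (1 + ‖z‖)) * (C1 * (1 + ‖z‖) ^ m * sobN (j + 1 + m) g) := by
            gcongr
            exact sobN_nonneg _ _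
        _ = _ := by
            rw [show j + 1 + m = j + (m + 1) by ring]
            ring
    · have := coef_wt_genOp hℓ (z := z - m) (by simp; linarith) a1 k
      rw [a3] at this
      push_cast
      rw [show z - ((m : ℂ) + 1) = z - m - 1 by ring, this]
      ring

end weights

end Benjamin
end

noncomputable section

namespace Benjamin

open scoped ComplexConjugate
open Complex (I)

/-! ### Decay of coefficients in weighted Sobolev spaces, by complex interpolation -/

section stein

variable {ℓ : ℝ}

/-- Laplace transforms are holomorphic. -/
lemma differentiableAt_integral_mul_exp {α : Type*} [MeasurableSpace α] {μ : Measure α}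
    {A : α → ℂ} {L : α → ℝ} (hL : Measurable L) (hL0 : ∀ a, 0 ≤ L a) {ε : ℝ}
    (hA : ∀ σ : ℝ, -ε < σ → Integrable (fun a => A a * Complex.exp (-(σ : ℂ) * L a)) μ)
    {z : ℂ} (hz : -ε < z.re) :
    DifferentiableAt ℂ (fun z : ℂ => ∫ a, A a * Complex.exp (-z * L a) ∂μ) z := by
  -- Within distance r of z, the factor L produced by differentiation is bounded by e^{rL}/r. The
  -- derivative is then dominated by the integrand at Re z - 2r, which is still larger than -ε.
  set r := (z.re + ε) / 3 with hr
  have hr0 : 0 < r := by rw [hr]; linarith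
  have hexp : ∀ w : ℂ, Measurable fun a => Complex.exp (-w * L a) := fun w =>
    Complex.measurable_exp.comp (measurable_const.mul (Complex.measurable_ofReal.comp hL))
  have hmeas : ∀ w : ℂ, AEStronglyMeasurable (fun a => A a * Complex.exp (-w * L a)) μ := by
    intro w
    have h1 := (hA z.re hz).1.mul (hexp (w - z.re)).aestronglyMeasurable
    refine h1.congr (ae_of_all _ fun a => ?_)
    simp only [Pi.mul_apply, mul_assoc, ← Complex.exp_add]
    congr 2
    ring
  have hint : ∀ w : ℂ, -ε < w.re → Integrable (fun a => A a * Complex.exp (-w * L a)) μ := by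
    intro w hw
    refine (hA w.re hw).norm.mono' (hmeas w) (ae_of_all _ fun a => ?_)
    rw [norm_mul, norm_mul, Complex.norm_exp, Complex.norm_exp]
    simp
  have hbound : Integrable (fun a => (1 / r) * ‖A a * Complex.exp (-((z.re - 2 * r : ℝ) : ℂ) * L a)‖) μ :=
    (hA _ (by rw [hr]; linarith)).norm.const_mul _
  have h := hasDerivAt_integral_of_dominated_loc_of_deriv_le (𝕜 := ℂ) (μ := μ)
    (F := fun w a => A a * Complex.exp (-w * L a))
    (F' := fun w a => A a * (Complex.exp (-w * L a) * (-L a)))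
    (x₀ := z) (s := Metric.ball z r) (Metric.ball_mem_nhds z hr0)
    (Eventually.of_forall hmeas) (hint z hz) ?_ (ae_of_all _ fun a w hw => ?_) hbound
    (ae_of_all _ fun a w _ => ?_)
  · exact h.2.differentiableAt
  · have := (hmeas z).mul (Complex.measurable_ofReal.comp hL).aestronglyMeasurable.neg
    refine this.congr (ae_of_all _ fun a => ?_)
    simp only [Pi.mul_apply, Pi.neg_apply, Function.comp_apply]
    ring
  · have hre : z.re - r ≤ w.re := by
      have h1 := Complex.abs_re_le_norm (w - z)
      rw [Metric.mem_ball, dist_eq_norm] at hw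
      rw [Complex.sub_re] at h1
      have := (abs_le.1 (h1.trans hw.le)).1
      linarith
    rw [norm_mul, norm_mul, norm_mul, norm_neg, Complex.norm_real, Real.norm_of_nonneg (hL0 a),
      Complex.norm_exp, Complex.norm_exp]
    simp only [neg_mul, Complex.neg_re, Complex.re_mul_ofReal, Complex.ofReal_re]
    have h1 : L a ≤ 1 / r * Real.exp (r * L a) := by
      rw [div_mul_eq_mul_div, one_mul, le_div_iff₀ hr0]
      linarith [Real.add_one_le_exp (r * L a)]
    have h2 : Real.exp (-(w.re * L a)) ≤ Real.exp (-((z.re - r) * L a)) :=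
      Real.exp_le_exp.2 (by nlinarith [hL0 a])
    have h3 : Real.exp (-((z.re - r) * L a)) * Real.exp (r * L a)
        = Real.exp (-((z.re - 2 * r) * L a)) := by
      rw [← Real.exp_add]; congr 1; ring
    calc ‖A a‖ * (Real.exp (-(w.re * L a)) * L a)
        ≤ ‖A a‖ * (Real.exp (-((z.re - r) * L a)) * (1 / r * Real.exp (r * L a))) := by
          gcongr
          exact hL0 a
      _ = 1 / r * (‖A a‖ * (Real.exp (-((z.re - r) * L a)) * Real.exp (r * L a))) := by ring
      _ = _ := by rw [h3]
  · have h1 : HasDerivAt (fun w : ℂ => -w * (L a : ℂ)) (-(L a : ℂ)) w := by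
      simpa using (hasDerivAt_neg w).mul_const (L a : ℂ)
    exact (h1.cexp.const_mul (A a))

/-- The Bessel symbol `(1 + (2πξ)²)^{-z/2}`. -/
def bes (z : ℂ) (ξ : ℝ) : ℂ := ((1 + (2 * Real.pi * ξ) ^ 2 : ℝ) : ℂ) ^ (-(z / 2))

lemma norm_bes (z : ℂ) (ξ : ℝ) : ‖bes z ξ‖ = (1 + (2 * Real.pi * ξ) ^ 2) ^ (-(z.re / 2)) := by
  rw [bes, Complex.norm_cpow_eq_rpow_re_of_pos (by positivity)]
  simp

lemma continuous_bes (z : ℂ) : Continuous (bes z) := by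
  unfold bes
  refine Continuous.cpow (by fun_prop) continuous_const fun ξ => ?_
  exact Complex.ofReal_mem_slitPlane.2 (by positivity)

lemma norm_bes_le_one {z : ℂ} (hz : 0 ≤ z.re) (ξ : ℝ) : ‖bes z ξ‖ ≤ 1 := by
  rw [norm_bes]
  exact Real.rpow_le_one_of_one_le_of_nonpos (by nlinarith [sq_nonneg (2 * Real.pi * ξ)])
    (by linarith)

/-- Bounded measurable functions with bounded support. -/
def IsBddCpt (φ : ℝ → ℂ) : Prop :=
  AEStronglyMeasurable φ volume ∧ ∃ B R : ℝ, ∀ ξ, ‖φ ξ‖ ≤ (Icc (-R) R).indicator (fun _ => B) ξ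

lemma IsBddCpt.mul_continuous {φ : ℝ → ℂ} (h : IsBddCpt φ) {a : ℝ → ℂ} (ha : Continuous a) :
    IsBddCpt fun ξ => a ξ * φ ξ := by
  obtain ⟨h0, B, R, h1⟩ := h
  obtain ⟨C, hC⟩ := (isCompact_Icc (a := -R) (b := R)).exists_bound_of_continuousOn ha.continuousOn
  refine ⟨ha.aestronglyMeasurable.mul h0, C * B, R, fun ξ => ?_⟩
  have := h1 ξ
  rw [norm_mul]
  by_cases hξ : ξ ∈ Icc (-R) R
  · rw [indicator_of_mem hξ] at this ⊢
    exact mul_le_mul (hC ξ hξ) this (norm_nonneg _) ((norm_nonneg _).trans (hC ξ hξ))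
  · rw [indicator_of_notMem hξ] at this ⊢
    rw [norm_le_zero_iff.1 this]
    simp

lemma IsBddCpt.memLp {φ : ℝ → ℂ} (h : IsBddCpt φ) (p : ℝ≥0∞) : MemLp φ p volume := by
  obtain ⟨h0, B, R, h1⟩ := h
  have h2 : MemLp ((Icc (-R) R).indicator (fun _ : ℝ => B)) p volume :=
    memLp_indicator_const p measurableSet_Icc B (Or.inr (by simp))
  refine h2.of_le h0 (ae_of_all _ fun ξ => (h1 ξ).trans (le_abs_self _))

lemma IsBddCpt.integrable {φ : ℝ → ℂ} (h : IsBddCpt φ) : Integrable φ :=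
  memLp_one_iff_integrable.1 (h.memLp 1)

lemma iteratedDeriv_fourierInv {φ : ℝ → ℂ} (h : IsBddCpt φ) (i : ℕ) :
    iteratedDeriv i (𝓕⁻ φ) = 𝓕⁻ fun ξ : ℝ => (2 * Real.pi * I * ξ) ^ i * φ ξ := by
  have hφ : IsBddCpt fun ξ => φ (-ξ) := by
    obtain ⟨h0, B, R, h1⟩ := h
    refine ⟨h0.comp_measurePreserving (Measure.measurePreserving_neg volume), B, R, fun ξ => ?_⟩
    refine (h1 (-ξ)).trans_eq ?_
    simp only [indicator, mem_Icc]
    congr 1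
    rw [eq_iff_iff]
    constructor <;> rintro ⟨a, b⟩ <;> constructor <;> linarith
  have e : ∀ φ : ℝ → ℂ, 𝓕⁻ φ = 𝓕 fun ξ => φ (-ξ) := fun φ => by
    rw [Real.fourierInv_eq_fourier_comp_neg]
  have hi : ∀ n : ℕ, (n : ℕ∞) ≤ ⊤ → Integrable fun ξ : ℝ => ξ ^ n • φ (-ξ) := fun n _ => by
    have := (hφ.mul_continuous (a := fun ξ : ℝ => (ξ : ℂ) ^ n) (by fun_prop)).integrable
    refine this.congr (ae_of_all _ fun ξ => ?_)
    simp
  rw [e, Real.iteratedDeriv_fourier hi le_top, e]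
  congr 1
  ext ξ
  rw [smul_eq_mul]
  push_cast
  ring

lemma hInf_fourierInv {φ : ℝ → ℂ} (h : IsBddCpt φ) : HInf (𝓕⁻ φ) := by
  refine ⟨?_, fun i => ?_⟩
  · have e : 𝓕⁻ φ = fun x => 𝓕 φ (-x) := funext fun x => Real.fourierInv_eq_fourier_neg φ x
    rw [e]
    refine (Real.contDiff_fourier fun n _ => ?_).comp contDiff_neg
    have := (h.mul_continuous (a := fun ξ : ℝ => (ξ : ℂ) ^ n) (by fun_prop)).integrable.norm
    refine this.congr (ae_of_all _ fun ξ => ?_)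
    simp
  · rw [iteratedDeriv_fourierInv h]
    have := h.mul_continuous (a := fun ξ : ℝ => (2 * Real.pi * I * ξ) ^ i) (by fun_prop)
    exact memLp_fourierInv this.integrable (this.memLp 2)

lemma l2n_fourierInv {φ : ℝ → ℂ} (h : IsBddCpt φ) : l2n (𝓕⁻ φ) = l2n φ := by
  have := integral_norm_sq_fourierInv h.integrable (h.memLp 2)
  rw [← l2n_sq (memLp_fourierInv h.integrable (h.memLp 2)), ← l2n_sq (h.memLp 2)] at this
  exact (sq_eq_sq₀ (l2n_nonneg _) (l2n_nonneg _)).1 this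

lemma l2n_bes_mul_le {z : ℂ} (hz : 0 ≤ z.re) {φ : ℝ → ℂ} (hφ : MemLp φ 2 volume) :
    l2n (fun ξ => bes z ξ * φ ξ) ≤ l2n φ := by
  rw [← one_mul (l2n φ)]
  refine l2n_le_mul hφ zero_le_one fun x => ?_
  rw [norm_mul]
  exact mul_le_mul_of_nonneg_right (norm_bes_le_one hz x) (norm_nonneg _)

/-- On the line Re z = m the modulus of the Bessel symbol is (1 + (2πξ)²)^{-m/2}, whatever Im z is,
and this compensates up to m derivatives. -/
lemma sobN_fourierInv_bes_le {m : ℕ} {z : ℂ} (hz : z.re = m) {φ : ℝ → ℂ} (hφ : IsBddCpt φ) :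
    sobN m (𝓕⁻ fun ξ => bes z ξ * φ ξ) ≤ (m + 1) * l2n φ := by
  have hb := hφ.mul_continuous (continuous_bes z)
  have : ∀ i ∈ Finset.range (m + 1),
      l2n (iteratedDeriv i (𝓕⁻ fun ξ => bes z ξ * φ ξ)) ≤ l2n φ := by
    intro i hi
    have him : i ≤ m := by simpa [Nat.lt_succ_iff] using hi
    have hc := hb.mul_continuous (a := fun ξ : ℝ => (2 * Real.pi * I * ξ) ^ i) (by fun_prop)
    rw [iteratedDeriv_fourierInv hb, l2n_fourierInv hc, ← one_mul (l2n φ)]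
    refine l2n_le_mul (hφ.memLp 2) zero_le_one fun ξ => ?_
    rw [norm_mul, norm_mul, ← mul_assoc]
    refine mul_le_mul_of_nonneg_right ?_ (norm_nonneg _)
    set y := 2 * Real.pi * ξ with hy
    have e1 : ‖(2 * Real.pi * I * ξ : ℂ) ^ i‖ = |y| ^ i := by
      rw [norm_pow]
      congr 1
      rw [hy, abs_mul, abs_mul]
      simp [abs_of_pos Real.pi_pos]
    have h1 : (1 : ℝ) ≤ 1 + y ^ 2 := by nlinarith [sq_nonneg y]
    have h2 : |y| ^ i ≤ (1 + y ^ 2) ^ ((m : ℝ) / 2) := by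
      have h3 : |y| ≤ (1 + y ^ 2) ^ ((1 : ℝ) / 2) := by
        rw [← Real.sqrt_eq_rpow]
        exact Real.abs_le_sqrt (by linarith)
      calc |y| ^ i ≤ ((1 + y ^ 2) ^ ((1 : ℝ) / 2)) ^ i := by gcongr
        _ = (1 + y ^ 2) ^ ((i : ℝ) / 2) := by
            rw [← Real.rpow_natCast, ← Real.rpow_mul (by positivity)]
            congr 1
            ring
        _ ≤ _ := by
            apply Real.rpow_le_rpow_of_exponent_le h1
            have : (i : ℝ) ≤ m := by exact_mod_cast him
            linarith
    rw [e1, norm_bes, hz, Real.rpow_neg (by positivity), ← div_eq_mul_inv]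
    exact (div_le_one (by positivity)).2 h2
  calc _ ≤ ∑ _i ∈ Finset.range (m + 1), l2n φ := Finset.sum_le_sum this
    _ = _ := by simp

end stein

end Benjamin
end

noncomputable section

namespace Benjamin

open scoped ComplexConjugate
open Complex (I)

/-! ### The analytic family of coefficients and the three lines theorem. -/

section stein

variable {ℓ : ℝ}

lemma exists_norm_psi_le_rpow (hℓ : 0 < ℓ) :
    ∃ C, 0 ≤ C ∧ ∀ (k : ℤ) (x : ℝ), ‖psi ℓ k x‖ ≤ C * (1 + x ^ 2) ^ (-(1 / 2 : ℝ)) := by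
  set A := 2 * ℓ / Real.pi with hA
  set B := 1 + 1 / ℓ ^ 2 with hB
  have hA0 : 0 < A := by positivity
  have hB0 : 0 < B := by positivity
  refine ⟨Real.sqrt (A * B), Real.sqrt_nonneg _, fun k x => ?_⟩
  rw [Real.rpow_neg (by positivity), ← Real.sqrt_eq_rpow, ← div_eq_mul_inv,
    ← Real.sqrt_div (by positivity)]
  refine Real.le_sqrt_of_sq_le ?_
  rw [norm_psi_sq hℓ, div_le_div_iff₀ (by positivity) (by positivity), mul_assoc]
  refine mul_le_mul_of_nonneg_left ?_ hA0.le
  have h1 : B * (ℓ ^ 2 + 4 * x ^ 2) = 1 + x ^ 2 + (ℓ ^ 2 + 3 * x ^ 2 + 4 * x ^ 2 / ℓ ^ 2) := by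
    rw [hB]; field_simp; ring
  rw [h1]
  have : 0 ≤ ℓ ^ 2 + 3 * x ^ 2 + 4 * x ^ 2 / ℓ ^ 2 := by positivity
  linarith

/-- The basis functions decay only like 1/|x| and just fail to be integrable. Any positive power of
the weight repairs this, which is the purpose of the shift ε in `steinCoef`. -/
lemma integrable_wt_mul_conj_psi (hℓ : 0 < ℓ) {z : ℂ} (hz : 0 < z.re) (k : ℤ) :
    Integrable fun x => wt z x * conj (psi ℓ k x) := by
  obtain ⟨C, hC, h⟩ := exists_norm_psi_le_rpow hℓ
  have h1 := integrable_rpow_neg_one_add_norm_sq (E := ℝ) (μ := volume) (r := 1 + 2 * z.re)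
    (by simp; linarith)
  refine (h1.const_mul C).mono' ((continuous_wt z).mul
    (Complex.continuous_conj.comp (continuous_psi hℓ k))).aestronglyMeasurable
    (ae_of_all _ fun x => ?_)
  rw [norm_mul, norm_wt, RCLike.norm_conj, Real.norm_eq_abs, sq_abs]
  have e : (1 + x ^ 2 : ℝ) ^ (-(1 + 2 * z.re) / 2)
      = (1 + x ^ 2) ^ (-z.re) * (1 + x ^ 2) ^ (-(1 / 2 : ℝ)) := by
    rw [← Real.rpow_add (by positivity)]; congr 1; ring
  rw [e, mul_left_comm]
  exact mul_le_mul_of_nonneg_left (h k x) (by positivity)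

/-- The exponent in the analytic family of weights and symbols. -/
def steinExp (a : ℝ × ℝ) : ℝ :=
  Real.log (1 + a.1 ^ 2) + Real.log (1 + (2 * Real.pi * a.2) ^ 2) / 2

lemma steinExp_nonneg (a : ℝ × ℝ) : 0 ≤ steinExp a := by
  have h1 := Real.log_nonneg (x := 1 + a.1 ^ 2) (by nlinarith [sq_nonneg a.1])
  have h2 := Real.log_nonneg (x := 1 + (2 * Real.pi * a.2) ^ 2)
    (by nlinarith [sq_nonneg (2 * Real.pi * a.2)])
  unfold steinExp
  linarith

lemma measurable_steinExp : Measurable steinExp := by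
  unfold steinExp
  fun_prop

lemma wt_eq_exp (z : ℂ) (x : ℝ) : wt z x = Complex.exp (-z * (Real.log (1 + x ^ 2) : ℝ)) := by
  rw [wt, Complex.cpow_def_of_ne_zero, ← Complex.ofReal_log (by positivity), mul_comm]
  have : (1 + x ^ 2 : ℝ) ≠ 0 := by positivity
  exact_mod_cast this

lemma bes_eq_exp (z : ℂ) (ξ : ℝ) :
    bes z ξ = Complex.exp (-z * (Real.log (1 + (2 * Real.pi * ξ) ^ 2) / 2 : ℝ)) := by
  rw [bes, Complex.cpow_def_of_ne_zero, ← Complex.ofReal_log (by positivity)]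
  · congr 1
    push_cast
    ring
  · have : (1 + (2 * Real.pi * ξ) ^ 2 : ℝ) ≠ 0 := by positivity
    exact_mod_cast this

lemma exp_steinExp (z : ℂ) (a : ℝ × ℝ) :
    Complex.exp (-z * steinExp a) = wt z a.1 * bes z a.2 := by
  rw [wt_eq_exp, bes_eq_exp, ← Complex.exp_add, steinExp]
  congr 1
  push_cast
  ring

lemma wt_add (z w : ℂ) (x : ℝ) : wt (z + w) x = wt z x * wt w x := by
  rw [wt_eq_exp, wt_eq_exp, wt_eq_exp, ← Complex.exp_add]
  congr 1
  ring

/-- The amplitude of the analytic family. -/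
def steinAmp (ℓ ε : ℝ) (k : ℤ) (φ : ℝ → ℂ) (a : ℝ × ℝ) : ℂ :=
  wt ε a.1 * conj (psi ℓ k a.1) * φ a.2 * Complex.exp (2 * Real.pi * I * a.2 * a.1)

/-- The analytic family of coefficients. -/
def steinCoef (ℓ ε : ℝ) (k : ℤ) (φ : ℝ → ℂ) (z : ℂ) : ℂ :=
  coef ℓ (fun x => wt (z + ε) x * 𝓕⁻ (fun ξ => bes z ξ * φ ξ) x) k

lemma integrable_steinAmp (hℓ : 0 < ℓ) {ε : ℝ} (k : ℤ) {φ : ℝ → ℂ} (hφ : IsBddCpt φ)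
    {z : ℂ} (hz : -ε < z.re) :
    Integrable (fun a => steinAmp ℓ ε k φ a * Complex.exp (-z * steinExp a))
      (volume.prod volume) := by
  have h1 := integrable_wt_mul_conj_psi hℓ (z := z + ε) (by simp; linarith) k
  have h2 := (hφ.mul_continuous (continuous_bes z)).integrable
  have h3 := h1.mul_prod h2
  have h4 : Continuous fun a : ℝ × ℝ => Complex.exp (2 * Real.pi * I * a.2 * a.1) := by fun_prop
  have h5 := h3.bdd_mul (c := 1) h4.aestronglyMeasurable (ae_of_all _ fun a => by
    rw [Complex.norm_exp]
    simp)
  refine h5.congr (ae_of_all _ fun a => ?_)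
  simp only [exp_steinExp, steinAmp, wt_add]
  ring

/-- By Fubini the coefficient is an absolutely convergent double integral over (x, ξ) in which z
occurs only in e^{-zL} with L ≥ 0, that is, a Laplace transform; holomorphy follows. -/
lemma steinCoef_eq (hℓ : 0 < ℓ) {ε : ℝ} (k : ℤ) {φ : ℝ → ℂ} (hφ : IsBddCpt φ)
    {z : ℂ} (hz : -ε < z.re) :
    steinCoef ℓ ε k φ z
      = ∫ a, steinAmp ℓ ε k φ a * Complex.exp (-z * steinExp a) ∂(volume.prod volume) := by
  rw [integral_prod _ (integrable_steinAmp hℓ k hφ hz), steinCoef, coef]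
  congr 1
  ext x
  rw [fourierInv_apply_eq, mul_right_comm, ← integral_const_mul]
  congr 1
  ext ξ
  rw [exp_steinExp, steinAmp, wt_add]
  ring

lemma differentiableAt_steinCoef (hℓ : 0 < ℓ) {ε : ℝ} (k : ℤ) {φ : ℝ → ℂ} (hφ : IsBddCpt φ)
    {z : ℂ} (hz : -ε < z.re) : DifferentiableAt ℂ (steinCoef ℓ ε k φ) z := by
  have h := differentiableAt_integral_mul_exp measurable_steinExp steinExp_nonneg
    (A := steinAmp ℓ ε k φ) (μ := volume.prod volume) (ε := ε)
    (fun σ hσ => integrable_steinAmp hℓ k hφ (z := σ) (by simpa using hσ)) hz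
  refine h.congr_of_eventuallyEq ?_
  have : {w : ℂ | -ε < w.re} ∈ 𝓝 z :=
    (isOpen_lt continuous_const Complex.continuous_re).mem_nhds hz
  filter_upwards [this] with w hw
  exact steinCoef_eq hℓ k hφ hw

/-- A qualitative bound that depends on k, ε and φ. It serves only for the a priori boundedness in
the strip that the three lines theorem requires. -/
lemma exists_norm_steinCoef_le (hℓ : 0 < ℓ) {ε : ℝ} (hε : 0 < ε) (k : ℤ) {φ : ℝ → ℂ}
    (hφ : IsBddCpt φ) : ∃ B, 0 ≤ B ∧ ∀ z : ℂ, 0 ≤ z.re → ‖steinCoef ℓ ε k φ z‖ ≤ B := by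
  have h0 := integrable_steinAmp hℓ k hφ (ε := ε) (z := 0) (by simpa using hε)
  refine ⟨∫ a, ‖steinAmp ℓ ε k φ a * Complex.exp (-0 * steinExp a)‖ ∂(volume.prod volume),
    integral_nonneg fun a => norm_nonneg _, fun z hz => ?_⟩
  rw [steinCoef_eq hℓ k hφ (by linarith)]
  refine norm_integral_le_of_norm_le h0.norm (ae_of_all _ fun a => ?_)
  rw [norm_mul, norm_mul]
  refine mul_le_mul_of_nonneg_left ?_ (norm_nonneg _)
  rw [Complex.norm_exp, Complex.norm_exp]
  refine Real.exp_le_exp.2 ?_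
  simp only [neg_mul, Complex.neg_re, Complex.re_mul_ofReal, Complex.zero_re, zero_mul]
  have := mul_nonneg hz (steinExp_nonneg a)
  simpa using this

lemma norm_sum_mul_le {ι : Type*} (s : Finset ι) (a b : ι → ℂ) :
    ‖∑ i ∈ s, a i * b i‖ ≤ Real.sqrt (∑ i ∈ s, ‖a i‖ ^ 2) * Real.sqrt (∑ i ∈ s, ‖b i‖ ^ 2) := by
  refine (norm_sum_le _ _).trans ?_
  simp only [norm_mul]
  exact Real.sum_mul_le_sqrt_mul_sqrt s _ _

lemma norm_one_add_cpow (k : ℕ) (z : ℂ) : ‖((1 + k : ℝ) : ℂ) ^ z‖ = (1 + k : ℝ) ^ z.re :=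
  Complex.norm_cpow_eq_rpow_re_of_pos (by positivity) z

lemma norm_exp_sq (z : ℂ) : ‖Complex.exp (z ^ 2)‖ = Real.exp (z.re ^ 2 - z.im ^ 2) := by
  rw [Complex.norm_exp]
  congr 1
  rw [sq, Complex.mul_re]
  ring

/-- On the line Re z = m the modulus of e^{z²} is e^{m² - y²} with y = Im z, which beats the
polynomial growth of the constants of the iterated generator. -/
lemma growth_bound (m : ℕ) (y : ℝ) :
    (m + 2 + |y|) ^ m * Real.exp ((m : ℝ) ^ 2 - y ^ 2) ≤ Real.exp ((m : ℝ) * (m + 2) + 2 * m ^ 2) := by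
  have h1 : (m + 2 + |y|) ^ m ≤ Real.exp (m * (m + 2 + |y|)) := by
    rw [Real.exp_nat_mul]
    gcongr
    linarith [Real.add_one_le_exp ((m : ℝ) + 2 + |y|)]
  calc _ ≤ Real.exp (m * (m + 2 + |y|)) * Real.exp ((m : ℝ) ^ 2 - y ^ 2) := by gcongr
    _ = Real.exp (m * (m + 2 + |y|) + ((m : ℝ) ^ 2 - y ^ 2)) := (Real.exp_add _ _).symm
    _ ≤ _ := by
      apply Real.exp_le_exp.2
      rw [← sq_abs y]
      nlinarith [sq_nonneg ((m : ℝ) - |y|), sq_nonneg ((m : ℝ) + |y|), sq_nonneg (m : ℝ), sq_nonneg |y|]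

/-- Left edge of the strip: weight and symbol have modulus at most one and (1+k)^z has modulus one,
so Parseval and Plancherel suffice. -/
lemma sqrt_sum_steinCoef_le (hℓ : 0 < ℓ) {ε : ℝ} (hε : 0 < ε) (K : ℕ) {φ : ℝ → ℂ}
    (hφ : IsBddCpt φ) {z : ℂ} (hz : z.re = 0) :
    Real.sqrt (∑ k ∈ Finset.range K, ‖((1 + k : ℝ) : ℂ) ^ z * steinCoef ℓ ε k φ z‖ ^ 2) ≤ l2n φ := by
  have hb := hφ.mul_continuous (continuous_bes z)
  have hm := memLp_fourierInv hb.integrable (hb.memLp 2)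
  have hz' : 0 ≤ (z + ε).re := by simp [hz, hε.le]
  have h1 := sum_norm_sq_coef_le hℓ (memLp_wt_mul hz' hm) K
  have h2 : l2n (fun x => wt (z + ε) x * 𝓕⁻ (fun ξ => bes z ξ * φ ξ) x) ≤ l2n φ :=
    (l2n_wt_mul_le hz' hm).trans ((l2n_fourierInv hb).trans_le (l2n_bes_mul_le hz.ge (hφ.memLp 2)))
  refine Real.sqrt_le_iff.2 ⟨l2n_nonneg _, ?_⟩
  refine le_trans (le_of_eq ?_) (h1.trans (pow_le_pow_left₀ (l2n_nonneg _) h2 2))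
  refine Finset.sum_congr rfl fun k _ => ?_
  rw [norm_mul, norm_one_add_cpow, hz, Real.rpow_zero, one_mul]
  rfl

/-- Right edge of the strip: m applications of the generator produce the factor (k+1)^m and use up
the weight of order m and the m derivatives supplied by the Bessel symbol. The constant does not
depend on ε. -/
lemma exists_sqrt_sum_steinCoef_le (hℓ : 0 < ℓ) (m : ℕ) : ∃ C, 0 ≤ C ∧ ∀ ε : ℝ, 0 < ε → ε ≤ 1 →
    ∀ K : ℕ, ∀ φ, IsBddCpt φ → ∀ z : ℂ, z.re = m →
    Real.sqrt (∑ k ∈ Finset.range K, ‖((1 + k : ℝ) : ℂ) ^ z * steinCoef ℓ ε k φ z‖ ^ 2)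
      ≤ C * (m + 2 + |z.im|) ^ m * l2n φ := by
  obtain ⟨C, hC, h⟩ := exists_coef_wt_eq hℓ m 0
  refine ⟨C * (m + 1), by positivity, fun ε hε hε1 K φ hφ z hz => ?_⟩
  have hb := hφ.mul_continuous (continuous_bes z)
  obtain ⟨g, hg, hs, hc⟩ := h (z + ε) (by simp [hz, hε.le]) _ (hInf_fourierInv hb)
  rw [zero_add, sobN_zero] at hs
  have hz' : 0 ≤ (z + ε - m).re := by simp [hz, hε.le]
  have h1 := sum_norm_sq_coef_le hℓ (memLp_wt_mul hz' hg.memLp) K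
  have h3 : ‖z + ε‖ ≤ m + |z.im| + 1 := by
    refine (norm_add_le _ _).trans ?_
    have := Complex.norm_le_abs_re_add_abs_im z
    rw [hz, abs_of_nonneg (by positivity)] at this
    rw [Complex.norm_real, Real.norm_of_nonneg hε.le]
    linarith
  have h2 : l2n (fun x => wt (z + ε - m) x * g x) ≤ C * (m + 1) * (m + 2 + |z.im|) ^ m * l2n φ := by
    refine (l2n_wt_mul_le hz' hg.memLp).trans (hs.trans ?_)
    calc _ ≤ C * (m + 2 + |z.im|) ^ m * ((m + 1) * l2n φ) := by
          have := sobN_fourierInv_bes_le hz hφ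
          have h0 := sobN_nonneg m (𝓕⁻ fun ξ => bes z ξ * φ ξ)
          have h4 : 1 + ‖z + ε‖ ≤ m + 2 + |z.im| := by linarith
          gcongr
      _ = _ := by ring
  refine Real.sqrt_le_iff.2 ⟨mul_nonneg (by positivity) (l2n_nonneg _), ?_⟩
  refine le_trans (le_of_eq ?_) (h1.trans (pow_le_pow_left₀ (l2n_nonneg _) h2 2))
  refine Finset.sum_congr rfl fun k _ => ?_
  rw [hc, norm_mul, norm_mul, norm_one_add_cpow, hz, Real.rpow_natCast]
  congr 2
  rw [norm_pow, norm_mul, Complex.norm_I, one_mul]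
  congr 1
  have : ((k : ℤ) : ℂ) + 1 = ((1 + k : ℝ) : ℂ) := by push_cast; ring
  rw [this, Complex.norm_real, Real.norm_of_nonneg (by positivity)]

/-- Complex interpolation between the exponents `0` and `m`. -/
lemma exists_norm_sum_steinCoef_le (hℓ : 0 < ℓ) (m : ℕ) (hm : 0 < m) : ∃ C, 0 ≤ C ∧
    ∀ ε : ℝ, 0 < ε → ε ≤ 1 → ∀ K : ℕ, ∀ φ, IsBddCpt φ → ∀ s : ℝ, 0 ≤ s → s ≤ m →
    ∀ b : ℕ → ℂ, ‖∑ k ∈ Finset.range K, b k * (((1 + k : ℝ) : ℂ) ^ (s : ℂ) * steinCoef ℓ ε k φ s)‖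
      ≤ C * (Real.sqrt (∑ k ∈ Finset.range K, ‖b k‖ ^ 2) * l2n φ) := by
  obtain ⟨C, hC, h⟩ := exists_sqrt_sum_steinCoef_le hℓ m
  set C' := 1 + C * Real.exp ((m : ℝ) * (m + 2) + 2 * m ^ 2) with hC'
  have hC'1 : 1 ≤ C' := by rw [hC']; have := Real.exp_pos ((m : ℝ) * (m + 2) + 2 * m ^ 2); nlinarith [mul_nonneg hC this.le]
  refine ⟨C', by linarith, fun ε hε hε1 K φ hφ s hs0 hsm b => ?_⟩
  set P := Real.sqrt (∑ k ∈ Finset.range K, ‖b k‖ ^ 2) * l2n φ with hP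
  have hP0 : 0 ≤ P := mul_nonneg (Real.sqrt_nonneg _) (l2n_nonneg _)
  -- The coefficients are paired with a fixed vector b so that the interpolation is scalar; e^{z²}
  -- tames the growth in Im z on the right edge.
  set F : ℂ → ℂ := fun z => Complex.exp (z ^ 2) *
    ∑ k ∈ Finset.range K, b k * (((1 + k : ℝ) : ℂ) ^ z * steinCoef ℓ ε k φ z) with hF
  have hm0 : (0 : ℝ) < m := by exact_mod_cast hm
  have hdiff : ∀ z : ℂ, -ε < z.re → DifferentiableAt ℂ F z := by
    intro z hz
    refine DifferentiableAt.mul (by fun_prop) (DifferentiableAt.fun_sum fun k _ => ?_)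
    refine (DifferentiableAt.mul ?_ (differentiableAt_steinCoef hℓ k hφ hz)).const_mul _
    refine (differentiableAt_id.const_cpow (Or.inl ?_))
    have : (1 + k : ℝ) ≠ 0 := by positivity
    exact_mod_cast this
  have hedge0 : ∀ z ∈ Complex.re ⁻¹' {(0 : ℝ)}, ‖F z‖ ≤ P := by
    intro z hz
    have hz0 : z.re = 0 := hz
    rw [hF, norm_mul, norm_exp_sq, hz0]
    have h1 : Real.exp ((0 : ℝ) ^ 2 - z.im ^ 2) ≤ 1 := by
      rw [Real.exp_le_one_iff]; nlinarith [sq_nonneg z.im]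
    have h2 := (norm_sum_mul_le (Finset.range K) b
      (fun k => ((1 + k : ℝ) : ℂ) ^ z * steinCoef ℓ ε k φ z)).trans
      (mul_le_mul_of_nonneg_left (sqrt_sum_steinCoef_le hℓ hε K hφ hz0) (Real.sqrt_nonneg _))
    calc _ ≤ 1 * P := mul_le_mul h1 h2 (norm_nonneg _) zero_le_one
      _ = P := one_mul _
  have hedgem : ∀ z ∈ Complex.re ⁻¹' {(m : ℝ)}, ‖F z‖ ≤ C' * P := by
    intro z hz
    have hz0 : z.re = m := hz
    rw [hF, norm_mul, norm_exp_sq, hz0]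
    have h2 := (norm_sum_mul_le (Finset.range K) b
      (fun k => ((1 + k : ℝ) : ℂ) ^ z * steinCoef ℓ ε k φ z)).trans
      (mul_le_mul_of_nonneg_left (h ε hε hε1 K φ hφ z hz0) (Real.sqrt_nonneg _))
    have h3 := growth_bound m z.im
    calc _ ≤ Real.exp ((m : ℝ) ^ 2 - z.im ^ 2) * (Real.sqrt (∑ k ∈ Finset.range K, ‖b k‖ ^ 2) *
          (C * (m + 2 + |z.im|) ^ m * l2n φ)) := mul_le_mul_of_nonneg_left h2 (Real.exp_pos _).le
      _ = C * ((m + 2 + |z.im|) ^ m * Real.exp ((m : ℝ) ^ 2 - z.im ^ 2)) * P := by rw [hP]; ring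
      _ ≤ C * Real.exp ((m : ℝ) * (m + 2) + 2 * m ^ 2) * P := by gcongr
      _ ≤ C' * P := by rw [hC']; nlinarith
  have hbdd : BddAbove (norm ∘ F '' Complex.HadamardThreeLines.verticalClosedStrip 0 m) := by
    choose B hB0 hB using fun k : ℕ => exists_norm_steinCoef_le hℓ hε k hφ
    refine ⟨Real.exp ((m : ℝ) ^ 2) * ∑ k ∈ Finset.range K, ‖b k‖ * ((1 + k : ℝ) ^ (m : ℝ) * B k), ?_⟩
    rintro _ ⟨z, hz, rfl⟩
    have hz' : 0 ≤ z.re ∧ z.re ≤ m := hz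
    rw [Function.comp_apply, hF, norm_mul, norm_exp_sq]
    refine mul_le_mul (Real.exp_le_exp.2 ?_) ?_ (norm_nonneg _) (Real.exp_pos _).le
    · nlinarith [sq_nonneg z.im]
    · refine (norm_sum_le _ _).trans (Finset.sum_le_sum fun k _ => ?_)
      rw [norm_mul, norm_mul, norm_one_add_cpow]
      refine mul_le_mul_of_nonneg_left (mul_le_mul ?_ (hB k z hz'.1) (norm_nonneg _)
        (by positivity)) (norm_nonneg _)
      exact Real.rpow_le_rpow_of_exponent_le (by simp) hz'.2
  have hcl : DiffContOnCl ℂ F (Complex.HadamardThreeLines.verticalStrip 0 m) := by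
    refine DifferentiableOn.diffContOnCl fun z hz => (hdiff z ?_).differentiableWithinAt
    have h1 : closure (Complex.HadamardThreeLines.verticalStrip 0 m) ⊆ {w : ℂ | 0 ≤ w.re} :=
      closure_minimal (fun w hw => (show 0 < w.re ∧ _ from hw).1.le)
        (isClosed_le continuous_const Complex.continuous_re)
    have : 0 ≤ z.re := h1 hz
    linarith
  have key := Complex.HadamardThreeLines.norm_le_interp_of_mem_verticalClosedStrip' hm0
    (z := (s : ℂ)) (show (s : ℂ).re ∈ Icc (0 : ℝ) m from ⟨by simpa, by simpa⟩) hcl hbdd hedge0 hedgem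
  have hle : ‖F s‖ ≤ C' * P := by
    refine key.trans ?_
    simp only [Complex.ofReal_re, sub_zero]
    have hq0 : 0 ≤ s / m := by positivity
    have hq1 : s / m ≤ 1 := (div_le_one hm0).2 hsm
    have hPC : P ≤ C' * P := by nlinarith
    calc P ^ (1 - s / m) * (C' * P) ^ (s / m)
        ≤ (C' * P) ^ (1 - s / m) * (C' * P) ^ (s / m) := by
          gcongr
      _ = C' * P := by
        rw [← Real.rpow_add_of_nonneg (by positivity) (by linarith) hq0]
        simp
  refine le_trans ?_ hle
  rw [hF, norm_mul, norm_exp_sq]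
  -- At the real point s the auxiliary factor e^{s²} is at least 1 and can be dropped.
  refine le_mul_of_one_le_left (norm_nonneg _) (Real.one_le_exp ?_)
  simp
  positivity

/-- The discrete smoothing estimate for nice densities. -/
lemma exists_sum_coef_wt_le (hℓ : 0 < ℓ) (s : ℝ) (hs : 0 ≤ s) : ∃ C, 0 ≤ C ∧
    ∀ K : ℕ, ∀ φ, IsBddCpt φ → ∑ k ∈ Finset.range K, (1 + k : ℝ) ^ (2 * s) *
      ‖coef ℓ (fun x => wt s x * 𝓕⁻ (fun ξ => bes s ξ * φ ξ) x) k‖ ^ 2 ≤ C * l2n φ ^ 2 := by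
  obtain ⟨C, hC, h⟩ := exists_norm_sum_steinCoef_le hℓ (⌈s⌉₊ + 1) (Nat.succ_pos _)
  refine ⟨C ^ 2, by positivity, fun K φ hφ => ?_⟩
  have hs1 : s ≤ (⌈s⌉₊ + 1 : ℕ) := by push_cast; linarith [Nat.le_ceil s]
  have step : ∀ ε : ℝ, 0 < ε → ε ≤ 1 → ∑ k ∈ Finset.range K, (1 + k : ℝ) ^ (2 * s) *
      ‖steinCoef ℓ ε k φ s‖ ^ 2 ≤ C ^ 2 * l2n φ ^ 2 := by
    intro ε hε hε1
    set Q := ∑ k ∈ Finset.range K, (1 + k : ℝ) ^ (2 * s) * ‖steinCoef ℓ ε k φ s‖ ^ 2 with hQ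
    have hQ0 : 0 ≤ Q := Finset.sum_nonneg fun k _ => by positivity
    -- Duality: b is the conjugate of the vector to be estimated, so the pairing equals the square
    -- of its Euclidean norm Q^{1/2} and one factor Q^{1/2} cancels.
    have h1 := h ε hε hε1 K φ hφ s hs hs1
      (fun k => conj (((1 + k : ℝ) : ℂ) ^ (s : ℂ) * steinCoef ℓ ε k φ s))
    have e1 : ∀ k : ℕ, ‖((1 + k : ℝ) : ℂ) ^ (s : ℂ) * steinCoef ℓ ε k φ s‖ ^ 2
        = (1 + k : ℝ) ^ (2 * s) * ‖steinCoef ℓ ε k φ s‖ ^ 2 := fun k => by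
      rw [norm_mul, norm_one_add_cpow, mul_pow, Complex.ofReal_re, mul_comm 2 s,
        Real.rpow_mul (by positivity)]
      norm_cast
    simp only [RCLike.norm_conj, e1, ← hQ, Complex.conj_mul'] at h1
    have e2 : ∑ k ∈ Finset.range K, (‖((1 + k : ℝ) : ℂ) ^ (s : ℂ) * steinCoef ℓ ε k φ s‖ : ℂ) ^ 2
        = (Q : ℂ) := by
      rw [hQ, Complex.ofReal_sum]
      refine Finset.sum_congr rfl fun k _ => ?_
      rw [← e1]
      push_cast
      rfl
    rw [e2, Complex.norm_real, Real.norm_of_nonneg hQ0] at h1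
    rcases hQ0.eq_or_lt with h0 | h0
    · rw [← h0]; positivity
    · have h2 : Real.sqrt Q ≤ C * l2n φ := by
        have h3 : Real.sqrt Q * Real.sqrt Q ≤ Real.sqrt Q * (C * l2n φ) := by
          rw [Real.mul_self_sqrt hQ0]; linarith
        exact le_of_mul_le_mul_left h3 (Real.sqrt_pos.2 h0)
      calc Q = Real.sqrt Q ^ 2 := (Real.sq_sqrt hQ0).symm
        _ ≤ (C * l2n φ) ^ 2 := pow_le_pow_left₀ (Real.sqrt_nonneg _) h2 2
        _ = _ := by ring
  have hb := hφ.mul_continuous (continuous_bes s)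
  have hm := memLp_fourierInv hb.integrable (hb.memLp 2)
  -- The bound is uniform in ε, so the auxiliary weight is removed by dominated convergence in each
  -- of the finitely many coefficients.
  have lim : ∀ k : ℕ, Tendsto (fun ε : ℝ => steinCoef ℓ ε k φ s) (𝓝[>] 0)
      (𝓝 (coef ℓ (fun x => wt s x * 𝓕⁻ (fun ξ => bes s ξ * φ ξ) x) k)) := by
    intro k
    unfold steinCoef coef
    refine tendsto_integral_filter_of_dominated_convergence
      (fun x => ‖𝓕⁻ (fun ξ => bes s ξ * φ ξ) x * conj (psi ℓ k x)‖) ?_ ?_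
      (integrable_mul_conj_psi hℓ hm k).norm (ae_of_all _ fun x => ?_)
    · refine Eventually.of_forall fun ε => ?_
      exact ((continuous_wt _).aestronglyMeasurable.mul hm.1).mul (memLp_conj_psi hℓ k).1
    · filter_upwards [self_mem_nhdsWithin] with ε hε
      refine ae_of_all _ fun x => ?_
      rw [mul_assoc, norm_mul]
      refine mul_le_of_le_one_left (norm_nonneg _) (norm_wt_le_one ?_ x)
      have : (0 : ℝ) < ε := hε
      simp
      linarith
    · refine Tendsto.mul_const _ (Tendsto.mul_const _ ?_)
      have hcont : Continuous fun ε : ℝ => wt ((s : ℂ) + ε) x := by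
        simp only [wt_eq_exp]
        fun_prop
      have : Tendsto (fun ε : ℝ => wt ((s : ℂ) + ε) x) (𝓝[>] 0) _ :=
        (hcont.tendsto 0).mono_left nhdsWithin_le_nhds
      simpa using this
  refine le_of_tendsto (tendsto_finsetSum _ fun k _ =>
    ((lim k).norm.pow 2).const_mul ((1 + k : ℝ) ^ (2 * s))) ?_
  filter_upwards [Ioc_mem_nhdsGT (zero_lt_one' ℝ)] with ε hε
  exact step ε hε.1 hε.2

end stein

end Benjamin
end

noncomputable section

namespace Benjamin

open scoped ComplexConjugate
open Complex (I)

/-! ### From weighted Sobolev norms to decay of coefficients. -/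

section decay

variable {ℓ : ℝ}

/-- Parseval's identity for the Fourier–Plancherel transform. -/
lemma integral_conj_fourierL2_mul {f g : ℝ → ℂ} (hf : MemLp f 2 volume) (hg : MemLp g 2 volume) :
    ∫ ξ, conj (fourierL2 f ξ) * fourierL2 g ξ = ∫ x, conj (f x) * g x := by
  have e : ∀ {f : ℝ → ℂ} (hf : MemLp f 2 volume),
      (memLp_fourierL2 hf).toLp (fourierL2 f) = 𝓕 (hf.toLp f) := by
    intro f hf
    rw [Lp.ext_iff]
    refine (MemLp.coeFn_toLp _).trans ?_
    rw [fourierL2_eq hf]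
  rw [← inner_toLp_eq hf hg, ← inner_toLp_eq (memLp_fourierL2 hf) (memLp_fourierL2 hg), e hf, e hg,
    Lp.inner_fourier_eq]

lemma stronglyMeasurable_fourierL2 {f : ℝ → ℂ} (hf : MemLp f 2 volume) :
    StronglyMeasurable (fourierL2 f) := by
  rw [fourierL2_eq hf]
  exact Lp.stronglyMeasurable _

lemma wt_ofReal (s : ℝ) (x : ℝ) : wt s x = (((1 + x ^ 2) ^ (-s) : ℝ) : ℂ) := by
  rw [wt, Complex.ofReal_cpow (by positivity)]
  push_cast
  rfl

lemma bes_ofReal (s : ℝ) (ξ : ℝ) : bes s ξ = (((1 + (2 * Real.pi * ξ) ^ 2) ^ (-(s / 2)) : ℝ) : ℂ) := by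
  rw [bes, Complex.ofReal_cpow (by positivity)]
  push_cast
  rfl

lemma coef_wt_mul_eq_conj (s : ℝ) (g : ℝ → ℂ) (k : ℤ) :
    coef ℓ (fun x => wt s x * g x) k = conj (∫ x, conj (g x) * (wt s x * psi ℓ k x)) := by
  rw [coef, ← integral_conj]
  congr 1
  ext x
  rw [map_mul, map_mul, Complex.conj_conj, wt_ofReal, Complex.conj_ofReal]
  ring

/-- A finite norm excludes the default value ∞ in `sobolevNorm`, so the weighted function is square
integrable; dividing the weight out again exhibits w in the form to which the smoothing estimate
applies. -/
lemma memLp_of_weightedSobolevNormC_ne_top {s : ℝ} (hs : 0 ≤ s) {w : ℝ → ℂ}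
    (h : weightedSobolevNormC s (2 * s) w ≠ ⊤) : MemLp w 2 volume ∧
      MemLp (fun x => (((1 + x ^ 2) ^ (2 * s / 2) : ℝ) : ℂ) * w x) 2 volume ∧
      w = fun x => wt s x * ((((1 + x ^ 2) ^ (2 * s / 2) : ℝ) : ℂ) * w x) := by
  have h1 : MemLp (fun x => (((1 + x ^ 2) ^ (2 * s / 2) : ℝ) : ℂ) * w x) 2 volume := by
    by_contra hc
    rw [weightedSobolevNormC, sobolevNorm, if_neg hc] at h
    exact h rfl
  have h2 : w = fun x => wt s x * ((((1 + x ^ 2) ^ (2 * s / 2) : ℝ) : ℂ) * w x) := by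
    ext x
    rw [wt_ofReal, ← mul_assoc, ← Complex.ofReal_mul, ← Real.rpow_add (by positivity)]
    have : -s + 2 * s / 2 = 0 := by ring
    rw [this]
    simp
  refine ⟨?_, h1, h2⟩
  rw [h2]
  exact memLp_wt_mul (by simpa using hs) h1

/-- Functions in the weighted Sobolev space have rapidly decreasing coefficients. -/
lemma exists_sum_coef_le (hℓ : 0 < ℓ) {s : ℝ} (hs : 0 ≤ s) : ∃ C : ℝ, 0 < C ∧
    ∀ w : ℝ → ℂ, ∀ K : ℕ, ENNReal.ofReal (Real.sqrt (∑ k ∈ Finset.range K, (1 + k : ℝ) ^ (2 * s) *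
      ‖coef ℓ w k‖ ^ 2) / C) ≤ weightedSobolevNormC s (2 * s) w := by
  obtain ⟨C, hC, hCb⟩ := exists_sum_coef_wt_le hℓ s hs
  refine ⟨Real.sqrt C + 1, by positivity, fun w K => ?_⟩
  by_cases htop : weightedSobolevNormC s (2 * s) w = ⊤
  · rw [htop]; exact le_top
  obtain ⟨hw, hG, hwG⟩ := memLp_of_weightedSobolevNormC_ne_top hs htop
  set G : ℝ → ℂ := fun x => (((1 + x ^ 2) ^ (2 * s / 2) : ℝ) : ℂ) * w x with hGdef
  -- With this density w = `wt s` · 𝓕⁻(`bes s` · φ) formally, and the L² norm of φ is exactly the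
  -- weighted Sobolev norm of w.
  set φ : ℝ → ℂ := fun ξ => (((1 + (2 * Real.pi * ξ) ^ 2) ^ (s / 2) : ℝ) : ℂ) * fourierL2 G ξ with hφ
  have hφm : StronglyMeasurable φ := by
    refine StronglyMeasurable.mul (Continuous.stronglyMeasurable ?_) (stronglyMeasurable_fourierL2 hG)
    refine Complex.continuous_ofReal.comp (Continuous.rpow_const (by fun_prop) fun x => Or.inl ?_)
    positivity
  have hnorm : weightedSobolevNormC s (2 * s) w = eLpNorm φ 2 volume := by
    rw [weightedSobolevNormC, sobolevNorm, if_pos hG, eLpNorm_eq_lintegral_rpow_enorm_toReal (by norm_num)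
      (by norm_num)]
    simp only [ENNReal.toReal_ofNat]
    congr 1
    refine lintegral_congr fun ξ => ?_
    rw [hφ, enorm_mul, ENNReal.mul_rpow_of_nonneg _ _ (by norm_num)]
    congr 1
    · rw [← ofReal_norm, Complex.norm_real, Real.norm_of_nonneg (by positivity),
        ENNReal.ofReal_rpow_of_nonneg (by positivity) (by norm_num), ← Real.rpow_mul (by positivity)]
      congr 2
      ring
    · norm_cast
  have hφL : MemLp φ 2 volume := ⟨hφm.aestronglyMeasurable, by rw [← hnorm]; exact lt_top_iff_ne_top.2 htop⟩
  -- Cutting φ off both in frequency and in size gives admissible densities that increase to φ. The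
  -- estimate passes to the limit because each coefficient is an L² pairing on the Fourier side.
  set S : ℕ → Set ℝ := fun n => {ξ | |ξ| ≤ n ∧ ‖φ ξ‖ ≤ n} with hS
  have hSm : ∀ n, MeasurableSet (S n) := fun n =>
    (measurableSet_le measurable_id.abs measurable_const).inter
      (measurableSet_le hφm.norm.measurable measurable_const)
  have hbdd : ∀ n, IsBddCpt ((S n).indicator φ) := fun n => by
    refine ⟨hφm.aestronglyMeasurable.indicator (hSm n), n, n, fun ξ => ?_⟩
    by_cases h : ξ ∈ S n
    · rw [indicator_of_mem h, indicator_of_mem (show ξ ∈ Icc (-(n : ℝ)) n from abs_le.1 h.1)]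
      exact h.2
    · rw [indicator_of_notMem h, norm_zero]
      exact indicator_nonneg (fun _ _ => Nat.cast_nonneg n) ξ
  have hbes : ∀ n, (fun ξ => bes s ξ * (S n).indicator φ ξ) = (S n).indicator (fourierL2 G) := by
    intro n
    ext ξ
    by_cases h : ξ ∈ S n
    · rw [indicator_of_mem h, indicator_of_mem h, hφ, bes_ofReal, ← mul_assoc, ← Complex.ofReal_mul,
        ← Real.rpow_add (by positivity)]
      simp
    · rw [indicator_of_notMem h, indicator_of_notMem h, mul_zero]
  have hbG : ∀ n, IsBddCpt ((S n).indicator (fourierL2 G)) := fun n => by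
    rw [← hbes n]; exact (hbdd n).mul_continuous (continuous_bes s)
  have hle : ∀ n, l2n ((S n).indicator φ) ≤ l2n φ := fun n => by
    rw [← one_mul (l2n φ)]
    refine l2n_le_mul hφL zero_le_one fun ξ => ?_
    rw [one_mul]
    exact norm_indicator_le_norm_self _ _
  have lim : ∀ k : ℕ, Tendsto (fun n => coef ℓ (fun x => wt s x * 𝓕⁻ ((S n).indicator (fourierL2 G)) x) k)
      atTop (𝓝 (coef ℓ w k)) := by
    intro k
    have hΨ : MemLp (fun x => wt s x * psi ℓ k x) 2 volume :=
      memLp_wt_mul (by simpa using hs) (memLp_psi hℓ k)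
    have e0 : coef ℓ w k = conj (∫ ξ, conj (fourierL2 G ξ) * fourierL2 (fun x => wt s x * psi ℓ k x) ξ) := by
      rw [integral_conj_fourierL2_mul hG hΨ, ← coef_wt_mul_eq_conj, ← hwG]
    have e1 : ∀ n, coef ℓ (fun x => wt s x * 𝓕⁻ ((S n).indicator (fourierL2 G)) x) k
        = conj (∫ ξ, conj ((S n).indicator (fourierL2 G) ξ) *
            fourierL2 (fun x => wt s x * psi ℓ k x) ξ) := fun n => by
      rw [coef_wt_mul_eq_conj, integral_conj_fourierInv_mul (hbG n).integrable ((hbG n).memLp 2) hΨ]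
    simp only [e0, e1]
    refine (Complex.continuous_conj.tendsto _).comp ?_
    have hGc : MemLp (fun ξ => conj (fourierL2 G ξ)) 2 volume := by
      refine (memLp_fourierL2 hG).of_le
        (Complex.continuous_conj.comp_aestronglyMeasurable (memLp_fourierL2 hG).1)
        (ae_of_all _ fun ξ => by simp)
    refine tendsto_integral_of_dominated_convergence
      (fun ξ => ‖conj (fourierL2 G ξ) * fourierL2 (fun x => wt s x * psi ℓ k x) ξ‖) (fun n => ?_)
      (hGc.integrable_mul (memLp_fourierL2 hΨ)).norm (fun n => ae_of_all _ fun ξ => ?_)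
      (ae_of_all _ fun ξ => ?_)
    · exact (Complex.continuous_conj.comp_aestronglyMeasurable (hbG n).1).mul (memLp_fourierL2 hΨ).1
    · rw [norm_mul, norm_mul, RCLike.norm_conj, RCLike.norm_conj]
      exact mul_le_mul_of_nonneg_right (norm_indicator_le_norm_self _ _) (norm_nonneg _)
    · refine Tendsto.mul_const _ ((Complex.continuous_conj.tendsto _).comp ?_)
      refine tendsto_const_nhds.congr' ?_
      filter_upwards [eventually_ge_atTop (max ⌈|ξ|⌉₊ ⌈‖φ ξ‖⌉₊)] with n hn
      rw [indicator_of_mem]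
      refine ⟨(Nat.le_ceil _).trans ?_, (Nat.le_ceil _).trans ?_⟩
      · exact_mod_cast (le_max_left _ _).trans hn
      · exact_mod_cast (le_max_right _ _).trans hn
  have hsum : ∑ k ∈ Finset.range K, (1 + k : ℝ) ^ (2 * s) * ‖coef ℓ w k‖ ^ 2 ≤ C * l2n φ ^ 2 := by
    refine le_of_tendsto (tendsto_finsetSum _ fun k _ =>
      ((lim k).norm.pow 2).const_mul ((1 + k : ℝ) ^ (2 * s))) (Eventually.of_forall fun n => ?_)
    have := hCb K _ (hbdd n)
    rw [hbes n] at this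
    refine this.trans (mul_le_mul_of_nonneg_left (pow_le_pow_left₀ (l2n_nonneg _) (hle n) 2) hC)
  rw [hnorm, ← ENNReal.ofReal_toReal hφL.2.ne]
  refine ENNReal.ofReal_le_ofReal ?_
  rw [div_le_iff₀ (by positivity)]
  calc _ ≤ Real.sqrt (C * l2n φ ^ 2) := Real.sqrt_le_sqrt hsum
    _ = Real.sqrt C * l2n φ := by rw [Real.sqrt_mul hC, Real.sqrt_sq (l2n_nonneg _)]
    _ ≤ l2n φ * (Real.sqrt C + 1) := by nlinarith [l2n_nonneg φ]

/-- Both scales of spaces consist of square integrable functions with rapidly decreasing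
coefficients. -/
lemma exists_sum_rcoef_le (hℓ : 0 < ℓ) {s : ℝ} (hs : 0 ≤ s) {X : ℝ → ℝ → (ℝ → ℝ) → ℝ≥0∞}
    (hX : X = weightedSobolevNorm ∨ X = hardyWeightedSobolevNorm) :
    (∀ f, X s (2 * s) f ≠ ⊤ → MemLp f 2 volume) ∧ ∃ C : ℝ, 0 < C ∧
    ∀ f : ℝ → ℝ, ∀ K : ℕ, ENNReal.ofReal (Real.sqrt (∑ k ∈ Finset.range K, (1 + k : ℝ) ^ (2 * s) *
      ‖rcoef ℓ f k‖ ^ 2) / C) ≤ X s (2 * s) f := by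
  obtain ⟨C, hC, h⟩ := exists_sum_coef_le hℓ hs
  have hre : ∀ f : ℝ → ℝ, MemLp (fun x => (f x : ℂ)) 2 volume → MemLp f 2 volume := fun f hf => by
    simpa using hf.re
  rcases hX with rfl | rfl
  · exact ⟨fun f hf => hre f (memLp_of_weightedSobolevNormC_ne_top hs hf).1, C, hC,
      fun f K => h _ K⟩
  · refine ⟨fun f hf => ?_, C, hC, fun f K => ?_⟩
    · by_contra hc
      refine hf ?_
      simp [hardyWeightedSobolevNorm, hc]
    · unfold hardyWeightedSobolevNorm
      refine le_iInf fun w₁ => le_iInf fun w₂ => le_iInf fun hw => ?_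
      -- Only w₁ is needed: coefficients with k ≥ 0 see positive frequencies alone, and the
      -- remaining ones are conjugates because f is real.
      refine le_trans ?_ le_self_add
      by_cases htop : weightedSobolevNormC s (2 * s) w₁ = ⊤
      · rw [htop]; exact le_top
      have hw1 := (memLp_of_weightedSobolevNormC_ne_top hs htop).1
      have e : ∀ k : ℕ, rcoef ℓ f k = coef ℓ w₁ k := by
        intro k
        obtain ⟨φ, h0, hφ⟩ := exists_coef_eq_integral hℓ k
        rw [rcoef, hφ _ (memLp_ofReal hw.1), hφ _ hw1]
        refine integral_congr_ae ?_
        filter_upwards [hw.2] with ξ hξ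
        rcases le_or_gt ξ 0 with h | h
        · rw [h0 ξ h]; simp
        · rw [hξ.1 h]
      simp only [e]
      exact h w₁ K

end decay

end Benjamin
end

noncomputable section

namespace Benjamin

/-! ### Stability of discretized Hamiltonian systems -/

section stability

open scoped RealInnerProductSpace

/-- A skew operator `D`, a symmetric operator `K` bounded by it and a totally symmetric product. -/
structure HamSystem (E : Type*) [NormedAddCommGroup E] [InnerProductSpace ℝ E] where
  D : E →L[ℝ] E
  K : E →L[ℝ] E
  B : E →L[ℝ] E →L[ℝ] E
  skew : ∀ x y, ⟪D x, y⟫ = -⟪x, D y⟫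
  symm : ∀ x y, ⟪K x, y⟫ = ⟪x, K y⟫
  norm_K_le : ∀ x, ‖K x‖ ≤ ‖D x‖
  B_comm : ∀ x y, B x y = B y x
  B_symm : ∀ x y z, ⟪B x y, z⟫ = ⟪B x z, y⟫

variable {E : Type*} [NormedAddCommGroup E] [InnerProductSpace ℝ E]

/-- The gradient of the cubic Hamiltonian. -/
def HamSystem.grad (S : HamSystem E) (α β γ δ : ℝ) (a : E) : E :=
  α • a + β • S.K a - γ • S.D (S.D a) + δ • S.B a a

/-- The linear part of the gradient. -/
def HamSystem.lin (S : HamSystem E) (α β γ : ℝ) : E →L[ℝ] E :=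
  α • ContinuousLinearMap.id ℝ E + β • S.K - γ • (S.D.comp S.D)

/-- The increment of the gradient. -/
def HamSystem.incr (S : HamSystem E) (α β γ δ : ℝ) (w e : E) : E :=
  S.lin α β γ e + (2 * δ) • S.B w e + δ • S.B e e

/-- The relative energy. -/
def HamSystem.rel (S : HamSystem E) (α β γ δ : ℝ) (w e : E) : ℝ :=
  1 / 2 * ⟪S.lin α β γ e, e⟫ + δ * ⟪S.B w e, e⟫ + δ / 3 * ⟪S.B e e, e⟫

lemma HamSystem.lin_apply (S : HamSystem E) (α β γ : ℝ) (e : E) :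
    S.lin α β γ e = α • e + β • S.K e - γ • S.D (S.D e) := rfl

lemma HamSystem.lin_symm (S : HamSystem E) (α β γ : ℝ) (x y : E) :
    ⟪S.lin α β γ x, y⟫ = ⟪S.lin α β γ y, x⟫ := by
  have h : ⟪S.D (S.D x), y⟫ = ⟪S.D (S.D y), x⟫ := by
    rw [S.skew (S.D x) y, S.skew (S.D y) x, real_inner_comm]
  simp only [S.lin_apply, inner_add_left, inner_sub_left, inner_smul_left, RCLike.conj_to_real]
  rw [h, S.symm, real_inner_comm, real_inner_comm (S.K y) x]

lemma HamSystem.grad_sub (S : HamSystem E) (α β γ δ : ℝ) (w e : E) :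
    S.grad α β γ δ (w + e) - S.grad α β γ δ w = S.incr α β γ δ w e := by
  simp only [HamSystem.grad, HamSystem.incr, S.lin_apply, map_add, add_apply,
    S.B_comm e w, smul_add, two_mul, add_smul]
  abel

/-- By symmetry of the linear part and total symmetry of B, the gradient of `rel` in e is `incr`;
the three equal contributions of the cubic term cancel the factor 1/3. Moving the base point w only
contributes through the quadratic term in e. -/
lemma HamSystem.hasDerivWithinAt_rel (S : HamSystem E) (α β γ δ : ℝ) {w e : ℝ → E} {w' e' : E}
    {s : Set ℝ} {t : ℝ} (hw : HasDerivWithinAt w w' s t) (he : HasDerivWithinAt e e' s t) :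
    HasDerivWithinAt (fun τ => S.rel α β γ δ (w τ) (e τ))
      (⟪S.incr α β γ δ (w t) (e t), e'⟫ + δ * ⟪S.B w' (e t), e t⟫) s t := by
  have h1 : HasDerivWithinAt (fun τ => S.lin α β γ (e τ)) (S.lin α β γ e') s t :=
    (S.lin α β γ).hasFDerivAt.comp_hasDerivWithinAt t he
  have hBw : HasDerivWithinAt (fun τ => S.B (w τ)) (S.B w') s t :=
    S.B.hasFDerivAt.comp_hasDerivWithinAt t hw
  have hBe : HasDerivWithinAt (fun τ => S.B (e τ)) (S.B e') s t :=
    S.B.hasFDerivAt.comp_hasDerivWithinAt t he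
  have h2 := hBw.clm_apply he
  have h3 := hBe.clm_apply he
  have H := (((h1.inner ℝ he).const_mul (1 / 2)).add ((h2.inner ℝ he).const_mul δ)).add
    ((h3.inner ℝ he).const_mul (δ / 3))
  refine H.congr_deriv ?_
  have e1 := S.lin_symm α β γ e' (e t)
  have e2 := S.B_symm (w t) e' (e t)
  have e3 := S.B_symm (e t) e' (e t)
  have e4 := S.B_symm e' (e t) (e t)
  simp only [HamSystem.incr, inner_add_left, inner_smul_left, RCLike.conj_to_real]
  rw [e1, e2, S.B_comm e' (e t), e3]
  ring

/-- The constant of the lower order terms. -/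
def stabConst (α β γ δ A : ℝ) : ℝ := |α| + |β| + |γ| + |δ| * (2 * A + 1) + 1

/-- The weight of the square of the norm in the energy. -/
def stabShift (α β γ δ A : ℝ) : ℝ := |α| / 2 + β ^ 2 / (4 * |γ|) + |δ| * (A + 1) + 1

lemma HamSystem.inner_D_self (S : HamSystem E) (x : E) : ⟪S.D x, x⟫ = 0 := by
  have := S.skew x x
  rw [real_inner_comm (S.D x) x] at this
  linarith

lemma HamSystem.inner_lin_self (S : HamSystem E) (α β γ : ℝ) (e : E) :
    ⟪S.lin α β γ e, e⟫ = α * ‖e‖ ^ 2 + β * ⟪S.K e, e⟫ + γ * ‖S.D e‖ ^ 2 := by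
  simp only [S.lin_apply, inner_add_left, inner_sub_left, inner_smul_left, RCLike.conj_to_real,
    S.skew (S.D e), real_inner_self_eq_norm_sq]
  ring

/-! ### Coercivity of the relative energy and bounds of its derivative. -/

section bounds

variable (S : HamSystem E) (α β γ δ : ℝ) {A : ℝ} (w e R : E)

/-- The term γ⟨D²e, R⟩ is not controlled by the energy, so one D is moved to R. This is why the
residual has to be measured together with DR. -/
lemma HamSystem.abs_incr_le (hA : 0 ≤ A) (hw : ‖S.B w e‖ ≤ A * ‖e‖) (he : ‖S.B e e‖ ≤ ‖e‖) :
    |⟪S.incr α β γ δ w e, R⟫| ≤ stabConst α β γ δ A *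
      (‖e‖ ^ 2 + ‖S.D e‖ ^ 2 + (‖R‖ ^ 2 + ‖S.D R‖ ^ 2)) := by
  have e0 : ⟪S.incr α β γ δ w e, R⟫ = α * ⟪e, R⟫ + β * ⟪S.K e, R⟫ + γ * ⟪S.D e, S.D R⟫
      + 2 * δ * ⟪S.B w e, R⟫ + δ * ⟪S.B e e, R⟫ := by
    simp only [HamSystem.incr, S.lin_apply, inner_add_left, inner_sub_left, inner_smul_left,
      RCLike.conj_to_real, S.skew (S.D e)]
    ring
  have i1 := abs_real_inner_le_norm e R
  have i2 := (abs_real_inner_le_norm (S.K e) R).trans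
    (mul_le_mul_of_nonneg_right (S.norm_K_le e) (norm_nonneg R))
  have i3 := abs_real_inner_le_norm (S.D e) (S.D R)
  have i4 := (abs_real_inner_le_norm (S.B w e) R).trans
    (mul_le_mul_of_nonneg_right hw (norm_nonneg R))
  have i5 := (abs_real_inner_le_norm (S.B e e) R).trans
    (mul_le_mul_of_nonneg_right he (norm_nonneg R))
  set Q := ‖e‖ ^ 2 + ‖S.D e‖ ^ 2 + (‖R‖ ^ 2 + ‖S.D R‖ ^ 2) with hQ
  have q1 : ‖e‖ * ‖R‖ ≤ Q := by
    nlinarith [sq_nonneg (‖e‖ - ‖R‖), sq_nonneg ‖e‖, sq_nonneg ‖R‖, sq_nonneg ‖S.D e‖, sq_nonneg ‖S.D R‖]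
  have q2 : ‖S.D e‖ * ‖R‖ ≤ Q := by
    nlinarith [sq_nonneg (‖S.D e‖ - ‖R‖), sq_nonneg ‖e‖, sq_nonneg ‖R‖, sq_nonneg ‖S.D e‖, sq_nonneg ‖S.D R‖]
  have q3 : ‖S.D e‖ * ‖S.D R‖ ≤ Q := by
    nlinarith [sq_nonneg (‖S.D e‖ - ‖S.D R‖), sq_nonneg ‖e‖, sq_nonneg ‖R‖, sq_nonneg ‖S.D e‖, sq_nonneg ‖S.D R‖]
  have hQ0 : 0 ≤ Q := by positivity
  rw [e0]
  calc _ ≤ |α * ⟪e, R⟫| + |β * ⟪S.K e, R⟫| + |γ * ⟪S.D e, S.D R⟫|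
      + |2 * δ * ⟪S.B w e, R⟫| + |δ * ⟪S.B e e, R⟫| := by
        refine (abs_add_le _ _).trans (add_le_add_left ((abs_add_le _ _).trans
          (add_le_add_left ((abs_add_le _ _).trans (add_le_add_left (abs_add_le _ _) _)) _)) _)
    _ ≤ |α| * Q + |β| * Q + |γ| * Q + 2 * |δ| * (A * Q) + |δ| * Q := by
        rw [abs_mul, abs_mul, abs_mul, abs_mul, abs_mul, abs_mul, abs_two]
        have : A * ‖e‖ * ‖R‖ ≤ A * Q := by rw [mul_assoc]; exact mul_le_mul_of_nonneg_left q1 hA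
        gcongr
        · exact i1.trans q1
        · exact i2.trans q2
        · exact i3.trans q3
        · exact i4.trans this
        · exact i5.trans q1
    _ ≤ _ := by rw [stabConst]; nlinarith

/-- This is the growth of ‖e‖²/2. The terms ⟨De, e⟩ and ⟨De, D²e⟩ vanish by skewness, which removes
the second derivative; what remains contains at most one D on each side. -/
lemma HamSystem.abs_inner_D_incr_le (hA : 0 ≤ A) (hw : ‖S.B w e‖ ≤ A * ‖e‖)
    (he : ‖S.B e e‖ ≤ ‖e‖) :
    |⟪S.D e, S.incr α β γ δ w e⟫| ≤ stabConst α β γ δ A * (‖e‖ ^ 2 + ‖S.D e‖ ^ 2) := by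
  have e0 : ⟪S.D e, S.incr α β γ δ w e⟫ = β * ⟪S.D e, S.K e⟫
      + 2 * δ * ⟪S.D e, S.B w e⟫ + δ * ⟪S.D e, S.B e e⟫ := by
    simp only [HamSystem.incr, S.lin_apply, inner_add_right, inner_sub_right, inner_smul_right]
    rw [S.inner_D_self, real_inner_comm (S.D (S.D e)) (S.D e), S.inner_D_self (S.D e)]
    ring
  have i2 := (abs_real_inner_le_norm (S.D e) (S.K e)).trans
    (mul_le_mul_of_nonneg_left (S.norm_K_le e) (norm_nonneg _))
  have i4 := (abs_real_inner_le_norm (S.D e) (S.B w e)).trans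
    (mul_le_mul_of_nonneg_left hw (norm_nonneg _))
  have i5 := (abs_real_inner_le_norm (S.D e) (S.B e e)).trans
    (mul_le_mul_of_nonneg_left he (norm_nonneg _))
  set Q := ‖e‖ ^ 2 + ‖S.D e‖ ^ 2 with hQ
  have q2 : ‖S.D e‖ * ‖S.D e‖ ≤ Q := by nlinarith [sq_nonneg ‖e‖]
  have q3 : ‖S.D e‖ * ‖e‖ ≤ Q := by
    nlinarith [sq_nonneg (‖S.D e‖ - ‖e‖), sq_nonneg ‖e‖, sq_nonneg ‖S.D e‖]
  have hQ0 : 0 ≤ Q := by positivity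
  rw [e0]
  calc _ ≤ |β * ⟪S.D e, S.K e⟫| + |2 * δ * ⟪S.D e, S.B w e⟫| + |δ * ⟪S.D e, S.B e e⟫| := by
        exact (abs_add_le _ _).trans (add_le_add_left (abs_add_le _ _) _)
    _ ≤ |β| * Q + 2 * |δ| * (A * Q) + |δ| * Q := by
        rw [abs_mul, abs_mul, abs_mul, abs_mul, abs_two]
        have : ‖S.D e‖ * (A * ‖e‖) ≤ A * Q := by
          rw [mul_left_comm]; exact mul_le_mul_of_nonneg_left q3 hA
        gcongr
        · exact i2.trans q2
        · exact i4.trans this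
        · exact i5.trans q3
    _ ≤ _ := by
        rw [stabConst]
        have := mul_nonneg (abs_nonneg α) hQ0
        have := mul_nonneg (abs_nonneg γ) hQ0
        nlinarith

lemma HamSystem.abs_lower_le (hw : ‖S.B w e‖ ≤ A * ‖e‖) (he : ‖S.B e e‖ ≤ ‖e‖) :
    |δ * ⟪S.B w e, e⟫ + δ / 3 * ⟪S.B e e, e⟫| ≤ |δ| * (A + 1) * ‖e‖ ^ 2 := by
  have i4 := (abs_real_inner_le_norm (S.B w e) e).trans
    (mul_le_mul_of_nonneg_right hw (norm_nonneg e))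
  have i5 := (abs_real_inner_le_norm (S.B e e) e).trans
    (mul_le_mul_of_nonneg_right he (norm_nonneg e))
  calc _ ≤ |δ| * |⟪S.B w e, e⟫| + |δ| / 3 * |⟪S.B e e, e⟫| := by
        refine (abs_add_le _ _).trans (le_of_eq ?_)
        rw [abs_mul, abs_mul, abs_div, abs_of_pos (by norm_num : (0 : ℝ) < 3)]
    _ ≤ |δ| * (A * ‖e‖ * ‖e‖) + |δ| / 3 * (‖e‖ * ‖e‖) := by gcongr
    _ ≤ _ := by nlinarith [mul_nonneg (abs_nonneg δ) (sq_nonneg ‖e‖)]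

/-- The factor sign γ makes the leading term |γ|/2 ‖De‖². Half of it absorbs the β term by Young's
inequality, at the price β²/(4|γ|) ‖e‖²; the shift `stabShift` covers all terms of order zero and
leaves ‖e‖² to spare. -/
lemma HamSystem.le_sign_mul_rel (hγ : γ ≠ 0) (hw : ‖S.B w e‖ ≤ A * ‖e‖) (he : ‖S.B e e‖ ≤ ‖e‖) :
    |γ| / 4 * ‖S.D e‖ ^ 2 + ‖e‖ ^ 2 ≤
      (SignType.sign γ : ℝ) * S.rel α β γ δ w e + stabShift α β γ δ A * ‖e‖ ^ 2 := by
  have h1 := S.abs_lower_le δ w e hw he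
  have h2 : |⟪S.K e, e⟫| ≤ ‖S.D e‖ * ‖e‖ := (abs_real_inner_le_norm _ _).trans
    (mul_le_mul_of_nonneg_right (S.norm_K_le e) (norm_nonneg e))
  have hg : 0 < |γ| := abs_pos.2 hγ
  have hσ : (SignType.sign γ : ℝ) * γ = |γ| := sign_mul_self γ
  have hσ1 : |(SignType.sign γ : ℝ)| ≤ 1 := by
    rcases lt_or_gt_of_ne hγ with h | h <;> simp [h]
  set σ := (SignType.sign γ : ℝ)
  have e0 : σ * S.rel α β γ δ w e = σ * (α / 2 * ‖e‖ ^ 2) + σ * (β / 2 * ⟪S.K e, e⟫)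
      + |γ| / 2 * ‖S.D e‖ ^ 2 + σ * (δ * ⟪S.B w e, e⟫ + δ / 3 * ⟪S.B e e, e⟫) := by
    rw [HamSystem.rel, S.inner_lin_self, ← hσ]
    ring
  have neg : ∀ x : ℝ, -|x| ≤ σ * x := fun x => by
    have : |σ * x| ≤ |x| := by
      rw [abs_mul]; exact mul_le_of_le_one_left (abs_nonneg _) hσ1
    linarith [neg_abs_le (σ * x)]
  have n1 := neg (α / 2 * ‖e‖ ^ 2)
  have n2 := neg (β / 2 * ⟪S.K e, e⟫)
  have n3 := neg (δ * ⟪S.B w e, e⟫ + δ / 3 * ⟪S.B e e, e⟫)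
  rw [abs_mul, abs_div, abs_two, abs_of_nonneg (sq_nonneg ‖e‖)] at n1
  rw [abs_mul, abs_div, abs_two] at n2
  have n4 : |β| / 2 * |⟪S.K e, e⟫| ≤ |γ| / 4 * ‖S.D e‖ ^ 2 + β ^ 2 / (4 * |γ|) * ‖e‖ ^ 2 := by
    have : |β| / 2 * |⟪S.K e, e⟫| ≤ |β| / 2 * (‖S.D e‖ * ‖e‖) :=
      mul_le_mul_of_nonneg_left h2 (by positivity)
    refine this.trans ?_
    have e1 : |γ| / 4 * ‖S.D e‖ ^ 2 + β ^ 2 / (4 * |γ|) * ‖e‖ ^ 2 - |β| / 2 * (‖S.D e‖ * ‖e‖)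
        = (|γ| * ‖S.D e‖ - |β| * ‖e‖) ^ 2 / (4 * |γ|) := by
      field_simp
      rw [← sq_abs β]
      ring
    have : 0 ≤ (|γ| * ‖S.D e‖ - |β| * ‖e‖) ^ 2 / (4 * |γ|) := by positivity
    linarith
  rw [e0, stabShift]
  nlinarith

lemma HamSystem.sign_mul_rel_le (hγ : γ ≠ 0) (hA : 0 ≤ A) (hw : ‖S.B w e‖ ≤ A * ‖e‖)
    (he : ‖S.B e e‖ ≤ ‖e‖) :
    (SignType.sign γ : ℝ) * S.rel α β γ δ w e ≤ stabConst α β γ δ A * (‖e‖ ^ 2 + ‖S.D e‖ ^ 2) := by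
  have h1 := S.abs_lower_le δ w e hw he
  have h2 : |⟪S.K e, e⟫| ≤ ‖S.D e‖ * ‖e‖ := (abs_real_inner_le_norm _ _).trans
    (mul_le_mul_of_nonneg_right (S.norm_K_le e) (norm_nonneg e))
  have hσ1 : |(SignType.sign γ : ℝ)| ≤ 1 := by
    rcases lt_or_gt_of_ne hγ with h | h <;> simp [h]
  have h3 : |S.rel α β γ δ w e| ≤ stabConst α β γ δ A * (‖e‖ ^ 2 + ‖S.D e‖ ^ 2) := by
    have e0 : S.rel α β γ δ w e = α / 2 * ‖e‖ ^ 2 + β / 2 * ⟪S.K e, e⟫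
        + γ / 2 * ‖S.D e‖ ^ 2 + (δ * ⟪S.B w e, e⟫ + δ / 3 * ⟪S.B e e, e⟫) := by
      rw [HamSystem.rel, S.inner_lin_self]
      ring
    rw [e0]
    calc _ ≤ |α / 2 * ‖e‖ ^ 2| + |β / 2 * ⟪S.K e, e⟫| + |γ / 2 * ‖S.D e‖ ^ 2|
          + |δ * ⟪S.B w e, e⟫ + δ / 3 * ⟪S.B e e, e⟫| := by
          exact (abs_add_le _ _).trans (add_le_add_left ((abs_add_le _ _).trans
            (add_le_add_left (abs_add_le _ _) _)) _)
      _ ≤ |α| / 2 * ‖e‖ ^ 2 + |β| / 2 * (‖S.D e‖ * ‖e‖) + |γ| / 2 * ‖S.D e‖ ^ 2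
          + |δ| * (A + 1) * ‖e‖ ^ 2 := by
          simp only [abs_mul, abs_div, abs_two, abs_pow, abs_norm]
          gcongr
      _ ≤ _ := by
          rw [stabConst]
          have q : ‖S.D e‖ * ‖e‖ ≤ ‖e‖ ^ 2 + ‖S.D e‖ ^ 2 := by
            nlinarith [sq_nonneg (‖S.D e‖ - ‖e‖), sq_nonneg ‖e‖, sq_nonneg ‖S.D e‖]
          have hδA : 0 ≤ |δ| * A := by positivity
          nlinarith [mul_le_mul_of_nonneg_left q (abs_nonneg β), mul_nonneg (abs_nonneg α) (sq_nonneg ‖e‖),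
            mul_nonneg (abs_nonneg α) (sq_nonneg ‖S.D e‖), mul_nonneg (abs_nonneg β) (sq_nonneg ‖e‖),
            mul_nonneg (abs_nonneg β) (sq_nonneg ‖S.D e‖), mul_nonneg (abs_nonneg γ) (sq_nonneg ‖e‖),
            mul_nonneg (abs_nonneg γ) (sq_nonneg ‖S.D e‖), mul_nonneg hδA (sq_nonneg ‖e‖),
            mul_nonneg hδA (sq_nonneg ‖S.D e‖), mul_nonneg (abs_nonneg δ) (sq_nonneg ‖e‖),
            mul_nonneg (abs_nonneg δ) (sq_nonneg ‖S.D e‖), sq_nonneg ‖e‖, sq_nonneg ‖S.D e‖]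
  calc _ ≤ |(SignType.sign γ : ℝ) * S.rel α β γ δ w e| := le_abs_self _
    _ ≤ |S.rel α β γ δ w e| := by rw [abs_mul]; exact mul_le_of_le_one_left (abs_nonneg _) hσ1
    _ ≤ _ := h3

end bounds

/-- The Gronwall constant. -/
def stabRate (α β γ δ A : ℝ) : ℝ :=
  (2 * stabConst α β γ δ A + 4 * stabShift α β γ δ A * stabConst α β γ δ A) / min 1 (|γ| / 4)

/-- The stability constant. -/
def stabBound (α β γ δ A T : ℝ) : ℝ :=
  Real.exp (stabRate α β γ δ A * T) *
    (stabConst α β γ δ A + stabShift α β γ δ A + stabRate α β γ δ A)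

lemma one_le_stabConst {α β γ δ A : ℝ} (hA : 0 ≤ A) : 1 ≤ stabConst α β γ δ A := by
  have : 0 ≤ |α| + |β| + |γ| + |δ| * (2 * A + 1) := by positivity
  rw [stabConst]; linarith

lemma one_le_stabShift {α β γ δ A : ℝ} (hA : 0 ≤ A) : 1 ≤ stabShift α β γ δ A := by
  have : 0 ≤ |α| / 2 + β ^ 2 / (4 * |γ|) + |δ| * (A + 1) := by positivity
  rw [stabShift]; linarith

lemma stabRate_nonneg {α β γ δ A : ℝ} (hA : 0 ≤ A) : 0 ≤ stabRate α β γ δ A := by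
  have h1 := one_le_stabConst (α := α) (β := β) (γ := γ) (δ := δ) hA
  have h2 := one_le_stabShift (α := α) (β := β) (γ := γ) (δ := δ) hA
  rw [stabRate]
  positivity

lemma stabBound_pos {α β γ δ A T : ℝ} (hA : 0 ≤ A) : 0 < stabBound α β γ δ A T := by
  have h1 := one_le_stabConst (α := α) (β := β) (γ := γ) (δ := δ) hA
  have h2 := one_le_stabShift (α := α) (β := β) (γ := γ) (δ := δ) hA
  have h3 := stabRate_nonneg (α := α) (β := β) (γ := γ) (δ := δ) hA
  rw [stabBound]
  positivity

/-- The differential inequality for the energy. -/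
lemma HamSystem.energy_deriv_le (S : HamSystem E) {α β γ δ A : ℝ} (hγ : γ ≠ 0) (hA : 0 ≤ A)
    (w w' e R : E) (hw : ‖S.B w e‖ ≤ A * ‖e‖) (hw' : ‖S.B w' e‖ ≤ A * ‖e‖)
    (he : ‖S.B e e‖ ≤ ‖e‖) :
    (SignType.sign γ : ℝ) * (⟪S.incr α β γ δ w e, -S.D (S.incr α β γ δ w e) - R⟫
        + δ * ⟪S.B w' e, e⟫)
      + stabShift α β γ δ A * (2 * ⟪e, -S.D (S.incr α β γ δ w e) - R⟫)
    ≤ stabRate α β γ δ A * ((SignType.sign γ : ℝ) * S.rel α β γ δ w e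
        + stabShift α β γ δ A * ‖e‖ ^ 2 + (‖R‖ ^ 2 + ‖S.D R‖ ^ 2)) := by
  set g := S.incr α β γ δ w e with hg
  set m := stabConst α β γ δ A
  set k := stabShift α β γ δ A
  have hm : 1 ≤ m := one_le_stabConst hA
  have hk : 1 ≤ k := one_le_stabShift hA
  set ρ := ‖R‖ ^ 2 + ‖S.D R‖ ^ 2 with hρ
  set q := ‖e‖ ^ 2 + ‖S.D e‖ ^ 2 with hq
  have hρ0 : 0 ≤ ρ := by positivity
  have hq0 : 0 ≤ q := by positivity
  have b1 : |⟪g, R⟫| ≤ m * (q + ρ) := S.abs_incr_le α β γ δ w e R hA hw he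
  have b2 : |⟪S.D e, g⟫| ≤ m * q := S.abs_inner_D_incr_le α β γ δ w e hA hw he
  have b3 := S.le_sign_mul_rel α β γ δ w e hγ hw he
  have b4 : |⟪e, R⟫| ≤ q + ρ := by
    refine (abs_real_inner_le_norm e R).trans ?_
    nlinarith [sq_nonneg (‖e‖ - ‖R‖), sq_nonneg ‖e‖, sq_nonneg ‖R‖, sq_nonneg ‖S.D e‖,
      sq_nonneg ‖S.D R‖]
  have b5 : |⟪S.B w' e, e⟫| ≤ A * q := by
    refine (abs_real_inner_le_norm _ e).trans ((mul_le_mul_of_nonneg_right hw' (norm_nonneg e)).trans ?_)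
    rw [mul_assoc]
    refine mul_le_mul_of_nonneg_left ?_ hA
    nlinarith [sq_nonneg ‖S.D e‖]
  have hσ1 : |(SignType.sign γ : ℝ)| ≤ 1 := by
    rcases lt_or_gt_of_ne hγ with h | h <;> simp [h]
  set σ := (SignType.sign γ : ℝ)
  set Φ := σ * S.rel α β γ δ w e + k * ‖e‖ ^ 2 with hΦ
  have pos : ∀ x : ℝ, σ * x ≤ |x| := fun x => by
    refine (le_abs_self _).trans ?_
    rw [abs_mul]; exact mul_le_of_le_one_left (abs_nonneg _) hσ1
  -- Conservation of energy: the gradient is orthogonal to the Hamiltonian part of the velocity, so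
  -- only the residual changes the relative energy.
  have e1 : ⟪g, -S.D g - R⟫ = -⟪g, R⟫ := by
    rw [inner_sub_right, inner_neg_right, real_inner_comm, S.inner_D_self]
    ring
  have e2 : ⟪e, -S.D g - R⟫ = ⟪S.D e, g⟫ - ⟪e, R⟫ := by
    rw [inner_sub_right, inner_neg_right, S.skew]
  rw [e1, e2]
  have hδ : |δ| * A ≤ m := by
    have : 0 ≤ |α| + |β| + |γ| + |δ| * A + |δ| := by positivity
    simp only [m, stabConst]; linarith
  have c1 : σ * (-⟪g, R⟫ + δ * ⟪S.B w' e, e⟫) ≤ 2 * m * (q + ρ) := by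
    refine (pos _).trans ((abs_add_le _ _).trans ?_)
    rw [abs_neg, abs_mul]
    have : |δ| * |⟪S.B w' e, e⟫| ≤ m * q := by
      calc _ ≤ |δ| * (A * q) := by gcongr
        _ = (|δ| * A) * q := by ring
        _ ≤ _ := by gcongr
    nlinarith
  have c2 : 2 * (⟪S.D e, g⟫ - ⟪e, R⟫) ≤ 4 * m * (q + ρ) := by
    have h1 := le_abs_self ⟪S.D e, g⟫
    have h2 := neg_abs_le ⟪e, R⟫
    have h3 : q + ρ ≤ m * (q + ρ) := le_mul_of_one_le_left (by positivity) hm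
    have h4 : m * q ≤ m * (q + ρ) := by gcongr; linarith
    linarith
  set μ := min 1 (|γ| / 4) with hμ
  have hμ0 : 0 < μ := lt_min one_pos (by positivity)
  -- Coercivity converts the quadratic bounds into a bound by the energy itself; dividing by μ is
  -- the origin of the denominator in `stabRate`.
  have hμΦ : μ * (q + ρ) ≤ Φ + ρ := by
    have h1 : μ ≤ 1 := min_le_left _ _
    have h2 : μ ≤ |γ| / 4 := min_le_right _ _
    have h3 := mul_le_mul_of_nonneg_right h1 (sq_nonneg ‖e‖)
    have h4 := mul_le_mul_of_nonneg_right h2 (sq_nonneg ‖S.D e‖)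
    have h5 := mul_le_mul_of_nonneg_right h1 hρ0
    have h6 : μ * (q + ρ) = μ * ‖e‖ ^ 2 + μ * ‖S.D e‖ ^ 2 + μ * ρ := by rw [hq]; ring
    rw [h6]
    linarith
  have c3 : 2 * m * (q + ρ) + k * (4 * m * (q + ρ)) ≤ stabRate α β γ δ A * (Φ + ρ) := by
    have : 2 * m * (q + ρ) + k * (4 * m * (q + ρ)) = stabRate α β γ δ A * (μ * (q + ρ)) := by
      rw [stabRate]
      field_simp
      ring
    rw [this]
    exact mul_le_mul_of_nonneg_left hμΦ (stabRate_nonneg hA)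
  have c4 := mul_le_mul_of_nonneg_left c2 (by linarith : 0 ≤ k)
  linarith

/-- Stability as long as the error stays in the ball of radius `r`. -/
lemma HamSystem.error_le_of_forall (S : HamSystem E) {α β γ δ A T r κ : ℝ} (hγ : γ ≠ 0)
    (hA : 0 ≤ A) (hκ : 0 ≤ κ) (hκr : κ * r ≤ 1) {w w' R y : ℝ → E} {P : ℝ → ℝ}
    (hB : ∀ a b, ‖S.B a b‖ ≤ κ * ‖a‖ * ‖b‖)
    (hw : ∀ t ∈ Icc 0 T, HasDerivWithinAt w (w' t) (Icc 0 T) t)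
    (hwR : ∀ t ∈ Icc 0 T, w' t = -S.D (S.grad α β γ δ (w t)) + R t)
    (hA1 : ∀ t ∈ Icc 0 T, ∀ b, ‖S.B (w t) b‖ ≤ A * ‖b‖)
    (hA2 : ∀ t ∈ Icc 0 T, ∀ b, ‖S.B (w' t) b‖ ≤ A * ‖b‖)
    (hyd : ∀ t ∈ Icc 0 T, ‖y t - w t‖ ≤ r →
      HasDerivWithinAt y (-S.D (S.grad α β γ δ (y t))) (Icc 0 T) t)
    (hP : ∀ t ∈ Icc 0 T, HasDerivWithinAt P (‖R t‖ ^ 2 + ‖S.D (R t)‖ ^ 2) (Icc 0 T) t)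
    (hP0 : P 0 = 0) {t₁ : ℝ} (ht₁ : t₁ ∈ Icc 0 T) (hle : ∀ t ∈ Icc 0 t₁, ‖y t - w t‖ ≤ r) :
    ‖y t₁ - w t₁‖ ^ 2 ≤ stabBound α β γ δ A T *
      (‖y 0 - w 0‖ ^ 2 + ‖S.D (y 0 - w 0)‖ ^ 2 + P T) := by
  set e : ℝ → E := fun t => y t - w t with he
  set C := stabRate α β γ δ A with hC
  have hC0 : 0 ≤ C := stabRate_nonneg hA
  set k := stabShift α β γ δ A with hk
  have hk1 : 1 ≤ k := one_le_stabShift hA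
  set σ := (SignType.sign γ : ℝ) with hσ
  -- Derivatives are kept relative to the whole interval [0, T] and used only up to t₁.
  have hsub : Icc 0 t₁ ⊆ Icc 0 T := Icc_subset_Icc_right ht₁.2
  -- The only use of the smallness of the error: in the ball of radius r the quadratic term is no
  -- larger than a linear one.
  have hBe : ∀ t ∈ Icc 0 t₁, ‖S.B (e t) (e t)‖ ≤ ‖e t‖ := fun t ht => by
    refine (hB _ _).trans ?_
    have : κ * ‖e t‖ ≤ 1 := (mul_le_mul_of_nonneg_left (hle t ht) hκ).trans hκr
    exact mul_le_of_le_one_left (norm_nonneg _) this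
  set Φ : ℝ → ℝ := fun t => σ * S.rel α β γ δ (w t) (e t) + k * ‖e t‖ ^ 2 with hΦ
  -- Gronwall by an integrating factor: Φ' ≤ C(Φ + P') makes Ψ nonincreasing, as e^{-Ct} ≤ 1.
  set Ψ : ℝ → ℝ := fun t => Real.exp (-C * t) * Φ t - C * P t with hΨ
  have hed : ∀ t ∈ Icc 0 t₁, HasDerivWithinAt e (-S.D (S.incr α β γ δ (w t) (e t)) - R t)
      (Icc 0 T) t := fun t ht => by
    refine ((hyd t (hsub ht) (hle t ht)).sub (hw t (hsub ht))).congr_deriv ?_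
    rw [hwR t (hsub ht), ← S.grad_sub, he]
    simp only [add_sub_cancel, map_sub]
    abel
  have hΦd : ∀ t ∈ Icc 0 t₁, ∃ Φ', HasDerivWithinAt Φ Φ' (Icc 0 T) t ∧
      Φ' ≤ C * (Φ t + (‖R t‖ ^ 2 + ‖S.D (R t)‖ ^ 2)) := fun t ht => by
    have h1 := (S.hasDerivWithinAt_rel α β γ δ (hw t (hsub ht)) (hed t ht)).const_mul σ
    have h2 := ((hed t ht).norm_sq).const_mul k
    refine ⟨_, h1.add h2, ?_⟩
    exact S.energy_deriv_le hγ hA _ _ _ _ (hA1 t (hsub ht) _) (hA2 t (hsub ht) _) (hBe t ht)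
  have hΨd : ∀ t ∈ Icc 0 t₁, ∃ Ψ', HasDerivWithinAt Ψ Ψ' (Icc 0 T) t ∧ Ψ' ≤ 0 := fun t ht => by
    obtain ⟨Φ', h1, h2⟩ := hΦd t ht
    have h3 : HasDerivWithinAt (fun τ : ℝ => Real.exp (-C * τ)) (Real.exp (-C * t) * (-C))
        (Icc 0 T) t := by
      have := ((hasDerivAt_id t).const_mul (-C)).exp.hasDerivWithinAt (s := Icc 0 T)
      simpa using this
    refine ⟨_, (h3.mul h1).sub ((hP t (hsub ht)).const_mul C), ?_⟩
    set ρ := ‖R t‖ ^ 2 + ‖S.D (R t)‖ ^ 2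
    have hρ : 0 ≤ ρ := by positivity
    have h4 : Real.exp (-C * t) ≤ 1 := by
      rw [Real.exp_le_one_iff]; nlinarith [ht.1]
    have h5 := mul_le_mul_of_nonneg_left h2 (Real.exp_pos (-C * t)).le
    have h6 := mul_le_mul_of_nonneg_right h4 (mul_nonneg hC0 hρ)
    linarith
  have hmono : ∀ f : ℝ → ℝ, (∀ t ∈ Icc 0 t₁, ∃ f', HasDerivWithinAt f f' (Icc 0 T) t ∧ f' ≤ 0) →
      f t₁ ≤ f 0 := by
    intro f hf
    have hanti : AntitoneOn f (Icc 0 t₁) := by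
      refine antitoneOn_of_deriv_nonpos (convex_Icc _ _) (fun t ht => ?_) (fun t ht => ?_) fun t ht => ?_
      · obtain ⟨f', h1, _⟩ := hf t ht
        exact (h1.mono hsub).continuousWithinAt
      all_goals
        rw [interior_Icc] at ht
        obtain ⟨f', h1, h2⟩ := hf t (Ioo_subset_Icc_self ht)
        have h3 := h1.hasDerivAt (Icc_mem_nhds ht.1 (ht.2.trans_le ht₁.2))
      · exact h3.differentiableAt.differentiableWithinAt
      · rw [h3.deriv]; exact h2
    exact hanti ⟨le_rfl, ht₁.1⟩ ⟨ht₁.1, le_rfl⟩ ht₁.1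
  have hΨle := hmono Ψ hΨd
  have hPmono : P t₁ ≤ P T := by
    have hmon : MonotoneOn P (Icc 0 T) := by
      refine monotoneOn_of_deriv_nonneg (convex_Icc _ _)
        (fun t ht => (hP t ht).continuousWithinAt) (fun t ht => ?_) fun t ht => ?_
      all_goals
        rw [interior_Icc] at ht
        have h3 := (hP t (Ioo_subset_Icc_self ht)).hasDerivAt (Icc_mem_nhds ht.1 ht.2)
      · exact h3.differentiableAt.differentiableWithinAt
      · rw [h3.deriv]; positivity
    exact hmon ht₁ ⟨ht₁.1.trans ht₁.2, le_rfl⟩ ht₁.2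
  have hP0' : 0 ≤ P t₁ := by
    have := hmono (fun t => -P t) fun t ht => ⟨_, (hP t (hsub ht)).neg, by
      have : 0 ≤ ‖R t‖ ^ 2 + ‖S.D (R t)‖ ^ 2 := by positivity
      linarith⟩
    simp only [hP0] at this
    linarith
  have h0 : (0 : ℝ) ∈ Icc 0 t₁ := ⟨le_rfl, ht₁.1⟩
  have h1 : t₁ ∈ Icc 0 t₁ := ⟨ht₁.1, le_rfl⟩
  have hΦ0 : Φ 0 ≤ (stabConst α β γ δ A + k) * (‖e 0‖ ^ 2 + ‖S.D (e 0)‖ ^ 2) := by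
    have := S.sign_mul_rel_le α β γ δ (w 0) (e 0) hγ hA (hA1 0 (hsub h0) _) (hBe 0 h0)
    have h2 : k * ‖e 0‖ ^ 2 ≤ k * (‖e 0‖ ^ 2 + ‖S.D (e 0)‖ ^ 2) := by
      gcongr
      linarith [sq_nonneg ‖S.D (e 0)‖]
    simp only [hΦ]
    linarith
  have hΦ1 : ‖e t₁‖ ^ 2 ≤ Φ t₁ := by
    have := S.le_sign_mul_rel α β γ δ (w t₁) (e t₁) hγ (hA1 t₁ ht₁ _) (hBe t₁ h1)
    have h2 : 0 ≤ |γ| / 4 * ‖S.D (e t₁)‖ ^ 2 := by positivity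
    simp only [hΦ]
    linarith
  have hm1 : 1 ≤ stabConst α β γ δ A := one_le_stabConst hA
  have h3 : Φ t₁ ≤ Real.exp (C * t₁) * (Φ 0 + C * P t₁) := by
    have h4 : Real.exp (-C * t₁) * Φ t₁ ≤ Φ 0 + C * P t₁ := by
      simp only [hΨ, hP0] at hΨle
      simp only [mul_zero, Real.exp_zero, one_mul, sub_zero] at hΨle
      linarith
    have h5 := mul_le_mul_of_nonneg_left h4 (Real.exp_pos (C * t₁)).le
    rw [← mul_assoc, ← Real.exp_add] at h5
    simpa using h5
  set J := ‖e 0‖ ^ 2 + ‖S.D (e 0)‖ ^ 2 with hJ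
  have hJ0 : 0 ≤ J := by positivity
  have h6 : Φ 0 + C * P t₁ ≤ (stabConst α β γ δ A + k + C) * (J + P T) := by
    have t1 : C * P t₁ ≤ C * (J + P T) := by gcongr; linarith
    have t2 : (stabConst α β γ δ A + k) * J ≤ (stabConst α β γ δ A + k) * (J + P T) := by
      gcongr; linarith
    linarith
  calc ‖e t₁‖ ^ 2 ≤ Real.exp (C * t₁) * (Φ 0 + C * P t₁) := hΦ1.trans h3
    _ ≤ Real.exp (C * T) * ((stabConst α β γ δ A + k + C) * (J + P T)) := by
      have : C * t₁ ≤ C * T := mul_le_mul_of_nonneg_left ht₁.2 hC0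
      have h7 : 0 ≤ (stabConst α β γ δ A + k + C) * (J + P T) := by
        refine mul_nonneg (by linarith) (by linarith)
      calc _ ≤ Real.exp (C * t₁) * ((stabConst α β γ δ A + k + C) * (J + P T)) := by gcongr
        _ ≤ _ := by gcongr
    _ = _ := by rw [stabBound]; ring

/-- Stability: small perturbations of the initial value and small residuals lead to small errors. -/
theorem HamSystem.error_le (S : HamSystem E) {α β γ δ A T r κ : ℝ} (hγ : γ ≠ 0)
    (hA : 0 ≤ A) (hr : 0 ≤ r) (hκ : 0 ≤ κ) (hκr : κ * r ≤ 1) {w w' R y : ℝ → E} {P : ℝ → ℝ}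
    (hB : ∀ a b, ‖S.B a b‖ ≤ κ * ‖a‖ * ‖b‖)
    (hw : ∀ t ∈ Icc 0 T, HasDerivWithinAt w (w' t) (Icc 0 T) t)
    (hwR : ∀ t ∈ Icc 0 T, w' t = -S.D (S.grad α β γ δ (w t)) + R t)
    (hA1 : ∀ t ∈ Icc 0 T, ∀ b, ‖S.B (w t) b‖ ≤ A * ‖b‖)
    (hA2 : ∀ t ∈ Icc 0 T, ∀ b, ‖S.B (w' t) b‖ ≤ A * ‖b‖)
    (hyc : ContinuousOn y (Icc 0 T))
    (hyd : ∀ t ∈ Icc 0 T, ‖y t - w t‖ ≤ r →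
      HasDerivWithinAt y (-S.D (S.grad α β γ δ (y t))) (Icc 0 T) t)
    (hP : ∀ t ∈ Icc 0 T, HasDerivWithinAt P (‖R t‖ ^ 2 + ‖S.D (R t)‖ ^ 2) (Icc 0 T) t)
    (hP0 : P 0 = 0)
    (hinit : ‖y 0 - w 0‖ < r)
    (hsmall : stabBound α β γ δ A T *
      (‖y 0 - w 0‖ ^ 2 + ‖S.D (y 0 - w 0)‖ ^ 2 + P T) < r ^ 2) {t : ℝ} (ht : t ∈ Icc 0 T) :
    ‖y t - w t‖ < r ∧ ‖y t - w t‖ ^ 2 ≤ stabBound α β γ δ A T *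
      (‖y 0 - w 0‖ ^ 2 + ‖S.D (y 0 - w 0)‖ ^ 2 + P T) := by
  have hec : ContinuousOn (fun t => ‖y t - w t‖) (Icc 0 T) :=
    (hyc.sub fun t ht => (hw t ht).continuousWithinAt).norm
  have hall : ∀ t ∈ Icc 0 T, ‖y t - w t‖ < r := by
    by_contra! hcon
    -- Continuity argument: at the first time t₁ of leaving the open ball the stability estimate
    -- holds on [0, t₁] and gives an error strictly below r, a contradiction.
    set Z := {t ∈ Icc 0 T | r ≤ ‖y t - w t‖} with hZ
    have hZne : Z.Nonempty := hcon
    have hZc : IsClosed Z := hec.preimage_isClosed_of_isClosed isClosed_Icc isClosed_Ici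
    have hZb : BddBelow Z := ⟨0, fun t ht => ht.1.1⟩
    set t₁ := sInf Z with ht₁
    have hm : t₁ ∈ Z := hZc.csInf_mem hZne hZb
    have hlt : ∀ t ∈ Ico 0 t₁, ‖y t - w t‖ < r := fun t ht => by
      by_contra! h
      exact absurd (csInf_le hZb (show t ∈ Z from ⟨⟨ht.1, ht.2.le.trans hm.1.2⟩, h⟩)) (not_le.2 ht.2)
    have h0 : 0 < t₁ := by
      rcases hm.1.1.eq_or_lt with h | h
      · exact absurd hm.2 (not_le.2 (h ▸ hinit))
      · exact h
    have hle : ∀ t ∈ Icc 0 t₁, ‖y t - w t‖ ≤ r := by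
      have hcl : closure (Ico 0 t₁) = Icc 0 t₁ := closure_Ico h0.ne
      have hc : ContinuousOn (fun t => ‖y t - w t‖) (closure (Ico 0 t₁)) := by
        rw [hcl]; exact hec.mono (Icc_subset_Icc_right hm.1.2)
      intro t ht
      rw [← hcl] at ht
      exact closure_minimal (s := Ico 0 t₁) (t := {x | x ∈ closure (Ico 0 t₁) ∧ ‖y x - w x‖ ≤ r})
        (fun x hx => ⟨subset_closure hx, (hlt x hx).le⟩)
        (hc.preimage_isClosed_of_isClosed isClosed_closure isClosed_Iic) ht |>.2
    have := S.error_le_of_forall hγ hA hκ hκr hB hw hwR hA1 hA2 hyd hP hP0 hm.1 hle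
    have h2 : r ^ 2 ≤ ‖y t₁ - w t₁‖ ^ 2 := pow_le_pow_left₀ hr hm.2 2
    linarith
  exact ⟨hall t ht, S.error_le_of_forall hγ hA hκ hκr hB hw hwR hA1 hA2 hyd hP hP0 ht
    fun τ hτ => (hall τ ⟨hτ.1, hτ.2.trans ht.2⟩).le⟩

/-- A smooth field on a finite dimensional space agrees on each ball with a complete field. -/
lemma exists_truncated_solution [FiniteDimensional ℝ E] {F : E → E} (hF : ContDiff ℝ 1 F)
    {T ρ : ℝ} (hT : 0 ≤ T) (hρ : 0 < ρ) (x₀ : E) : ∃ y : ℝ → E, y 0 = x₀ ∧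
    ContinuousOn y (Icc 0 T) ∧
    ∀ t ∈ Icc 0 T, ‖y t‖ ≤ ρ → HasDerivWithinAt y (F (y t)) (Icc 0 T) t := by
  -- The truncated field is bounded and globally Lipschitz, so one Picard–Lindelöf step with radius
  -- L·T covers all of [0, T].
  let b : ContDiffBump (0 : E) := ⟨ρ, ρ + 1, hρ, by linarith⟩
  set G : E → E := fun x => b x • F x with hG
  have hsupp : HasCompactSupport G := b.hasCompactSupport.smul_right
  have hGd : ContDiff ℝ 1 G := b.contDiff.smul hF
  obtain ⟨K, hK⟩ := hGd.lipschitzWith_of_hasCompactSupport hsupp one_ne_zero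
  obtain ⟨L, hL⟩ := hsupp.exists_bound_of_continuous hGd.continuous
  have hL0 : 0 ≤ L := (norm_nonneg _).trans (hL 0)
  have h0 : (0 : ℝ) ∈ Icc 0 T := ⟨le_rfl, hT⟩
  have hPL : IsPicardLindelof (fun _ => G) (⟨0, h0⟩ : Icc (0 : ℝ) T) x₀
      (⟨L * T, by positivity⟩ : NNReal) 0 (⟨L, hL0⟩ : NNReal) K := by
    refine IsPicardLindelof.of_time_independent (fun x _ => hL x) hK.lipschitzOnWith ?_
    simp only [sub_zero, sub_self, max_eq_left hT, NNReal.coe_zero]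
    exact le_rfl
  obtain ⟨y, hy0, hy⟩ := hPL.exists_eq_forall_mem_Icc_hasDerivWithinAt₀
  refine ⟨y, hy0, fun t ht => (hy t ht).continuousWithinAt, fun t ht hρt => ?_⟩
  refine (hy t ht).congr_deriv ?_
  have : b (y t) = 1 := b.one_of_mem_closedBall (by simpa using hρt)
  simp only [hG, this, one_smul]

end stability

end Benjamin
end

noncomputable section

namespace Benjamin

open scoped ComplexConjugate
open Complex (I)

/-! ### The discrete spaces in terms of coefficients -/

section discrete

variable {ℓ : ℝ} {p : ℕ}

/-- The space of the coefficients of elements of `ℙ_n`. -/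
abbrev Coef (p : ℕ) := EuclideanSpace ℂ (Fin p)

/-- Extension by zero. -/
def ext (a : Coef p) (k : ℕ) : ℂ := if h : k < p then a ⟨k, h⟩ else 0

/-- Truncation. -/
def tr (p : ℕ) (a : ℕ → ℂ) : Coef p := WithLp.toLp 2 fun k => a k

lemma ext_eq_zero (a : Coef p) {k : ℕ} (hk : p ≤ k) : ext a k = 0 := dif_neg (by omega)

lemma ext_apply (a : Coef p) (k : Fin p) : ext a k = a k := by
  rw [ext, dif_pos k.2]

lemma tr_apply (a : ℕ → ℂ) (k : Fin p) : tr p a k = a k := rfl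

lemma ext_tr_of_lt (a : ℕ → ℂ) {k : ℕ} (hk : k < p) : ext (tr p a) k = a k := by
  rw [ext, dif_pos hk]
  rfl

lemma ext_tr {a : ℕ → ℂ} (h : ∀ k, p ≤ k → a k = 0) : ext (tr p a) = a := by
  ext k
  rcases lt_or_ge k p with hk | hk
  · exact ext_tr_of_lt a hk
  · rw [ext_eq_zero _ hk, h k hk]

lemma tr_ext (a : Coef p) : tr p (ext a) = a := by
  ext k
  rw [tr_apply, ext_apply]

lemma tr_congr {a b : ℕ → ℂ} (h : ∀ k < p, a k = b k) : tr p a = tr p b := by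
  ext k
  rw [tr_apply, tr_apply, h k k.2]

lemma ext_add (a b : Coef p) (k : ℕ) : ext (a + b) k = ext a k + ext b k := by
  unfold ext
  split_ifs <;> simp

lemma ext_smul (c : ℝ) (a : Coef p) (k : ℕ) : ext (c • a) k = c * ext a k := by
  unfold ext
  split_ifs <;> simp

lemma ext_csmul (c : ℂ) (a : Coef p) (k : ℕ) : ext (c • a) k = c * ext a k := by
  unfold ext
  split_ifs <;> simp

lemma inner_eq_sum (a b : Coef p) :
    inner ℝ a b = (∑ k ∈ Finset.range p, conj (ext a k) * ext b k).re := by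
  rw [PiLp.inner_apply, Complex.re_sum, Finset.sum_range]
  simp only [Complex.inner, ext_apply]
  exact Finset.sum_congr rfl fun k _ => by rw [mul_comm]

lemma norm_sq_eq_sum (a : Coef p) : ‖a‖ ^ 2 = ∑ k ∈ Finset.range p, ‖ext a k‖ ^ 2 := by
  rw [EuclideanSpace.norm_sq_eq, Finset.sum_range]
  simp only [ext_apply]

lemma norm_sq_tr (f : ℕ → ℂ) : ‖tr p f‖ ^ 2 = ∑ k ∈ Finset.range p, ‖f k‖ ^ 2 := by
  rw [norm_sq_eq_sum]
  exact Finset.sum_congr rfl fun k hk => by rw [ext_tr_of_lt _ (Finset.mem_range.1 hk)]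

lemma summable_ext (a : Coef p) : Summable fun k => ‖ext a k‖ :=
  summable_norm_of_support fun _ hk => ext_eq_zero a hk

/-- The function with given coefficients. -/
def recon (ℓ : ℝ) (a : Coef p) : ℝ → ℝ := synth ℓ (ext a)

lemma rec_eq_sum (a : Coef p) (x : ℝ) :
    recon ℓ a x = 2 * (∑ k ∈ Finset.range p, ext a k * psi ℓ k x).re :=
  synth_eq_sum (fun _ hk => ext_eq_zero a hk) x

lemma rec_add (a b : Coef p) (x : ℝ) : recon ℓ (a + b) x = recon ℓ a x + recon ℓ b x := by
  simp only [rec_eq_sum, ext_add, add_mul, Finset.sum_add_distrib, Complex.add_re]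
  ring

lemma rec_smul (c : ℝ) (a : Coef p) (x : ℝ) : recon ℓ (c • a) x = c * recon ℓ a x := by
  simp only [rec_eq_sum, ext_smul, mul_assoc, ← Finset.mul_sum, Complex.re_ofReal_mul]
  ring

/-- The synthesis map as a linear map. -/
def recL (ℓ : ℝ) (p : ℕ) : Coef p →ₗ[ℝ] (ℝ → ℝ) where
  toFun := recon ℓ
  map_add' a b := funext fun x => rec_add a b x
  map_smul' c a := funext fun x => rec_smul c a x

lemma recL_apply (a : Coef p) : recL ℓ p a = recon ℓ a := rfl

lemma memLp_rec (hℓ : 0 < ℓ) (a : Coef p) : MemLp (recon ℓ a) 2 volume := memLp_synth hℓ (summable_ext a)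

lemma rcoef_rec (hℓ : 0 < ℓ) (a : Coef p) (k : ℕ) : rcoef ℓ (recon ℓ a) k = ext a k :=
  rcoef_synth hℓ (summable_ext a) k

lemma integral_rec_sq (hℓ : 0 < ℓ) (a : Coef p) : ∫ x, recon ℓ a x ^ 2 = 2 * ‖a‖ ^ 2 := by
  have h := hasSum_norm_sq_rcoef hℓ (memLp_rec hℓ a)
  simp only [rcoef_rec hℓ] at h
  rw [← h.tsum_eq, tsum_eq_sum (s := Finset.range p), norm_sq_eq_sum, Finset.mul_sum]
  intro k hk
  rw [ext_eq_zero a (by simpa using hk)]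
  simp

lemma integrable_rec_mul (hℓ : 0 < ℓ) (a b : Coef p) : Integrable fun x => recon ℓ a x * recon ℓ b x :=
  (memLp_rec hℓ a).integrable_mul (memLp_rec hℓ b)

/-- Polarization of Parseval. The factor 2 comes from the negative indices, which repeat the
contribution of the nonnegative ones; it recurs in `discreteG_rec` and `inner_ic`. -/
lemma innerL2_rec (hℓ : 0 < ℓ) (a b : Coef p) :
    ∫ x, recon ℓ a x * recon ℓ b x = 2 * inner ℝ a b := by
  have h1 := integral_rec_sq hℓ (a + b)
  have h2 := integral_rec_sq hℓ (a - b)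
  have e1 : ∀ x, recon ℓ (a - b) x = recon ℓ a x - recon ℓ b x := fun x =>
    congr_fun ((recL ℓ p).map_sub a b) x
  simp only [rec_add, e1] at h1 h2
  have i : ∀ a b : Coef p, Integrable fun x => recon ℓ a x * recon ℓ b x := integrable_rec_mul hℓ
  have e2 : ∫ x, recon ℓ a x * recon ℓ b x
      = 1 / 4 * ((∫ x, (recon ℓ a x + recon ℓ b x) ^ 2) - ∫ x, (recon ℓ a x - recon ℓ b x) ^ 2) := by
    have j : ∀ c : Coef p, Integrable fun x => recon ℓ c x ^ 2 := fun c => (memLp_rec hℓ c).integrable_sq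
    have j1 := j (a + b)
    have j2 := j (a - b)
    simp only [rec_add, e1] at j1 j2
    rw [← integral_sub j1 j2, ← integral_const_mul]
    congr 1
    ext x
    ring
  rw [e2, h1, h2, norm_add_sq_real, norm_sub_sq_real]
  ring

/-- The matrix of the projected derivative. -/
def dmat (ℓ : ℝ) (p : ℕ) : Coef p →ₗ[ℝ] Coef p where
  toFun a := tr p (dseq ℓ (ext a))
  map_add' a b := by
    ext k
    simp only [tr_apply, dseq, ext_add, PiLp.add_apply]
    ring
  map_smul' c a := by
    ext k
    simp only [tr_apply, dseq, ext_smul, PiLp.smul_apply, Complex.real_smul, RingHom.id_apply]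
    ring

lemma dmat_apply (a : Coef p) : dmat ℓ p a = tr p (dseq ℓ (ext a)) := rfl

lemma sum_shift (p : ℕ) (f g : ℕ → ℂ) :
    ∑ k ∈ Finset.range p, (k : ℂ) * f (k - 1) * g k + p * f (p - 1) * g p
      = ∑ k ∈ Finset.range p, ((k : ℂ) + 1) * f k * g (k + 1) := by
  rw [← Finset.sum_range_succ (fun k => (k : ℂ) * f (k - 1) * g k), Finset.sum_range_succ']
  simp

/-- Summation by parts. -/
lemma sum_conj_dseq_mul (p : ℕ) (a b : ℕ → ℂ) (h1 : conj (a (p - 1)) * b p = 0)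
    (h2 : conj (a p) * b (p - 1) = 0) :
    ∑ k ∈ Finset.range p, conj (dseq ℓ a k) * b k
      = -∑ k ∈ Finset.range p, conj (a k) * dseq ℓ b k := by
  have s1 := sum_shift p (fun k => conj (a k)) b
  have s2 := sum_shift p b (fun k => conj (a k))
  rw [mul_assoc, h1, mul_zero, add_zero] at s1
  rw [mul_assoc, mul_comm (b _), h2, mul_zero, add_zero] at s2
  have e1 : ∀ k : ℕ, conj (dseq ℓ a k) * b k = -(I / ℓ) * ((2 * k + 1) * (conj (a k) * b k))
      + -(I / ℓ) * (k * conj (a (k - 1)) * b k)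
      + -(I / ℓ) * ((k + 1) * b k * conj (a (k + 1))) := fun k => by
    simp only [dseq, map_mul, map_add, map_div₀, Complex.conj_I, Complex.conj_ofReal, map_natCast,
      map_one, Complex.conj_ofNat]
    ring
  have e2 : ∀ k : ℕ, -(conj (a k) * dseq ℓ b k) = -(I / ℓ) * ((2 * k + 1) * (conj (a k) * b k))
      + -(I / ℓ) * ((k + 1) * conj (a k) * b (k + 1))
      + -(I / ℓ) * (k * b (k - 1) * conj (a k)) := fun k => by
    simp only [dseq]
    ring
  rw [← Finset.sum_neg_distrib]
  simp only [e1, e2, Finset.sum_add_distrib, ← Finset.mul_sum]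
  rw [s1, ← s2]

/-- Summation by parts; the boundary terms at index p vanish because both sequences are extended by
zero. -/
lemma inner_dmat (a b : Coef p) : inner ℝ (dmat ℓ p a) b = -inner ℝ a (dmat ℓ p b) := by
  rw [inner_eq_sum, inner_eq_sum, dmat_apply, dmat_apply, ← Complex.neg_re]
  congr 1
  have h := sum_conj_dseq_mul (ℓ := ℓ) p (ext a) (ext b)
    (by rw [ext_eq_zero b le_rfl, mul_zero]) (by rw [ext_eq_zero a le_rfl, map_zero, zero_mul])
  refine Eq.trans ?_ (h.trans (congr_arg Neg.neg ?_))
  all_goals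
    exact Finset.sum_congr rfl fun k hk => by rw [ext_tr_of_lt _ (Finset.mem_range.1 hk)]

lemma deriv_rec (hℓ : 0 < ℓ) (a : Coef p) : deriv (recon ℓ a) = synth ℓ (dseq ℓ (ext a)) :=
  funext fun x => (hasDerivAt_synth hℓ (fun _ hk => ext_eq_zero a hk) x).deriv

/-! The space `ℙ_n` and the projection onto it. -/

lemma mtc_even (hℓ : 0 < ℓ) (k : ℕ) (x : ℝ) : mtc ℓ (2 * k) x = Real.sqrt 2 * (psi ℓ k x).re := by
  rw [mtc, if_pos (even_two_mul k), Nat.mul_div_cancel_left k two_pos, mtcComplex_eq_psi hℓ]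

lemma mtc_odd (hℓ : 0 < ℓ) (k : ℕ) (x : ℝ) : mtc ℓ (2 * k + 1) x = Real.sqrt 2 * (psi ℓ k x).im := by
  have h : (2 * k + 1) / 2 = k := by omega
  rw [mtc, if_neg (by simp), h, mtcComplex_eq_psi hℓ]

lemma sum_range_two_mul (p : ℕ) (f : ℕ → ℝ) :
    ∑ m ∈ Finset.range (2 * p), f m = ∑ k ∈ Finset.range p, (f (2 * k) + f (2 * k + 1)) := by
  induction p with
  | zero => simp
  | succ p ih =>
    rw [Finset.sum_range_succ, ← ih, mul_add, mul_one, Finset.sum_range_succ, Finset.sum_range_succ]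
    ring

lemma rec_tr_eq (hℓ : 0 < ℓ) (f : ℕ → ℂ) (x : ℝ) : recon ℓ (tr p f) x = ∑ k ∈ Finset.range p,
    (Real.sqrt 2 * (f k).re * mtc ℓ (2 * k) x - Real.sqrt 2 * (f k).im * mtc ℓ (2 * k + 1) x) := by
  rw [rec_eq_sum, Complex.re_sum, Finset.mul_sum]
  refine Finset.sum_congr rfl fun k hk => ?_
  rw [ext_tr_of_lt _ (Finset.mem_range.1 hk), Complex.mul_re, mtc_even hℓ, mtc_odd hℓ]
  have h2 : Real.sqrt 2 * Real.sqrt 2 = 2 := Real.mul_self_sqrt zero_le_two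
  linear_combination (-((f k).re * (psi ℓ k x).re) + (f k).im * (psi ℓ k x).im) * h2

/-- The pair φ_{2k}, φ_{2k+1} consists of √2 times the real and the imaginary part of ψ_k, so real
combinations of 2p functions amount to p complex coefficients. -/
lemma mem_mtcSpace_iff (hℓ : 0 < ℓ) (f : ℝ → ℝ) : f ∈ mtcSpace ℓ p ↔ ∃ a : Coef p, f = recon ℓ a := by
  have hr : mtcSpace ℓ p = LinearMap.range (recL ℓ p) := by
    apply le_antisymm
    · rw [mtcSpace, Submodule.span_le]
      rintro _ ⟨m, rfl⟩
      have h2 : Real.sqrt 2 ≠ 0 := by positivity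
      have hm : (m : ℕ) / 2 < p := by omega
      rcases Nat.even_or_odd' (m : ℕ) with ⟨k, hk | hk⟩
      -- By `rec_tr_eq` a coefficient c contributes √2 Re c to φ_{2k} and -√2 Im c to φ_{2k+1};
      -- hence the witnesses 1/√2 and, in the odd case, -i/√2.
      · refine ⟨tr p fun j => if j = k then ((1 / Real.sqrt 2 : ℝ) : ℂ) else 0, ?_⟩
        ext x
        have hkp : k < p := by omega
        simp only [recL_apply, rec_tr_eq hℓ, hk]
        rw [Finset.sum_eq_single k (fun j _ hj => by simp [hj])
          (fun h => absurd (Finset.mem_range.2 hkp) h)]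
        simp only [if_true, Complex.ofReal_re, Complex.ofReal_im]
        field_simp
        ring
      · refine ⟨tr p fun j => if j = k then ((-1 / Real.sqrt 2 : ℝ) : ℂ) * I else 0, ?_⟩
        ext x
        have hkp : k < p := by omega
        simp only [recL_apply, rec_tr_eq hℓ, hk]
        rw [Finset.sum_eq_single k (fun j _ hj => by simp [hj])
          (fun h => absurd (Finset.mem_range.2 hkp) h)]
        simp only [if_true, Complex.re_ofReal_mul, Complex.im_ofReal_mul, Complex.I_re, Complex.I_im]
        field_simp
        ring
    · rintro _ ⟨a, rfl⟩
      have e : recL ℓ p a = ∑ k ∈ Finset.range p, ((Real.sqrt 2 * (ext a k).re) • mtc ℓ (2 * k)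
          - (Real.sqrt 2 * (ext a k).im) • mtc ℓ (2 * k + 1)) := by
        ext x
        rw [recL_apply]
        conv_lhs => rw [← tr_ext a]
        rw [rec_tr_eq hℓ]
        simp [Finset.sum_apply]
      rw [e]
      refine Submodule.sum_mem _ fun k hk => ?_
      have hk' := Finset.mem_range.1 hk
      exact Submodule.sub_mem _
        (Submodule.smul_mem _ _ (Submodule.subset_span ⟨⟨2 * k, by omega⟩, rfl⟩))
        (Submodule.smul_mem _ _ (Submodule.subset_span ⟨⟨2 * k + 1, by omega⟩, rfl⟩))
  rw [hr]
  constructor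
  · rintro ⟨a, rfl⟩; exact ⟨a, rfl⟩
  · rintro ⟨a, rfl⟩; exact ⟨a, rfl⟩

lemma proj_eq (hℓ : 0 < ℓ) {f : ℝ → ℝ} (hf : MemLp f 2 volume) :
    proj ℓ p f = recon ℓ (tr p (rcoef ℓ f)) := by
  ext x
  have hi : ∀ k : ℕ, Integrable fun x => (f x : ℂ) * conj (psi ℓ k x) := fun k =>
    integrable_mul_conj_psi hℓ hf.ofReal k
  have h1 : ∀ k : ℕ, innerL2 f (mtc ℓ (2 * k)) = Real.sqrt 2 * (rcoef ℓ f k).re := fun k => by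
    have := integral_re (hi k)
    simp only [RCLike.re_eq_complex_re, Complex.re_ofReal_mul, Complex.conj_re] at this
    rw [rcoef, coef, ← this, ← integral_const_mul, innerL2]
    congr 1
    ext x
    rw [mtc_even hℓ]
    ring
  have h2 : ∀ k : ℕ, innerL2 f (mtc ℓ (2 * k + 1)) = -(Real.sqrt 2 * (rcoef ℓ f k).im) := fun k => by
    have := integral_im (hi k)
    simp only [RCLike.im_eq_complex_im, Complex.im_ofReal_mul, Complex.conj_im] at this
    rw [rcoef, coef, ← this, ← integral_const_mul, ← integral_neg, innerL2]
    congr 1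
    ext x
    rw [mtc_odd hℓ]
    ring
  rw [proj, sum_range_two_mul, rec_tr_eq hℓ]
  refine Finset.sum_congr rfl fun k _ => ?_
  rw [h1, h2]
  ring

lemma proj_rec (hℓ : 0 < ℓ) (a : Coef p) : proj ℓ p (recon ℓ a) = recon ℓ a := by
  rw [proj_eq hℓ (memLp_rec hℓ a)]
  congr 1
  rw [funext (rcoef_rec hℓ a), tr_ext]

lemma discreteJ_rec (hℓ : 0 < ℓ) (a : Coef p) : discreteJ ℓ p (recon ℓ a) = recon ℓ (-dmat ℓ p a) := by
  have hs : Summable fun k => ‖dseq ℓ (ext a) k‖ :=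
    summable_norm_of_support (dseq_eq_zero fun _ hk => ext_eq_zero a hk)
  rw [discreteJ, proj_rec hℓ, deriv_rec hℓ, proj_eq hℓ (memLp_synth hℓ hs),
    funext (rcoef_synth hℓ hs), ← dmat_apply]
  exact ((recL ℓ p).map_neg _).symm

/-- The space ℙ_n is invariant under the Hilbert transform. Equality holds almost everywhere, since
`hilbert` is a chosen representative, and that suffices under the integral in `discreteG`. -/
lemma hilbert_rec (hℓ : 0 < ℓ) (a : Coef p) : hilbert (recon ℓ a) =ᵐ[volume] recon ℓ ((-I) • a) := by
  refine ae_eq_of_rcoef_eq hℓ (memLp_hilbert (memLp_rec hℓ a)) (memLp_rec hℓ _) fun k => ?_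
  rw [rcoef_hilbert hℓ (memLp_rec hℓ a), rcoef_rec hℓ, rcoef_rec hℓ, ext_csmul]

end discrete

end Benjamin
end

noncomputable section

namespace Benjamin

open scoped ComplexConjugate
open Complex (I)

/-! ### Quadrature, interpolation and the semi-discrete system -/

section quadrature

variable {ℓ : ℝ} {p : ℕ}

/-- The angles of the nodes. -/
def angle (p : ℕ) (i : Fin (2 * p)) : ℝ := Real.pi * (2 * ((i : ℕ) : ℝ) + 1 - 2 * p) / (2 * p)

lemma node_eq (ℓ : ℝ) (p : ℕ) (i : Fin (2 * p)) : node ℓ p i = lineOfAngle ℓ (angle p i) := by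
  rw [node, lineOfAngle, angle]
  congr 2
  ring

lemma angle_mem (i : Fin (2 * p)) : angle p i ∈ Ioo (-Real.pi) Real.pi := by
  have hi := i.2
  have hp : 0 < p := by omega
  have hp' : (0 : ℝ) < p := by exact_mod_cast hp
  have h1 : ((i : ℕ) : ℝ) + 1 ≤ 2 * p := by exact_mod_cast hi
  have h0 : (0 : ℝ) ≤ (i : ℕ) := Nat.cast_nonneg _
  have hpi := Real.pi_pos
  rw [angle, mem_Ioo, lt_div_iff₀ (by positivity), div_lt_iff₀ (by positivity)]
  constructor <;> nlinarith

lemma cayley_node (hℓ : 0 < ℓ) (i : Fin (2 * p)) :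
    cayley ℓ (node ℓ p i) = Complex.exp (angle p i * I) := by
  rw [node_eq]
  refine cayley_lineOfAngle hℓ (Real.cos_pos_of_mem_Ioo ?_).ne'
  have := angle_mem i
  constructor <;> linarith [this.1, this.2]

/-- The quadrature weights. -/
def qweight (ℓ : ℝ) (p : ℕ) (i : Fin (2 * p)) : ℝ :=
  Real.pi / p * ((ℓ ^ 2 + 4 * node ℓ p i ^ 2) / (4 * ℓ))

lemma qweight_nonneg (hℓ : 0 < ℓ) (i : Fin (2 * p)) : 0 ≤ qweight ℓ p i := by
  unfold qweight
  have := Real.pi_pos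
  positivity

lemma qweight_mul_norm_psi_sq (hℓ : 0 < ℓ) (i : Fin (2 * p)) (k : ℤ) :
    qweight ℓ p i * ‖psi ℓ k (node ℓ p i)‖ ^ 2 = 1 / (2 * p) := by
  have hp : 0 < p := by have := i.2; omega
  have hp' : (p : ℝ) ≠ 0 := by exact_mod_cast hp.ne'
  have h1 : ℓ ^ 2 + 4 * node ℓ p i ^ 2 ≠ 0 := by positivity
  rw [norm_psi_sq hℓ, qweight]
  field_simp
  norm_num

/-- The nodes are the 2p-th roots of unity turned by half a step, so this is a geometric sum whose
ratio is not 1 because 2p does not divide m. -/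
lemma sum_exp_angle (m : ℤ) (h0 : m ≠ 0) (hm : |m| < 2 * p) :
    ∑ i : Fin (2 * p), Complex.exp (angle p i * I) ^ m = 0 := by
  have hp : 0 < p := by
    by_contra h
    have : p = 0 := by omega
    subst this
    simp at hm
    exact absurd hm (not_lt.2 (abs_nonneg m))
  have hpc : (p : ℂ) ≠ 0 := by exact_mod_cast hp.ne'
  set ζ := Complex.exp (2 * Real.pi * I * (m / (2 * p))) with hζ
  have e : ∀ i : Fin (2 * p), Complex.exp (angle p i * I) ^ m
      = Complex.exp (Real.pi * (1 - 2 * p) / (2 * p) * I * m) * ζ ^ (i : ℕ) := fun i => by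
    rw [← Complex.exp_int_mul, hζ, ← Complex.exp_nat_mul, ← Complex.exp_add, angle]
    congr 1
    push_cast
    field_simp
    ring
  have h1 : ζ ≠ 1 := by
    rw [hζ, Ne, Complex.exp_eq_one_iff]
    rintro ⟨n, hn⟩
    have h2 : (2 * Real.pi * I : ℂ) ≠ 0 := Complex.two_pi_I_ne_zero
    have h3 : (m / (2 * p) : ℂ) = n := by
      refine mul_left_cancel₀ h2 ?_
      rw [hn]; ring
    rw [div_eq_iff (mul_ne_zero two_ne_zero hpc)] at h3
    have h4 : m = n * (2 * p) := by exact_mod_cast h3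
    have h5 : n ≠ 0 := by rintro rfl; simp at h4; exact h0 h4
    have h6 : 1 ≤ |n| := Int.one_le_abs h5
    rw [h4, abs_mul, abs_of_nonneg (by positivity : (0 : ℤ) ≤ 2 * p)] at hm
    nlinarith
  have h2 : ζ ^ (2 * p) = 1 := by
    rw [hζ, ← Complex.exp_nat_mul, Complex.exp_eq_one_iff]
    refine ⟨m, ?_⟩
    push_cast
    field_simp
  simp only [e]
  rw [← Finset.mul_sum, ← Finset.sum_range (fun i => ζ ^ i), geom_sum_eq h1, h2]
  simp

/-- The quadrature rule is exact on products of basis functions. -/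
lemma sum_qweight_psi (hℓ : 0 < ℓ) (j k : ℤ) (h : |j - k| < 2 * p) :
    ∑ i : Fin (2 * p), (qweight ℓ p i : ℂ) * (psi ℓ j (node ℓ p i) * conj (psi ℓ k (node ℓ p i)))
      = if j = k then 1 else 0 := by
  have key : ∀ i : Fin (2 * p), (qweight ℓ p i : ℂ) *
      (psi ℓ j (node ℓ p i) * conj (psi ℓ k (node ℓ p i)))
      = 1 / (2 * p) * Complex.exp (angle p i * I) ^ (j - k) := fun i => by
    have h1 : psi ℓ j (node ℓ p i) = cayley ℓ (node ℓ p i) ^ (j - k) * psi ℓ k (node ℓ p i) := by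
      rw [psi, psi, ← mul_div_assoc]
      congr 1
      rw [mul_left_comm, ← zpow_add₀ (cayley_ne_zero hℓ _)]
      congr 2
      ring
    have h2 := qweight_mul_norm_psi_sq hℓ i k
    rw [h1, mul_assoc, Complex.mul_conj', cayley_node hℓ, mul_left_comm, mul_comm]
    congr 1
    have : ((qweight ℓ p i * ‖psi ℓ k (node ℓ p i)‖ ^ 2 : ℝ) : ℂ) = ((1 / (2 * p) : ℝ) : ℂ) := by
      rw [h2]
    push_cast at this
    exact this
  simp only [key]
  rw [← Finset.mul_sum]
  split_ifs with hjk
  · have hp : (p : ℂ) ≠ 0 := by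
      have : p ≠ 0 := by rintro rfl; simp [hjk] at h
      exact_mod_cast this
    subst hjk
    simp
    field_simp
  · rw [sum_exp_angle _ (sub_ne_zero.2 hjk) h, mul_zero]

/-- Evaluation at the nodes. -/
def ev (ℓ : ℝ) (p : ℕ) : Coef p →ₗ[ℝ] (Fin (2 * p) → ℝ) where
  toFun a i := recon ℓ a (node ℓ p i)
  map_add' a b := funext fun _ => rec_add a b _
  map_smul' c a := funext fun _ => rec_smul c a _

lemma ev_apply (a : Coef p) (i : Fin (2 * p)) : ev ℓ p a i = recon ℓ a (node ℓ p i) := rfl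

/-- The coefficients of the interpolant of given nodal values. -/
def ic (ℓ : ℝ) (p : ℕ) : (Fin (2 * p) → ℝ) →ₗ[ℝ] Coef p where
  toFun y := tr p fun k => ∑ i, (qweight ℓ p i : ℂ) * (y i * conj (psi ℓ k (node ℓ p i)))
  map_add' y z := by
    ext k
    simp only [tr_apply, PiLp.add_apply, Pi.add_apply, Complex.ofReal_add, add_mul, mul_add,
      Finset.sum_add_distrib]
  map_smul' c y := by
    ext k
    simp only [tr_apply, PiLp.smul_apply, Pi.smul_apply, smul_eq_mul, Complex.ofReal_mul,
      RingHom.id_apply, Complex.real_smul, Finset.mul_sum]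
    exact Finset.sum_congr rfl fun i _ => by ring

lemma ext_ic (y : Fin (2 * p) → ℝ) {k : ℕ} (hk : k < p) :
    ext (ic ℓ p y) k = ∑ i, (qweight ℓ p i : ℂ) * (y i * conj (psi ℓ k (node ℓ p i))) :=
  ext_tr_of_lt (fun k => ∑ i, (qweight ℓ p i : ℂ) * (y i * conj (psi ℓ k (node ℓ p i)))) hk

lemma rec_eq_add_conj (a : Coef p) (x : ℝ) : (recon ℓ a x : ℂ)
    = ∑ k ∈ Finset.range p, ext a k * psi ℓ k x + conj (∑ k ∈ Finset.range p, ext a k * psi ℓ k x) := by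
  rw [Complex.add_conj, rec_eq_sum]

/-- A real function of ℙ_n has indices from -p to p-1. Any two of them differ by less than 2p, so
the quadrature is exact and recovers the coefficients. -/
lemma ic_ev (hℓ : 0 < ℓ) (a : Coef p) : ic ℓ p (ev ℓ p a) = a := by
  rw [← tr_ext (ic ℓ p (ev ℓ p a)), ← tr_ext a, tr_ext a]
  refine tr_congr (b := ext a) (fun k hk => ?_) |>.trans (tr_ext a)
  rw [ext_ic _ hk]
  simp only [ev_apply, rec_eq_add_conj, map_sum, map_mul, add_mul, mul_add, Finset.sum_mul,
    Finset.mul_sum, Finset.sum_add_distrib]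
  rw [Finset.sum_comm, Finset.sum_comm (s := Finset.univ)]
  have h1 : ∀ j ∈ Finset.range p, ∑ i : Fin (2 * p), (qweight ℓ p i : ℂ) *
      (ext a j * psi ℓ j (node ℓ p i) * conj (psi ℓ k (node ℓ p i)))
      = ext a j * if (j : ℤ) = k then 1 else 0 := fun j hj => by
    have hj' := Finset.mem_range.1 hj
    rw [← sum_qweight_psi hℓ (p := p) j k (by rw [abs_lt]; constructor <;> omega), Finset.mul_sum]
    exact Finset.sum_congr rfl fun i _ => by ring
  have h2 : ∀ j ∈ Finset.range p, ∑ i : Fin (2 * p), (qweight ℓ p i : ℂ) *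
      (conj (ext a j) * conj (psi ℓ j (node ℓ p i)) * conj (psi ℓ k (node ℓ p i))) = 0 := fun j hj => by
    have hj' := Finset.mem_range.1 hj
    have := sum_qweight_psi hℓ (p := p) (-j - 1) k (by rw [abs_lt]; constructor <;> omega)
    rw [if_neg (by omega)] at this
    rw [← mul_zero (conj (ext a j)), ← this, Finset.mul_sum]
    exact Finset.sum_congr rfl fun i _ => by rw [conj_psi hℓ j]; ring
  rw [Finset.sum_congr rfl h1, Finset.sum_congr rfl h2]
  simp [hk]

/-- Evaluation is injective by `ic_ev`, and both spaces have real dimension 2p; hence every nodal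
vector is attained. -/
lemma ev_ic (hℓ : 0 < ℓ) (y : Fin (2 * p) → ℝ) : ev ℓ p (ic ℓ p y) = y := by
  have hinj : Function.Injective (ev ℓ p) := fun a b h => by
    rw [← ic_ev hℓ a, ← ic_ev hℓ b, h]
  have hdim : Module.finrank ℝ (Coef p) = Module.finrank ℝ (Fin (2 * p) → ℝ) := by
    rw [Module.finrank_fin_fun, ← Module.finrank_mul_finrank ℝ ℂ (Coef p),
      finrank_euclideanSpace_fin, Complex.finrank_real_complex]
  obtain ⟨a, rfl⟩ := (LinearMap.injective_iff_surjective_of_finrank_eq_finrank hdim).1 hinj y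
  rw [ic_ev hℓ]

lemma inner_ic (y : Fin (2 * p) → ℝ) (z : Coef p) :
    2 * inner ℝ (ic ℓ p y) z = ∑ i, qweight ℓ p i * (y i * ev ℓ p z i) := by
  have e : ∑ k ∈ Finset.range p, conj (ext (ic ℓ p y) k) * ext z k
      = ∑ i, ((qweight ℓ p i * y i : ℝ) : ℂ) *
        ∑ k ∈ Finset.range p, ext z k * psi ℓ k (node ℓ p i) := by
    simp only [Finset.mul_sum]
    rw [Finset.sum_comm]
    refine Finset.sum_congr rfl fun k hk => ?_
    rw [ext_ic _ (Finset.mem_range.1 hk), map_sum, Finset.sum_mul]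
    refine Finset.sum_congr rfl fun i _ => ?_
    simp only [map_mul, Complex.conj_ofReal, Complex.conj_conj]
    push_cast
    ring
  rw [inner_eq_sum, e, Complex.re_sum, Finset.mul_sum]
  refine Finset.sum_congr rfl fun i _ => ?_
  rw [Complex.re_ofReal_mul, ev_apply, rec_eq_sum]
  ring

lemma norm_ic_sq (hℓ : 0 < ℓ) (y : Fin (2 * p) → ℝ) :
    2 * ‖ic ℓ p y‖ ^ 2 = ∑ i, qweight ℓ p i * y i ^ 2 := by
  rw [← real_inner_self_eq_norm_sq, inner_ic, ev_ic hℓ]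
  exact Finset.sum_congr rfl fun i _ => by ring

/-- The pointwise product at the nodes. -/
def bmul (ℓ : ℝ) (p : ℕ) : Coef p →ₗ[ℝ] Coef p →ₗ[ℝ] Coef p :=
  LinearMap.mk₂ ℝ (fun a b => ic ℓ p (ev ℓ p a * ev ℓ p b))
    (fun a b c => by rw [map_add, add_mul, map_add])
    (fun r a b => by rw [map_smul, smul_mul_assoc, map_smul])
    (fun a b c => by rw [map_add, mul_add, map_add])
    (fun r a b => by rw [map_smul, mul_smul_comm, map_smul])

lemma bmul_apply (a b : Coef p) : bmul ℓ p a b = ic ℓ p (ev ℓ p a * ev ℓ p b) := rfl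

/-- At the nodes B(a, ·) is multiplication by the values of a, and the norm of coefficients is the
weighted norm of nodal values. This bound does not deteriorate with p and is applied to the
truncated solution. -/
lemma norm_bmul_le (hℓ : 0 < ℓ) (a b : Coef p) {A : ℝ} (hA : 0 ≤ A) (h : ∀ i, |ev ℓ p a i| ≤ A) :
    ‖bmul ℓ p a b‖ ≤ A * ‖b‖ := by
  have h1 := norm_ic_sq hℓ (ev ℓ p a * ev ℓ p b)
  have h2 := norm_ic_sq hℓ (ev ℓ p b)
  rw [ic_ev hℓ] at h2
  have h3 : ‖bmul ℓ p a b‖ ^ 2 ≤ (A * ‖b‖) ^ 2 := by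
    have : ∑ i, qweight ℓ p i * (ev ℓ p a * ev ℓ p b) i ^ 2
        ≤ A ^ 2 * ∑ i, qweight ℓ p i * ev ℓ p b i ^ 2 := by
      rw [Finset.mul_sum]
      refine Finset.sum_le_sum fun i _ => ?_
      have h4 : ev ℓ p a i ^ 2 ≤ A ^ 2 := by
        rw [← sq_abs]; exact pow_le_pow_left₀ (abs_nonneg _) (h i) 2
      have h5 := mul_le_mul_of_nonneg_right h4
        (mul_nonneg (qweight_nonneg hℓ i) (sq_nonneg (ev ℓ p b i)))
      rw [Pi.mul_apply]
      linarith
    rw [bmul_apply, mul_pow]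
    rw [← h1, ← h2] at this
    linarith
  exact (pow_le_pow_iff_left₀ (norm_nonneg _) (by positivity) two_ne_zero).1 h3

/-- Cauchy–Schwarz over p modes. The resulting √p in the bound of B on arbitrary arguments
determines the radius in which the nonlinear term of the error is harmless. -/
lemma abs_rec_le (hℓ : 0 < ℓ) (a : Coef p) (x : ℝ) :
    |recon ℓ a x| ≤ 2 * (psiConst ℓ / ℓ) * Real.sqrt p * ‖a‖ := by
  have h1 : ‖∑ k ∈ Finset.range p, ext a k * psi ℓ k x‖ ≤ psiConst ℓ / ℓ * (Real.sqrt p * ‖a‖) := by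
    calc _ ≤ ∑ k ∈ Finset.range p, ‖ext a k * psi ℓ k x‖ := norm_sum_le _ _
      _ ≤ ∑ k ∈ Finset.range p, psiConst ℓ / ℓ * (1 * ‖ext a k‖) := by
        refine Finset.sum_le_sum fun k _ => ?_
        rw [norm_mul, mul_comm, one_mul]
        exact mul_le_mul_of_nonneg_right (norm_psi_le hℓ k x) (norm_nonneg _)
      _ = psiConst ℓ / ℓ * ∑ k ∈ Finset.range p, 1 * ‖ext a k‖ := by rw [Finset.mul_sum]
      _ ≤ _ := by
        have := Real.sum_mul_le_sqrt_mul_sqrt (Finset.range p) (fun _ => 1) fun k => ‖ext a k‖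
        rw [← norm_sq_eq_sum, Real.sqrt_sq (norm_nonneg _)] at this
        simp only [one_pow, Finset.sum_const, Finset.card_range, nsmul_eq_mul, mul_one] at this
        have h0 := (psiConst_pos hℓ).le
        gcongr
  rw [rec_eq_sum, abs_mul, abs_two]
  have := (Complex.abs_re_le_norm (∑ k ∈ Finset.range p, ext a k * psi ℓ k x)).trans h1
  linarith

lemma norm_bmul_le_mul (hℓ : 0 < ℓ) (a b : Coef p) :
    ‖bmul ℓ p a b‖ ≤ 2 * (psiConst ℓ / ℓ) * Real.sqrt p * ‖a‖ * ‖b‖ :=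
  norm_bmul_le hℓ a b (by have := (psiConst_pos hℓ).le; positivity) fun i => abs_rec_le hℓ a _

lemma inner_bmul (a b c : Coef p) :
    2 * inner ℝ (bmul ℓ p a b) c = ∑ i, qweight ℓ p i * (ev ℓ p a i * ev ℓ p b i * ev ℓ p c i) := by
  rw [bmul_apply, inner_ic]
  rfl

/-- The semi-discrete Hamiltonian system. -/
def hamSystem (hℓ : 0 < ℓ) (p : ℕ) : HamSystem (Coef p) where
  D := LinearMap.toContinuousLinearMap (dmat ℓ p)
  K := LinearMap.toContinuousLinearMap
    (((-I) • (LinearMap.id : Coef p →ₗ[ℂ] Coef p)).restrictScalars ℝ ∘ₗ dmat ℓ p)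
  B := LinearMap.mkContinuous₂ (bmul ℓ p) (2 * (psiConst ℓ / ℓ) * Real.sqrt p)
    (norm_bmul_le_mul hℓ)
  skew := inner_dmat
  symm x y := by
    have key : ∀ x y : Coef p, inner ℝ ((-I) • x) y = -inner ℝ x ((-I) • y) := fun x y => by
      simp only [inner_eq_sum, ext_csmul, ← Complex.neg_re, ← Finset.sum_neg_distrib]
      congr 1
      refine Finset.sum_congr rfl fun k _ => ?_
      simp only [map_mul, map_neg, Complex.conj_I]
      ring
    -- The discrete derivative is complex linear and commutes with the Hilbert transform -i; the
    -- product of two commuting skew operators is symmetric.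
    have key2 : ∀ y : Coef p, dmat ℓ p ((-I) • y) = (-I) • dmat ℓ p y := fun y => by
      ext k
      simp only [dmat_apply, tr_apply, dseq, ext_csmul, PiLp.smul_apply, smul_eq_mul]
      ring
    change inner ℝ ((-I) • dmat ℓ p x) y = inner ℝ x ((-I) • dmat ℓ p y)
    rw [key, inner_dmat, neg_neg, key2]
  norm_K_le x := by
    change ‖(-I) • dmat ℓ p x‖ ≤ ‖dmat ℓ p x‖
    rw [norm_smul]
    simp
  B_comm x y := by
    change bmul ℓ p x y = bmul ℓ p y x
    rw [bmul_apply, bmul_apply, mul_comm (ev ℓ p x)]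
  B_symm x y z := by
    change inner ℝ (bmul ℓ p x y) z = inner ℝ (bmul ℓ p x z) y
    have h1 := inner_bmul (ℓ := ℓ) x y z
    have h2 := inner_bmul (ℓ := ℓ) x z y
    have : ∑ i, qweight ℓ p i * (ev ℓ p x i * ev ℓ p y i * ev ℓ p z i)
        = ∑ i, qweight ℓ p i * (ev ℓ p x i * ev ℓ p z i * ev ℓ p y i) :=
      Finset.sum_congr rfl fun i _ => by ring
    linarith

lemma hamSystem_D (hℓ : 0 < ℓ) (a : Coef p) : (hamSystem hℓ p).D a = dmat ℓ p a := rfl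
lemma hamSystem_K (hℓ : 0 < ℓ) (a : Coef p) : (hamSystem hℓ p).K a = (-I) • dmat ℓ p a := rfl
lemma hamSystem_B (hℓ : 0 < ℓ) (a b : Coef p) : (hamSystem hℓ p).B a b = bmul ℓ p a b := rfl

/-- The choice in `interp` is harmless: an interpolant exists by `ev_ic` and is unique by `ic_ev`.
-/
lemma interp_eq (hℓ : 0 < ℓ) (f : ℝ → ℝ) :
    interp ℓ p f = recon ℓ (ic ℓ p fun i => f (node ℓ p i)) := by
  have h : ∃ g : ℝ → ℝ, g ∈ mtcSpace ℓ p ∧ ∀ i : Fin (2 * p), g (node ℓ p i) = f (node ℓ p i) :=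
    ⟨recon ℓ (ic ℓ p fun i => f (node ℓ p i)), (mem_mtcSpace_iff hℓ _).2 ⟨_, rfl⟩, fun i =>
      congr_fun (ev_ic hℓ fun i => f (node ℓ p i)) i⟩
  obtain ⟨h1, h2⟩ := Classical.epsilon_spec h
  change interp ℓ p f ∈ _ at h1
  change ∀ i, interp ℓ p f (node ℓ p i) = _ at h2
  obtain ⟨a, ha⟩ := (mem_mtcSpace_iff hℓ _).1 h1
  rw [ha] at h2 ⊢
  have : ev ℓ p a = fun i => f (node ℓ p i) := funext h2
  rw [← this, ic_ev hℓ]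

/-- With 𝒥_n = -D and the Hilbert transform -i, the term -β w H[𝒥_n w] becomes +β w K w. The
discrete Hamiltonian is then the relative energy at the base point 0, so a single derivative
computation serves both. -/
lemma discreteG_rec (hℓ : 0 < ℓ) (α β γ δ : ℝ) (a : Coef p) :
    discreteG ℓ p α β γ δ (recon ℓ a) = 2 * (hamSystem hℓ p).rel α β γ δ 0 a := by
  have e1 : interp ℓ p (fun y => recon ℓ a y ^ 2) = recon ℓ (bmul ℓ p a a) := by
    rw [interp_eq hℓ, bmul_apply]
    congr 2
    ext i
    rw [Pi.mul_apply, ev_apply, sq]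
  have e2 := hilbert_rec hℓ (-dmat ℓ p a)
  have hK : (-I) • -dmat ℓ p a = -(hamSystem hℓ p).K a := by rw [hamSystem_K, smul_neg]
  rw [hK] at e2
  have i := integrable_rec_mul (p := p) hℓ
  rw [discreteG, discreteJ_rec hℓ, e1]
  have e3 : ∫ x, (α * recon ℓ a x ^ 2 - β * recon ℓ a x * hilbert (recon ℓ (-dmat ℓ p a)) x
      + γ * recon ℓ (-dmat ℓ p a) x ^ 2 + 2 * δ / 3 * recon ℓ a x * recon ℓ (bmul ℓ p a a) x)
      = ∫ x, (α * (recon ℓ a x * recon ℓ a x) - β * (recon ℓ a x * recon ℓ (-(hamSystem hℓ p).K a) x)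
      + γ * (recon ℓ (-dmat ℓ p a) x * recon ℓ (-dmat ℓ p a) x)
      + 2 * δ / 3 * (recon ℓ a x * recon ℓ (bmul ℓ p a a) x)) := by
    refine integral_congr_ae ?_
    filter_upwards [e2] with x hx
    rw [hx]
    ring
  rw [e3, integral_add, integral_add, integral_sub, integral_const_mul, integral_const_mul,
    integral_const_mul, integral_const_mul, innerL2_rec hℓ, innerL2_rec hℓ, innerL2_rec hℓ,
    innerL2_rec hℓ, HamSystem.rel, HamSystem.inner_lin_self, hamSystem_B, hamSystem_B, hamSystem_D]
  · rw [inner_neg_right, inner_neg_left, inner_neg_right, real_inner_self_eq_norm_sq,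
      real_inner_self_eq_norm_sq, real_inner_comm a ((hamSystem hℓ p).K a),
      real_inner_comm a (bmul ℓ p a a)]
    simp only [map_zero, LinearMap.zero_apply, inner_zero_left]
    ring
  · exact (i _ _).const_mul _
  · exact (i _ _).const_mul _
  · exact ((i _ _).const_mul _).sub ((i _ _).const_mul _)
  · exact (i _ _).const_mul _
  · exact (((i _ _).const_mul _).sub ((i _ _).const_mul _)).add ((i _ _).const_mul _)
  · exact (i _ _).const_mul _

/-- Both the Hamiltonian and the inner product of L² carry the factor 2 relative to coefficients, so
the factors cancel and the L² gradient is `grad`. -/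
lemma isGradientAt_iff (hℓ : 0 < ℓ) (α β γ δ : ℝ) (a : Coef p) (g : ℝ → ℝ) :
    IsGradientAt ℓ p (discreteG ℓ p α β γ δ) (recon ℓ a) g
      ↔ g = recon ℓ ((hamSystem hℓ p).grad α β γ δ a) := by
  set S := hamSystem hℓ p with hS
  have hd : ∀ b : Coef p, HasDerivAt (fun τ : ℝ => discreteG ℓ p α β γ δ (recon ℓ a + τ • recon ℓ b))
      (2 * inner ℝ (S.grad α β γ δ a) b) 0 := fun b => by
    have e : ∀ τ : ℝ, recon ℓ a + τ • recon ℓ b = recon ℓ (a + τ • b) := fun τ => by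
      ext x
      rw [rec_add, rec_smul]
      rfl
    simp only [e, discreteG_rec hℓ]
    have h1 : HasDerivWithinAt (fun τ : ℝ => a + τ • b) b univ 0 := by
      have := ((hasDerivAt_id (0 : ℝ)).smul_const b).const_add a
      simpa using this.hasDerivWithinAt (s := univ)
    have h2 := S.hasDerivWithinAt_rel α β γ δ (hasDerivWithinAt_const (0 : ℝ) univ (0 : Coef p)) h1
    rw [hasDerivWithinAt_univ] at h2
    refine (h2.const_mul 2).congr_deriv ?_
    have : S.incr α β γ δ 0 a = S.grad α β γ δ a := by
      have h3 := S.grad_sub α β γ δ 0 a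
      rw [← h3, zero_add]
      simp [HamSystem.grad]
    simp [this]
  constructor
  · rintro ⟨h1, h2⟩
    obtain ⟨c, rfl⟩ := (mem_mtcSpace_iff hℓ _).1 h1
    congr 1
    refine ext_inner_right ℝ fun b => ?_
    have h3 := (h2 (recon ℓ b) ((mem_mtcSpace_iff hℓ _).2 ⟨b, rfl⟩)).unique (hd b)
    rw [innerL2, innerL2_rec hℓ] at h3
    linarith
  · rintro rfl
    refine ⟨(mem_mtcSpace_iff hℓ _).2 ⟨_, rfl⟩, fun z hz => ?_⟩
    obtain ⟨b, rfl⟩ := (mem_mtcSpace_iff hℓ _).1 hz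
    rw [innerL2, innerL2_rec hℓ]
    exact hd b

/-- The collocation scheme as an ordinary differential equation for coefficients. -/
lemma IsCollocationSolution.exists_coef (hℓ : 0 < ℓ) {α β γ δ T : ℝ} {u₀ : ℝ → ℝ}
    {ubar : ℝ → ℝ → ℝ} (hT : 0 ≤ T) (h : IsCollocationSolution ℓ p α β γ δ T u₀ ubar) :
    ∃ a : ℝ → Coef p, (∀ t ∈ Icc 0 T, ubar t = recon ℓ (a t)) ∧
      a 0 = ic ℓ p (fun i => u₀ (node ℓ p i)) ∧
      ∀ t ∈ Icc 0 T, HasDerivWithinAt a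
        (-(hamSystem hℓ p).D ((hamSystem hℓ p).grad α β γ δ (a t))) (Icc 0 T) t := by
  set a : ℝ → Coef p := fun t => ic ℓ p fun i => ubar t (node ℓ p i) with ha
  have h1 : ∀ t ∈ Icc 0 T, ubar t = recon ℓ (a t) := fun t ht => by
    obtain ⟨b, hb⟩ := (mem_mtcSpace_iff hℓ _).1 (h.mem t ht)
    have : (fun i => ubar t (node ℓ p i)) = ev ℓ p b := by rw [hb]; rfl
    rw [ha]
    simp only
    rw [this, ic_ev hℓ, hb]
  have h0 : (0 : ℝ) ∈ Icc 0 T := ⟨le_rfl, hT⟩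
  refine ⟨a, h1, ?_, fun t ht => ?_⟩
  · have := h1 0 h0
    rw [h.initial, interp_eq hℓ] at this
    have e := congr_arg (fun f : ℝ → ℝ => ic ℓ p fun i => f (node ℓ p i)) this
    have e2 : ∀ b : Coef p, ic ℓ p (fun i => recon ℓ b (node ℓ p i)) = b := ic_ev hℓ
    rw [e2, e2] at e
    exact e.symm
  · obtain ⟨g, hg, hd⟩ := h.equation t ht
    rw [h1 t ht, isGradientAt_iff hℓ] at hg
    rw [hg, discreteJ_rec hℓ] at hd
    have h2 : HasDerivWithinAt (fun τ (i : Fin (2 * p)) => ubar τ (node ℓ p i))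
        (ev ℓ p (-dmat ℓ p ((hamSystem hℓ p).grad α β γ δ (a t)))) (Icc 0 T) t :=
      hasDerivWithinAt_pi.2 fun i => hd (node ℓ p i)
    have h3 := (LinearMap.toContinuousLinearMap (ic ℓ p)).hasFDerivAt.comp_hasDerivWithinAt t h2
    refine h3.congr_deriv ?_
    exact ic_ev hℓ _

lemma isCollocationSolution_of_coef (hℓ : 0 < ℓ) {α β γ δ T : ℝ} {u₀ : ℝ → ℝ} {a : ℝ → Coef p}
    (h0 : a 0 = ic ℓ p (fun i => u₀ (node ℓ p i)))
    (h : ∀ t ∈ Icc 0 T, HasDerivWithinAt a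
        (-(hamSystem hℓ p).D ((hamSystem hℓ p).grad α β γ δ (a t))) (Icc 0 T) t) :
    IsCollocationSolution ℓ p α β γ δ T u₀ fun t => recon ℓ (a t) := by
  refine ⟨fun t _ => (mem_mtcSpace_iff hℓ _).2 ⟨_, rfl⟩, by rw [h0, interp_eq hℓ], fun t ht =>
    ⟨_, (isGradientAt_iff hℓ α β γ δ (a t) _).2 rfl, fun x => ?_⟩⟩
  rw [discreteJ_rec hℓ]
  have h3 := (LinearMap.toContinuousLinearMap
    ((LinearMap.proj x : (ℝ → ℝ) →ₗ[ℝ] ℝ) ∘ₗ recL ℓ p)).hasFDerivAt.comp_hasDerivWithinAt t (h t ht)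
  exact h3

end quadrature

end Benjamin
end

noncomputable section

namespace Benjamin

open scoped ComplexConjugate
open Complex (I)

/-! ### The equation in terms of coefficients -/

section weak

variable {ℓ : ℝ}

/-- The derivative of a basis function. -/
def dpsi (ℓ : ℝ) (k : ℤ) (x : ℝ) : ℂ :=
  I / ℓ * ((2 * k + 1) * psi ℓ k x + (k + 1) * psi ℓ (k + 1) x + k * psi ℓ (k - 1) x)

lemma hasDerivAt_conj_psi (hℓ : 0 < ℓ) (k : ℤ) (x : ℝ) :
    HasDerivAt (fun y => conj (psi ℓ k y)) (conj (dpsi ℓ k x)) x :=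
  Complex.conjCLE.toContinuousLinearMap.hasFDerivAt.comp_hasDerivAt x (hasDerivAt_psi hℓ k x)

lemma conj_dpsi (k : ℤ) (x : ℝ) : conj (dpsi ℓ k x) = -(I / ℓ) * ((2 * k + 1) * conj (psi ℓ k x)
    + (k + 1) * conj (psi ℓ (k + 1) x) + k * conj (psi ℓ (k - 1) x)) := by
  simp only [dpsi, map_mul, map_add, map_div₀, Complex.conj_I, Complex.conj_ofReal, map_intCast,
    map_one, Complex.conj_ofNat]
  ring

lemma continuous_conj_dpsi (hℓ : 0 < ℓ) (k : ℤ) : Continuous fun x => conj (dpsi ℓ k x) := by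
  have h : Continuous (dpsi ℓ k) := by
    have := continuous_psi hℓ k
    have := continuous_psi hℓ (k + 1)
    have := continuous_psi hℓ (k - 1)
    unfold dpsi
    fun_prop
  exact Complex.continuous_conj.comp h

lemma memLp_conj_dpsi (hℓ : 0 < ℓ) (k : ℤ) : MemLp (fun x => conj (dpsi ℓ k x)) 2 volume := by
  simp only [conj_dpsi]
  exact ((((memLp_conj_psi hℓ k).const_mul _).add ((memLp_conj_psi hℓ (k + 1)).const_mul _)).add
    ((memLp_conj_psi hℓ (k - 1)).const_mul _)).const_mul _

/-- The derivative groups into sums ψ_j + ψ_{j+1}, each a multiple of ψ_0 ψ_j by `psi_mul_psi`;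
hence it decays quadratically. -/
lemma exists_norm_dpsi_le (hℓ : 0 < ℓ) (k : ℤ) :
    ∃ C, 0 ≤ C ∧ ∀ x, ‖conj (dpsi ℓ k x)‖ ≤ C * (1 + x ^ 2)⁻¹ := by
  obtain ⟨C, hC, h⟩ := exists_norm_psi_le_rpow hℓ
  have hc := psiConst_pos hℓ
  have key : ∀ (j : ℤ) (x : ℝ), ‖psi ℓ j x + psi ℓ (j + 1) x‖ ≤ 2 * ℓ / psiConst ℓ * (C ^ 2 * (1 + x ^ 2)⁻¹) := by
    intro j x
    have h1 := psi_mul_psi hℓ 0 j x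
    rw [zero_add] at h1
    have h2 : psi ℓ j x + psi ℓ (j + 1) x
        = ((2 * ℓ / psiConst ℓ : ℝ) : ℂ) * (psi ℓ 0 x * psi ℓ j x) := by
      rw [h1, ← mul_assoc, ← Complex.ofReal_mul]
      have : 2 * ℓ / psiConst ℓ * (psiConst ℓ / (2 * ℓ)) = 1 := by field_simp
      rw [this]
      simp
    rw [h2, norm_mul, Complex.norm_real, Real.norm_of_nonneg (by positivity), norm_mul]
    refine mul_le_mul_of_nonneg_left ?_ (by positivity)
    have e : C ^ 2 * (1 + x ^ 2)⁻¹
        = (C * (1 + x ^ 2) ^ (-(1 / 2 : ℝ))) * (C * (1 + x ^ 2) ^ (-(1 / 2 : ℝ))) := by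
      rw [mul_mul_mul_comm, ← Real.rpow_add (by positivity), ← Real.rpow_neg_one, sq]
      norm_num
    rw [e]
    gcongr
    · exact h 0 x
    · exact h j x
  refine ⟨‖I / (ℓ : ℂ)‖ * ((‖((k : ℂ) + 1)‖ + ‖(k : ℂ)‖) * (2 * ℓ / psiConst ℓ * C ^ 2)), by positivity,
    fun x => ?_⟩
  have e : dpsi ℓ k x = I / ℓ * ((k + 1) * (psi ℓ k x + psi ℓ (k + 1) x)
      + k * (psi ℓ (k - 1) x + psi ℓ (k - 1 + 1) x)) := by
    rw [dpsi, sub_add_cancel]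
    ring
  rw [RCLike.norm_conj, e, norm_mul, mul_assoc]
  gcongr
  refine (norm_add_le _ _).trans ?_
  rw [norm_mul, norm_mul, mul_assoc, add_mul]
  have h1 := mul_le_mul_of_nonneg_left (key k x) (norm_nonneg ((k : ℂ) + 1))
  have h2 := mul_le_mul_of_nonneg_left (key (k - 1) x) (norm_nonneg (k : ℂ))
  rw [← mul_assoc (2 * ℓ / psiConst ℓ)] at h1 h2
  linarith

lemma integral_lincomb {f g h : ℝ → ℂ} (hf : Integrable f) (hg : Integrable g)
    (hh : Integrable h) (a b c d : ℂ) :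
    ∫ x, a * (b * f x + c * g x + d * h x) = a * (b * ∫ x, f x) + a * (c * ∫ x, g x)
      + a * (d * ∫ x, h x) := by
  have h1 : Integrable fun x => b * f x + c * g x := (hf.const_mul b).add (hg.const_mul c)
  rw [integral_const_mul, integral_add h1 (hh.const_mul d),
    integral_add (hf.const_mul b) (hg.const_mul c), integral_const_mul, integral_const_mul,
    integral_const_mul]
  ring

lemma integral_mul_conj_dpsi (hℓ : 0 < ℓ) {f : ℝ → ℝ} (hf : MemLp f 2 volume) (k : ℕ) :
    ∫ x, (f x : ℂ) * conj (dpsi ℓ k x) = -dseq ℓ (rcoef ℓ f) k := by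
  have i : ∀ j : ℤ, Integrable fun x => (f x : ℂ) * conj (psi ℓ j x) :=
    integrable_mul_conj_psi hℓ hf.ofReal
  have e : ∀ x, (f x : ℂ) * conj (dpsi ℓ k x) = -(I / ℓ) * ((2 * k + 1) * ((f x : ℂ) * conj (psi ℓ k x))
      + (k + 1) * ((f x : ℂ) * conj (psi ℓ (k + 1) x)) + k * ((f x : ℂ) * conj (psi ℓ (k - 1) x))) := by
    intro x
    rw [conj_dpsi]
    push_cast
    ring
  simp only [e]
  rw [integral_lincomb (i _) (i _) (i _), dseq]
  have h1 : ∫ x, (f x : ℂ) * conj (psi ℓ k x) = rcoef ℓ f k := rfl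
  have h2 : ∫ x, (f x : ℂ) * conj (psi ℓ (k + 1) x) = rcoef ℓ f (k + 1) := by
    rw [rcoef, coef]; push_cast; rfl
  -- For k = 0 the integral has index -1 and the sequence index 0; they differ, but both are
  -- multiplied by zero.
  have h3 : (k : ℂ) * ∫ x, (f x : ℂ) * conj (psi ℓ (k - 1) x) = k * rcoef ℓ f (k - 1) := by
    rcases k with _ | k
    · simp
    · rw [rcoef, coef]
      simp
  rw [h1, h2, h3]
  ring

lemma rcoef_deriv (hℓ : 0 < ℓ) {f f' : ℝ → ℝ} (hd : ∀ x, HasDerivAt f (f' x) x)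
    (hf : MemLp f 2 volume) (hf' : MemLp f' 2 volume) (k : ℕ) :
    rcoef ℓ f' k = dseq ℓ (rcoef ℓ f) k := by
  have h := integral_mul_deriv_eq_deriv_mul_of_integrable
    (u := fun x => (f x : ℂ)) (u' := fun x => (f' x : ℂ))
    (v := fun x => conj (psi ℓ k x)) (v' := fun x => conj (dpsi ℓ k x))
    (fun x _ => (hd x).ofReal_comp) (fun x _ => hasDerivAt_conj_psi hℓ k x)
    (hf.ofReal.integrable_mul (memLp_conj_dpsi hℓ k)) (integrable_mul_conj_psi hℓ hf'.ofReal k)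
    (integrable_mul_conj_psi hℓ hf.ofReal k)
  rw [integral_mul_conj_dpsi hℓ hf] at h
  exact (neg_injective h).symm

/-- A function with square integrable derivative grows at most like `|x|^{1/2}`. -/
lemma exists_abs_le_of_hasDerivAt {n v : ℝ → ℝ} (hd : ∀ x, HasDerivAt n (v x) x)
    (hv : MemLp v 2 volume) : ∃ C, 0 ≤ C ∧ ∀ x, |n x| ≤ C * (1 + x ^ 2) ^ (1 / 4 : ℝ) := by
  have hi : ∀ a b, IntervalIntegrable v volume a b := fun a b =>
    intervalIntegrable_iff.2 ((hv.locallyIntegrable one_le_two).integrableOn_isCompact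
      isCompact_uIcc |>.mono_set uIoc_subset_uIcc)
  have hsq : Integrable fun x => v x ^ 2 := hv.integrable_sq
  set V := ∫ x, v x ^ 2 with hV
  have hV0 : 0 ≤ V := integral_nonneg fun x => sq_nonneg _
  refine ⟨|n 0| + 1 + V, by positivity, fun x => ?_⟩
  set y := (1 + x ^ 2 : ℝ) ^ (1 / 4 : ℝ) with hy
  have hy1 : 1 ≤ y := Real.one_le_rpow (by nlinarith [sq_nonneg x]) (by norm_num)
  have hy2 : |x| ≤ y * y := by
    rw [hy, ← Real.rpow_add (by positivity)]
    norm_num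
    rw [← Real.sqrt_eq_rpow]
    exact Real.abs_le_sqrt (by linarith)
  have h1 : n x = n 0 + ∫ s in (0 : ℝ)..x, v s := by
    rw [intervalIntegral.integral_eq_sub_of_hasDerivAt (fun s _ => hd s) (hi 0 x)]
    ring
  have h2 : |∫ s in (0 : ℝ)..x, v s| ≤ |∫ s in (0 : ℝ)..x, (y⁻¹ + y * v s ^ 2)| := by
    rw [← Real.norm_eq_abs]
    refine intervalIntegral.norm_integral_le_abs_of_norm_le (ae_of_all _ fun s => ?_) ?_
    · rw [Real.norm_eq_abs]
      have h0 : 0 < y := by linarith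
      -- Young's inequality with y = (1 + x²)^{1/4} in place of Cauchy–Schwarz: after integration
      -- the first term is at most |x|/y ≤ y and the second at most y times ∫ v².
      have h3 : |v s| * 2 ≤ y⁻¹ + y * v s ^ 2 := by
        have : 0 ≤ y * (|v s| - y⁻¹) ^ 2 := by positivity
        have e : y * (|v s| - y⁻¹) ^ 2 = y * v s ^ 2 - 2 * |v s| + y⁻¹ := by
          rw [← sq_abs (v s)]
          field_simp
          ring
        linarith
      linarith [abs_nonneg (v s)]
    · exact intervalIntegrable_const.add (hsq.intervalIntegrable.const_mul y)
  have h3 : |∫ s in (0 : ℝ)..x, (y⁻¹ + y * v s ^ 2)| ≤ y + y * V := by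
    rw [intervalIntegral.integral_add intervalIntegrable_const (hsq.intervalIntegrable.const_mul y),
      intervalIntegral.integral_const, intervalIntegral.integral_const_mul]
    refine (abs_add_le _ _).trans (add_le_add ?_ ?_)
    · have h0 : 0 < y := by linarith
      rw [sub_zero, smul_eq_mul, abs_mul, abs_of_pos (inv_pos.2 h0), ← div_eq_mul_inv,
        div_le_iff₀ h0]
      exact hy2
    · rw [abs_mul, abs_of_nonneg (by linarith : 0 ≤ y)]
      refine mul_le_mul_of_nonneg_left ?_ (by linarith)
      rw [← Real.norm_eq_abs]
      refine (intervalIntegral.norm_integral_le_integral_norm_uIoc).trans ?_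
      have : ∀ s, ‖v s ^ 2‖ = v s ^ 2 := fun s => Real.norm_of_nonneg (sq_nonneg _)
      simp only [this]
      exact setIntegral_le_integral hsq (ae_of_all _ fun s => sq_nonneg _)
  rw [h1]
  refine (abs_add_le _ _).trans ?_
  have := h2.trans h3
  nlinarith [abs_nonneg (n 0)]

lemma tendsto_rpow_one_add_sq : Tendsto (fun x : ℝ => (1 + x ^ 2 : ℝ) ^ (-(1 / 4 : ℝ))) (atBot ⊔ atTop) (𝓝 0) := by
  have h := tendsto_rpow_neg_atTop (y := 1 / 4) (by norm_num)
  have h2 : Tendsto (fun x : ℝ => (1 + x ^ 2 : ℝ)) (atBot ⊔ atTop) atTop := by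
    refine tendsto_atTop_add_const_left _ _ ?_
    rw [tendsto_sup]
    constructor
    · have := (tendsto_pow_atTop (α := ℝ) two_ne_zero).comp tendsto_neg_atBot_atTop
      refine this.congr fun x => ?_
      simp
    · exact tendsto_pow_atTop two_ne_zero
  exact h.comp h2

/-- The bracket of the equation is not assumed square integrable. Growth like |x|^{1/2} is
nevertheless beaten by ψ_k at infinity and, in the integral, by the quadratic decay of its
derivative. -/
lemma rcoef_of_hasDerivAt_neg (hℓ : 0 < ℓ) {n v : ℝ → ℝ} (hd : ∀ x, HasDerivAt n (-v x) x)
    (hv : MemLp v 2 volume) (k : ℕ) :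
    Integrable (fun x => (n x : ℂ) * conj (dpsi ℓ k x)) ∧
      rcoef ℓ v k = ∫ x, (n x : ℂ) * conj (dpsi ℓ k x) := by
  obtain ⟨C, hC, hn⟩ := exists_abs_le_of_hasDerivAt hd hv.neg
  obtain ⟨C₁, hC₁, hpsi⟩ := exists_norm_psi_le_rpow hℓ
  obtain ⟨C₂, hC₂, hdpsi⟩ := exists_norm_dpsi_le hℓ k
  have hcont : Continuous n := continuous_iff_continuousAt.2 fun x => (hd x).continuousAt
  have hint : Integrable fun x => (n x : ℂ) * conj (dpsi ℓ k x) := by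
    have h1 := integrable_rpow_neg_one_add_norm_sq (E := ℝ) (μ := volume) (r := 3 / 2)
      (by norm_num)
    refine (h1.const_mul (C * C₂)).mono' ((Complex.continuous_ofReal.comp hcont).mul
      (continuous_conj_dpsi hℓ k)).aestronglyMeasurable (ae_of_all _ fun x => ?_)
    rw [norm_mul, Complex.norm_real, Real.norm_eq_abs, Real.norm_eq_abs, sq_abs]
    calc _ ≤ (C * (1 + x ^ 2) ^ (1 / 4 : ℝ)) * (C₂ * (1 + x ^ 2)⁻¹) := by
          gcongr
          · exact hn x
          · exact hdpsi x
      _ = C * C₂ * ((1 + x ^ 2) ^ (1 / 4 : ℝ) * (1 + x ^ 2) ^ (-1 : ℝ)) := by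
          rw [Real.rpow_neg_one]; ring
      _ = _ := by
          rw [← Real.rpow_add (by positivity)]
          norm_num
  have hlim : Tendsto ((fun x => (n x : ℂ)) * fun x => conj (psi ℓ k x)) (atBot ⊔ atTop) (𝓝 0) := by
    rw [tendsto_zero_iff_norm_tendsto_zero]
    refine squeeze_zero (fun _ => norm_nonneg _) (fun x => ?_)
      (by simpa using tendsto_rpow_one_add_sq.const_mul (C * C₁))
    rw [Pi.mul_apply, norm_mul, Complex.norm_real, Real.norm_eq_abs, RCLike.norm_conj]
    calc _ ≤ (C * (1 + x ^ 2) ^ (1 / 4 : ℝ)) * (C₁ * (1 + x ^ 2) ^ (-(1 / 2) : ℝ)) := by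
          gcongr
          · exact hn x
          · exact hpsi k x
      _ = C * C₁ * ((1 + x ^ 2) ^ (1 / 4 : ℝ) * (1 + x ^ 2) ^ (-(1 / 2) : ℝ)) := by ring
      _ = _ := by
          rw [← Real.rpow_add (by positivity)]
          norm_num
  have h := integral_mul_deriv_eq_deriv_mul
    (u := fun x => (n x : ℂ)) (u' := fun x => ((-v x : ℝ) : ℂ))
    (v := fun x => conj (psi ℓ k x)) (v' := fun x => conj (dpsi ℓ k x))
    (fun x _ => (hd x).ofReal_comp) (fun x _ => hasDerivAt_conj_psi hℓ k x)
    hint (integrable_mul_conj_psi hℓ hv.neg.ofReal k) (hlim.mono_left le_sup_left)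
    (hlim.mono_left le_sup_right)
  refine ⟨hint, ?_⟩
  rw [h, rcoef, coef]
  simp only [Complex.ofReal_neg, neg_mul, integral_neg]
  simp

/-- The coefficients of the bracket in the equation. -/
def fluxSeq (ℓ α β γ δ : ℝ) (a q : ℕ → ℂ) (k : ℕ) : ℂ :=
  α * a k - I * β * dseq ℓ a k - γ * dseq ℓ (dseq ℓ a) k + δ * q k

lemma dseq_congr_add (a b : ℕ → ℂ) (c d : ℂ) (k : ℕ) :
    dseq ℓ (fun j => c * a j + d * b j) k = c * dseq ℓ a k + d * dseq ℓ b k := by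
  simp only [dseq]
  ring

/-- The equation in terms of coefficients. -/
lemma rcoef_eq_neg_dseq_flux (hℓ : 0 < ℓ) {α β γ δ : ℝ} {u v h : ℝ → ℝ} (hu : ContDiff ℝ 2 u)
    (hu2 : MemLp u 2 volume) (husq : MemLp (fun x => u x ^ 2) 2 volume)
    (hh : IsHilbertTransform (deriv u) h) (hv : MemLp v 2 volume)
    (heq : ∀ x, HasDerivAt (fun y => α * u y + β * h y - γ * deriv (deriv u) y + δ * u y ^ 2)
      (-(v x)) x) (k : ℕ) :
    rcoef ℓ v k = -dseq ℓ (fluxSeq ℓ α β γ δ (rcoef ℓ u) (rcoef ℓ fun x => u x ^ 2)) k := by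
  have hu' : MemLp (deriv u) 2 volume := hh.1
  have hhL : MemLp h 2 volume := (memLp_congr_ae hh.2).2 (memLp_hilbert hh.1)
  have hd1 : ∀ x, HasDerivAt u (deriv u x) x := fun x =>
    (hu.differentiable (by norm_num) x).hasDerivAt
  have hd2 : ∀ x, HasDerivAt (deriv u) (deriv (deriv u) x) x := fun x => by
    have : ContDiff ℝ 1 (deriv u) := (contDiff_succ_iff_deriv (n := 1)).1 hu |>.2.2
    exact (this.differentiable (by norm_num) x).hasDerivAt
  -- The square integrable part of the bracket. The term γ u'' is integrable against conj ψ_k' only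
  -- as the difference of g and the whole bracket, and a second integration by parts reduces it to
  -- u'.
  set g : ℝ → ℝ := fun x => α * u x + β * h x + δ * u x ^ 2 with hg
  have hgL : MemLp g 2 volume := ((hu2.const_mul α).add (hhL.const_mul β)).add (husq.const_mul δ)
  obtain ⟨hint, hE⟩ := rcoef_of_hasDerivAt_neg hℓ heq hv k
  have ig : Integrable fun x => (g x : ℂ) * conj (dpsi ℓ k x) :=
    hgL.ofReal.integrable_mul (memLp_conj_dpsi hℓ k)
  have i2 : Integrable fun x => ((γ * deriv (deriv u) x : ℝ) : ℂ) * conj (dpsi ℓ k x) := by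
    refine (ig.sub hint).congr (ae_of_all _ fun x => ?_)
    simp only [Pi.sub_apply, hg]
    push_cast
    ring
  have e1 : rcoef ℓ v k = (∫ x, (g x : ℂ) * conj (dpsi ℓ k x))
      - ∫ x, ((γ * deriv (deriv u) x : ℝ) : ℂ) * conj (dpsi ℓ k x) := by
    rw [hE, ← integral_sub ig i2]
    congr 1
    ext x
    simp only [hg]
    push_cast
    ring
  have hrd : ∀ j, rcoef ℓ (deriv u) j = dseq ℓ (rcoef ℓ u) j := rcoef_deriv hℓ hd1 hu2 hu'
  have e2 : ∫ x, ((γ * deriv (deriv u) x : ℝ) : ℂ) * conj (dpsi ℓ k x)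
      = -(γ * dseq ℓ (dseq ℓ (dseq ℓ (rcoef ℓ u))) k) := by
    rcases eq_or_ne γ 0 with h0 | h0
    · simp [h0]
    have hγc : (γ : ℂ) ≠ 0 := by exact_mod_cast h0
    have i3 : Integrable fun x => ((deriv (deriv u) x : ℝ) : ℂ) * conj (dpsi ℓ k x) := by
      refine (i2.const_mul (γ : ℂ)⁻¹).congr (ae_of_all _ fun x => ?_)
      push_cast
      field_simp
    set dd : ℝ → ℂ := fun x => -(I / ℓ) * ((2 * k + 1) * conj (dpsi ℓ k x)
      + (k + 1) * conj (dpsi ℓ (k + 1) x) + k * conj (dpsi ℓ (k - 1) x)) with hdd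
    have hddd : ∀ x, HasDerivAt (fun y => conj (dpsi ℓ k y)) (dd x) x := fun x => by
      simp only [conj_dpsi (ℓ := ℓ) (k : ℤ)]
      have := ((((hasDerivAt_conj_psi hℓ k x).const_mul (2 * (k : ℂ) + 1)).add
        ((hasDerivAt_conj_psi hℓ (k + 1) x).const_mul ((k : ℂ) + 1))).add
        ((hasDerivAt_conj_psi hℓ (k - 1) x).const_mul (k : ℂ))).const_mul (-(I / ℓ))
      push_cast
      exact this
    have j : ∀ m : ℤ, Integrable fun x => ((deriv u x : ℝ) : ℂ) * conj (dpsi ℓ m x) := fun m =>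
      hu'.ofReal.integrable_mul (memLp_conj_dpsi hℓ m)
    have esum : ∀ x, ((deriv u x : ℝ) : ℂ) * dd x = -(I / ℓ) *
        ((2 * k + 1) * (((deriv u x : ℝ) : ℂ) * conj (dpsi ℓ k x))
        + (k + 1) * (((deriv u x : ℝ) : ℂ) * conj (dpsi ℓ (k + 1) x))
        + k * (((deriv u x : ℝ) : ℂ) * conj (dpsi ℓ (k - 1) x))) := fun x => by
      rw [hdd]; ring
    have jsum := (((j k).const_mul (2 * (k : ℂ) + 1)).add ((j (k + 1)).const_mul ((k : ℂ) + 1)))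
    have jdd : Integrable fun x => ((deriv u x : ℝ) : ℂ) * dd x := by
      simp only [esum]
      exact (jsum.add ((j (k - 1)).const_mul (k : ℂ))).const_mul _
    have hb := integral_mul_deriv_eq_deriv_mul_of_integrable
      (u := fun x => ((deriv u x : ℝ) : ℂ)) (u' := fun x => ((deriv (deriv u) x : ℝ) : ℂ))
      (v := fun x => conj (dpsi ℓ k x)) (v' := dd)
      (fun x _ => (hd2 x).ofReal_comp) (fun x _ => hddd x) jdd i3 (j k)
    have e3 : ∫ x, ((deriv u x : ℝ) : ℂ) * dd x = dseq ℓ (dseq ℓ (dseq ℓ (rcoef ℓ u))) k := by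
      simp only [esum]
      rw [integral_lincomb (j _) (j _) (j _), integral_mul_conj_dpsi hℓ hu']
      have h1 : ∫ x, ((deriv u x : ℝ) : ℂ) * conj (dpsi ℓ (k + 1) x)
          = -dseq ℓ (rcoef ℓ (deriv u)) (k + 1) := by
        rw [← integral_mul_conj_dpsi hℓ hu']
        push_cast
        rfl
      have h2 : (k : ℂ) * ∫ x, ((deriv u x : ℝ) : ℂ) * conj (dpsi ℓ (k - 1) x)
          = k * -dseq ℓ (rcoef ℓ (deriv u)) (k - 1) := by
        rcases k with _ | k
        · simp
        · rw [Nat.add_sub_cancel, ← integral_mul_conj_dpsi hℓ hu']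
          simp
      rw [h1, h2, funext hrd, dseq.eq_1 ℓ (dseq ℓ (dseq ℓ (rcoef ℓ u)))]
      ring
    have e4 : ∫ x, ((γ * deriv (deriv u) x : ℝ) : ℂ) * conj (dpsi ℓ k x)
        = γ * ∫ x, ((deriv (deriv u) x : ℝ) : ℂ) * conj (dpsi ℓ k x) := by
      rw [← integral_const_mul]
      congr 1
      ext x
      push_cast
      ring
    rw [e4, ← neg_eq_iff_eq_neg.2 hb, e3]
    ring
  have hhc : ∀ j, rcoef ℓ h j = -I * dseq ℓ (rcoef ℓ u) j := fun j => by
    have : rcoef ℓ h j = rcoef ℓ (hilbert (deriv u)) j := by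
      refine coef_congr_ae ?_ j
      filter_upwards [hh.2] with x hx
      rw [hx]
    rw [this, rcoef_hilbert hℓ hu', hrd]
  have hgc : ∀ j, rcoef ℓ g j = α * rcoef ℓ u j - I * β * dseq ℓ (rcoef ℓ u) j
      + δ * rcoef ℓ (fun x => u x ^ 2) j := fun j => by
    have h0 : MemLp (fun x => α * u x + β * h x) 2 volume :=
      (hu2.const_mul α).add (hhL.const_mul β)
    have h1 := rcoef_add hℓ h0 (husq.const_mul δ) j
    have h2 := rcoef_add hℓ (hu2.const_mul α) (hhL.const_mul β) j
    rw [rcoef_const_mul, rcoef_const_mul, hhc] at h2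
    rw [rcoef_const_mul] at h1
    rw [hg, h1, h2]
    ring
  rw [e1, e2, integral_mul_conj_dpsi hℓ hgL, funext hgc]
  simp only [dseq, fluxSeq]
  ring

end weak

end Benjamin
end

noncomputable section

namespace Benjamin

open scoped ComplexConjugate
open Complex (I)

/-! ### Decreasing sequences -/

section decreasing

/-- The sequence `a` has norm at most `W` in the weighted space of order `s`. -/
def HS (s W : ℝ) (a : ℕ → ℂ) : Prop :=
  ∀ K : ℕ, ∑ k ∈ Finset.range K, (1 + k : ℝ) ^ (2 * s) * ‖a k‖ ^ 2 ≤ W ^ 2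

variable {s W : ℝ} {a : ℕ → ℂ}

lemma HS.sum_le (h : HS s W a) (F : Finset ℕ) :
    ∑ k ∈ F, (1 + k : ℝ) ^ (2 * s) * ‖a k‖ ^ 2 ≤ W ^ 2 := by
  obtain ⟨K, hK⟩ := F.exists_nat_subset_range
  exact (Finset.sum_le_sum_of_subset_of_nonneg hK fun k _ _ => by positivity).trans (h K)

lemma HS.sum_sq_le (h : HS s W a) (hs : 0 ≤ s) {K : ℕ} {F : Finset ℕ} (hF : ∀ k ∈ F, K ≤ k) :
    ∑ k ∈ F, ‖a k‖ ^ 2 ≤ ((1 + K : ℝ) ^ (-s) * W) ^ 2 := by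
  have h1 : ∀ k ∈ F, ‖a k‖ ^ 2 ≤ (1 + K : ℝ) ^ (-(2 * s)) * ((1 + k : ℝ) ^ (2 * s) * ‖a k‖ ^ 2) := by
    intro k hk
    have h2 : (1 + K : ℝ) ^ (2 * s) ≤ (1 + k : ℝ) ^ (2 * s) := by
      have : (K : ℝ) ≤ k := by exact_mod_cast hF k hk
      gcongr
    rw [Real.rpow_neg (by positivity), ← mul_assoc, inv_mul_eq_div]
    refine le_mul_of_one_le_left (sq_nonneg _) ?_
    rwa [one_le_div (by positivity)]
  refine (Finset.sum_le_sum h1).trans ?_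
  rw [← Finset.mul_sum, mul_pow]
  have e : ((1 + K : ℝ) ^ (-s)) ^ 2 = (1 + K : ℝ) ^ (-(2 * s)) := by
    rw [← Real.rpow_natCast, ← Real.rpow_mul (by positivity)]
    congr 1
    push_cast
    ring
  rw [e]
  exact mul_le_mul_of_nonneg_left (h.sum_le F) (by positivity)

/-- The constant in the embedding into summable sequences. -/
def embConst : ℝ := Real.sqrt (∑' k : ℕ, 1 / (k + 1 : ℝ) ^ 2)

lemma sum_inv_sq_le (F : Finset ℕ) : ∑ k ∈ F, ((1 + k : ℝ) ^ (-1 : ℝ)) ^ 2 ≤ embConst ^ 2 := by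
  have hs : Summable fun k : ℕ => 1 / (k + 1 : ℝ) ^ 2 := by
    have := (summable_nat_add_iff 1).2 (Real.summable_one_div_nat_pow.2 one_lt_two)
    simpa using this
  rw [embConst, Real.sq_sqrt (tsum_nonneg fun k => by positivity)]
  refine le_trans (le_of_eq ?_) (hs.sum_le_tsum F fun k _ => by positivity)
  refine Finset.sum_congr rfl fun k _ => ?_
  rw [Real.rpow_neg_one, inv_pow, one_div, add_comm]

lemma embConst_nonneg : 0 ≤ embConst := Real.sqrt_nonneg _

/-- Cauchy–Schwarz against the square summable sequence (1+k)^{-1}. One full power is lost where one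
half would be natural, but the residual loses one power anyway. -/
lemma HS.sum_norm_le (h : HS s W a) (hs : 1 ≤ s) (hW : 0 ≤ W) {K : ℕ} {F : Finset ℕ}
    (hF : ∀ k ∈ F, K ≤ k) :
    ∑ k ∈ F, ‖a k‖ ≤ embConst * ((1 + K : ℝ) ^ (1 - s) * W) := by
  have h1 : ∀ k ∈ F, ‖a k‖ ≤ (1 + K : ℝ) ^ (1 - s) *
      ((1 + k : ℝ) ^ (-1 : ℝ) * ((1 + k : ℝ) ^ s * ‖a k‖)) := by
    intro k hk
    have h2 : (1 + k : ℝ) ^ (1 - s) ≤ (1 + K : ℝ) ^ (1 - s) := by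
      have : (K : ℝ) ≤ k := by exact_mod_cast hF k hk
      exact Real.rpow_le_rpow_of_nonpos (by positivity) (by linarith) (by linarith)
    have e : ‖a k‖ = (1 + k : ℝ) ^ (1 - s) * ((1 + k : ℝ) ^ (-1 : ℝ) * ((1 + k : ℝ) ^ s * ‖a k‖)) := by
      rw [← mul_assoc, ← mul_assoc, ← Real.rpow_add (by positivity), ← Real.rpow_add (by positivity),
        show 1 - s + -1 + s = 0 by ring, Real.rpow_zero, one_mul]
    calc ‖a k‖ = _ := e
      _ ≤ _ := by gcongr
  refine (Finset.sum_le_sum h1).trans ?_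
  rw [← Finset.mul_sum, mul_left_comm]
  refine mul_le_mul_of_nonneg_left ?_ (by positivity)
  refine (Real.sum_mul_le_sqrt_mul_sqrt F _ _).trans ?_
  refine mul_le_mul ?_ ?_ (Real.sqrt_nonneg _) embConst_nonneg
  · exact Real.sqrt_le_iff.2 ⟨embConst_nonneg, sum_inv_sq_le F⟩
  · refine Real.sqrt_le_iff.2 ⟨hW, le_trans (le_of_eq ?_) (h.sum_le F)⟩
    refine Finset.sum_congr rfl fun k _ => ?_
    rw [mul_pow, ← Real.rpow_natCast ((1 + k : ℝ) ^ s), ← Real.rpow_mul (by positivity)]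
    congr 2
    push_cast
    ring

lemma HS.summable (h : HS s W a) (hs : 1 ≤ s) (hW : 0 ≤ W) : Summable fun k => ‖a k‖ :=
  summable_of_sum_le (fun _ => norm_nonneg _) fun F => h.sum_norm_le hs hW (K := 0) (F := F) (by simp)

lemma HS.tsum_le (h : HS s W a) (hs : 1 ≤ s) (hW : 0 ≤ W) : ∑' k, ‖a k‖ ≤ embConst * W := by
  refine (h.summable hs hW).tsum_le_of_sum_le fun F => ?_
  have := h.sum_norm_le hs hW (K := 0) (F := F) (by simp)
  simpa using this

end decreasing

/-! ### Regularity in time -/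

section time

variable {ℓ : ℝ}

/-- A function that is everywhere a derivative and almost everywhere equal to a continuous function
equals it everywhere: its primitive n is recovered from the continuous representative by the
fundamental theorem of calculus and differentiated again. -/
lemma eq_synth_of_hasDerivAt (hℓ : 0 < ℓ) {n v : ℝ → ℝ} (hd : ∀ x, HasDerivAt n (-v x) x)
    (hv : MemLp v 2 volume) (hs : Summable fun k => ‖rcoef ℓ v k‖) :
    v = synth ℓ (rcoef ℓ v) := by
  set V := synth ℓ (rcoef ℓ v) with hV
  have hVc : Continuous V := continuous_synth hℓ hs
  have hae : v =ᵐ[volume] V := ae_eq_synth_rcoef hℓ hv hs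
  have hi : ∀ a b, IntervalIntegrable v volume a b := fun a b =>
    intervalIntegrable_iff.2 ((hv.locallyIntegrable one_le_two).integrableOn_isCompact
      isCompact_uIcc |>.mono_set uIoc_subset_uIcc)
  have h1 : ∀ x, n x = n 0 - ∫ s in (0 : ℝ)..x, V s := fun x => by
    have h2 := intervalIntegral.integral_eq_sub_of_hasDerivAt (fun s _ => hd s) (hi 0 x).neg
    have h3 : ∫ s in (0 : ℝ)..x, v s = ∫ s in (0 : ℝ)..x, V s :=
      intervalIntegral.integral_congr_ae (hae.mono fun s hs _ => hs)
    simp only [intervalIntegral.integral_neg] at h2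
    linarith
  ext x
  have h2 : HasDerivAt n (-V x) x := by
    have h3 := (hVc.integral_hasStrictDerivAt 0 x).hasDerivAt.const_sub (n 0)
    exact h3.congr_of_eventuallyEq (Eventually.of_forall h1)
  exact neg_injective ((hd x).unique h2)

/-- No measurability of f' is assumed: in the interior it agrees with `deriv f`, which is always
measurable, so the fundamental theorem applies. -/
lemma abs_sub_le_of_ae_bound {f f' : ℝ → ℝ} {T L : ℝ}
    (hd : ∀ t ∈ Icc 0 T, HasDerivWithinAt f (f' t) (Icc 0 T) t)
    (hb : ∀ᵐ t ∂volume.restrict (Icc 0 T), |f' t| ≤ L) {a b : ℝ} (ha : a ∈ Icc 0 T)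
    (hb' : b ∈ Icc 0 T) : |f a - f b| ≤ L * |a - b| := by
  wlog hab : b ≤ a generalizing a b
  · rw [abs_sub_comm, abs_sub_comm a b]
    exact this hb' ha (le_of_not_ge hab)
  have hsub : Icc b a ⊆ Icc 0 T := Icc_subset_Icc hb'.1 ha.2
  have hda : ∀ t ∈ Ioo b a, HasDerivAt f (f' t) t := fun t ht =>
    (hd t (hsub (Ioo_subset_Icc_self ht))).hasDerivAt
      (Icc_mem_nhds (hb'.1.trans_lt ht.1) (ht.2.trans_le ha.2))
  have hbd : ∀ᵐ t ∂volume.restrict (Ioc b a), |f' t| ≤ L :=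
    ae_restrict_of_ae_restrict_of_subset (Ioc_subset_Icc_self.trans hsub) hb
  have hint : IntervalIntegrable f' volume b a := by
    rw [intervalIntegrable_iff_integrableOn_Ioc_of_le hab]
    refine Integrable.mono' (g := fun _ => L) (integrable_const L) ?_ hbd
    rw [← restrict_Ioo_eq_restrict_Ioc]
    refine (measurable_deriv f).aestronglyMeasurable.congr ?_
    filter_upwards [ae_restrict_mem measurableSet_Ioo] with t ht
    exact (hda t ht).deriv
  have h := intervalIntegral.integral_eq_sub_of_hasDeriv_right_of_le hab
    (fun t ht => ((hd t (hsub ht)).mono hsub).continuousWithinAt)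
    (fun t ht => (hda t ht).hasDerivWithinAt) hint
  rw [← h, ← Real.norm_eq_abs]
  refine intervalIntegral.norm_integral_le_of_norm_le_const_ae ?_
  rw [uIoc_of_le hab]
  exact (ae_restrict_iff' measurableSet_Ioc).1 hbd

/-- When F is continuous and equals the derivative almost everywhere, f is an integral of F, so F is
the derivative at every point, the end points included. -/
lemma hasDerivWithinAt_of_ae_eq {f f' F : ℝ → ℂ} {T : ℝ} (hT : 0 < T)
    (hc : ContinuousOn f (Icc 0 T)) (hd : ∀ t ∈ Ioo 0 T, HasDerivAt f (f' t) t)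
    (hae : ∀ᵐ t ∂volume.restrict (Icc 0 T), f' t = F t) (hF : ContinuousOn F (Icc 0 T)) {t : ℝ}
    (ht : t ∈ Icc 0 T) : HasDerivWithinAt f (F t) (Icc 0 T) t := by
  set G : ℝ → ℂ := IccExtend hT.le (domRestrict (Icc 0 T) F) with hG
  have hGc : Continuous G := (continuousOn_iff_continuous_domRestrict.1 hF).Icc_extend'
  have hGF : ∀ t ∈ Icc 0 T, G t = F t := fun t ht => by
    rw [hG, IccExtend_of_mem _ _ ht]; rfl
  have key : ∀ t ∈ Icc 0 T, f t = f 0 + ∫ s in (0 : ℝ)..t, G s := by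
    intro t ht
    have hsub : Icc 0 t ⊆ Icc 0 T := Icc_subset_Icc_right ht.2
    have hae' : ∀ᵐ s ∂volume.restrict (Ioc 0 t), f' s = G s := by
      have := ae_restrict_of_ae_restrict_of_subset (Ioc_subset_Icc_self.trans hsub) hae
      filter_upwards [this, ae_restrict_mem measurableSet_Ioc] with s h1 h2
      rw [h1, hGF s (hsub (Ioc_subset_Icc_self h2))]
    have hint : IntervalIntegrable f' volume 0 t := by
      rw [intervalIntegrable_iff_integrableOn_Ioc_of_le ht.1]
      have : IntegrableOn G (Ioc 0 t) volume :=
        (hGc.intervalIntegrable 0 t).1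
      exact this.congr (hae'.mono fun s hs => hs.symm)
    have h := intervalIntegral.integral_eq_sub_of_hasDeriv_right_of_le ht.1 (hc.mono hsub)
      (fun s hs => (hd s ⟨hs.1, hs.2.trans_le ht.2⟩).hasDerivWithinAt) hint
    have h2 : ∫ s in (0 : ℝ)..t, f' s = ∫ s in (0 : ℝ)..t, G s := by
      refine intervalIntegral.integral_congr_ae ?_
      rw [uIoc_of_le ht.1]
      exact (ae_restrict_iff' measurableSet_Ioc).1 hae'
    rw [← h2, h]
    ring
  have h1 : HasDerivAt (fun t => f 0 + ∫ s in (0 : ℝ)..t, G s) (G t) t :=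
    (hGc.integral_hasStrictDerivAt 0 t).hasDerivAt.const_add (f 0)
  rw [hGF t ht] at h1
  exact h1.hasDerivWithinAt.congr key (key t ht)

lemma forall_le_of_ae_le {f : ℝ → ℝ} {T c : ℝ} (hT : 0 < T) (hf : ContinuousOn f (Icc 0 T))
    (h : ∀ᵐ t ∂volume.restrict (Icc 0 T), f t ≤ c) {t : ℝ} (ht : t ∈ Icc 0 T) : f t ≤ c := by
  have h1 : (fun t => max (f t) c) =ᵐ[volume.restrict (Icc 0 T)] fun _ => c := by
    filter_upwards [h] with t ht
    exact max_eq_right ht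
  have h2 := Measure.eqOn_Icc_of_ae_eq volume hT.ne h1 (hf.sup continuousOn_const)
    continuousOn_const ht
  exact max_eq_right_iff.1 h2

/-- Time derivatives of the coefficients. -/
def vseq (ℓ α β γ δ : ℝ) (f : ℝ → ℝ) (k : ℕ) : ℂ :=
  -dseq ℓ (fluxSeq ℓ α β γ δ (rcoef ℓ f) (rcoef ℓ fun x => f x ^ 2)) k

/-- The properties of a solution that are used in the convergence proof. -/
structure IsCoefSolution (ℓ α β γ δ T s W : ℝ) (u : ℝ → ℝ → ℝ) : Prop where
  memLp : ∀ t ∈ Icc 0 T, MemLp (u t) 2 volume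
  cont : ∀ t ∈ Icc 0 T, Continuous (u t)
  hasDeriv : ∀ k, ∀ t ∈ Icc 0 T,
    HasDerivWithinAt (fun τ => rcoef ℓ (u τ) k) (vseq ℓ α β γ δ (u t) k) (Icc 0 T) t
  contDeriv : ∀ k, ContinuousOn (fun t => vseq ℓ α β γ δ (u t) k) (Icc 0 T)
  hs : ∀ t ∈ Icc 0 T, HS s W (rcoef ℓ (u t))
  hs' : ∀ t ∈ Icc 0 T, HS s W (vseq ℓ α β γ δ (u t))

/-- The norms control u and v only for almost every time. The coefficients of u_t are expressed
through those of u and u² by the equation, and these depend continuously on time, so every bound on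
finitely many coefficients extends to all times. -/
lemma isCoefSolution_of_classical (hℓ : 0 < ℓ) {α β γ δ T s W : ℝ} (hT : 0 < T) (hs : 1 ≤ s)
    (hW : 0 ≤ W) {u v : ℝ → ℝ → ℝ} (h : IsClassicalSolution α β γ δ T u v)
    (hgood : ∀ᵐ t ∂volume.restrict (Icc 0 T), MemLp (u t) 2 volume ∧ MemLp (v t) 2 volume ∧
      HS s W (rcoef ℓ (u t)) ∧ HS s W (rcoef ℓ (v t))) :
    IsCoefSolution ℓ α β γ δ T s W u ∧
      ∀ᵐ t ∂volume.restrict (Icc 0 T), ∀ k, vseq ℓ α β γ δ (u t) k = rcoef ℓ (v t) k := by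
  have hmem : ∀ᵐ t ∂volume.restrict (Icc 0 T), t ∈ Icc 0 T := ae_restrict_mem measurableSet_Icc
  set L := 2 * (embConst * W) with hL
  have hL0 : 0 ≤ L := by have := embConst_nonneg; positivity
  have hcont : ∀ t ∈ Icc 0 T, Continuous (u t) := fun t ht => (h.contDiff t ht).continuous
  -- The bound by |ψ_0(x)| rather than by a constant is essential: multiplied by another basis
  -- function it gives the integrable majorant |ψ_0|² for dominated convergence.
  have hsynth : ∀ {a : ℕ → ℂ}, HS s W a → ∀ x, |synth ℓ a x| ≤ L * ‖psi ℓ 0 x‖ := fun {a} ha x => by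
    refine (abs_synth_le hℓ (ha.summable hs hW) x).trans ?_
    have := ha.tsum_le hs hW
    rw [hL]
    gcongr
  have hvb : ∀ᵐ t ∂volume.restrict (Icc 0 T), ∀ x, |v t x| ≤ L * ‖psi ℓ 0 x‖ := by
    filter_upwards [hgood, hmem] with t ht htT x
    obtain ⟨g, _, heq⟩ := h.equation t htT
    rw [eq_synth_of_hasDerivAt hℓ heq ht.2.1 (ht.2.2.2.summable hs hW)]
    exact hsynth ht.2.2.2 x
  have hlip : ∀ x, ∀ a ∈ Icc 0 T, ∀ b ∈ Icc 0 T, |u a x - u b x| ≤ L * ‖psi ℓ 0 x‖ * |a - b| :=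
    fun x a ha b hb => abs_sub_le_of_ae_bound (fun t ht => h.time_deriv t ht x)
      (hvb.mono fun t ht => ht x) ha hb
  have hne : (ae (volume.restrict (Icc (0 : ℝ) T))).NeBot := by
    rw [ae_neBot, Ne, Measure.restrict_eq_zero, Real.volume_Icc]
    simpa using hT
  -- One good time bounds u; the Lipschitz estimate in time, with the same profile in x, carries the
  -- bound to all times.
  obtain ⟨t₀, ht₀, ht₀T⟩ := (hgood.and hmem).exists
  set A := L + L * T with hA
  have hub : ∀ t ∈ Icc 0 T, ∀ x, |u t x| ≤ A * ‖psi ℓ 0 x‖ := fun t ht x => by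
    have h1 : |u t₀ x| ≤ L * ‖psi ℓ 0 x‖ := by
      rw [eq_synth_rcoef hℓ (hcont t₀ ht₀T) ht₀.1 (ht₀.2.2.1.summable hs hW)]
      exact hsynth ht₀.2.2.1 x
    have h2 := hlip x t ht t₀ ht₀T
    have h3 : |t - t₀| ≤ T := by
      rw [abs_le]; constructor <;> linarith [ht.1, ht.2, ht₀T.1, ht₀T.2]
    have h4 : L * ‖psi ℓ 0 x‖ * |t - t₀| ≤ L * ‖psi ℓ 0 x‖ * T := by gcongr
    have h5 : |u t x| ≤ |u t₀ x| + |u t x - u t₀ x| := by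
      have := abs_add_le (u t₀ x) (u t x - u t₀ x)
      simpa using this
    rw [hA]
    linarith
  have hL2 : ∀ t ∈ Icc 0 T, MemLp (u t) 2 volume := fun t ht =>
    MemLp.of_le_mul (c := A) (memLp_psi hℓ 0) (hcont t ht).aestronglyMeasurable
      (ae_of_all _ fun x => hub t ht x)
  set P := psiConst ℓ / ℓ with hP
  have hP0 : 0 ≤ P := by have := (psiConst_pos hℓ).le; positivity
  have hA0 : 0 ≤ A := by positivity
  have hsqb : ∀ t ∈ Icc 0 T, ∀ x, |u t x ^ 2| ≤ A * A * P * ‖psi ℓ 0 x‖ := fun t ht x => by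
    rw [abs_pow, sq]
    calc |u t x| * |u t x| ≤ (A * ‖psi ℓ 0 x‖) * (A * P) := by
          refine mul_le_mul (hub t ht x) ((hub t ht x).trans ?_) (abs_nonneg _) (by positivity)
          gcongr
          exact norm_psi_le hℓ 0 x
      _ = _ := by ring
  have hsq : ∀ t ∈ Icc 0 T, MemLp (fun x => u t x ^ 2) 2 volume := fun t ht =>
    MemLp.of_le_mul (c := A * A * P) (memLp_psi hℓ 0) ((hcont t ht).pow 2).aestronglyMeasurable
      (ae_of_all _ fun x => hsqb t ht x)
  have hib : ∀ C : ℝ, Integrable fun x => C * ‖psi ℓ 0 x‖ ^ 2 := fun C =>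
    (integrable_norm_psi_sq hℓ 0).const_mul C
  have hut : ∀ x, ContinuousOn (fun t => u t x) (Icc 0 T) := fun x t ht =>
    (h.time_deriv t ht x).continuousWithinAt
  have hccont : ∀ k, ContinuousOn (fun t => rcoef ℓ (u t) k) (Icc 0 T) := fun k => by
    refine continuousOn_of_dominated (bound := fun x => A * ‖psi ℓ 0 x‖ ^ 2)
      (fun t ht => (integrable_mul_conj_psi hℓ (hL2 t ht).ofReal k).1)
      (fun t ht => ae_of_all _ fun x => ?_) (hib A) (ae_of_all _ fun x => ?_)
    · rw [norm_mul, RCLike.norm_conj, norm_psi_eq_zero_index hℓ, Complex.norm_real,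
        Real.norm_eq_abs, sq, ← mul_assoc]
      exact mul_le_mul_of_nonneg_right (hub t ht x) (norm_nonneg _)
    · exact (Complex.continuous_ofReal.comp_continuousOn (hut x)).mul continuousOn_const
  have hqcont : ∀ k, ContinuousOn (fun t => rcoef ℓ (fun x => u t x ^ 2) k) (Icc 0 T) := fun k => by
    refine continuousOn_of_dominated (bound := fun x => A * A * P * ‖psi ℓ 0 x‖ ^ 2)
      (fun t ht => (integrable_mul_conj_psi hℓ (hsq t ht).ofReal k).1)
      (fun t ht => ae_of_all _ fun x => ?_) (hib _) (ae_of_all _ fun x => ?_)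
    · rw [norm_mul, RCLike.norm_conj, norm_psi_eq_zero_index hℓ, Complex.norm_real,
        Real.norm_eq_abs, sq ‖psi ℓ 0 x‖, ← mul_assoc]
      exact mul_le_mul_of_nonneg_right (hsqb t ht x) (norm_nonneg _)
    · exact (Complex.continuous_ofReal.comp_continuousOn ((hut x).pow 2)).mul continuousOn_const
  have hvcont : ∀ k, ContinuousOn (fun t => vseq ℓ α β γ δ (u t) k) (Icc 0 T) := fun k => by
    unfold vseq
    simp only [dseq, fluxSeq]
    fun_prop
  have hweak : ∀ᵐ t ∂volume.restrict (Icc 0 T), ∀ k, vseq ℓ α β γ δ (u t) k = rcoef ℓ (v t) k := by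
    filter_upwards [hgood, hmem] with t ht htT k
    obtain ⟨g, hg, heq⟩ := h.equation t htT
    exact (rcoef_eq_neg_dseq_flux hℓ (h.contDiff t htT) (hL2 t htT) (hsq t htT) hg ht.2.1 heq k).symm
  have hderiv : ∀ k, ∀ t ∈ Ioo 0 T,
      HasDerivAt (fun τ => rcoef ℓ (u τ) k) (rcoef ℓ (v t) k) t := fun k t ht => by
    have htT := Ioo_subset_Icc_self ht
    have hnhds : Icc 0 T ∈ 𝓝 t := Icc_mem_nhds ht.1 ht.2
    refine (hasDerivAt_integral_of_dominated_loc_of_lip (𝕜 := ℝ) (μ := volume)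
      (F := fun τ x => (u τ x : ℂ) * conj (psi ℓ k x))
      (F' := fun x => (v t x : ℂ) * conj (psi ℓ k x))
      (bound := fun x => L * ‖psi ℓ 0 x‖ ^ 2) hnhds ?_
      (integrable_mul_conj_psi hℓ (hL2 t htT).ofReal k) ?_ (ae_of_all _ fun x => ?_) (hib L)
      (ae_of_all _ fun x => ?_)).2
    · filter_upwards [hnhds] with τ hτ
      exact (integrable_mul_conj_psi hℓ (hL2 τ hτ).ofReal k).1
    · obtain ⟨g, _, heq⟩ := h.equation t htT
      -- Measurability of v(t) in x comes from the equation, which presents it as a derivative.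
      have e : v t = fun x => -deriv (fun y => α * u t y + β * g y
          - γ * deriv (deriv (u t)) y + δ * (u t y) ^ 2) x := by
        ext x
        rw [(heq x).deriv, neg_neg]
      have hm : Measurable (v t) := by
        rw [e]
        exact (measurable_deriv _).neg
      exact (Complex.measurable_ofReal.comp hm).aestronglyMeasurable.mul
        (memLp_conj_psi hℓ k).1
    · refine LipschitzOnWith.of_dist_le_mul fun a ha b hb => ?_
      rw [dist_eq_norm, ← sub_mul, norm_mul, RCLike.norm_conj, norm_psi_eq_zero_index hℓ,
        ← Complex.ofReal_sub, Complex.norm_real, Real.norm_eq_abs, Real.coe_nnabs,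
        abs_of_nonneg (show 0 ≤ L * ‖psi ℓ 0 x‖ ^ 2 by positivity), Real.dist_eq]
      have := mul_le_mul_of_nonneg_right (hlip x a ha b hb) (norm_nonneg (psi ℓ 0 x))
      refine this.trans (le_of_eq ?_)
      ring
    · exact (((h.time_deriv t htT x).hasDerivAt hnhds).ofReal_comp).mul_const _
  refine ⟨⟨hL2, hcont, fun k t ht => ?_, hvcont, fun t ht K => ?_, fun t ht K => ?_⟩, hweak⟩
  · exact hasDerivWithinAt_of_ae_eq hT (hccont k) (hderiv k)
      (hweak.mono fun t ht => (ht k).symm) (hvcont k) ht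
  · refine forall_le_of_ae_le (f := fun t => ∑ k ∈ Finset.range K, (1 + k : ℝ) ^ (2 * s) *
      ‖rcoef ℓ (u t) k‖ ^ 2) hT ?_ (hgood.mono fun t ht => ht.2.2.1 K) ht
    exact continuousOn_finsetSum _ fun k _ => continuousOn_const.mul ((hccont k).norm.pow 2)
  · refine forall_le_of_ae_le (f := fun t => ∑ k ∈ Finset.range K, (1 + k : ℝ) ^ (2 * s) *
      ‖vseq ℓ α β γ δ (u t) k‖ ^ 2) hT ?_ ?_ ht
    · exact continuousOn_finsetSum _ fun k _ => continuousOn_const.mul ((hvcont k).norm.pow 2)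
    · filter_upwards [hgood, hweak] with t h1 h2
      simp only [h2]
      exact h1.2.2.2 K

end time

end Benjamin
end

noncomputable section

namespace Benjamin

open scoped ComplexConjugate
open Complex (I)

/-! ### Euclidean norms over windows of indices -/

section window

/-- The Euclidean norm of a sequence over a finite set of indices. -/
def nrm (F : Finset ℕ) (f : ℕ → ℝ) : ℝ := Real.sqrt (∑ k ∈ F, f k ^ 2)

variable {F G : Finset ℕ} {f g : ℕ → ℝ}

lemma nrm_nonneg (F : Finset ℕ) (f : ℕ → ℝ) : 0 ≤ nrm F f := Real.sqrt_nonneg _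

lemma nrm_sq (F : Finset ℕ) (f : ℕ → ℝ) : nrm F f ^ 2 = ∑ k ∈ F, f k ^ 2 :=
  Real.sq_sqrt (Finset.sum_nonneg fun _ _ => sq_nonneg _)

lemma nrm_le_of_sq_le {c : ℝ} (hc : 0 ≤ c) (h : ∑ k ∈ F, f k ^ 2 ≤ c ^ 2) : nrm F f ≤ c :=
  Real.sqrt_le_iff.2 ⟨hc, h⟩

lemma nrm_le_nrm (h0 : ∀ k ∈ F, 0 ≤ f k) (h : ∀ k ∈ F, f k ≤ g k) : nrm F f ≤ nrm F g :=
  Real.sqrt_le_sqrt (Finset.sum_le_sum fun k hk => pow_le_pow_left₀ (h0 k hk) (h k hk) 2)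

lemma nrm_add_le (F : Finset ℕ) (f g : ℕ → ℝ) : nrm F (fun k => f k + g k) ≤ nrm F f + nrm F g := by
  refine nrm_le_of_sq_le (add_nonneg (nrm_nonneg _ _) (nrm_nonneg _ _)) ?_
  have h := Real.sum_mul_le_sqrt_mul_sqrt F f g
  have e : ∑ k ∈ F, (f k + g k) ^ 2 = ∑ k ∈ F, f k ^ 2 + 2 * ∑ k ∈ F, f k * g k + ∑ k ∈ F, g k ^ 2 := by
    rw [Finset.mul_sum, ← Finset.sum_add_distrib, ← Finset.sum_add_distrib]
    exact Finset.sum_congr rfl fun k _ => by ring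
  rw [e, add_sq, nrm_sq, nrm_sq]
  unfold nrm
  linarith

lemma nrm_const_mul (F : Finset ℕ) {c : ℝ} (hc : 0 ≤ c) (f : ℕ → ℝ) :
    nrm F (fun k => c * f k) = c * nrm F f := by
  simp only [nrm, mul_pow, ← Finset.mul_sum]
  rw [Real.sqrt_mul (sq_nonneg c), Real.sqrt_sq hc]

lemma sum_mul_le_nrm (F : Finset ℕ) (f g : ℕ → ℝ) : ∑ k ∈ F, f k * g k ≤ nrm F f * nrm F g :=
  Real.sum_mul_le_sqrt_mul_sqrt F f g

lemma nrm_comp_le {σ : ℕ → ℕ} (hσ : Set.InjOn σ F) (h : ∀ k ∈ F, σ k ∈ G) (f : ℕ → ℝ) :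
    nrm F (fun k => f (σ k)) ≤ nrm G f := by
  refine Real.sqrt_le_sqrt ?_
  rw [← Finset.sum_image (f := fun k => f k ^ 2) hσ]
  refine Finset.sum_le_sum_of_subset_of_nonneg ?_ fun _ _ _ => sq_nonneg _
  intro j hj
  obtain ⟨k, hk, rfl⟩ := Finset.mem_image.1 hj
  exact h k hk

lemma nrm_mono (h : F ⊆ G) (f : ℕ → ℝ) : nrm F f ≤ nrm G f :=
  nrm_comp_le (σ := id) (injOn_id _) h f

lemma nrm_of_support (h : F ⊆ G) (h0 : ∀ k ∈ G, k ∉ F → f k = 0) : nrm G f = nrm F f := by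
  rw [nrm, nrm, Finset.sum_subset h fun k hk hk' => by rw [h0 k hk hk']; ring]

lemma nrm_add_one_le (h : ∀ k ∈ F, k + 1 ∈ G) (f : ℕ → ℝ) :
    nrm F (fun k => f (k + 1)) ≤ nrm G f :=
  nrm_comp_le (fun _ _ _ _ h => Nat.succ_injective h) h f

lemma nrm_sub_one_le (h1 : ∀ k ∈ F, 1 ≤ k) (h : ∀ k ∈ F, k - 1 ∈ G) (f : ℕ → ℝ) :
    nrm F (fun k => f (k - 1)) ≤ nrm G f :=
  nrm_comp_le (σ := fun k => k - 1) (fun a ha b hb hab => by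
    have := h1 a ha
    have := h1 b hb
    simp only at hab
    omega) h f

lemma HS.nrm_le {s W : ℝ} {a : ℕ → ℂ} (h : HS s W a) (hs : 0 ≤ s) (hW : 0 ≤ W) {K : ℕ}
    (hF : ∀ k ∈ F, K ≤ k) : nrm F (fun k => ‖a k‖) ≤ (1 + K : ℝ) ^ (-s) * W :=
  nrm_le_of_sq_le (by positivity) (h.sum_sq_le hs hF)

variable {ℓ : ℝ}

lemma norm_dseq_le (hℓ : 0 < ℓ) (a : ℕ → ℂ) (k : ℕ) :
    ‖dseq ℓ a k‖ ≤ 1 / ℓ * ((2 * k + 1) * ‖a k‖ + k * ‖a (k - 1)‖ + (k + 1) * ‖a (k + 1)‖) := by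
  rw [dseq, norm_mul, norm_div, Complex.norm_I, Complex.norm_real, Real.norm_of_nonneg hℓ.le]
  refine mul_le_mul_of_nonneg_left ?_ (by positivity)
  refine (norm_add₃_le).trans (le_of_eq ?_)
  rw [norm_mul, norm_mul, norm_mul]
  have e1 : ‖(2 * k + 1 : ℂ)‖ = 2 * k + 1 := by
    have : (2 * k + 1 : ℂ) = ((2 * k + 1 : ℕ) : ℂ) := by push_cast; ring
    rw [this, Complex.norm_natCast]; push_cast; ring
  have e2 : ‖(k + 1 : ℂ)‖ = k + 1 := by
    have : (k + 1 : ℂ) = ((k + 1 : ℕ) : ℂ) := by push_cast; ring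
    rw [this, Complex.norm_natCast]; push_cast; ring
  rw [e1, e2, Complex.norm_natCast]

/-- On indices below B the derivative costs at most 4B/ℓ and widens the window by one on each side.
-/
lemma nrm_dseq_le (hℓ : 0 < ℓ) {B : ℕ} (hB : ∀ k ∈ F, k + 1 ≤ B) (h0 : ∀ k ∈ F, k ∈ G)
    (h1 : ∀ k ∈ F, k + 1 ∈ G) (h2 : ∀ k ∈ F, k - 1 ∈ G) (a : ℕ → ℂ) :
    nrm F (fun k => ‖dseq ℓ a k‖) ≤ 4 * B / ℓ * nrm G fun k => ‖a k‖ := by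
  have hc : ∀ k ∈ F, ((k : ℝ) + 1) ≤ B := fun k hk => by exact_mod_cast hB k hk
  -- The shift k ↦ k - 1 on ℕ is injective only away from 0; at 0 its coefficient vanishes, so the
  -- term may be set to zero.
  set f : ℕ → ℝ := fun k => if k = 0 then 0 else ‖a (k - 1)‖ with hf
  have h3 : nrm F f ≤ nrm G fun k => ‖a k‖ := by
    rw [nrm_of_support (Finset.erase_subset 0 F) (f := f)]
    · refine le_trans (le_of_eq ?_) (nrm_sub_one_le (F := F.erase 0) (G := G) (fun k hk => ?_)
        (fun k hk => h2 k (Finset.mem_of_mem_erase hk)) fun k => ‖a k‖)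
      · unfold nrm
        congr 1
        refine Finset.sum_congr rfl fun k hk => ?_
        simp only [hf, if_neg (Finset.ne_of_mem_erase hk)]
      · have := Finset.ne_of_mem_erase hk
        omega
    · intro k hk hk'
      have : k = 0 := by
        by_contra h
        exact hk' (Finset.mem_erase.2 ⟨h, hk⟩)
      simp [hf, this]
  have h4 : nrm F (fun k => ‖dseq ℓ a k‖) ≤
      nrm F fun k => B / ℓ * (2 * ‖a k‖ + f k + ‖a (k + 1)‖) := by
    refine nrm_le_nrm (fun k _ => norm_nonneg _) fun k hk => (norm_dseq_le hℓ a k).trans ?_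
    rw [div_mul_eq_mul_div, div_mul_eq_mul_div, one_mul]
    refine div_le_div_of_nonneg_right ?_ hℓ.le
    have h5 : (k : ℝ) * ‖a (k - 1)‖ ≤ B * f k := by
      rcases eq_or_ne k 0 with h | h
      · simp [hf, h]
      · simp only [hf, if_neg h]
        have := hc k hk
        exact mul_le_mul_of_nonneg_right (by linarith) (norm_nonneg _)
    have := hc k hk
    have h6 : (2 * k + 1 : ℝ) * ‖a k‖ ≤ B * (2 * ‖a k‖) := by nlinarith [norm_nonneg (a k)]
    have h7 : (k + 1 : ℝ) * ‖a (k + 1)‖ ≤ B * ‖a (k + 1)‖ := by gcongr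
    linarith
  refine h4.trans ?_
  rw [nrm_const_mul _ (by positivity)]
  have h5 := nrm_add_le F (fun k => 2 * ‖a k‖ + f k) fun k => ‖a (k + 1)‖
  have h6 := nrm_add_le F (fun k => 2 * ‖a k‖) f
  rw [nrm_const_mul _ zero_le_two] at h6
  have h7 := nrm_mono h0 fun k => ‖a k‖
  have h8 := nrm_add_one_le h1 fun k => ‖a k‖
  have h9 : (4 * B / ℓ : ℝ) * nrm G (fun k => ‖a k‖) = B / ℓ * (4 * nrm G fun k => ‖a k‖) := by ring
  rw [h9]
  refine mul_le_mul_of_nonneg_left ?_ (by positivity)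
  linarith

end window

end Benjamin
end

noncomputable section

namespace Benjamin

open scoped ComplexConjugate
open Complex (I)

/-! ### Cutoff functions in the index -/

section cutoff

variable {m : ℕ}

/-- A tent function with support between `3m` and `5m`. -/
def tent (m k : ℕ) : ℝ := max 0 (m - |(k : ℝ) - 4 * m|)

lemma tent_nonneg (m k : ℕ) : 0 ≤ tent m k := le_max_left _ _

lemma tent_le (m k : ℕ) : tent m k ≤ m :=
  max_le (Nat.cast_nonneg m) (by linarith [abs_nonneg ((k : ℝ) - 4 * m)])

lemma tent_of_le {k : ℕ} (h : k ≤ 3 * m) : tent m k = 0 := by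
  have h' : (k : ℝ) ≤ 3 * m := by exact_mod_cast h
  refine max_eq_left ?_
  linarith [neg_abs_le ((k : ℝ) - 4 * m)]

lemma tent_of_ge {k : ℕ} (h : 5 * m ≤ k) : tent m k = 0 := by
  have h' : (5 * m : ℝ) ≤ k := by exact_mod_cast h
  refine max_eq_left ?_
  linarith [le_abs_self ((k : ℝ) - 4 * m)]

lemma abs_tent_succ_sub_le (m k : ℕ) : |tent m (k + 1) - tent m k| ≤ 1 := by
  unfold tent
  have h := abs_max_sub_max_le_max 0 ((m : ℝ) - |((k + 1 : ℕ) : ℝ) - 4 * m|) 0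
    ((m : ℝ) - |(k : ℝ) - 4 * m|)
  refine h.trans (max_le (by simp) ?_)
  have h1 := abs_abs_sub_abs_le_abs_sub ((k : ℝ) - 4 * m) (((k + 1 : ℕ) : ℝ) - 4 * m)
  have e : (k : ℝ) - 4 * m - (((k + 1 : ℕ) : ℝ) - 4 * m) = -1 := by push_cast; ring
  rw [e, abs_neg, abs_one] at h1
  refine le_trans (le_of_eq ?_) h1
  congr 1
  ring

/-- The normalizing constant. -/
def tentSum (m : ℕ) : ℝ := ∑ j ∈ Finset.range (5 * m), tent m j

/-- The left half of the tent is 0 + 1 + … + (m-1). Dividing the tent by its sum therefore gives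
heights of order 1/m and increments of order 1/m². -/
lemma sq_le_tentSum (hm : 2 ≤ m) : (m : ℝ) ^ 2 / 4 ≤ tentSum m := by
  have h1 : ∑ i ∈ Finset.range m, tent m (3 * m + i) ≤ tentSum m := by
    have : Finset.range (3 * m + m) ⊆ Finset.range (5 * m) :=
      Finset.range_subset_range.2 (by omega)
    refine le_trans ?_ (Finset.sum_le_sum_of_subset_of_nonneg this fun k _ _ => tent_nonneg m k)
    rw [Finset.sum_range_add]
    exact le_add_of_nonneg_left (Finset.sum_nonneg fun k _ => tent_nonneg m k)
  have h2 : ∑ i ∈ Finset.range m, tent m (3 * m + i) = ∑ i ∈ Finset.range m, (i : ℝ) := by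
    refine Finset.sum_congr rfl fun i hi => ?_
    have hi' : (i : ℝ) ≤ m := by exact_mod_cast (Finset.mem_range.1 hi).le
    have e : ((3 * m + i : ℕ) : ℝ) - 4 * m = -(m - i) := by push_cast; ring
    rw [tent, e, abs_neg, abs_of_nonneg (by linarith), sub_sub_cancel, max_eq_right (Nat.cast_nonneg i)]
  have h3 : (∑ i ∈ Finset.range m, (i : ℝ)) * 2 = m * (m - 1) := by
    have := Finset.sum_range_id_mul_two m
    have h4 : ((∑ i ∈ Finset.range m, i : ℕ) : ℝ) * 2 = ((m * (m - 1) : ℕ) : ℝ) := by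
      exact_mod_cast this
    rw [Nat.cast_sum, Nat.cast_mul, Nat.cast_sub (by omega)] at h4
    simpa using h4
  have h5 : (2 : ℝ) ≤ m := by exact_mod_cast hm
  nlinarith

/-- A cutoff function: `1` up to `3m`, `0` from `5m` on, with differences of order `1/m` and
second differences of order `1/m²`. -/
def chi (m k : ℕ) : ℝ := 1 - (∑ j ∈ Finset.range k, tent m j) / tentSum m

lemma tentSum_pos (hm : 2 ≤ m) : 0 < tentSum m := by
  have : (2 : ℝ) ≤ m := by exact_mod_cast hm
  exact lt_of_lt_of_le (by positivity) (sq_le_tentSum hm)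

lemma chi_succ_sub (m k : ℕ) : chi m (k + 1) - chi m k = -(tent m k / tentSum m) := by
  rw [chi, chi, Finset.sum_range_succ, add_div]
  ring

lemma chi_of_le {k : ℕ} (h : k ≤ 3 * m) : chi m k = 1 := by
  rw [chi, Finset.sum_eq_zero fun j hj => tent_of_le (by have := Finset.mem_range.1 hj; omega)]
  simp

lemma chi_of_ge (hm : 2 ≤ m) {k : ℕ} (h : 5 * m ≤ k) : chi m k = 0 := by
  have : ∑ j ∈ Finset.range k, tent m j = tentSum m := by
    refine (Finset.sum_subset (Finset.range_subset_range.2 h) fun j _ hj => tent_of_ge ?_).symm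
    simpa using hj
  rw [chi, this, div_self (tentSum_pos hm).ne', sub_self]

lemma chi_antitone (hm : 2 ≤ m) : Antitone (chi m) := by
  refine antitone_nat_of_succ_le fun k => ?_
  have := chi_succ_sub m k
  have h := div_nonneg (tent_nonneg m k) (tentSum_pos hm).le
  linarith

lemma chi_nonneg (hm : 2 ≤ m) (k : ℕ) : 0 ≤ chi m k := by
  have := chi_antitone hm (Nat.le_add_right k (5 * m))
  rwa [chi_of_ge hm (by omega)] at this

lemma chi_le_one (hm : 2 ≤ m) (k : ℕ) : chi m k ≤ 1 := by
  have := chi_antitone hm (Nat.zero_le k)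
  rwa [chi_of_le (by omega : 0 ≤ 3 * m)] at this

lemma tent_div_le (hm : 2 ≤ m) (k : ℕ) : tent m k / tentSum m ≤ 4 / m := by
  have h2 : (2 : ℝ) ≤ m := by exact_mod_cast hm
  rw [div_le_div_iff₀ (tentSum_pos hm) (by linarith)]
  have h1 := tent_le m k
  have h3 := sq_le_tentSum hm
  have h4 := mul_le_mul_of_nonneg_right h1 (by linarith : (0 : ℝ) ≤ m)
  nlinarith

lemma abs_tent_succ_sub_div_le (hm : 2 ≤ m) (k : ℕ) :
    |tent m (k + 1) / tentSum m - tent m k / tentSum m| ≤ 4 / (m : ℝ) ^ 2 := by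
  have h2 : (2 : ℝ) ≤ m := by exact_mod_cast hm
  rw [← sub_div, abs_div, abs_of_pos (tentSum_pos hm), div_le_div_iff₀ (tentSum_pos hm) (by positivity)]
  have h1 := abs_tent_succ_sub_le m k
  have h3 := sq_le_tentSum hm
  have h4 := mul_le_mul_of_nonneg_right h1 (by positivity : (0 : ℝ) ≤ (m : ℝ) ^ 2)
  linarith

/-- A cutoff to the window between `m` and `7m`, with differences of order `1/m`. -/
def eta (m k : ℕ) : ℝ := max 0 (min 1 ((3 * m - |(k : ℝ) - 4 * m|) / m))

lemma eta_nonneg (m k : ℕ) : 0 ≤ eta m k := le_max_left _ _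

lemma eta_le_one (m k : ℕ) : eta m k ≤ 1 := max_le zero_le_one (min_le_left _ _)

lemma eta_of_le {k : ℕ} (h : k ≤ m) : eta m k = 0 := by
  have h' : (k : ℝ) ≤ m := by exact_mod_cast h
  refine max_eq_left ((min_le_right _ _).trans (div_nonpos_of_nonpos_of_nonneg ?_ (Nat.cast_nonneg m)))
  linarith [neg_abs_le ((k : ℝ) - 4 * m)]

lemma eta_of_ge {k : ℕ} (h : 7 * m ≤ k) : eta m k = 0 := by
  have h' : (7 * m : ℝ) ≤ k := by exact_mod_cast h
  refine max_eq_left ((min_le_right _ _).trans (div_nonpos_of_nonpos_of_nonneg ?_ (Nat.cast_nonneg m)))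
  linarith [le_abs_self ((k : ℝ) - 4 * m)]

lemma eta_of_mem (hm : 0 < m) {k : ℕ} (h : k ∈ Finset.Icc (2 * m) (6 * m)) : eta m k = 1 := by
  have hm' : (0 : ℝ) < m := by exact_mod_cast hm
  obtain ⟨h1, h2⟩ := Finset.mem_Icc.1 h
  have h1' : (2 * m : ℝ) ≤ k := by exact_mod_cast h1
  have h2' : (k : ℝ) ≤ 6 * m := by exact_mod_cast h2
  have : |(k : ℝ) - 4 * m| ≤ 2 * m := abs_le.2 ⟨by linarith, by linarith⟩
  rw [eta, min_eq_left, max_eq_right zero_le_one]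
  rw [one_le_div hm']
  linarith

lemma abs_eta_succ_sub_le (m k : ℕ) : |eta m (k + 1) - eta m k| ≤ 1 / m := by
  unfold eta
  have h := abs_max_sub_max_le_max 0 (min 1 ((3 * m - |((k + 1 : ℕ) : ℝ) - 4 * m|) / m)) 0
    (min 1 ((3 * m - |(k : ℝ) - 4 * m|) / m))
  refine h.trans (max_le (by simp) ?_)
  have h' := abs_min_sub_min_le_max 1 ((3 * m - |((k + 1 : ℕ) : ℝ) - 4 * m|) / m) 1
    ((3 * m - |(k : ℝ) - 4 * m|) / m)
  refine h'.trans (max_le (by simp) ?_)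
  have h1 := abs_abs_sub_abs_le_abs_sub ((k : ℝ) - 4 * m) (((k + 1 : ℕ) : ℝ) - 4 * m)
  have e : (k : ℝ) - 4 * m - (((k + 1 : ℕ) : ℝ) - 4 * m) = -1 := by push_cast; ring
  rw [e, abs_neg, abs_one] at h1
  rw [← sub_div, abs_div, Nat.abs_cast]
  refine div_le_div_of_nonneg_right (le_trans (le_of_eq ?_) h1) (Nat.cast_nonneg m)
  congr 1
  ring

end cutoff

/-! ### Commutators of the derivative with cutoffs -/

section commutator

variable {ℓ : ℝ} {m : ℕ}

/-- The commutator of the derivative with a multiplier. -/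
def comm (ℓ : ℝ) (χ : ℕ → ℝ) (a : ℕ → ℂ) (k : ℕ) : ℂ :=
  dseq ℓ (fun j => χ j * a j) k - χ k * dseq ℓ a k

/-- The second commutator of the derivative with a multiplier. -/
def comm₂ (ℓ : ℝ) (χ : ℕ → ℝ) (a : ℕ → ℂ) (k : ℕ) : ℂ :=
  dseq ℓ (comm ℓ χ a) k - comm ℓ χ (dseq ℓ a) k

/-- Only differences of χ survive, multiplied by an index of size k. Where they are of order 1/m on
indices of order m, the commutator has order zero. -/
lemma comm_eq (χ : ℕ → ℝ) (a : ℕ → ℂ) (k : ℕ) : comm ℓ χ a k = I / ℓ *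
    ((k + 1) * ((χ (k + 1) - χ k : ℝ) : ℂ) * a (k + 1)
      - k * ((χ k - χ (k - 1) : ℝ) : ℂ) * a (k - 1)) := by
  simp only [comm, dseq]
  push_cast
  ring

lemma comm₂_eq (χ : ℕ → ℝ) (a : ℕ → ℂ) (k : ℕ) : comm₂ ℓ χ a (k + 2) = (I / ℓ) ^ 2 *
    (-(2 * ((k + 3) * ((χ (k + 3) - χ (k + 2) : ℝ) : ℂ)) * a (k + 3))
      - 2 * ((k + 2) * ((χ (k + 2) - χ (k + 1) : ℝ) : ℂ)) * a (k + 1)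
      + 2 * ((k + 2) ^ 2 * (((χ (k + 2) - χ (k + 1)) - (χ (k + 3) - χ (k + 2)) : ℝ) : ℂ)
        - (2 * k + 5) * ((χ (k + 3) - χ (k + 2) : ℝ) : ℂ)) * a (k + 2)
      + (k + 3) * (k + 4) * (((χ (k + 4) - χ (k + 3)) - (χ (k + 3) - χ (k + 2)) : ℝ) : ℂ) * a (k + 4)
      + (k + 2) * (k + 1) * (((χ (k + 2) - χ (k + 1)) - (χ (k + 1) - χ k) : ℝ) : ℂ) * a k) := by
  simp only [comm₂, comm_eq, dseq, Nat.add_sub_cancel, show k + 2 - 1 = k + 1 by omega,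
    show k + 2 + 1 = k + 3 by omega, show k + 3 - 1 = k + 2 by omega,
    show k + 1 + 1 = k + 2 by omega, show k + 3 + 1 = k + 4 by omega]
  push_cast
  ring

lemma dseq_dseq_mul (χ : ℕ → ℝ) (a : ℕ → ℂ) (k : ℕ) :
    dseq ℓ (dseq ℓ fun j => χ j * a j) k
      = χ k * dseq ℓ (dseq ℓ a) k + 2 * comm ℓ χ (dseq ℓ a) k + comm₂ ℓ χ a k := by
  have e : (dseq ℓ fun j => χ j * a j) = fun k => 1 * (χ k * dseq ℓ a k) + 1 * comm ℓ χ a k := by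
    ext k
    rw [comm]
    ring
  rw [e, dseq_congr_add, comm₂, comm]
  ring

/-- Each commutator is moved to the left of as many derivatives as possible; a derivative stays
outside only on the second commutator, which is applied to the undifferentiated sequence. -/
lemma dseq_dseq_dseq_mul (χ : ℕ → ℝ) (a : ℕ → ℂ) (k : ℕ) :
    dseq ℓ (dseq ℓ (dseq ℓ fun j => χ j * a j)) k
      = χ k * dseq ℓ (dseq ℓ (dseq ℓ a)) k + 3 * comm ℓ χ (dseq ℓ (dseq ℓ a)) k
        + 2 * comm₂ ℓ χ (dseq ℓ a) k + dseq ℓ (comm₂ ℓ χ a) k := by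
  have e : (dseq ℓ (dseq ℓ fun j => χ j * a j)) = fun k =>
      1 * (1 * (χ k * dseq ℓ (dseq ℓ a) k) + 2 * comm ℓ χ (dseq ℓ a) k) + 1 * comm₂ ℓ χ a k := by
    ext k
    rw [dseq_dseq_mul]
    ring
  rw [e, dseq_congr_add, dseq_congr_add]
  have h1 : dseq ℓ (comm ℓ χ (dseq ℓ a)) k = comm ℓ χ (dseq ℓ (dseq ℓ a)) k + comm₂ ℓ χ (dseq ℓ a) k := by
    rw [comm₂]; ring
  have h2 : dseq ℓ (fun j => χ j * dseq ℓ (dseq ℓ a) j) k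
      = χ k * dseq ℓ (dseq ℓ (dseq ℓ a)) k + comm ℓ χ (dseq ℓ (dseq ℓ a)) k := by
    rw [comm]; ring
  rw [h1, h2]
  ring

lemma norm_I_div (hℓ : 0 < ℓ) : ‖I / (ℓ : ℂ)‖ = 1 / ℓ := by
  rw [norm_div, Complex.norm_I, Complex.norm_real, Real.norm_of_nonneg hℓ.le]

/-- The differences vanish from index 5m on, and 5m times their bound 4/m is 20. -/
lemma mul_abs_chi_sub_le (hm : 2 ≤ m) (k : ℕ) : (k + 1 : ℝ) * |chi m (k + 1) - chi m k| ≤ 20 := by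
  have hm0 : (0 : ℝ) < m := by exact_mod_cast (by omega : 0 < m)
  rw [chi_succ_sub, abs_neg, abs_of_nonneg (div_nonneg (tent_nonneg m k) (tentSum_pos hm).le)]
  rcases lt_or_ge k (5 * m) with h | h
  · have h1 : (k + 1 : ℝ) ≤ 5 * m := by exact_mod_cast h
    calc (k + 1 : ℝ) * (tent m k / tentSum m) ≤ 5 * m * (4 / m) :=
          mul_le_mul h1 (tent_div_le hm k) (div_nonneg (tent_nonneg m k) (tentSum_pos hm).le)
            (by positivity)
      _ = 20 := by field_simp; norm_num
  · rw [tent_of_ge h]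
    norm_num

lemma norm_comm_chi_le (hℓ : 0 < ℓ) (hm : 2 ≤ m) (a : ℕ → ℂ) (k : ℕ) :
    ‖comm ℓ (chi m) a k‖ ≤ 20 / ℓ * (‖a (k + 1)‖ + ‖a (k - 1)‖) := by
  rw [comm_eq, norm_mul, norm_I_div hℓ]
  have h1 : ‖((k : ℂ) + 1) * ((chi m (k + 1) - chi m k : ℝ) : ℂ)‖ ≤ 20 := by
    have := mul_abs_chi_sub_le hm k
    rw [norm_mul, Complex.norm_real, Real.norm_eq_abs]
    have e : ‖(k + 1 : ℂ)‖ = k + 1 := by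
      rw [← Nat.cast_succ, Complex.norm_natCast]; push_cast; ring
    rwa [e]
  have h2 : ‖(k : ℂ) * ((chi m k - chi m (k - 1) : ℝ) : ℂ)‖ ≤ 20 := by
    rcases k with _ | k
    · simp
    · have := mul_abs_chi_sub_le hm k
      rw [norm_mul, Complex.norm_real, Real.norm_eq_abs, Complex.norm_natCast, Nat.add_sub_cancel]
      exact_mod_cast this
  have h3 : ‖((k : ℂ) + 1) * ((chi m (k + 1) - chi m k : ℝ) : ℂ) * a (k + 1)
      - k * ((chi m k - chi m (k - 1) : ℝ) : ℂ) * a (k - 1)‖ ≤ 20 * ‖a (k + 1)‖ + 20 * ‖a (k - 1)‖ := by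
    refine (norm_sub_le _ _).trans ?_
    rw [norm_mul _ (a (k + 1)), norm_mul _ (a (k - 1))]
    gcongr
  calc _ ≤ 1 / ℓ * (20 * ‖a (k + 1)‖ + 20 * ‖a (k - 1)‖) := by gcongr
    _ = _ := by ring

lemma comm_chi_eq_zero {k : ℕ} (hk : k ∉ Finset.Icc (3 * m) (5 * m)) (a : ℕ → ℂ) :
    comm ℓ (chi m) a k = 0 := by
  rw [Finset.mem_Icc] at hk
  have h1 : tent m k = 0 := by
    rcases le_or_gt k (3 * m) with h | h
    · exact tent_of_le h
    · exact tent_of_ge (by omega)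
  rw [comm_eq, chi_succ_sub, h1]
  rcases k with _ | k
  · simp
  · have h2 : tent m k = 0 := by
      rcases le_or_gt k (3 * m) with h | h
      · exact tent_of_le h
      · exact tent_of_ge (by omega)
    rw [Nat.add_sub_cancel, chi_succ_sub, h2]
    simp

/-- Two factors of index size meet second differences of order 1/m², and one such factor meets a
first difference of order 1/m. The constant 400 covers the largest coefficient, the diagonal one,
bounded by 2(144 + 52). -/
lemma norm_comm₂_chi_le (hℓ : 0 < ℓ) (hm : 3 ≤ m) (a : ℕ → ℂ) {k : ℕ} (hk : k + 2 ≤ 6 * m) :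
    ‖comm₂ ℓ (chi m) a (k + 2)‖ ≤ 400 / ℓ ^ 2 *
      (‖a (k + 3)‖ + ‖a (k + 1)‖ + ‖a (k + 2)‖ + ‖a (k + 4)‖ + ‖a k‖) := by
  have hm2 : 2 ≤ m := by omega
  have hm0 : (3 : ℝ) ≤ m := by exact_mod_cast hm
  have hmp : (0 : ℝ) < m := by linarith
  have hkm : (k + 2 : ℝ) ≤ 6 * m := by exact_mod_cast hk
  have nk : ∀ n : ℕ, ‖((k : ℂ) + n)‖ = k + n := fun n => by
    rw [← Nat.cast_add, Complex.norm_natCast]; push_cast; ring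
  have nk1 := nk 1
  have nk2 := nk 2
  have nk3 := nk 3
  have nk4 := nk 4
  push_cast at nk1 nk2 nk3 nk4
  have first : ∀ j : ℕ, |chi m (j + 1) - chi m j| ≤ 4 / m := fun j => by
    rw [chi_succ_sub, abs_neg, abs_of_nonneg (div_nonneg (tent_nonneg m j) (tentSum_pos hm2).le)]
    exact tent_div_le hm2 j
  have second : ∀ j : ℕ, |(chi m (j + 2) - chi m (j + 1)) - (chi m (j + 1) - chi m j)| ≤ 4 / (m : ℝ) ^ 2 :=
    fun j => by
    have := abs_tent_succ_sub_div_le hm2 j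
    rw [chi_succ_sub, chi_succ_sub, ← abs_neg]
    refine le_trans (le_of_eq ?_) this
    congr 1
    ring
  have c1 : ‖2 * (((k : ℂ) + 3) * ((chi m (k + 3) - chi m (k + 2) : ℝ) : ℂ))‖ ≤ 400 := by
    have := mul_abs_chi_sub_le hm2 (k + 2)
    push_cast at this
    rw [norm_mul, norm_mul, nk3, Complex.norm_real, Real.norm_eq_abs, Complex.norm_two]
    have e : (k + 2 + 1 : ℝ) = k + 3 := by ring
    rw [e] at this
    linarith
  have c2 : ‖2 * (((k : ℂ) + 2) * ((chi m (k + 2) - chi m (k + 1) : ℝ) : ℂ))‖ ≤ 400 := by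
    have := mul_abs_chi_sub_le hm2 (k + 1)
    push_cast at this
    rw [norm_mul, norm_mul, nk2, Complex.norm_real, Real.norm_eq_abs, Complex.norm_two]
    have e : (k + 1 + 1 : ℝ) = k + 2 := by ring
    rw [e] at this
    linarith
  have c3 : ‖2 * (((k : ℂ) + 2) ^ 2 *
      (((chi m (k + 2) - chi m (k + 1)) - (chi m (k + 3) - chi m (k + 2)) : ℝ) : ℂ)
        - (2 * k + 5) * ((chi m (k + 3) - chi m (k + 2) : ℝ) : ℂ))‖ ≤ 400 := by
    have n5 : ‖(2 * k + 5 : ℂ)‖ = 2 * k + 5 := by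
      have : (2 * k + 5 : ℂ) = ((2 * k + 5 : ℕ) : ℂ) := by push_cast; ring
      rw [this, Complex.norm_natCast]; push_cast; ring
    rw [norm_mul, Complex.norm_two]
    have h1 : ‖((k : ℂ) + 2) ^ 2 *
      (((chi m (k + 2) - chi m (k + 1)) - (chi m (k + 3) - chi m (k + 2)) : ℝ) : ℂ)‖ ≤ 144 := by
      rw [norm_mul, norm_pow, nk2, Complex.norm_real, Real.norm_eq_abs, abs_sub_comm]
      calc _ ≤ (6 * m : ℝ) ^ 2 * (4 / (m : ℝ) ^ 2) := by
            gcongr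
            exact second (k + 1)
        _ = 144 := by field_simp; norm_num
    have h2 : ‖(2 * k + 5 : ℂ) * ((chi m (k + 3) - chi m (k + 2) : ℝ) : ℂ)‖ ≤ 52 := by
      rw [norm_mul, n5, Complex.norm_real, Real.norm_eq_abs]
      calc _ ≤ (13 * m : ℝ) * (4 / m) := by
            refine mul_le_mul (by linarith) (first (k + 2)) (abs_nonneg _) (by positivity)
        _ = 52 := by field_simp; norm_num
    have h3 := norm_sub_le (((k : ℂ) + 2) ^ 2 *
      (((chi m (k + 2) - chi m (k + 1)) - (chi m (k + 3) - chi m (k + 2)) : ℝ) : ℂ))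
      ((2 * k + 5 : ℂ) * ((chi m (k + 3) - chi m (k + 2) : ℝ) : ℂ))
    linarith
  have c4 : ‖((k : ℂ) + 3) * (k + 4) *
      (((chi m (k + 4) - chi m (k + 3)) - (chi m (k + 3) - chi m (k + 2)) : ℝ) : ℂ)‖ ≤ 400 := by
    rw [norm_mul, norm_mul, nk3, nk4, Complex.norm_real, Real.norm_eq_abs]
    calc _ ≤ (7 * m : ℝ) * (7 * m) * (4 / (m : ℝ) ^ 2) := by
          refine mul_le_mul (mul_le_mul (by linarith) (by linarith) (by positivity) (by positivity))
            (second (k + 2)) (abs_nonneg _) (by positivity)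
      _ ≤ 400 := by field_simp; norm_num
  have c5 : ‖((k : ℂ) + 2) * (k + 1) *
      (((chi m (k + 2) - chi m (k + 1)) - (chi m (k + 1) - chi m k) : ℝ) : ℂ)‖ ≤ 400 := by
    rw [norm_mul, norm_mul, nk2, nk1, Complex.norm_real, Real.norm_eq_abs]
    calc _ ≤ (7 * m : ℝ) * (7 * m) * (4 / (m : ℝ) ^ 2) := by
          refine mul_le_mul (mul_le_mul (by linarith) (by linarith) (by positivity) (by positivity))
            (second k) (abs_nonneg _) (by positivity)
      _ ≤ 400 := by field_simp; norm_num
  rw [comm₂_eq, norm_mul, norm_pow, norm_I_div hℓ]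
  have tri : ∀ x₁ x₂ x₃ x₄ x₅ : ℂ, ‖-x₁ - x₂ + x₃ + x₄ + x₅‖ ≤ ‖x₁‖ + ‖x₂‖ + ‖x₃‖ + ‖x₄‖ + ‖x₅‖ :=
    fun x₁ x₂ x₃ x₄ x₅ => by
    refine (norm_add_le _ _).trans (add_le_add_left ((norm_add_le _ _).trans (add_le_add_left
      ((norm_add_le _ _).trans (add_le_add_left ((norm_sub_le _ _).trans ?_) _)) _)) _)
    rw [norm_neg]
  have hmul : ∀ {c b : ℂ}, ‖c‖ ≤ 400 → ‖c * b‖ ≤ 400 * ‖b‖ := fun {c b} h => by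
    rw [norm_mul]
    gcongr
  have e : (400 / ℓ ^ 2 * (‖a (k + 3)‖ + ‖a (k + 1)‖ + ‖a (k + 2)‖ + ‖a (k + 4)‖ + ‖a k‖) : ℝ)
      = (1 / ℓ) ^ 2 * (400 * ‖a (k + 3)‖ + 400 * ‖a (k + 1)‖ + 400 * ‖a (k + 2)‖ + 400 * ‖a (k + 4)‖
        + 400 * ‖a k‖) := by ring
  rw [e]
  refine mul_le_mul_of_nonneg_left ((tri _ _ _ _ _).trans ?_) (by positivity)
  exact add_le_add (add_le_add (add_le_add (add_le_add (hmul c1) (hmul c2)) (hmul c3)) (hmul c4))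
    (hmul c5)

lemma comm₂_chi_eq_zero (hm : 3 ≤ m) {k : ℕ} (hk : k ∉ Finset.Icc (3 * m - 1) (5 * m + 1))
    (a : ℕ → ℂ) : comm₂ ℓ (chi m) a k = 0 := by
  rw [Finset.mem_Icc] at hk
  have h : ∀ j, k - 1 ≤ j → j ≤ k + 1 → j ∉ Finset.Icc (3 * m) (5 * m) := fun j h1 h2 h3 => by
    rw [Finset.mem_Icc] at h3
    omega
  rw [comm₂, comm_chi_eq_zero (h k (by omega) (by omega)), dseq,
    comm_chi_eq_zero (h k (by omega) (by omega)), comm_chi_eq_zero (h (k - 1) (by omega) (by omega)),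
    comm_chi_eq_zero (h (k + 1) (by omega) (by omega))]
  simp

lemma nrm_comm_chi_le (hℓ : 0 < ℓ) (hm : 3 ≤ m) (F : Finset ℕ) (a : ℕ → ℂ) :
    nrm F (fun k => ‖comm ℓ (chi m) a k‖) ≤ 40 / ℓ * nrm (Finset.Icc (2 * m) (6 * m)) fun k => ‖a k‖ := by
  rw [nrm_of_support (F := F.filter (· ∈ Finset.Icc (3 * m) (5 * m))) (Finset.filter_subset _ _)
    (fun k hk hk' => by
      rw [comm_chi_eq_zero (fun h => hk' (Finset.mem_filter.2 ⟨hk, h⟩)), norm_zero])]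
  have hF : ∀ k ∈ F.filter (· ∈ Finset.Icc (3 * m) (5 * m)), 3 * m ≤ k ∧ k ≤ 5 * m := fun k hk =>
    Finset.mem_Icc.1 (Finset.mem_filter.1 hk).2
  set F' := F.filter (· ∈ Finset.Icc (3 * m) (5 * m))
  have h1 := nrm_le_nrm (F := F') (fun k _ => norm_nonneg _)
    fun k _ => norm_comm_chi_le hℓ (by omega : 2 ≤ m) a k
  refine h1.trans ?_
  rw [nrm_const_mul _ (by positivity)]
  have h2 := nrm_add_le F' (fun k => ‖a (k + 1)‖) fun k => ‖a (k - 1)‖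
  have h3 := nrm_add_one_le (F := F') (G := Finset.Icc (2 * m) (6 * m)) (fun k hk => by
    have := hF k hk; rw [Finset.mem_Icc]; omega) fun k => ‖a k‖
  have h4 := nrm_sub_one_le (F := F') (G := Finset.Icc (2 * m) (6 * m)) (fun k hk => by
    have := hF k hk; omega) (fun k hk => by
    have := hF k hk; rw [Finset.mem_Icc]; omega) fun k => ‖a k‖
  rw [show (40 / ℓ : ℝ) = 20 / ℓ * 2 by ring, mul_assoc]
  refine mul_le_mul_of_nonneg_left ?_ (by positivity)
  linarith

lemma nrm_comm₂_chi_le (hℓ : 0 < ℓ) (hm : 3 ≤ m) (F : Finset ℕ) (a : ℕ → ℂ) :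
    nrm F (fun k => ‖comm₂ ℓ (chi m) a k‖)
      ≤ 2000 / ℓ ^ 2 * nrm (Finset.Icc (2 * m) (6 * m)) fun k => ‖a k‖ := by
  rw [nrm_of_support (F := F.filter (· ∈ Finset.Icc (3 * m - 1) (5 * m + 1))) (Finset.filter_subset _ _)
    (fun k hk hk' => by
      rw [comm₂_chi_eq_zero hm (fun h => hk' (Finset.mem_filter.2 ⟨hk, h⟩)), norm_zero])]
  have hF : ∀ k ∈ F.filter (· ∈ Finset.Icc (3 * m - 1) (5 * m + 1)), 3 * m - 1 ≤ k ∧ k ≤ 5 * m + 1 :=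
    fun k hk => Finset.mem_Icc.1 (Finset.mem_filter.1 hk).2
  set F' := F.filter (· ∈ Finset.Icc (3 * m - 1) (5 * m + 1))
  have h1 : nrm F' (fun k => ‖comm₂ ℓ (chi m) a k‖) ≤ nrm F' fun k => 400 / ℓ ^ 2 *
      (‖a (k + 1)‖ + ‖a (k - 1)‖ + ‖a k‖ + ‖a (k + 2)‖ + ‖a (k - 2)‖) := by
    refine nrm_le_nrm (fun k _ => norm_nonneg _) fun k hk => ?_
    have hk' := hF k hk
    obtain ⟨j, rfl⟩ : ∃ j, k = j + 2 := ⟨k - 2, by omega⟩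
    exact norm_comm₂_chi_le hℓ hm a (by omega)
  refine h1.trans ?_
  rw [nrm_const_mul _ (by positivity)]
  have shift : ∀ σ : ℕ → ℕ, (∀ k, 2 ≤ k → k ≤ σ k + 2 ∧ σ k ≤ k + 2) →
      (∀ j k, 2 ≤ j → 2 ≤ k → σ j = σ k → j = k) →
      nrm F' (fun k => ‖a (σ k)‖) ≤ nrm (Finset.Icc (2 * m) (6 * m)) fun k => ‖a k‖ := by
    intro σ h h'
    refine nrm_comp_le (fun j hj k hk e => h' j k ?_ ?_ e) (fun k hk => ?_) fun k => ‖a k‖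
    · have := hF j hj; omega
    · have := hF k hk; omega
    · have := hF k hk
      have := h k (by omega)
      rw [Finset.mem_Icc]
      omega
  have s1 := shift (fun k => k + 1) (fun k _ => by omega) (fun j k _ _ => by omega)
  have s2 := shift (fun k => k - 1) (fun k _ => by omega) (fun j k _ _ => by omega)
  have s3 := shift (fun k => k) (fun k _ => by omega) (fun j k _ _ => by omega)
  have s4 := shift (fun k => k + 2) (fun k _ => by omega) (fun j k _ _ => by omega)
  have s5 := shift (fun k => k - 2) (fun k _ => by omega) (fun j k _ _ => by omega)
  have t1 := nrm_add_le F' (fun k => ‖a (k + 1)‖ + ‖a (k - 1)‖ + ‖a k‖ + ‖a (k + 2)‖)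
    fun k => ‖a (k - 2)‖
  have t2 := nrm_add_le F' (fun k => ‖a (k + 1)‖ + ‖a (k - 1)‖ + ‖a k‖) fun k => ‖a (k + 2)‖
  have t3 := nrm_add_le F' (fun k => ‖a (k + 1)‖ + ‖a (k - 1)‖) fun k => ‖a k‖
  have t4 := nrm_add_le F' (fun k => ‖a (k + 1)‖) fun k => ‖a (k - 1)‖
  rw [show (2000 / ℓ ^ 2 : ℝ) = 400 / ℓ ^ 2 * 5 by ring, mul_assoc]
  refine mul_le_mul_of_nonneg_left ?_ (by positivity)
  linarith

end commutator

end Benjamin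
end

noncomputable section

namespace Benjamin

open scoped ComplexConjugate
open Complex (I)

/-! ### A local energy estimate -/

section energy

variable {ℓ : ℝ} {m : ℕ}

/-- The difference of η² is 1/m times 2η + 1/m. The part with η is absorbed into the weighted norm
being estimated, and the remainder has an extra 1/m that pays for the crude bound of b. -/
lemma norm_comm_eta_sq_le (hℓ : 0 < ℓ) (hm : 1 ≤ m) (b : ℕ → ℂ) {k : ℕ} (hk : k ≤ 7 * m) :
    ‖comm ℓ (fun j => eta m j ^ 2) b k‖ ≤ 8 / ℓ *
      ((2 * (eta m (k + 1) * ‖b (k + 1)‖) + 1 / m * ‖b (k + 1)‖)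
        + (2 * (eta m (k - 1) * ‖b (k - 1)‖) + 1 / m * ‖b (k - 1)‖)) := by
  have hm0 : (1 : ℝ) ≤ m := by exact_mod_cast hm
  have hkm : (k : ℝ) ≤ 7 * m := by exact_mod_cast hk
  have sqd : ∀ i j : ℕ, |eta m i - eta m j| ≤ 1 / m →
      |eta m i ^ 2 - eta m j ^ 2| ≤ 1 / m * (2 * eta m i + 1 / m) := fun i j h => by
    have e : eta m i ^ 2 - eta m j ^ 2 = (eta m i - eta m j) * (eta m i + eta m j) := by ring
    rw [e, abs_mul]
    have h1 := eta_nonneg m i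
    have h2 := eta_nonneg m j
    rw [abs_of_nonneg (add_nonneg h1 h2)]
    refine mul_le_mul h ?_ (add_nonneg h1 h2) (by positivity)
    have := (abs_le.1 h).1
    linarith
  have h1 : ‖((k : ℂ) + 1) * ((eta m (k + 1) ^ 2 - eta m k ^ 2 : ℝ) : ℂ)‖
      ≤ 8 * (2 * eta m (k + 1) + 1 / m) := by
    have e : ‖(k + 1 : ℂ)‖ = k + 1 := by
      rw [← Nat.cast_succ, Complex.norm_natCast]; push_cast; ring
    rw [norm_mul, Complex.norm_real, Real.norm_eq_abs, e]
    have h2 := sqd (k + 1) k (abs_eta_succ_sub_le m k)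
    have h0 := eta_nonneg m (k + 1)
    calc _ ≤ (8 * m : ℝ) * (1 / m * (2 * eta m (k + 1) + 1 / m)) :=
          mul_le_mul (by linarith) h2 (abs_nonneg _) (by positivity)
      _ = _ := by field_simp
  have h2 : ‖(k : ℂ) * ((eta m k ^ 2 - eta m (k - 1) ^ 2 : ℝ) : ℂ)‖
      ≤ 8 * (2 * eta m (k - 1) + 1 / m) := by
    rcases k with _ | k
    · have h0 := eta_nonneg m (0 - 1)
      simp only [Nat.cast_zero, zero_mul, norm_zero]
      positivity
    · rw [norm_mul, Complex.norm_real, Real.norm_eq_abs, Complex.norm_natCast, Nat.add_sub_cancel,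
        abs_sub_comm]
      have h2 := sqd k (k + 1) (by rw [abs_sub_comm]; exact abs_eta_succ_sub_le m k)
      have h0 := eta_nonneg m k
      calc _ ≤ (8 * m : ℝ) * (1 / m * (2 * eta m k + 1 / m)) :=
            mul_le_mul (by linarith) h2 (abs_nonneg _) (by positivity)
        _ = _ := by field_simp
  rw [comm_eq, norm_mul, norm_I_div hℓ]
  have h3 := norm_sub_le (((k : ℂ) + 1) * ((eta m (k + 1) ^ 2 - eta m k ^ 2 : ℝ) : ℂ) * b (k + 1))
    (k * ((eta m k ^ 2 - eta m (k - 1) ^ 2 : ℝ) : ℂ) * b (k - 1))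
  rw [norm_mul _ (b (k + 1)), norm_mul _ (b (k - 1))] at h3
  have h4 := mul_le_mul_of_nonneg_right h1 (norm_nonneg (b (k + 1)))
  have h5 := mul_le_mul_of_nonneg_right h2 (norm_nonneg (b (k - 1)))
  calc _ ≤ 1 / ℓ * (8 * (2 * eta m (k + 1) + 1 / m) * ‖b (k + 1)‖
        + 8 * (2 * eta m (k - 1) + 1 / m) * ‖b (k - 1)‖) := by
        refine mul_le_mul_of_nonneg_left (h3.trans (add_le_add h4 h5)) (by positivity)
    _ = _ := by ring

lemma comm_eta_sq_eq_zero {b : ℕ → ℂ} {k : ℕ} (hk : k ∉ Finset.Icc m (7 * m)) :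
    comm ℓ (fun j => eta m j ^ 2) b k = 0 := by
  rw [Finset.mem_Icc] at hk
  have h : ∀ j, k - 1 ≤ j → j ≤ k + 1 → eta m j = 0 := fun j h1 h2 => by
    rcases le_or_gt j m with h | h
    · exact eta_of_le h
    · exact eta_of_ge (by omega)
  rw [comm_eq, h k (by omega) (by omega), h (k - 1) (by omega) (by omega), h (k + 1) (by omega) (by omega)]
  simp

lemma dseq_fluxSeq {α β γ δ : ℝ} (u q : ℕ → ℂ) (k : ℕ) :
    dseq ℓ (fluxSeq ℓ α β γ δ u q) k = α * dseq ℓ u k - I * β * dseq ℓ (dseq ℓ u) k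
      - γ * dseq ℓ (dseq ℓ (dseq ℓ u)) k + δ * dseq ℓ q k := by
  simp only [dseq, fluxSeq]
  ring

lemma le_of_sq_le_quadratic {Y Z A B : ℝ} (hZ : 0 ≤ Z) (hA : 0 ≤ A) (hB : 0 ≤ B)
    (h : Y ^ 2 ≤ A * Z * Y + B * Z ^ 2) : Y ≤ (1 + A + B) * Z := by
  by_contra! hc
  have h1 : Z ≤ Y := by nlinarith [mul_nonneg hA hZ, mul_nonneg hB hZ]
  rcases hZ.eq_or_lt with h0 | h0
  · subst h0
    nlinarith
  · have h2 : B * Z ^ 2 ≤ B * Z * Y := by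
      rw [sq, ← mul_assoc]
      exact mul_le_mul_of_nonneg_left h1 (by positivity)
    nlinarith

/-- The second derivative of a solution, restricted to indices of order `m`, is as small as if the
equation were not dispersive. -/
lemma exists_local_bound (hℓ : 0 < ℓ) (α β δ : ℝ) {γ : ℝ} (hγ : γ ≠ 0) : ∃ C, 0 ≤ C ∧
    ∀ m : ℕ, 3 ≤ m → ∀ (u v q : ℕ → ℂ) (Z : ℝ), 0 ≤ Z →
      (∀ k, v k = -dseq ℓ (fluxSeq ℓ α β γ δ u q) k) →
      nrm (Finset.Icc (m - 3) (8 * m)) (fun k => ‖u k‖) ≤ Z / m →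
      nrm (Finset.Icc (m - 3) (8 * m)) (fun k => ‖v k‖) ≤ Z →
      nrm (Finset.Icc (m - 3) (8 * m)) (fun k => ‖q k‖) ≤ Z / m →
      nrm (Finset.Icc (2 * m) (6 * m)) (fun k => ‖dseq ℓ (dseq ℓ u) k‖) ≤ C * Z := by
  set A := 32 / ℓ * (|β| / |γ| + 32 / ℓ) with hA
  set B := 32 / ℓ * ((1 + |α| * (32 / ℓ) + |δ| * (32 / ℓ)) / |γ| + 8 / ℓ * (2 * (32 / ℓ) ^ 2)) with hB
  have hA0 : 0 ≤ A := by positivity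
  have hB0 : 0 ≤ B := by positivity
  refine ⟨1 + A + B, by positivity, fun m hm u v q Z hZ hv hu hvn hq => ?_⟩
  have hm0 : (3 : ℝ) ≤ m := by exact_mod_cast hm
  have hmp : (0 : ℝ) < m := by linarith
  have hγ0 : 0 < |γ| := abs_pos.2 hγ
  set a := dseq ℓ u with ha
  set b := dseq ℓ a with hb
  -- Each derivative widens the window by one; the interval from m-3 to 8m accommodates three of
  -- them since m ≥ 3.
  have step : ∀ i : ℕ, i ≤ 2 → ∀ f : ℕ → ℂ, nrm (Finset.Icc (m - i) (7 * m + i)) (fun k => ‖dseq ℓ f k‖)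
      ≤ 32 * m / ℓ * nrm (Finset.Icc (m - (i + 1)) (7 * m + (i + 1))) fun k => ‖f k‖ := by
    intro i hi f
    have := nrm_dseq_le hℓ (F := Finset.Icc (m - i) (7 * m + i))
      (G := Finset.Icc (m - (i + 1)) (7 * m + (i + 1))) (B := 8 * m)
      (fun k hk => by rw [Finset.mem_Icc] at hk; omega)
      (fun k hk => by rw [Finset.mem_Icc] at hk ⊢; omega)
      (fun k hk => by rw [Finset.mem_Icc] at hk ⊢; omega)
      (fun k hk => by rw [Finset.mem_Icc] at hk ⊢; omega) f
    refine this.trans (le_of_eq ?_)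
    push_cast
    ring
  have big : ∀ i : ℕ, i ≤ 3 → ∀ f : ℕ → ℝ, nrm (Finset.Icc (m - i) (7 * m + i)) f
      ≤ nrm (Finset.Icc (m - 3) (8 * m)) f := fun i hi f =>
    nrm_mono (fun k hk => by rw [Finset.mem_Icc] at hk ⊢; omega) f
  have hm_cancel : 32 * m / ℓ * (Z / m) = 32 / ℓ * Z := by field_simp
  have hua : nrm (Finset.Icc m (7 * m)) (fun k => ‖a k‖) ≤ 32 / ℓ * Z := by
    rw [← hm_cancel]
    refine (step 0 (by omega) u).trans (mul_le_mul_of_nonneg_left ?_ (by positivity))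
    exact (big 1 (by omega) _).trans hu
  have hDq : nrm (Finset.Icc m (7 * m)) (fun k => ‖dseq ℓ q k‖) ≤ 32 / ℓ * Z := by
    rw [← hm_cancel]
    refine (step 0 (by omega) q).trans (mul_le_mul_of_nonneg_left ?_ (by positivity))
    exact (big 1 (by omega) _).trans hq
  have hub : nrm (Finset.Icc (m - 1) (7 * m + 1)) (fun k => ‖b k‖) ≤ m * ((32 / ℓ) ^ 2 * Z) := by
    have h1 := step 1 (by omega) a
    have h2 := step 2 (by omega) u
    have h3 := (big 3 le_rfl fun k => ‖u k‖).trans hu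
    calc _ ≤ 32 * m / ℓ * (32 * m / ℓ * (Z / m)) :=
          h1.trans (mul_le_mul_of_nonneg_left (h2.trans (mul_le_mul_of_nonneg_left h3 (by positivity)))
            (by positivity))
      _ = _ := by rw [hm_cancel]; ring
  set Y := nrm (Finset.range (8 * m)) (fun k => eta m k * ‖b k‖) with hY
  have hYY : nrm (Finset.Icc (2 * m) (6 * m)) (fun k => ‖b k‖) ≤ Y := by
    refine le_trans (nrm_le_nrm (g := fun k => eta m k * ‖b k‖) (fun k _ => norm_nonneg _) fun k hk => ?_)
      (nrm_mono (fun k hk => ?_) _)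
    · rw [eta_of_mem (by omega) hk, one_mul]
    · rw [Finset.mem_Icc] at hk
      rw [Finset.mem_range]
      omega
  refine hYY.trans (le_of_sq_le_quadratic hZ hA0 hB0 ?_)
  set g : ℕ → ℂ := fun k => ((eta m k ^ 2 : ℝ) : ℂ) * b k with hg
  -- The energy estimate: the localized norm of the second derivative b = Da is integrated by parts
  -- onto the first derivative a and Db. The cutoff η vanishes near the ends, so there are no
  -- boundary terms.
  have hparts : ((Y ^ 2 : ℝ) : ℂ) = -∑ k ∈ Finset.range (8 * m), conj (a k) * dseq ℓ g k := by
    rw [← sum_conj_dseq_mul (8 * m) a g, hY, nrm_sq]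
    · push_cast
      refine Finset.sum_congr rfl fun k _ => ?_
      rw [hg, ← hb]
      have := Complex.conj_mul' (b k)
      push_cast
      linear_combination (-(eta m k : ℂ) ^ 2) * this
    · rw [hg]
      simp [eta_of_ge (by omega : 7 * m ≤ 8 * m)]
    · rw [hg]
      simp [eta_of_ge (by omega : 7 * m ≤ 8 * m - 1)]
  have hYle : Y ^ 2 ≤ ∑ k ∈ Finset.range (8 * m), ‖a k‖ * ‖dseq ℓ g k‖ := by
    have h1 := congr_arg norm hparts
    rw [Complex.norm_real, Real.norm_of_nonneg (sq_nonneg _), norm_neg] at h1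
    rw [h1]
    refine (norm_sum_le _ _).trans (Finset.sum_le_sum fun k _ => ?_)
    rw [norm_mul, RCLike.norm_conj]
  have hDg : ∀ k, dseq ℓ g k = comm ℓ (fun j => eta m j ^ 2) b k + ((eta m k ^ 2 : ℝ) : ℂ) * dseq ℓ b k :=
    fun k => by rw [comm]; ring
  have hsub : Finset.Icc m (7 * m) ⊆ Finset.range (8 * m) := fun k hk => by
    rw [Finset.mem_Icc] at hk
    rw [Finset.mem_range]
    omega
  have hrestr : ∑ k ∈ Finset.range (8 * m), ‖a k‖ * ‖dseq ℓ g k‖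
      = ∑ k ∈ Finset.Icc m (7 * m), ‖a k‖ * ‖dseq ℓ g k‖ := by
    refine (Finset.sum_subset hsub fun k _ hk => ?_).symm
    have h0 : eta m k = 0 := by
      rw [Finset.mem_Icc] at hk
      rcases le_or_gt k m with h | h
      · exact eta_of_le h
      · exact eta_of_ge (by omega)
    rw [hDg, comm_eta_sq_eq_zero hk, h0]
    simp
  -- The equation expresses the third derivative through v and lower order terms, here γ ≠ 0 is
  -- used. Of the weight η² one factor η is kept on b, so the β term is bounded by Y, and the result
  -- is a quadratic inequality for Y.
  have hDb : ∀ k, eta m k ^ 2 * ‖dseq ℓ b k‖ ≤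
      1 / |γ| * (‖v k‖ + |α| * ‖a k‖ + |β| * (eta m k * ‖b k‖) + |δ| * ‖dseq ℓ q k‖) := fun k => by
    have h1 : γ * dseq ℓ b k = v k + α * a k - I * β * b k + δ * dseq ℓ q k := by
      rw [hv, dseq_fluxSeq]
      ring
    have h2 : |γ| * ‖dseq ℓ b k‖ ≤ ‖v k‖ + |α| * ‖a k‖ + |β| * ‖b k‖ + |δ| * ‖dseq ℓ q k‖ := by
      have h3 := congr_arg norm h1
      rw [norm_mul, Complex.norm_real, Real.norm_eq_abs] at h3
      rw [h3]
      refine (norm_add_le _ _).trans (add_le_add ((norm_sub_le _ _).trans (add_le_add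
        ((norm_add_le _ _).trans (add_le_add le_rfl ?_)) ?_)) ?_)
      all_goals simp
    have e0 := eta_nonneg m k
    have e1 := eta_le_one m k
    have e2 : eta m k ^ 2 ≤ eta m k := by nlinarith
    have e3 : eta m k ^ 2 ≤ 1 := by nlinarith
    rw [div_mul_eq_mul_div, one_mul, le_div_iff₀ hγ0]
    have x1 := mul_le_mul_of_nonneg_left h2 (sq_nonneg (eta m k))
    have x2 := mul_le_mul_of_nonneg_right e3 (norm_nonneg (v k))
    have x3 := mul_le_mul_of_nonneg_right e3 (show 0 ≤ |α| * ‖a k‖ by positivity)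
    have x4 := mul_le_mul_of_nonneg_right e2 (show 0 ≤ |β| * ‖b k‖ by positivity)
    have x5 := mul_le_mul_of_nonneg_right e3 (show 0 ≤ |δ| * ‖dseq ℓ q k‖ by positivity)
    linarith
  set F := Finset.Icc m (7 * m) with hF
  set G := Finset.Icc (m - 1) (7 * m + 1) with hG
  have hg1 : nrm F (fun k => eta m k ^ 2 * ‖dseq ℓ b k‖) ≤
      1 / |γ| * (Z + |α| * (32 / ℓ * Z) + |β| * Y + |δ| * (32 / ℓ * Z)) := by
    refine (nrm_le_nrm (fun k _ => by positivity) fun k _ => hDb k).trans ?_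
    rw [nrm_const_mul _ (by positivity)]
    refine mul_le_mul_of_nonneg_left ?_ (by positivity)
    refine (nrm_add_le _ _ _).trans (add_le_add ((nrm_add_le _ _ _).trans (add_le_add
      ((nrm_add_le _ _ _).trans (add_le_add ?_ ?_)) ?_)) ?_)
    · exact (big 0 (by omega) _).trans hvn
    · rw [nrm_const_mul _ (abs_nonneg _)]
      exact mul_le_mul_of_nonneg_left hua (abs_nonneg _)
    · rw [nrm_const_mul _ (abs_nonneg _)]
      exact mul_le_mul_of_nonneg_left (nrm_mono hsub _) (abs_nonneg _)
    · rw [nrm_const_mul _ (abs_nonneg _)]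
      exact mul_le_mul_of_nonneg_left hDq (abs_nonneg _)
  have hmG : 1 / m * nrm G (fun k => ‖b k‖) ≤ (32 / ℓ) ^ 2 * Z := by
    rw [div_mul_eq_mul_div, one_mul, div_le_iff₀ hmp, mul_comm _ (m : ℝ)]
    exact hub
  have hF1 : ∀ k ∈ F, 1 ≤ k := fun k hk => by rw [hF, Finset.mem_Icc] at hk; omega
  have hterm : ∀ σ : ℕ → ℕ, (∀ f : ℕ → ℝ, nrm F (fun k => f (σ k)) ≤ nrm G f) →
      (∀ f : ℕ → ℝ, nrm F (fun k => f (σ k)) ≤ nrm (Finset.range (8 * m)) f) →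
      nrm F (fun k => 2 * (eta m (σ k) * ‖b (σ k)‖) + 1 / m * ‖b (σ k)‖) ≤ 2 * Y + (32 / ℓ) ^ 2 * Z := by
    intro σ h1 h2
    refine (nrm_add_le F (fun k => 2 * (eta m (σ k) * ‖b (σ k)‖)) fun k => 1 / m * ‖b (σ k)‖).trans
      (add_le_add ?_ ?_)
    · rw [nrm_const_mul _ zero_le_two]
      exact mul_le_mul_of_nonneg_left (h2 fun k => eta m k * ‖b k‖) zero_le_two
    · rw [nrm_const_mul _ (by positivity)]
      exact (mul_le_mul_of_nonneg_left (h1 fun k => ‖b k‖) (by positivity)).trans hmG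
  have hsucc := hterm (fun k => k + 1)
    (nrm_add_one_le fun k hk => by rw [hF, Finset.mem_Icc] at hk; rw [hG, Finset.mem_Icc]; omega)
    (nrm_add_one_le fun k hk => by rw [hF, Finset.mem_Icc] at hk; rw [Finset.mem_range]; omega)
  have hpred := hterm (fun k => k - 1)
    (nrm_sub_one_le hF1 fun k hk => by rw [hF, Finset.mem_Icc] at hk; rw [hG, Finset.mem_Icc]; omega)
    (nrm_sub_one_le hF1 fun k hk => by rw [hF, Finset.mem_Icc] at hk; rw [Finset.mem_range]; omega)
  have hg2 : nrm F (fun k => ‖comm ℓ (fun j => eta m j ^ 2) b k‖) ≤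
      8 / ℓ * ((2 * Y + (32 / ℓ) ^ 2 * Z) + (2 * Y + (32 / ℓ) ^ 2 * Z)) := by
    refine (nrm_le_nrm (fun k _ => norm_nonneg _) fun k hk =>
      norm_comm_eta_sq_le hℓ (by omega) b (Finset.mem_Icc.1 hk).2).trans ?_
    rw [nrm_const_mul _ (by positivity)]
    exact mul_le_mul_of_nonneg_left ((nrm_add_le _ _ _).trans (add_le_add hsucc hpred)) (by positivity)
  have hg3 : nrm F (fun k => ‖dseq ℓ g k‖) ≤
      8 / ℓ * ((2 * Y + (32 / ℓ) ^ 2 * Z) + (2 * Y + (32 / ℓ) ^ 2 * Z))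
      + 1 / |γ| * (Z + |α| * (32 / ℓ * Z) + |β| * Y + |δ| * (32 / ℓ * Z)) := by
    refine (nrm_le_nrm (fun k _ => norm_nonneg _) fun k _ => ?_).trans
      ((nrm_add_le F _ _).trans (add_le_add hg2 hg1))
    rw [hDg]
    refine (norm_add_le _ _).trans (add_le_add le_rfl (le_of_eq ?_))
    rw [norm_mul, Complex.norm_real, Real.norm_of_nonneg (sq_nonneg _)]
  rw [hrestr] at hYle
  refine hYle.trans ((sum_mul_le_nrm F _ _).trans ?_)
  refine (mul_le_mul hua hg3 (nrm_nonneg _ _) (by positivity)).trans (le_of_eq ?_)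
  rw [hA, hB]
  field_simp
  ring

end energy

end Benjamin
end

noncomputable section

namespace Benjamin

open scoped ComplexConjugate
open Complex (I)

/-! ### The quadratic term -/

section quadratic

variable {ℓ : ℝ} {s W G : ℝ}

lemma HS.mul {s W : ℝ}
    {a : ℕ → ℂ} (ha : HS s W a) {θ : ℕ → ℝ} (h0 : ∀ k, 0 ≤ θ k) (h1 : ∀ k, θ k ≤ 1) :
    HS s W fun k => θ k * a k := fun K => by
  refine le_trans (Finset.sum_le_sum fun k _ => ?_) (ha K)
  rw [norm_mul, Complex.norm_real, Real.norm_of_nonneg (h0 k)]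
  have : θ k * ‖a k‖ ≤ ‖a k‖ := mul_le_of_le_one_left (norm_nonneg _) (h1 k)
  have h2 := h0 k
  gcongr

lemma HS.abs_synth_le (hℓ : 0 < ℓ) {a : ℕ → ℂ} (ha : HS s W a) (hs : 1 ≤ s) (hW : 0 ≤ W) (x : ℝ) :
    |synth ℓ a x| ≤ 2 * embConst * W * (psiConst ℓ / ℓ) := by
  refine (Benjamin.abs_synth_le hℓ (ha.summable hs hW) x).trans ?_
  have h1 := ha.tsum_le hs hW
  have h2 := norm_psi_le hℓ 0 x
  have h3 := embConst_nonneg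
  rw [mul_assoc 2 embConst]
  gcongr

lemma memLp_sq_of_bounded {f : ℝ → ℝ} (hc : Continuous f) (hf : MemLp f 2 volume) {A : ℝ}
    (hA : ∀ x, |f x| ≤ A) : MemLp (fun x => f x ^ 2) 2 volume :=
  MemLp.of_le_mul (c := A) hf (hc.pow 2).aestronglyMeasurable (ae_of_all _ fun x => by
    rw [norm_pow, sq, Real.norm_eq_abs]
    exact mul_le_mul_of_nonneg_right (hA x) (abs_nonneg _))

lemma sum_norm_sq_rcoef_le (hℓ : 0 < ℓ) {f : ℝ → ℝ} (hf : MemLp f 2 volume) (F : Finset ℕ) :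
    2 * ∑ k ∈ F, ‖rcoef ℓ f k‖ ^ 2 ≤ ∫ x, f x ^ 2 := by
  rw [Finset.mul_sum]
  exact sum_le_hasSum F (fun k _ => by positivity) (hasSum_norm_sq_rcoef hℓ hf)

/-- The effect of a cutoff on the coefficients of the square. -/
lemma nrm_rcoef_sq_sub_le (hℓ : 0 < ℓ) (hs : 1 ≤ s) (hW : 0 ≤ W) (hG : 0 ≤ G) {u : ℝ → ℝ}
    (hc : Continuous u) (hu : MemLp u 2 volume) (hHW : HS s W (rcoef ℓ u)) (hHG : HS s G (rcoef ℓ u))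
    {θ : ℕ → ℝ} (h0 : ∀ k, 0 ≤ θ k) (h1 : ∀ k, θ k ≤ 1) {J : ℕ} (hJ : ∀ k < J, θ k = 1)
    (F : Finset ℕ) :
    nrm F (fun k => ‖rcoef ℓ (fun x => synth ℓ (fun j => θ j * rcoef ℓ u j) x ^ 2) k
      - rcoef ℓ (fun x => u x ^ 2) k‖) ≤
      4 * embConst * W * (psiConst ℓ / ℓ) * ((1 + J : ℝ) ^ (-s) * G) := by
  set a := rcoef ℓ u with ha
  have hb : HS s W fun j => (θ j : ℂ) * a j := hHW.mul (θ := θ) h0 h1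
  set f := synth ℓ (fun j => (θ j : ℂ) * a j) with hf
  have hus : u = synth ℓ a := eq_synth_rcoef hℓ hc hu (hHW.summable hs hW)
  have hfc : Continuous f := continuous_synth hℓ (hb.summable hs hW)
  have hfL : MemLp f 2 volume := memLp_synth hℓ (hb.summable hs hW)
  set A := 2 * embConst * W * (psiConst ℓ / ℓ) with hA
  have hA0 : 0 ≤ A := by
    have := embConst_nonneg
    have := (psiConst_pos hℓ).le
    positivity
  have hfb : ∀ x, |f x| ≤ A := hb.abs_synth_le hℓ hs hW
  have hub : ∀ x, |u x| ≤ A := fun x => by rw [hus]; exact hHW.abs_synth_le hℓ hs hW x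
  have hf2 := memLp_sq_of_bounded hfc hfL hfb
  have hu2 := memLp_sq_of_bounded hc hu hub
  have hd : MemLp (fun x => f x - u x) 2 volume := hfL.sub hu
  have hd2 : MemLp (fun x => f x ^ 2 - u x ^ 2) 2 volume := hf2.sub hu2
  have hdc : ∀ k, rcoef ℓ (fun x => f x - u x) k = (θ k - 1) * a k := fun k => by
    rw [rcoef_sub hℓ hfL hu, hf, rcoef_synth hℓ (hb.summable hs hW)]
    ring
  -- The cutoff changes only coefficients from J on, each by at most its own size. The difference of
  -- squares is then this difference times f + u, which is bounded by 2A.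
  have hdI : ∫ x, (f x - u x) ^ 2 ≤ 2 * ((1 + J : ℝ) ^ (-s) * G) ^ 2 := by
    have hS := hasSum_norm_sq_rcoef hℓ hd
    rw [← hS.tsum_eq]
    refine hS.summable.tsum_le_of_sum_le fun F => ?_
    rw [← Finset.mul_sum]
    refine mul_le_mul_of_nonneg_left ?_ zero_le_two
    have h2 : ∑ k ∈ F, ‖rcoef ℓ (fun x => f x - u x) k‖ ^ 2
        ≤ ∑ k ∈ F.filter (J ≤ ·), ‖a k‖ ^ 2 := by
      rw [Finset.sum_filter]
      refine Finset.sum_le_sum fun k _ => ?_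
      rw [hdc, norm_mul]
      split_ifs with h
      · have : ‖(θ k : ℂ) - 1‖ ≤ 1 := by
          rw [← Complex.ofReal_one, ← Complex.ofReal_sub, Complex.norm_real, Real.norm_eq_abs, abs_le]
          constructor <;> linarith [h0 k, h1 k]
        exact pow_le_pow_left₀ (by positivity) (mul_le_of_le_one_left (norm_nonneg _) this) 2
      · rw [hJ k (by omega)]
        simp
    exact h2.trans (hHG.sum_sq_le (by linarith) fun k hk => (Finset.mem_filter.1 hk).2)
  refine nrm_le_of_sq_le (by have := embConst_nonneg; have := (psiConst_pos hℓ).le; positivity) ?_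
  have h3 := sum_norm_sq_rcoef_le hℓ hd2 F
  have h4 : ∫ x, (f x ^ 2 - u x ^ 2) ^ 2 ≤ (2 * A) ^ 2 * ∫ x, (f x - u x) ^ 2 := by
    rw [← integral_const_mul]
    refine integral_mono hd2.integrable_sq (hd.integrable_sq.const_mul _) fun x => ?_
    have e : (f x ^ 2 - u x ^ 2) ^ 2 = |f x + u x| ^ 2 * (f x - u x) ^ 2 := by rw [sq_abs]; ring
    simp only [e]
    have : |f x + u x| ≤ 2 * A := (abs_add_le _ _).trans (by linarith [hfb x, hub x])
    gcongr
  simp only [rcoef_sub hℓ hf2 hu2] at h3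
  have e : (4 * embConst * W * (psiConst ℓ / ℓ) * ((1 + J : ℝ) ^ (-s) * G)) ^ 2
      = (2 * A) ^ 2 * ((1 + J : ℝ) ^ (-s) * G) ^ 2 := by rw [hA]; ring
  rw [e]
  have h5 := mul_le_mul_of_nonneg_left hdI (sq_nonneg (2 * A))
  linarith

/-- High coefficients of the square. -/
lemma nrm_rcoef_sq_le (hℓ : 0 < ℓ) (hs : 1 ≤ s) (hW : 0 ≤ W) (hG : 0 ≤ G) {u : ℝ → ℝ}
    (hc : Continuous u) (hu : MemLp u 2 volume) (hHW : HS s W (rcoef ℓ u)) (hHG : HS s G (rcoef ℓ u))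
    {J : ℕ} {F : Finset ℕ} (hF : ∀ k ∈ F, 2 * J ≤ k) :
    nrm F (fun k => ‖rcoef ℓ (fun x => u x ^ 2) k‖) ≤
      4 * embConst * W * (psiConst ℓ / ℓ) * ((1 + J : ℝ) ^ (-s) * G) := by
  -- With a sharp cutoff at J the square of the truncation has no coefficient from 2J on, so there
  -- the coefficients of u² are those of the difference.
  set θ : ℕ → ℝ := fun k => if k < J then 1 else 0 with hθ
  have h := nrm_rcoef_sq_sub_le hℓ hs hW hG hc hu hHW hHG (θ := θ)
    (fun k => by simp only [hθ]; split_ifs <;> norm_num)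
    (fun k => by simp only [hθ]; split_ifs <;> norm_num) (J := J)
    (fun k hk => if_pos hk) F
  refine le_trans (nrm_le_nrm (fun k _ => norm_nonneg _) fun k hk => le_of_eq ?_) h
  have h2 := rcoef_synth_mul_synth hℓ (a := fun j => (θ j : ℂ) * rcoef ℓ u j)
    (b := fun j => (θ j : ℂ) * rcoef ℓ u j) (K := J)
    (fun k hk => by simp [hθ, not_lt.2 hk]) (fun k hk => by simp [hθ, not_lt.2 hk]) k (hF k hk)
  simp only [← sq] at h2
  rw [h2, zero_sub, norm_neg]

/-- Brings the tails that start at m - 3, at (m - 3)/2 or at m to a common form; the hypothesis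
holds for all three once m ≥ 4. -/
lemma rpow_neg_le_four_rpow {m K : ℕ} (hs : 0 ≤ s) (hm : 0 < m) (h : m ≤ 4 * (1 + K)) :
    (1 + K : ℝ) ^ (-s) ≤ 4 ^ s * (m : ℝ) ^ (-s) := by
  have hm0 : (0 : ℝ) < m := by exact_mod_cast hm
  have h' : (m : ℝ) ≤ 4 * (1 + K) := by exact_mod_cast h
  have e : (4 : ℝ) ^ s * (m : ℝ) ^ (-s) = ((m : ℝ) / 4) ^ (-s) := by
    rw [Real.div_rpow hm0.le (by norm_num), Real.rpow_neg (by norm_num : (0 : ℝ) ≤ 4), div_inv_eq_mul,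
      mul_comm]
  rw [e]
  exact Real.rpow_le_rpow_of_nonpos (by positivity) (by linarith) (by linarith)

end quadratic

/-! ### The residual of the truncated solution -/

section residual

variable {ℓ : ℝ} {p : ℕ}

lemma dmat_tr {a : ℕ → ℂ} (h : ∀ k, p ≤ k → a k = 0) : dmat ℓ p (tr p a) = tr p (dseq ℓ a) := by
  rw [dmat_apply, ext_tr h]

/-- No aliasing: the square of a function with indices below K has indices below 2K ≤ p, so it lies
in ℙ_n and equals its interpolant. -/
lemma bmul_tr (hℓ : 0 < ℓ) {a : ℕ → ℂ} {K : ℕ} (h : ∀ k, K ≤ k → a k = 0) (hp : 2 * K ≤ p) :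
    bmul ℓ p (tr p a) (tr p a) = tr p (rcoef ℓ fun x => synth ℓ a x ^ 2) := by
  have ha : Summable fun k => ‖a k‖ := summable_norm_of_support h
  have hrec : ∀ x, recon ℓ (tr p a) x = synth ℓ a x := fun x => by
    rw [recon, ext_tr fun k hk => h k (by omega)]
  have hc : Continuous (synth ℓ a) := continuous_synth hℓ ha
  have hL : MemLp (synth ℓ a) 2 volume := memLp_synth hℓ ha
  obtain ⟨A, hA⟩ : ∃ A, ∀ x, |synth ℓ a x| ≤ A := by
    refine ⟨2 * (∑' k, ‖a k‖) * (psiConst ℓ / ℓ), fun x => (abs_synth_le hℓ ha x).trans ?_⟩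
    have : 0 ≤ ∑' k, ‖a k‖ := tsum_nonneg fun k => norm_nonneg (a k)
    gcongr
    exact norm_psi_le hℓ 0 x
  have hq : ∀ k, p ≤ k → rcoef ℓ (fun x => synth ℓ a x ^ 2) k = 0 := fun k hk => by
    have := rcoef_synth_mul_synth hℓ h h k (by omega)
    simpa only [← sq] using this
  have e : (fun x => synth ℓ a x ^ 2) = recon ℓ (tr p (rcoef ℓ fun x => synth ℓ a x ^ 2)) := by
    rw [recon, ext_tr hq]
    exact eq_synth_rcoef hℓ (hc.pow 2) (memLp_sq_of_bounded hc hL hA) (summable_norm_of_support hq)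
  rw [bmul_apply, ← ic_ev hℓ (tr p (rcoef ℓ fun x => synth ℓ a x ^ 2))]
  congr 1
  ext i
  rw [Pi.mul_apply, ev_apply, ev_apply, ← e, hrec]
  exact (sq _).symm

/-- For coefficients supported well below p none of the projections in the scheme acts, and the
discrete field is the exact one. The residual therefore comes only from the cutoff. -/
lemma D_grad_tr (hℓ : 0 < ℓ) (α β γ δ : ℝ) {a : ℕ → ℂ} {K : ℕ} (h : ∀ k, K ≤ k → a k = 0)
    (hp : 2 * K ≤ p) (hp' : K + 2 ≤ p) :
    (hamSystem hℓ p).D ((hamSystem hℓ p).grad α β γ δ (tr p a))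
      = tr p (dseq ℓ (fluxSeq ℓ α β γ δ a (rcoef ℓ fun x => synth ℓ a x ^ 2))) := by
  have h1 : ∀ k, K + 1 ≤ k → dseq ℓ a k = 0 := dseq_eq_zero h
  have h2 : ∀ k, K + 1 + 1 ≤ k → dseq ℓ (dseq ℓ a) k = 0 := dseq_eq_zero h1
  have hq : ∀ k, p ≤ k → rcoef ℓ (fun x => synth ℓ a x ^ 2) k = 0 := fun k hk => by
    have := rcoef_synth_mul_synth hℓ h h k (by omega)
    simpa only [← sq] using this
  have e : (hamSystem hℓ p).grad α β γ δ (tr p a)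
      = tr p (fluxSeq ℓ α β γ δ a (rcoef ℓ fun x => synth ℓ a x ^ 2)) := by
    rw [HamSystem.grad, hamSystem_K, hamSystem_D, hamSystem_D, hamSystem_B, bmul_tr hℓ h hp,
      dmat_tr fun k hk => h k (by omega), dmat_tr fun k hk => h1 k (by omega)]
    ext k
    simp only [PiLp.add_apply, PiLp.sub_apply, PiLp.smul_apply, tr_apply, fluxSeq, Complex.real_smul,
      smul_eq_mul]
    ring
  rw [e, hamSystem_D, dmat_tr]
  intro k hk
  rw [fluxSeq, h k (by omega), h1 k (by omega), h2 k (by omega), hq k hk]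
  simp

lemma norm_tr_eq_nrm (f : ℕ → ℂ) : ‖tr p f‖ = nrm (Finset.range p) fun k => ‖f k‖ := by
  rw [nrm, ← norm_sq_tr, Real.sqrt_sq (norm_nonneg _)]

lemma norm_dmat_le (hℓ : 0 < ℓ) (a : Coef p) : ‖dmat ℓ p a‖ ≤ 4 * p / ℓ * ‖a‖ := by
  have h := nrm_dseq_le hℓ (F := Finset.range p) (G := Finset.range (p + 1)) (B := p)
    (fun k hk => Finset.mem_range.1 hk) (fun k hk => by rw [Finset.mem_range] at hk ⊢; omega)
    (fun k hk => by rw [Finset.mem_range] at hk ⊢; omega)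
    (fun k hk => by rw [Finset.mem_range] at hk ⊢; omega) (ext a)
  rw [dmat_apply, norm_tr_eq_nrm]
  refine h.trans (le_of_eq ?_)
  rw [nrm_of_support (F := Finset.range p) (Finset.range_subset_range.2 (by omega)) fun k _ hk => by
    rw [ext_eq_zero a (by simpa using hk), norm_zero], ← norm_tr_eq_nrm, tr_ext]

/-- The residual of the truncated solution. -/
lemma exists_residual_bound (hℓ : 0 < ℓ) (α β δ : ℝ) {γ s W : ℝ} (hγ : γ ≠ 0) (hs : 1 ≤ s)
    (hW : 0 ≤ W) : ∃ C, 0 ≤ C ∧ ∀ m p : ℕ, 4 ≤ m → 10 * m ≤ p → p ≤ 32 * m → ∀ (u : ℝ → ℝ) (G : ℝ),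
      0 ≤ G → Continuous u → MemLp u 2 volume → HS s W (rcoef ℓ u) → HS s G (rcoef ℓ u) →
      HS s G (vseq ℓ α β γ δ u) →
      ‖tr p (fun k => chi m k * vseq ℓ α β γ δ u k)
        + (hamSystem hℓ p).D ((hamSystem hℓ p).grad α β γ δ (tr p fun k => chi m k * rcoef ℓ u k))‖
      ≤ C * (m * (m : ℝ) ^ (-s) * G) := by
  obtain ⟨C₁, hC₁, hloc⟩ := exists_local_bound hℓ α β δ hγ
  set Q := 4 * embConst * W * (psiConst ℓ / ℓ) with hQ
  have hQ0 : 0 ≤ Q := by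
    have := embConst_nonneg
    have := (psiConst_pos hℓ).le
    positivity
  set C₂ := |α| * (40 / ℓ) + |β| * (2 * (40 / ℓ * (32 / ℓ)) + 2000 / ℓ ^ 2)
    + |γ| * (3 * (40 / ℓ * (C₁ * (1 + Q))) + 2 * (2000 / ℓ ^ 2 * (32 / ℓ)) + 128 / ℓ * (2000 / ℓ ^ 2))
    + |δ| * (128 / ℓ * (2 * Q) + 40 / ℓ * Q) with hC₂
  have hC₂0 : 0 ≤ C₂ := by positivity
  refine ⟨C₂ * 4 ^ s, by positivity, fun m p hm hp1 hp2 u G hG hc hu hHW hHG hHV => ?_⟩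
  have hs0 : 0 ≤ s := by linarith
  have hm0 : (4 : ℝ) ≤ m := by exact_mod_cast hm
  set a := rcoef ℓ u with ha
  set q := rcoef ℓ (fun x => u x ^ 2) with hq
  set v := vseq ℓ α β γ δ u with hv
  set w : ℕ → ℂ := fun k => chi m k * a k with hw
  set qw := rcoef ℓ (fun x => synth ℓ w x ^ 2) with hqw
  set τ := 4 ^ s * (m : ℝ) ^ (-s) * G with hτ
  have hτ0 : 0 ≤ τ := by positivity
  have hτm : τ ≤ m * τ := le_mul_of_one_le_left hτ0 (by linarith)
  have hm2 : 2 ≤ m := by omega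
  have hpow : ∀ K : ℕ, m ≤ 4 * (1 + K) → (1 + K : ℝ) ^ (-s) * G ≤ τ := fun K hK =>
    mul_le_mul_of_nonneg_right (rpow_neg_le_four_rpow hs0 (by omega) hK) hG
  set J := Finset.Icc (m - 3) (8 * m) with hJ
  have hJmem : ∀ k ∈ J, m - 3 ≤ k := fun k hk => (Finset.mem_Icc.1 hk).1
  have hua : nrm J (fun k => ‖a k‖) ≤ τ := (hHG.nrm_le hs0 hG hJmem).trans (hpow _ (by omega))
  have hva : nrm J (fun k => ‖v k‖) ≤ τ := (hHV.nrm_le hs0 hG hJmem).trans (hpow _ (by omega))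
  have hqtail : ∀ F : Finset ℕ, (∀ k ∈ F, m - 3 ≤ k) → nrm F (fun k => ‖q k‖) ≤ Q * τ := fun F hF => by
    refine (nrm_rcoef_sq_le hℓ hs hW hG hc hu hHW hHG (J := (m - 3) / 2) fun k hk => ?_).trans
      (mul_le_mul_of_nonneg_left (hpow _ (by omega)) hQ0)
    have := hF k hk
    omega
  -- The tail τ, of order m^{-s}, is scaled by m so that `exists_local_bound` applies to u and u²;
  -- it bounds the second derivative by mτ instead of m²τ.
  set Z := m * ((1 + Q) * τ) with hZ
  have hZm : Z / m = (1 + Q) * τ := by rw [hZ]; field_simp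
  have hZ1 : τ ≤ (1 + Q) * τ := by nlinarith
  have hZ2 : Q * τ ≤ (1 + Q) * τ := by nlinarith
  have hZ3 : (1 + Q) * τ ≤ Z := le_mul_of_one_le_left (by positivity) (by linarith)
  have hDDu : nrm (Finset.Icc (2 * m) (6 * m)) (fun k => ‖dseq ℓ (dseq ℓ a) k‖) ≤ C₁ * Z :=
    hloc m (by omega) a v q Z (by positivity) (fun k => rfl) (hua.trans (by rw [hZm]; exact hZ1))
      (hva.trans (hZ1.trans hZ3)) ((hqtail J hJmem).trans (by rw [hZm]; exact hZ2))
  set L := Finset.Icc (2 * m) (6 * m) with hL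
  have hLJ : L ⊆ J := fun k hk => by
    rw [hL, Finset.mem_Icc] at hk
    rw [hJ, Finset.mem_Icc]
    omega
  have huL : nrm L (fun k => ‖a k‖) ≤ τ := (nrm_mono hLJ _).trans hua
  have hDu : nrm L (fun k => ‖dseq ℓ a k‖) ≤ 32 / ℓ * (m * τ) := by
    have := nrm_dseq_le hℓ (F := L) (G := J) (B := 8 * m)
      (fun k hk => by rw [hL, Finset.mem_Icc] at hk; omega) hLJ
      (fun k hk => by rw [hL, Finset.mem_Icc] at hk; rw [hJ, Finset.mem_Icc]; omega)
      (fun k hk => by rw [hL, Finset.mem_Icc] at hk; rw [hJ, Finset.mem_Icc]; omega) a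
    refine this.trans ((mul_le_mul_of_nonneg_left hua (by positivity)).trans (le_of_eq ?_))
    push_cast
    ring
  have hqL : nrm L (fun k => ‖q k‖) ≤ Q * τ := hqtail L fun k hk => hJmem k (hLJ hk)
  have hDrange : ∀ f : ℕ → ℂ, nrm (Finset.range p) (fun k => ‖dseq ℓ f k‖)
      ≤ 128 / ℓ * (m * nrm (Finset.range (p + 1)) fun k => ‖f k‖) := fun f => by
    have := nrm_dseq_le hℓ (F := Finset.range p) (G := Finset.range (p + 1)) (B := 32 * m)
      (fun k hk => by rw [Finset.mem_range] at hk; omega)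
      (fun k hk => by rw [Finset.mem_range] at hk ⊢; omega)
      (fun k hk => by rw [Finset.mem_range] at hk ⊢; omega)
      (fun k hk => by rw [Finset.mem_range] at hk ⊢; omega) f
    refine this.trans (le_of_eq ?_)
    push_cast
    ring
  -- Squaring and cutting off do not commute; the defect has two parts, the change of the square
  -- under the cutoff and the high coefficients of the square.
  have hqdiff : nrm (Finset.range (p + 1)) (fun k => ‖qw k - chi m k * q k‖) ≤ 2 * Q * τ := by
    have h1 := nrm_rcoef_sq_sub_le hℓ hs hW hG hc hu hHW hHG (chi_nonneg hm2) (chi_le_one hm2)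
      (J := m) (fun k hk => chi_of_le (by omega)) (Finset.range (p + 1))
    have h2 : nrm (Finset.range (p + 1)) (fun k => ‖qw k - chi m k * q k‖) ≤
        nrm (Finset.range (p + 1)) (fun k => ‖qw k - q k‖ + (if m - 3 ≤ k then ‖q k‖ else 0)) := by
      refine nrm_le_nrm (fun k _ => norm_nonneg _) fun k _ => ?_
      have e : qw k - chi m k * q k = (qw k - q k) + ((1 - chi m k : ℝ) : ℂ) * q k := by
        push_cast
        ring
      rw [e]
      refine (norm_add_le _ _).trans (add_le_add le_rfl ?_)
      rw [norm_mul, Complex.norm_real]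
      split_ifs with h
      · refine mul_le_of_le_one_left (norm_nonneg _) ?_
        rw [Real.norm_eq_abs, abs_le]
        constructor <;> linarith [chi_nonneg hm2 k, chi_le_one hm2 k]
      · rw [chi_of_le (by omega)]
        simp
    have h3 := nrm_add_le (Finset.range (p + 1)) (fun k => ‖qw k - q k‖)
      fun k => if m - 3 ≤ k then ‖q k‖ else 0
    have h4 : nrm (Finset.range (p + 1)) (fun k => if m - 3 ≤ k then ‖q k‖ else 0) ≤ Q * τ := by
      refine le_trans (le_of_eq ?_) (hqtail ((Finset.range (p + 1)).filter (m - 3 ≤ ·))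
        fun k hk => (Finset.mem_filter.1 hk).2)
      unfold nrm
      rw [Finset.sum_filter]
      congr 1
      refine Finset.sum_congr rfl fun k _ => ?_
      beta_reduce
      by_cases h : m - 3 ≤ k
      · rw [if_pos h, if_pos h]
      · rw [if_neg h, if_neg h]
        norm_num
    have h5 := mul_le_mul_of_nonneg_left (hpow m (by omega)) hQ0
    linarith
  -- The exact equation multiplied by χ is subtracted, so only commutators and the defect of the
  -- square remain. Each of them is bounded by a multiple of mτ.
  have hident : ∀ k, chi m k * v k + dseq ℓ (fluxSeq ℓ α β γ δ w qw) k
      = α * comm ℓ (chi m) a k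
        - I * β * (2 * comm ℓ (chi m) (dseq ℓ a) k + comm₂ ℓ (chi m) a k)
        - γ * (3 * comm ℓ (chi m) (dseq ℓ (dseq ℓ a)) k + 2 * comm₂ ℓ (chi m) (dseq ℓ a) k
          + dseq ℓ (comm₂ ℓ (chi m) a) k)
        + δ * (dseq ℓ (fun j => qw j - chi m j * q j) k + comm ℓ (chi m) q k) := fun k => by
    have e1 : dseq ℓ (fun j => qw j - chi m j * q j) k
        = dseq ℓ qw k - dseq ℓ (fun j => chi m j * q j) k := by
      simp only [dseq]
      ring
    have e2 : v k = -dseq ℓ (fluxSeq ℓ α β γ δ a q) k := rfl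
    have e3 : dseq ℓ w k = chi m k * dseq ℓ a k + comm ℓ (chi m) a k := by rw [comm]; ring
    have e4 : dseq ℓ (fun j => chi m j * q j) k = chi m k * dseq ℓ q k + comm ℓ (chi m) q k := by
      rw [comm]; ring
    have e5 := dseq_dseq_mul (ℓ := ℓ) (chi m) a k
    have e6 := dseq_dseq_dseq_mul (ℓ := ℓ) (chi m) a k
    rw [e2, dseq_fluxSeq, dseq_fluxSeq, e1, e3, e4, hw, e5, e6]
    ring
  rw [D_grad_tr hℓ α β γ δ (K := 5 * m) (fun k hk => by simp [hw, chi_of_ge hm2 hk]) (by omega)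
    (by omega)]
  have hsum : tr p (fun k => (chi m k : ℂ) * v k) + tr p (dseq ℓ (fluxSeq ℓ α β γ δ w qw))
      = tr p fun k => chi m k * v k + dseq ℓ (fluxSeq ℓ α β γ δ w qw) k := rfl
  change ‖tr p (fun k => (chi m k : ℂ) * v k) + tr p (dseq ℓ (fluxSeq ℓ α β γ δ w qw))‖ ≤ _
  rw [hsum, norm_tr_eq_nrm]
  set F := Finset.range p with hF
  have hpt : ∀ k ∈ F, ‖chi m k * v k + dseq ℓ (fluxSeq ℓ α β γ δ w qw) k‖
      ≤ |α| * ‖comm ℓ (chi m) a k‖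
        + |β| * (2 * ‖comm ℓ (chi m) (dseq ℓ a) k‖ + ‖comm₂ ℓ (chi m) a k‖)
        + |γ| * (3 * ‖comm ℓ (chi m) (dseq ℓ (dseq ℓ a)) k‖ + 2 * ‖comm₂ ℓ (chi m) (dseq ℓ a) k‖
          + ‖dseq ℓ (comm₂ ℓ (chi m) a) k‖)
        + |δ| * (‖dseq ℓ (fun j => qw j - chi m j * q j) k‖ + ‖comm ℓ (chi m) q k‖) := by
    intro k _
    rw [hident]
    refine (norm_add_le _ _).trans (add_le_add ((norm_sub_le _ _).trans (add_le_add
      ((norm_sub_le _ _).trans (add_le_add ?_ ?_)) ?_)) ?_)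
    · rw [norm_mul, Complex.norm_real, Real.norm_eq_abs]
    · rw [norm_mul, norm_mul, Complex.norm_I, one_mul, Complex.norm_real, Real.norm_eq_abs]
      refine mul_le_mul_of_nonneg_left ((norm_add_le _ _).trans ?_) (abs_nonneg _)
      rw [norm_mul, Complex.norm_two]
    · rw [norm_mul, Complex.norm_real, Real.norm_eq_abs]
      refine mul_le_mul_of_nonneg_left (norm_add₃_le.trans ?_) (abs_nonneg _)
      rw [norm_mul, norm_mul, Complex.norm_two, Complex.norm_ofNat]
    · rw [norm_mul, Complex.norm_real, Real.norm_eq_abs]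
      exact mul_le_mul_of_nonneg_left (norm_add_le _ _) (abs_nonneg _)
  refine (nrm_le_nrm (fun k _ => norm_nonneg _) hpt).trans ?_
  have hm3 : 3 ≤ m := by omega
  have b1 := (nrm_comm_chi_le hℓ hm3 F a).trans (mul_le_mul_of_nonneg_left (huL.trans hτm) (by positivity))
  have b2 := (nrm_comm_chi_le hℓ hm3 F (dseq ℓ a)).trans (mul_le_mul_of_nonneg_left hDu (by positivity))
  have b3 := (nrm_comm₂_chi_le hℓ hm3 F a).trans (mul_le_mul_of_nonneg_left (huL.trans hτm) (by positivity))
  have b4 := (nrm_comm_chi_le hℓ hm3 F (dseq ℓ (dseq ℓ a))).trans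
    (mul_le_mul_of_nonneg_left hDDu (by positivity))
  have b5 := (nrm_comm₂_chi_le hℓ hm3 F (dseq ℓ a)).trans (mul_le_mul_of_nonneg_left hDu (by positivity))
  have b6 := (hDrange (comm₂ ℓ (chi m) a)).trans (mul_le_mul_of_nonneg_left
    (mul_le_mul_of_nonneg_left ((nrm_comm₂_chi_le hℓ hm3 _ a).trans
      (mul_le_mul_of_nonneg_left huL (by positivity))) (by positivity)) (by positivity))
  have b7 := (hDrange fun j => qw j - chi m j * q j).trans (mul_le_mul_of_nonneg_left
    (mul_le_mul_of_nonneg_left hqdiff (by positivity)) (by positivity))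
  have b8 := (nrm_comm_chi_le hℓ hm3 F q).trans (mul_le_mul_of_nonneg_left
    (hqL.trans (mul_le_mul_of_nonneg_left hτm hQ0)) (by positivity))
  have three : (0 : ℝ) ≤ 3 := by norm_num
  refine le_trans (b := |α| * (40 / ℓ * (m * τ))
    + |β| * (2 * (40 / ℓ * (32 / ℓ * (m * τ))) + 2000 / ℓ ^ 2 * (m * τ))
    + |γ| * (3 * (40 / ℓ * (C₁ * Z)) + 2 * (2000 / ℓ ^ 2 * (32 / ℓ * (m * τ)))
      + 128 / ℓ * (m * (2000 / ℓ ^ 2 * τ)))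
    + |δ| * (128 / ℓ * (m * (2 * Q * τ)) + 40 / ℓ * (Q * (m * τ)))) ?_ (le_of_eq ?_)
  · refine (nrm_add_le _ _ _).trans (add_le_add ((nrm_add_le _ _ _).trans (add_le_add
      ((nrm_add_le _ _ _).trans (add_le_add ?_ ?_)) ?_)) ?_)
    · rw [nrm_const_mul _ (abs_nonneg _)]
      exact mul_le_mul_of_nonneg_left b1 (abs_nonneg _)
    · rw [nrm_const_mul _ (abs_nonneg _)]
      refine mul_le_mul_of_nonneg_left ((nrm_add_le _ _ _).trans (add_le_add ?_ b3)) (abs_nonneg _)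
      rw [nrm_const_mul _ zero_le_two]
      exact mul_le_mul_of_nonneg_left b2 zero_le_two
    · rw [nrm_const_mul _ (abs_nonneg _)]
      refine mul_le_mul_of_nonneg_left ((nrm_add_le _ _ _).trans (add_le_add
        ((nrm_add_le _ _ _).trans (add_le_add ?_ ?_)) b6)) (abs_nonneg _)
      · rw [nrm_const_mul _ three]
        exact mul_le_mul_of_nonneg_left b4 three
      · rw [nrm_const_mul _ zero_le_two]
        exact mul_le_mul_of_nonneg_left b5 zero_le_two
    · rw [nrm_const_mul _ (abs_nonneg _)]
      exact mul_le_mul_of_nonneg_left ((nrm_add_le _ _ _).trans (add_le_add b7 b8)) (abs_nonneg _)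
  · rw [hC₂, hZ, hτ]
    ring

end residual

end Benjamin
end

noncomputable section

namespace Benjamin

open scoped ComplexConjugate
open Complex (I)

/-! ### Bounds in time -/

section timebound

variable {ℓ : ℝ}

/-- Bounds of the initial value and of the solution in a space of functions of time. -/
def HasTimeBound (ℓ α β γ δ T s G₀ E : ℝ) (u : ℝ → ℝ → ℝ) : Prop :=
  HS s G₀ (rcoef ℓ (u 0)) ∧ ∃ G : ℝ → ℝ, (∀ t, 0 ≤ G t) ∧
    (∀ᵐ t ∂volume.restrict (Icc 0 T), HS s (G t) (rcoef ℓ (u t)) ∧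
      HS s (G t) (vseq ℓ α β γ δ (u t))) ∧
    ∫⁻ t in Icc 0 T, ENNReal.ofReal (G t ^ 2) ≤ ENNReal.ofReal (E ^ 2)

lemma IsCoefSolution.hasTimeBound {α β γ δ T s W : ℝ} {u : ℝ → ℝ → ℝ} (hT : 0 ≤ T) (hW : 0 ≤ W)
    (h : IsCoefSolution ℓ α β γ δ T s W u) :
    HasTimeBound ℓ α β γ δ T s W (Real.sqrt T * W) u := by
  refine ⟨h.hs 0 ⟨le_rfl, hT⟩, fun _ => W, fun _ => hW, ?_, ?_⟩
  · filter_upwards [ae_restrict_mem measurableSet_Icc] with t ht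
    exact ⟨h.hs t ht, h.hs' t ht⟩
  · rw [setLIntegral_const, Real.volume_Icc, sub_zero, mul_pow, Real.sq_sqrt hT, mul_comm T,
      ENNReal.ofReal_mul (sq_nonneg W)]

/-- The majorant G arises from extended norms and need not be measurable; the comparison is made
with lower integrals, where that does not matter. -/
lemma setIntegral_le_of_le_sq {f G : ℝ → ℝ} {c E T : ℝ} (hf : ContinuousOn f (Icc 0 T))
    (h0 : ∀ t ∈ Icc 0 T, 0 ≤ f t) (hc : 0 ≤ c)
    (h : ∀ᵐ t ∂volume.restrict (Icc 0 T), f t ≤ c * G t ^ 2)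
    (hG : ∫⁻ t in Icc 0 T, ENNReal.ofReal (G t ^ 2) ≤ ENNReal.ofReal (E ^ 2)) :
    ∫ t in Icc 0 T, f t ≤ c * E ^ 2 := by
  have hi : Integrable f (volume.restrict (Icc 0 T)) := hf.integrableOn_Icc
  have h1 := ofReal_integral_eq_lintegral_ofReal hi
    (by filter_upwards [ae_restrict_mem measurableSet_Icc] with t ht using h0 t ht)
  rw [← ENNReal.ofReal_le_ofReal_iff (by positivity), h1]
  calc _ ≤ ∫⁻ t in Icc 0 T, ENNReal.ofReal c * ENNReal.ofReal (G t ^ 2) := by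
        refine lintegral_mono_ae (h.mono fun t ht => ?_)
        rw [← ENNReal.ofReal_mul hc]
        exact ENNReal.ofReal_le_ofReal ht
    _ = ENNReal.ofReal c * ∫⁻ t in Icc 0 T, ENNReal.ofReal (G t ^ 2) :=
        lintegral_const_mul' _ _ ENNReal.ofReal_ne_top
    _ ≤ _ := by
        rw [ENNReal.ofReal_mul hc]
        gcongr

lemma exists_primitive {f : ℝ → ℝ} {T : ℝ} (hT : 0 ≤ T) (hf : ContinuousOn f (Icc 0 T)) :
    ∃ P : ℝ → ℝ, P 0 = 0 ∧ (∀ t ∈ Icc 0 T, HasDerivWithinAt P (f t) (Icc 0 T) t) ∧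
      P T = ∫ t in Icc 0 T, f t := by
  set g : ℝ → ℝ := IccExtend hT (domRestrict (Icc 0 T) f) with hg
  have hgc : Continuous g := (continuousOn_iff_continuous_domRestrict.1 hf).Icc_extend'
  have hgf : ∀ t ∈ Icc 0 T, g t = f t := fun t ht => by
    rw [hg, IccExtend_of_mem _ _ ht]; rfl
  refine ⟨fun t => ∫ τ in (0 : ℝ)..t, g τ, by simp, fun t ht => ?_, ?_⟩
  · rw [← hgf t ht]
    exact (hgc.integral_hasStrictDerivAt 0 t).hasDerivAt.hasDerivWithinAt
  · simp only
    rw [intervalIntegral.integral_of_le hT, integral_Icc_eq_integral_Ioc]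
    exact setIntegral_congr_fun measurableSet_Ioc fun t ht => hgf t (Ioc_subset_Icc_self ht)

/-- The embedding of H¹ in time into the bounded functions for one mode, with Cauchy–Schwarz
obtained by expanding ∫ (‖f'‖ - J/T)² ≥ 0. Summed over modes it gives a bound at every time in terms
of the H¹ norm. -/
lemma norm_sq_le_of_hasDerivWithinAt {f f' : ℝ → ℂ} {T : ℝ} (hT : 0 < T)
    (hd : ∀ t ∈ Icc 0 T, HasDerivWithinAt f (f' t) (Icc 0 T) t) (hf' : ContinuousOn f' (Icc 0 T))
    {t : ℝ} (ht : t ∈ Icc 0 T) :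
    ‖f t‖ ^ 2 ≤ 2 * ‖f 0‖ ^ 2 + 2 * T * ∫ τ in Icc 0 T, ‖f' τ‖ ^ 2 := by
  set J := ∫ τ in Icc 0 T, ‖f' τ‖ with hJ
  have hi1 : IntegrableOn (fun τ => ‖f' τ‖) (Icc 0 T) := hf'.norm.integrableOn_Icc
  have hi2 : IntegrableOn (fun τ => ‖f' τ‖ ^ 2) (Icc 0 T) := (hf'.norm.pow 2).integrableOn_Icc
  have hJ0 : 0 ≤ J := integral_nonneg fun _ => norm_nonneg _
  have hcs : J ^ 2 ≤ T * ∫ τ in Icc 0 T, ‖f' τ‖ ^ 2 := by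
    have h0 : 0 ≤ ∫ τ in Icc 0 T, (‖f' τ‖ - J / T) ^ 2 := integral_nonneg fun _ => sq_nonneg _
    have e : ∫ τ in Icc 0 T, (‖f' τ‖ - J / T) ^ 2
        = (∫ τ in Icc 0 T, ‖f' τ‖ ^ 2) - 2 * (J / T) * J + T * (J / T) ^ 2 := by
      have e1 : ∀ τ, (‖f' τ‖ - J / T) ^ 2 = ‖f' τ‖ ^ 2 - 2 * (J / T) * ‖f' τ‖ + (J / T) ^ 2 :=
        fun τ => by ring
      have i3 : Integrable (fun τ => ‖f' τ‖ ^ 2 - 2 * (J / T) * ‖f' τ‖) (volume.restrict (Icc 0 T)) :=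
        hi2.sub (hi1.const_mul _)
      simp only [e1]
      rw [integral_add i3 (integrable_const _), integral_sub hi2 (hi1.const_mul _),
        integral_const_mul, setIntegral_const, Real.volume_real_Icc_of_le hT.le, sub_zero, smul_eq_mul]
    rw [e] at h0
    have e2 : T * ((∫ τ in Icc 0 T, ‖f' τ‖ ^ 2) - 2 * (J / T) * J + T * (J / T) ^ 2)
        = T * (∫ τ in Icc 0 T, ‖f' τ‖ ^ 2) - J ^ 2 := by
      field_simp
      ring
    have := mul_nonneg hT.le h0
    rw [e2] at this
    linarith
  have hsub : Icc 0 t ⊆ Icc 0 T := Icc_subset_Icc_right ht.2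
  have hftc := intervalIntegral.integral_eq_sub_of_hasDeriv_right_of_le ht.1
    (fun τ hτ => ((hd τ (hsub hτ)).mono hsub).continuousWithinAt)
    (fun τ hτ => ((hd τ (hsub (Ioo_subset_Icc_self hτ))).hasDerivAt
      (Icc_mem_nhds hτ.1 (hτ.2.trans_le ht.2))).hasDerivWithinAt)
    ((hf'.mono hsub).intervalIntegrable_of_Icc ht.1)
  have h1 : ‖f t - f 0‖ ≤ J := by
    rw [← hftc]
    refine (intervalIntegral.norm_integral_le_integral_norm ht.1).trans ?_
    rw [intervalIntegral.integral_of_le ht.1]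
    exact setIntegral_mono_set hi1 (ae_of_all _ fun _ => norm_nonneg _)
      (Ioc_subset_Icc_self.trans hsub).eventuallyLE
  have h2 : ‖f t‖ ≤ ‖f 0‖ + ‖f t - f 0‖ := by
    have := norm_add_le (f 0) (f t - f 0)
    simpa using this
  have h3 : ‖f t‖ ≤ ‖f 0‖ + J := by linarith
  have h4 : ‖f t‖ ^ 2 ≤ (‖f 0‖ + J) ^ 2 := pow_le_pow_left₀ (norm_nonneg _) h3 2
  nlinarith [sq_nonneg (‖f 0‖ - J)]

/-- The high modes of the solution. -/
lemma IsCoefSolution.sum_high_le {α β γ δ T s W G₀ E : ℝ} {u : ℝ → ℝ → ℝ} (hT : 0 < T) (hs : 0 ≤ s)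
    (h : IsCoefSolution ℓ α β γ δ T s W u) (hB : HasTimeBound ℓ α β γ δ T s G₀ E u) {m : ℕ}
    {F : Finset ℕ} (hF : ∀ k ∈ F, m ≤ k) {t : ℝ} (ht : t ∈ Icc 0 T) :
    ∑ k ∈ F, ‖rcoef ℓ (u t) k‖ ^ 2
      ≤ 2 * (1 + T) * (((1 + m : ℝ) ^ (-s)) ^ 2 * (G₀ ^ 2 + E ^ 2)) := by
  obtain ⟨h0, G, hG0, hG, hGE⟩ := hB
  have h1 : ∑ k ∈ F, ‖rcoef ℓ (u t) k‖ ^ 2 ≤ ∑ k ∈ F, (2 * ‖rcoef ℓ (u 0) k‖ ^ 2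
      + 2 * T * ∫ τ in Icc 0 T, ‖vseq ℓ α β γ δ (u τ) k‖ ^ 2) :=
    Finset.sum_le_sum fun k _ =>
      norm_sq_le_of_hasDerivWithinAt hT (h.hasDeriv k) (h.contDeriv k) ht
  have hi : ∀ k ∈ F, Integrable (fun τ => ‖vseq ℓ α β γ δ (u τ) k‖ ^ 2) (volume.restrict (Icc 0 T)) :=
    fun k _ => ((h.contDeriv k).norm.pow 2).integrableOn_Icc
  rw [Finset.sum_add_distrib, ← Finset.mul_sum, ← Finset.mul_sum, ← integral_finsetSum _ hi] at h1
  have h2 : ∫ τ in Icc 0 T, ∑ k ∈ F, ‖vseq ℓ α β γ δ (u τ) k‖ ^ 2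
      ≤ ((1 + m : ℝ) ^ (-s)) ^ 2 * E ^ 2 := by
    refine setIntegral_le_of_le_sq (continuousOn_finsetSum _ fun k _ => (h.contDeriv k).norm.pow 2)
      (fun τ _ => Finset.sum_nonneg fun k _ => sq_nonneg _) (sq_nonneg _) (hG.mono fun τ hτ => ?_) hGE
    rw [← mul_pow]
    exact hτ.2.sum_sq_le hs hF
  have h3 := h0.sum_sq_le hs hF
  rw [mul_pow] at h3
  set A := ((1 + m : ℝ) ^ (-s)) ^ 2
  have hA : 0 ≤ A := sq_nonneg _
  have h4 := mul_le_mul_of_nonneg_left h2 (by positivity : 0 ≤ 2 * T)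
  nlinarith [mul_nonneg hA (sq_nonneg G₀), mul_nonneg hA (sq_nonneg E),
    mul_nonneg hT.le (mul_nonneg hA (sq_nonneg G₀))]

end timebound

/-! ### The truncated solution -/

section truncated

variable {ℓ : ℝ} {p m : ℕ}

/-- The coefficients cut off. -/
def cutoff (p m : ℕ) (a : ℕ → ℂ) : Coef p := tr p fun k => chi m k * a k

lemma recon_cutoff (hm : 2 ≤ m) (hp : 5 * m ≤ p) (a : ℕ → ℂ) :
    recon ℓ (cutoff p m a) = synth ℓ fun k => chi m k * a k := by
  rw [recon, cutoff, ext_tr]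
  intro k hk
  rw [chi_of_ge hm (by omega)]
  simp

lemma norm_bmul_cutoff_le (hℓ : 0 < ℓ) (hm : 2 ≤ m) (hp : 5 * m ≤ p) {s W : ℝ} (hs : 1 ≤ s)
    (hW : 0 ≤ W) {a : ℕ → ℂ} (ha : HS s W a) (b : Coef p) :
    ‖bmul ℓ p (cutoff p m a) b‖ ≤ 2 * embConst * W * (psiConst ℓ / ℓ) * ‖b‖ := by
  refine norm_bmul_le hℓ _ b ?_ fun i => ?_
  · have := embConst_nonneg
    have := (psiConst_pos hℓ).le
    positivity
  · rw [ev_apply, recon_cutoff hm hp]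
    exact (ha.mul (chi_nonneg hm) (chi_le_one hm)).abs_synth_le hℓ hs hW _

lemma continuousOn_tr {f : ℝ → ℕ → ℂ} {S : Set ℝ} (h : ∀ k, ContinuousOn (fun t => f t k) S) :
    ContinuousOn (fun t => tr p (f t)) S :=
  (PiLp.continuous_toLp 2 _).comp_continuousOn (continuousOn_pi.2 fun k => h k)

lemma hasDerivWithinAt_tr {f : ℝ → ℕ → ℂ} {f' : ℕ → ℂ} {S : Set ℝ} {t : ℝ}
    (h : ∀ k, HasDerivWithinAt (fun τ => f τ k) (f' k) S t) :
    HasDerivWithinAt (fun τ => tr p (f τ)) (tr p f') S t := by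
  have h1 : HasDerivWithinAt (fun τ (k : Fin p) => f τ k) (fun k : Fin p => f' k) S t :=
    hasDerivWithinAt_pi.2 fun k => h k
  exact (PiLp.continuousLinearEquiv 2 ℝ (fun _ : Fin p => ℂ)).symm.hasFDerivAt.comp_hasDerivWithinAt t h1

lemma IsCoefSolution.hasDerivWithinAt_cutoff {α β γ δ T s W : ℝ} {u : ℝ → ℝ → ℝ}
    (h : IsCoefSolution ℓ α β γ δ T s W u) {t : ℝ} (ht : t ∈ Icc 0 T) :
    HasDerivWithinAt (fun τ => cutoff p m (rcoef ℓ (u τ))) (cutoff p m (vseq ℓ α β γ δ (u t)))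
      (Icc 0 T) t :=
  hasDerivWithinAt_tr fun k => (h.hasDeriv k t ht).const_mul _

lemma rpow_one_sub_eq {m : ℕ} (hm : 0 < m) (s : ℝ) :
    (m : ℝ) ^ (1 - s) = m * (m : ℝ) ^ (-s) := by
  have hm0 : (0 : ℝ) < m := by exact_mod_cast hm
  rw [sub_eq_add_neg, Real.rpow_add hm0, Real.rpow_one]

/-- The error of the initial value. -/
lemma norm_ic_sub_cutoff_le (hℓ : 0 < ℓ) (hm : 2 ≤ m) (hp : 5 * m ≤ p) {s W G : ℝ} (hs : 1 ≤ s)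
    (hW : 0 ≤ W) (hG : 0 ≤ G) {f : ℝ → ℝ} (hc : Continuous f) (hf : MemLp f 2 volume)
    (hfW : HS s W (rcoef ℓ f)) (hfG : HS s G (rcoef ℓ f)) :
    ‖ic ℓ p (fun i => f (node ℓ p i)) - cutoff p m (rcoef ℓ f)‖
      ≤ 2 * embConst * (m * (m : ℝ) ^ (-s) * G) := by
  set a := rcoef ℓ f with ha
  set b : ℕ → ℂ := fun k => a k - chi m k * a k with hb
  have hsa := hfW.summable hs hW
  have hsc := (hfW.mul (chi_nonneg hm) (chi_le_one hm)).summable hs hW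
  have hnb : ∀ k, ‖b k‖ = (1 - chi m k) * ‖a k‖ := fun k => by
    have : b k = ((1 - chi m k : ℝ) : ℂ) * a k := by rw [hb]; push_cast; ring
    rw [this, norm_mul, Complex.norm_real, Real.norm_of_nonneg (by linarith [chi_le_one hm k])]
  have hble : ∀ k, ‖b k‖ ≤ ‖a k‖ := fun k => by
    rw [hnb]
    exact mul_le_of_le_one_left (norm_nonneg _) (by linarith [chi_nonneg hm k])
  have hsb : Summable fun k => ‖b k‖ := hsa.of_nonneg_of_le (fun _ => norm_nonneg _) hble
  set S := ∑' k, ‖b k‖ with hS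
  have hS0 : 0 ≤ S := tsum_nonneg fun _ => norm_nonneg _
  have hSle : S ≤ embConst * (m * (m : ℝ) ^ (-s) * G) := by
    refine hsb.tsum_le_of_sum_le fun F => ?_
    have h1 : ∑ k ∈ F, ‖b k‖ ≤ ∑ k ∈ F.filter (m ≤ ·), ‖a k‖ := by
      rw [Finset.sum_filter]
      refine Finset.sum_le_sum fun k _ => ?_
      split_ifs with h
      · exact hble k
      · rw [hnb, chi_of_le (by omega)]
        simp
    refine h1.trans ((hfG.sum_norm_le hs hG fun k hk => (Finset.mem_filter.1 hk).2).trans ?_)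
    rw [← rpow_one_sub_eq (by omega)]
    have hm0 : (0 : ℝ) < m := by exact_mod_cast (by omega : 0 < m)
    have : (1 + m : ℝ) ^ (1 - s) ≤ (m : ℝ) ^ (1 - s) :=
      Real.rpow_le_rpow_of_nonpos hm0 (by linarith) (by linarith)
    have := embConst_nonneg
    gcongr
  have hfs : f = synth ℓ a := eq_synth_rcoef hℓ hc hf hsa
  have hy : ic ℓ p (fun i => f (node ℓ p i)) - cutoff p m a
      = ic ℓ p fun i => synth ℓ b (node ℓ p i) := by
    rw [← ic_ev hℓ (cutoff p m a), ← map_sub]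
    congr 1
    ext i
    rw [Pi.sub_apply, ev_apply, recon_cutoff hm hp, hb, synth_sub hℓ hsa hsc, ← hfs]
  have hsq : 2 * ‖ic ℓ p fun i => synth ℓ b (node ℓ p i)‖ ^ 2 ≤ 4 * S ^ 2 := by
    rw [norm_ic_sq hℓ]
    -- Nodal values of the tail are bounded by 2S|ψ_0|, and the quadrature weights times |ψ_0|² sum
    -- to one over the 2p nodes. The interpolation error is thus bounded by the ℓ¹ norm of the tail.
    have h1 : ∀ i : Fin (2 * p), qweight ℓ p i * synth ℓ b (node ℓ p i) ^ 2
        ≤ 4 * S ^ 2 * (1 / (2 * p)) := fun i => by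
      have h2 := abs_synth_le hℓ hsb (node ℓ p i)
      have h3 : synth ℓ b (node ℓ p i) ^ 2 ≤ (2 * S * ‖psi ℓ 0 (node ℓ p i)‖) ^ 2 := by
        rw [← sq_abs]
        exact pow_le_pow_left₀ (abs_nonneg _) h2 2
      calc _ ≤ qweight ℓ p i * (2 * S * ‖psi ℓ 0 (node ℓ p i)‖) ^ 2 :=
            mul_le_mul_of_nonneg_left h3 (qweight_nonneg hℓ i)
        _ = 4 * S ^ 2 * (qweight ℓ p i * ‖psi ℓ 0 (node ℓ p i)‖ ^ 2) := by ring
        _ = _ := by rw [qweight_mul_norm_psi_sq hℓ]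
    refine (Finset.sum_le_sum fun i _ => h1 i).trans (le_of_eq ?_)
    have hp0 : (0 : ℝ) < p := by exact_mod_cast (by omega : 0 < p)
    rw [Finset.sum_const, Finset.card_univ, Fintype.card_fin, nsmul_eq_mul]
    push_cast
    field_simp
  rw [hy]
  have h2S : ‖ic ℓ p fun i => synth ℓ b (node ℓ p i)‖ ≤ 2 * S := by
    refine abs_le_of_sq_le_sq' (by nlinarith) (by positivity) |>.2
  calc _ ≤ 2 * S := h2S
    _ ≤ _ := by rw [mul_assoc 2]; gcongr

/-- The distance of the solution from its truncation. -/
lemma IsCoefSolution.integral_sub_cutoff_sq_le (hℓ : 0 < ℓ) {α β γ δ T s W G₀ E : ℝ}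
    {u : ℝ → ℝ → ℝ} (hT : 0 < T) (hs : 0 ≤ s) (h : IsCoefSolution ℓ α β γ δ T s W u)
    (hB : HasTimeBound ℓ α β γ δ T s G₀ E u) (hm : 2 ≤ m) (hp : 5 * m ≤ p) {t : ℝ}
    (ht : t ∈ Icc 0 T) :
    ∫ x, (u t x - recon ℓ (cutoff p m (rcoef ℓ (u t))) x) ^ 2
      ≤ 4 * (1 + T) * (((m : ℝ) ^ (-s)) ^ 2 * (G₀ ^ 2 + E ^ 2)) := by
  have hL := h.memLp t ht
  have hd : MemLp (fun x => u t x - recon ℓ (cutoff p m (rcoef ℓ (u t))) x) 2 volume :=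
    hL.sub (memLp_rec hℓ _)
  have hS := hasSum_norm_sq_rcoef hℓ hd
  have hcoef : ∀ k, ‖rcoef ℓ (fun x => u t x - recon ℓ (cutoff p m (rcoef ℓ (u t))) x) k‖
      = (1 - chi m k) * ‖rcoef ℓ (u t) k‖ := fun k => by
    rw [rcoef_sub hℓ hL (memLp_rec hℓ _), rcoef_rec hℓ, cutoff, ext_tr (fun k hk => by
      rw [chi_of_ge hm (by omega)]; simp)]
    have : rcoef ℓ (u t) k - chi m k * rcoef ℓ (u t) k = ((1 - chi m k : ℝ) : ℂ) * rcoef ℓ (u t) k := by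
      push_cast; ring
    rw [this, norm_mul, Complex.norm_real, Real.norm_of_nonneg (by linarith [chi_le_one hm k])]
  rw [← hS.tsum_eq]
  refine hS.summable.tsum_le_of_sum_le fun F => ?_
  have h1 : ∑ k ∈ F, 2 * ‖rcoef ℓ (fun x => u t x - recon ℓ (cutoff p m (rcoef ℓ (u t))) x) k‖ ^ 2
      ≤ 2 * ∑ k ∈ F.filter (m ≤ ·), ‖rcoef ℓ (u t) k‖ ^ 2 := by
    rw [Finset.sum_filter, Finset.mul_sum]
    refine Finset.sum_le_sum fun k _ => mul_le_mul_of_nonneg_left ?_ zero_le_two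
    rw [hcoef]
    split_ifs with hk
    · have := chi_le_one hm k
      exact pow_le_pow_left₀ (mul_nonneg (by linarith) (norm_nonneg _))
        (mul_le_of_le_one_left (norm_nonneg _) (by linarith [chi_nonneg hm k])) 2
    · rw [chi_of_le (by omega)]
      simp
  refine h1.trans ?_
  have h2 := h.sum_high_le hT hs hB (m := m) (F := F.filter (m ≤ ·))
    (fun k hk => (Finset.mem_filter.1 hk).2) ht
  have hm0 : (0 : ℝ) < m := by exact_mod_cast (by omega : 0 < m)
  have h3 : ((1 + m : ℝ) ^ (-s)) ^ 2 ≤ ((m : ℝ) ^ (-s)) ^ 2 :=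
    pow_le_pow_left₀ (by positivity) (Real.rpow_le_rpow_of_nonpos hm0 (by linarith) (by linarith)) 2
  have h4 := mul_le_mul_of_nonneg_right h3 (show 0 ≤ G₀ ^ 2 + E ^ 2 by positivity)
  have h5 := mul_le_mul_of_nonneg_left h4 (show 0 ≤ 2 * (1 + T) by positivity)
  linarith

end truncated

end Benjamin
end

noncomputable section

namespace Benjamin

/-! ### Convergence of the coefficients -/

section convergence

variable {ℓ : ℝ} {p m : ℕ}

lemma HamSystem.contDiff_grad {E : Type*} [NormedAddCommGroup E] [InnerProductSpace ℝ E]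
    (S : HamSystem E) (α β γ δ : ℝ) : ContDiff ℝ 1 (S.grad α β γ δ) := by
  have h : ContDiff ℝ 1 fun a => S.B a a := S.B.contDiff.clm_apply contDiff_id
  exact (((contDiff_id.const_smul α).add (S.K.contDiff.const_smul β)).sub
    ((S.D.contDiff.comp S.D.contDiff).const_smul γ)).add (h.const_smul δ)

/-- The bound of the sum of the squares of the initial error and of the residuals. -/
def dataConst (ℓ C : ℝ) : ℝ := (1 + (128 / ℓ) ^ 2) * ((2 * embConst) ^ 2 + C ^ 2)

lemma dataConst_nonneg (ℓ C : ℝ) : 0 ≤ dataConst ℓ C := by unfold dataConst; positivity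

lemma norm_sq_add_norm_D_sq_le (hℓ : 0 < ℓ) (hm : 1 ≤ m) (hp : p ≤ 32 * m) {a : Coef p} {b : ℝ}
    (h : ‖a‖ ≤ b) :
    ‖a‖ ^ 2 + ‖(hamSystem hℓ p).D a‖ ^ 2 ≤ (1 + (128 / ℓ) ^ 2) * (m ^ 2 * b ^ 2) := by
  have hm0 : (1 : ℝ) ≤ m := by exact_mod_cast hm
  have hp0 : (p : ℝ) ≤ 32 * m := by exact_mod_cast hp
  have hb : 0 ≤ b := (norm_nonneg a).trans h
  have h1 : ‖(hamSystem hℓ p).D a‖ ≤ 128 / ℓ * (m * b) := by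
    rw [hamSystem_D]
    calc _ ≤ 4 * p / ℓ * ‖a‖ := norm_dmat_le hℓ a
      _ ≤ 4 * (32 * m) / ℓ * b := by gcongr
      _ = _ := by ring
  have h2 : ‖(hamSystem hℓ p).D a‖ ^ 2 ≤ (128 / ℓ * (m * b)) ^ 2 := pow_le_pow_left₀ (norm_nonneg _) h1 2
  have h3 : ‖a‖ ≤ m * b := h.trans (le_mul_of_one_le_left hb hm0)
  have h4 : ‖a‖ ^ 2 ≤ (m * b) ^ 2 := pow_le_pow_left₀ (norm_nonneg _) h3 2
  have e : (1 + (128 / ℓ) ^ 2) * (m ^ 2 * b ^ 2) = (m * b) ^ 2 + (128 / ℓ * (m * b)) ^ 2 := by ring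
  rw [e]
  exact add_le_add h4 h2

/-- Existence of the solution of the scheme and its distance to the truncated exact solution, for a
sufficiently fine discretization. -/
lemma IsCoefSolution.error_cutoff_le (hℓ : 0 < ℓ) {α β γ δ T s W C : ℝ} {u : ℝ → ℝ → ℝ}
    (hγ : γ ≠ 0) (hT : 0 < T) (hs : 1 ≤ s) (hW : 0 ≤ W)
    (h : IsCoefSolution ℓ α β γ δ T s W u) (hm : 4 ≤ m) (hp1 : 10 * m ≤ p) (hp2 : p ≤ 32 * m)
    (hres : ∀ t ∈ Icc 0 T, ∀ G, 0 ≤ G → HS s G (rcoef ℓ (u t)) → HS s G (vseq ℓ α β γ δ (u t)) →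
      ‖cutoff p m (vseq ℓ α β γ δ (u t)) + (hamSystem hℓ p).D ((hamSystem hℓ p).grad α β γ δ
        (cutoff p m (rcoef ℓ (u t))))‖ ≤ C * (m * (m : ℝ) ^ (-s) * G))
    (hsmall : stabBound α β γ δ (2 * embConst * W * (psiConst ℓ / ℓ)) T *
      (dataConst ℓ C * (((m : ℝ) ^ 2 * (m : ℝ) ^ (-s)) ^ 2 * (W ^ 2 + (Real.sqrt T * W) ^ 2)))
      < (1 / (2 * (psiConst ℓ / ℓ) * Real.sqrt p)) ^ 2) :
    (∃ ubar : ℝ → ℝ → ℝ, IsCollocationSolution ℓ p α β γ δ T (u 0) ubar) ∧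
    ∀ y : ℝ → Coef p, y 0 = ic ℓ p (fun i => u 0 (node ℓ p i)) →
      (∀ t ∈ Icc 0 T, HasDerivWithinAt y (-(hamSystem hℓ p).D ((hamSystem hℓ p).grad α β γ δ (y t)))
        (Icc 0 T) t) →
      ∀ G₀ E : ℝ, 0 ≤ G₀ → HasTimeBound ℓ α β γ δ T s G₀ E u → ∀ t ∈ Icc 0 T,
        ‖y t - cutoff p m (rcoef ℓ (u t))‖ ^ 2 ≤
          stabBound α β γ δ (2 * embConst * W * (psiConst ℓ / ℓ)) T *
            (dataConst ℓ C * (((m : ℝ) ^ 2 * (m : ℝ) ^ (-s)) ^ 2 * (G₀ ^ 2 + E ^ 2))) := by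
  set S := hamSystem hℓ p with hS
  set A := 2 * embConst * W * (psiConst ℓ / ℓ) with hA
  have hψ : 0 < psiConst ℓ / ℓ := div_pos (psiConst_pos hℓ) hℓ
  have hA0 : 0 ≤ A := by have := embConst_nonneg; positivity
  have hm2 : 2 ≤ m := by omega
  have hp5 : 5 * m ≤ p := by omega
  have hp0 : (0 : ℝ) < p := by exact_mod_cast (by omega : 0 < p)
  set κ := 2 * (psiConst ℓ / ℓ) * Real.sqrt p with hκ
  have hκ0 : 0 < κ := by positivity
  -- Here κ is the norm bound of the discrete product, of order √p, so that κ‖e‖ ≤ 1 within the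
  -- radius.
  set r := 1 / κ with hr
  have hr0 : 0 < r := by positivity
  have hκr : κ * r ≤ 1 := by rw [hr, mul_one_div_cancel hκ0.ne']
  have h0T : (0 : ℝ) ∈ Icc 0 T := ⟨le_rfl, hT.le⟩
  set w : ℝ → Coef p := fun t => cutoff p m (rcoef ℓ (u t)) with hw
  set w' : ℝ → Coef p := fun t => cutoff p m (vseq ℓ α β γ δ (u t)) with hw'
  set R : ℝ → Coef p := fun t => w' t + S.D (S.grad α β γ δ (w t)) with hR
  have hwd : ∀ t ∈ Icc 0 T, HasDerivWithinAt w (w' t) (Icc 0 T) t := fun t ht =>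
    h.hasDerivWithinAt_cutoff ht
  have hwc : ContinuousOn w (Icc 0 T) := fun t ht => (hwd t ht).continuousWithinAt
  have hw'c : ContinuousOn w' (Icc 0 T) :=
    continuousOn_tr fun k => continuousOn_const.mul (h.contDeriv k)
  have hgc : Continuous (S.grad α β γ δ) := (S.contDiff_grad α β γ δ).continuous
  have hRc : ContinuousOn R (Icc 0 T) :=
    hw'c.add (S.D.continuous.comp_continuousOn (hgc.comp_continuousOn hwc))
  set f : ℝ → ℝ := fun t => ‖R t‖ ^ 2 + ‖S.D (R t)‖ ^ 2 with hf
  have hfc : ContinuousOn f (Icc 0 T) :=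
    (hRc.norm.pow 2).add ((S.D.continuous.comp_continuousOn hRc).norm.pow 2)
  obtain ⟨P, hP0, hP, hPT⟩ := exists_primitive hT.le hfc
  set μ := (m : ℝ) ^ 2 * (m : ℝ) ^ (-s) with hμ
  set St := stabBound α β γ δ A T with hSt
  have hSt0 : 0 < St := stabBound_pos hA0
  have hB : ∀ a b, ‖S.B a b‖ ≤ κ * ‖a‖ * ‖b‖ := norm_bmul_le_mul hℓ
  have hA1 : ∀ t ∈ Icc 0 T, ∀ b, ‖S.B (w t) b‖ ≤ A * ‖b‖ := fun t ht b =>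
    norm_bmul_cutoff_le hℓ hm2 hp5 hs hW (h.hs t ht) b
  have hA2 : ∀ t ∈ Icc 0 T, ∀ b, ‖S.B (w' t) b‖ ≤ A * ‖b‖ := fun t ht b =>
    norm_bmul_cutoff_le hℓ hm2 hp5 hs hW (h.hs' t ht) b
  have hwR : ∀ t ∈ Icc 0 T, w' t = -S.D (S.grad α β γ δ (w t)) + R t := fun t _ => by
    simp only [hR]
    rw [add_comm (w' t), neg_add_cancel_left]
  set e₀ := ic ℓ p (fun i => u 0 (node ℓ p i)) - w 0 with he₀
  have hdata : ∀ G₀ E : ℝ, 0 ≤ G₀ → HasTimeBound ℓ α β γ δ T s G₀ E u →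
      ‖e₀‖ ^ 2 + ‖S.D e₀‖ ^ 2 + P T ≤ dataConst ℓ C * (μ ^ 2 * (G₀ ^ 2 + E ^ 2)) := by
    intro G₀ E hG₀ hGB
    have h1 : ‖e₀‖ ≤ 2 * embConst * (m * (m : ℝ) ^ (-s) * G₀) :=
      norm_ic_sub_cutoff_le hℓ hm2 hp5 hs hW hG₀ (h.cont 0 h0T) (h.memLp 0 h0T) (h.hs 0 h0T) hGB.1
    have h2 := norm_sq_add_norm_D_sq_le hℓ (by omega : 1 ≤ m) hp2 h1
    obtain ⟨G, hG0, hG, hGE⟩ := hGB.2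
    have h3 : ∫ t in Icc 0 T, f t ≤
        ((1 + (128 / ℓ) ^ 2) * C ^ 2 * μ ^ 2) * E ^ 2 := by
      refine setIntegral_le_of_le_sq hfc (fun t _ => by positivity) (by positivity) ?_ hGE
      filter_upwards [hG, ae_restrict_mem measurableSet_Icc] with t ht htT
      have h4 := norm_sq_add_norm_D_sq_le hℓ (by omega : 1 ≤ m) hp2
        (hres t htT (G t) (hG0 t) ht.1 ht.2)
      refine h4.trans (le_of_eq ?_)
      rw [hμ]
      ring
    rw [hPT]
    have e : dataConst ℓ C * (μ ^ 2 * (G₀ ^ 2 + E ^ 2))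
        = (1 + (128 / ℓ) ^ 2) * (m ^ 2 * (2 * embConst * (m * (m : ℝ) ^ (-s) * G₀)) ^ 2)
          + ((1 + (128 / ℓ) ^ 2) * C ^ 2 * μ ^ 2) * E ^ 2
          + (1 + (128 / ℓ) ^ 2) * μ ^ 2 * ((2 * embConst) ^ 2 * E ^ 2 + C ^ 2 * G₀ ^ 2) := by
      rw [dataConst, hμ]
      ring
    rw [e]
    have h5 : 0 ≤ (1 + (128 / ℓ) ^ 2) * μ ^ 2 * ((2 * embConst) ^ 2 * E ^ 2 + C ^ 2 * G₀ ^ 2) := by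
      positivity
    have h2' : ‖e₀‖ ^ 2 + ‖S.D e₀‖ ^ 2
      ≤ (1 + (128 / ℓ) ^ 2) * (m ^ 2 * (2 * embConst * (m * (m : ℝ) ^ (-s) * G₀)) ^ 2) := h2
    linarith
  -- Smallness is decided by the uniform bound W alone, so the threshold for p does not depend on u;
  -- the final estimate uses the finer data G₀ and E.
  have hcrude := hdata W (Real.sqrt T * W) hW (h.hasTimeBound hT.le hW)
  have hsm : St * (‖e₀‖ ^ 2 + ‖S.D e₀‖ ^ 2 + P T) < r ^ 2 :=
    (mul_le_mul_of_nonneg_left hcrude hSt0.le).trans_lt hsmall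
  have hPT0 : 0 ≤ P T := by
    rw [hPT]
    exact integral_nonneg fun t => by positivity
  have hSt1 : 1 ≤ St := by
    have h1 := one_le_stabConst (α := α) (β := β) (γ := γ) (δ := δ) hA0
    have h2 := one_le_stabShift (α := α) (β := β) (γ := γ) (δ := δ) hA0
    have h3 := stabRate_nonneg (α := α) (β := β) (γ := γ) (δ := δ) hA0
    have h4 : 1 ≤ Real.exp (stabRate α β γ δ A * T) := Real.one_le_exp (by positivity)
    rw [hSt, stabBound]
    nlinarith
  have hinit : ‖e₀‖ < r := by
    refine lt_of_pow_lt_pow_left₀ 2 hr0.le (lt_of_le_of_lt ?_ hsm)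
    nlinarith [sq_nonneg ‖e₀‖, sq_nonneg ‖S.D e₀‖]
  have main : ∀ y : ℝ → Coef p, y 0 = ic ℓ p (fun i => u 0 (node ℓ p i)) → ContinuousOn y (Icc 0 T) →
      (∀ t ∈ Icc 0 T, ‖y t - w t‖ ≤ r → HasDerivWithinAt y (-S.D (S.grad α β γ δ (y t))) (Icc 0 T) t) →
      ∀ t ∈ Icc 0 T, ‖y t - w t‖ < r ∧
        ‖y t - w t‖ ^ 2 ≤ St * (‖e₀‖ ^ 2 + ‖S.D e₀‖ ^ 2 + P T) := by
    intro y hy0 hyc hyd t ht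
    have := S.error_le hγ hA0 hr0.le hκ0.le hκr hB hwd hwR hA1 hA2 hyc hyd hP hP0
      (by rw [hy0]; exact hinit) (by rw [hy0]; exact hsm) ht
    rwa [hy0] at this
  constructor
  -- The field is truncated outside a ball that contains the r-neighbourhood of the curve w. The
  -- stability estimate keeps the solution in that neighbourhood, where it solves the original
  -- equation.
  · obtain ⟨ρ, hρ⟩ := isCompact_Icc.exists_bound_of_continuousOn hwc
    have hρ0 : 0 ≤ ρ := (norm_nonneg _).trans (hρ 0 h0T)
    obtain ⟨y, hy0, hyc, hyd⟩ := exists_truncated_solution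
      (F := fun a => -S.D (S.grad α β γ δ a)) (S.D.contDiff.comp (S.contDiff_grad α β γ δ)).neg hT.le
      (by positivity : 0 < ρ + r) (ic ℓ p fun i => u 0 (node ℓ p i))
    have hyd' : ∀ t ∈ Icc 0 T, ‖y t - w t‖ ≤ r →
        HasDerivWithinAt y (-S.D (S.grad α β γ δ (y t))) (Icc 0 T) t := fun t ht hle => by
      refine hyd t ht ?_
      have := norm_add_le (w t) (y t - w t)
      rw [add_sub_cancel] at this
      linarith [hρ t ht]
    exact ⟨_, isCollocationSolution_of_coef hℓ hy0 fun t ht =>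
      hyd' t ht (main y hy0 hyc hyd' t ht).1.le⟩
  · intro y hy0 hyd G₀ E hG₀ hGB t ht
    refine (main y hy0 (fun t ht => (hyd t ht).continuousWithinAt) (fun t ht _ => hyd t ht) t ht).2.trans ?_
    exact mul_le_mul_of_nonneg_left (hdata G₀ E hG₀ hGB) hSt0.le

end convergence

end Benjamin
end

noncomputable section

namespace Benjamin

/-! ### Convergence of the scheme -/

section scheme

variable {ℓ : ℝ}

/-- The squared error m^{4-2s} must be below the squared radius, which is of order 1/p; as m is
comparable to p this is m^{5-2s} → 0, the only place where s > 5/2 is needed. -/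
lemma eventually_small {s : ℝ} (hs : 5 / 2 < s) (A κ : ℝ) (hκ : 0 < κ) : ∀ᶠ p : ℕ in atTop,
    A * ((((p / 16 : ℕ) : ℝ) ^ 2 * ((p / 16 : ℕ) : ℝ) ^ (-s)) ^ 2) < (1 / (κ * Real.sqrt p)) ^ 2 := by
  have hlim : Tendsto (fun p : ℕ => |A| * (κ ^ 2 * 32) * ((p / 16 : ℕ) : ℝ) ^ (-(2 * s - 5))) atTop (𝓝 0) := by
    have h := (tendsto_rpow_neg_atTop (y := 2 * s - 5) (by linarith)).comp
      (tendsto_natCast_atTop_atTop.comp (Nat.tendsto_div_const_atTop (n := 16) (by norm_num)))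
    simpa using h.const_mul (|A| * (κ ^ 2 * 32))
  filter_upwards [hlim.eventually (gt_mem_nhds one_pos), eventually_ge_atTop 16] with p hp h16
  set m := p / 16 with hm
  have hm1 : 1 ≤ m := by omega
  have hm0 : (0 : ℝ) < m := by exact_mod_cast (by omega : 0 < m)
  have hp0 : (0 : ℝ) < p := by exact_mod_cast (by omega : 0 < p)
  have hpm : (p : ℝ) ≤ 32 * m := by exact_mod_cast (by omega : p ≤ 32 * m)
  set μ := (m : ℝ) ^ 2 * (m : ℝ) ^ (-s) with hμ
  have e : (m : ℝ) ^ (-(2 * s - 5)) = μ ^ 2 * m := by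
    have e1 : (m : ℝ) ^ (-(2 * s - 5)) = (m : ℝ) ^ (-s) * (m : ℝ) ^ (-s) * (m : ℝ) ^ (5 : ℝ) := by
      rw [← Real.rpow_add hm0, ← Real.rpow_add hm0]
      congr 1
      ring
    rw [e1, hμ, show (5 : ℝ) = ((5 : ℕ) : ℝ) by norm_num, Real.rpow_natCast]
    ring
  rw [e] at hp
  rw [div_pow, one_pow, mul_pow κ, Real.sq_sqrt hp0.le, lt_div_iff₀ (by positivity)]
  calc A * μ ^ 2 * (κ ^ 2 * p) ≤ |A| * μ ^ 2 * (κ ^ 2 * (32 * m)) := by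
        gcongr
        exact le_abs_self A
    _ = |A| * (κ ^ 2 * 32) * (μ ^ 2 * m) := by ring
    _ < 1 := hp

lemma normL2_le {f : ℝ → ℝ} (hf : MemLp f 2 volume) {c : ℝ} (hc : 0 ≤ c) (h : ∫ x, f x ^ 2 ≤ c ^ 2) :
    normL2 f ≤ ENNReal.ofReal c := by
  rw [normL2, hf.eLpNorm_eq_integral_rpow_norm two_ne_zero ENNReal.ofNat_ne_top]
  refine ENNReal.ofReal_le_ofReal ?_
  simp only [ENNReal.toReal_ofNat, Real.rpow_two, Real.norm_eq_abs, sq_abs]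
  calc _ ≤ (c ^ 2) ^ (2 : ℝ)⁻¹ := Real.rpow_le_rpow (integral_nonneg fun _ => sq_nonneg _) h (by norm_num)
    _ = c := by
      rw [← Real.rpow_natCast, ← Real.rpow_mul hc]
      norm_num

lemma sub_sq_le_two_mul (a b c : ℝ) : (a - b) ^ 2 ≤ 2 * (a - c) ^ 2 + 2 * (b - c) ^ 2 := by
  nlinarith [sq_nonneg (a - c + (b - c))]

/-- Existence of the solution of the scheme and the error estimate. -/
theorem exists_error_bound (hℓ : 0 < ℓ) (α β δ : ℝ) {γ T s W : ℝ} (hγ : γ ≠ 0) (hT : 0 < T)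
    (hs : 5 / 2 < s) (hW : 0 ≤ W) : ∃ C, 0 ≤ C ∧ ∃ N : ℕ, ∀ p : ℕ, N ≤ p → ∀ u : ℝ → ℝ → ℝ,
      IsCoefSolution ℓ α β γ δ T s W u →
      (∃ ubar : ℝ → ℝ → ℝ, IsCollocationSolution ℓ p α β γ δ T (u 0) ubar) ∧
      ∀ ubar : ℝ → ℝ → ℝ, IsCollocationSolution ℓ p α β γ δ T (u 0) ubar →
        ∀ G₀ E : ℝ, 0 ≤ G₀ → 0 ≤ E → HasTimeBound ℓ α β γ δ T s G₀ E u →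
          normLinfty T normL2 (fun t x => u t x - ubar t x)
            ≤ ENNReal.ofReal (C * (p : ℝ) ^ (2 - s) * (G₀ + E)) := by
  have hs1 : 1 ≤ s := by linarith
  obtain ⟨C, _, hres⟩ := exists_residual_bound hℓ α β δ hγ hs1 hW
  set A := 2 * embConst * W * (psiConst ℓ / ℓ) with hA
  have hψ : 0 < psiConst ℓ / ℓ := div_pos (psiConst_pos hℓ) hℓ
  have hA0 : 0 ≤ A := by have := embConst_nonneg; positivity
  set St := stabBound α β γ δ A T with hSt
  have hSt0 : 0 < St := stabBound_pos hA0
  have hD0 := dataConst_nonneg ℓ C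
  set Q := 8 * (1 + T) + 4 * (St * dataConst ℓ C) with hQ
  have hQ0 : 0 ≤ Q := by positivity
  obtain ⟨N, hN⟩ := eventually_atTop.1 (eventually_small hs
    (St * (dataConst ℓ C * (W ^ 2 + (Real.sqrt T * W) ^ 2))) (2 * (psiConst ℓ / ℓ)) (by positivity))
  refine ⟨Real.sqrt Q * 32 ^ (s - 2), by positivity, max N 64, fun p hp u hu => ?_⟩
  have hp64 : 64 ≤ p := (le_max_right _ _).trans hp
  have hsmall := hN p ((le_max_left _ _).trans hp)
  -- Any fixed fraction with 10m ≤ p ≤ 32m would do: the lower bound on p excludes aliasing of the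
  -- cutoff at 5m, and p ≥ 64 gives m ≥ 4.
  set m := p / 16 with hm
  have hm4 : 4 ≤ m := by omega
  have hp1 : 10 * m ≤ p := by omega
  have hp2 : p ≤ 32 * m := by omega
  have hm0 : (4 : ℝ) ≤ m := by exact_mod_cast hm4
  have hp0 : (0 : ℝ) < p := by exact_mod_cast (by omega : 0 < p)
  set μ := (m : ℝ) ^ 2 * (m : ℝ) ^ (-s) with hμ
  have hμ0 : 0 ≤ μ := by positivity
  obtain ⟨hex, herr⟩ := hu.error_cutoff_le hℓ hγ hT hs1 hW hm4 hp1 hp2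
    (fun t ht G hG h1 h2 => hres m p hm4 hp1 hp2 (u t) G hG (hu.cont t ht) (hu.memLp t ht)
      (hu.hs t ht) h1 h2) (by
      refine lt_of_eq_of_lt ?_ hsmall
      ring)
  refine ⟨hex, fun ubar hubar G₀ E hG₀ hE hB => ?_⟩
  obtain ⟨y, hy, hy0, hyd⟩ := hubar.exists_coef hℓ hT.le
  refine essSup_le_of_ae_le _ ?_
  filter_upwards [ae_restrict_mem measurableSet_Icc] with t ht
  have h1 := herr y hy0 hyd G₀ E hG₀ hB t ht
  set w := cutoff p m (rcoef ℓ (u t)) with hw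
  have h2 : ∫ x, (u t x - recon ℓ w x) ^ 2
      ≤ 4 * (1 + T) * (((m : ℝ) ^ (-s)) ^ 2 * (G₀ ^ 2 + E ^ 2)) :=
    hu.integral_sub_cutoff_sq_le hℓ hT (by linarith) hB (by omega) (by omega) ht
  have hL := hu.memLp t ht
  have hrw := memLp_rec hℓ w
  have hry := memLp_rec hℓ (y t)
  rw [hy t ht]
  have hd : MemLp (fun x => u t x - recon ℓ (y t) x) 2 volume := hL.sub hry
  have hd1 : MemLp (fun x => u t x - recon ℓ w x) 2 volume := hL.sub hrw
  have e1 : ∀ x, recon ℓ (y t - w) x = recon ℓ (y t) x - recon ℓ w x := fun x =>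
    congr_fun ((recL ℓ p).map_sub (y t) w) x
  have h3 : ∫ x, (recon ℓ (y t) x - recon ℓ w x) ^ 2 = 2 * ‖y t - w‖ ^ 2 := by
    simp only [← e1]
    exact integral_rec_sq hℓ _
  have hd2 : MemLp (fun x => recon ℓ (y t) x - recon ℓ w x) 2 volume := hry.sub hrw
  have h4 : ∫ x, (u t x - recon ℓ (y t) x) ^ 2 ≤ 2 * (∫ x, (u t x - recon ℓ w x) ^ 2)
      + 2 * ∫ x, (recon ℓ (y t) x - recon ℓ w x) ^ 2 := by
    rw [← integral_const_mul, ← integral_const_mul, ← integral_add (hd1.integrable_sq.const_mul _)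
      (hd2.integrable_sq.const_mul _)]
    refine integral_mono hd.integrable_sq ((hd1.integrable_sq.const_mul _).add
      (hd2.integrable_sq.const_mul _)) fun x => ?_
    exact sub_sq_le_two_mul _ _ _
  have h5 : (m : ℝ) ^ (-s) ≤ μ := le_mul_of_one_le_left (by positivity) (one_le_pow₀ (by linarith))
  have h6 : ((m : ℝ) ^ (-s)) ^ 2 ≤ μ ^ 2 := pow_le_pow_left₀ (by positivity) h5 2
  have hμp : μ ≤ 32 ^ (s - 2) * (p : ℝ) ^ (2 - s) := by
    have hp2' : (p : ℝ) ≤ 32 * m := by exact_mod_cast hp2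
    have e2 : μ = (m : ℝ) ^ (2 - s) := by
      rw [hμ, sub_eq_add_neg, Real.rpow_add (by linarith), Real.rpow_two]
    have e3 : (32 : ℝ) ^ (s - 2) * (p : ℝ) ^ (2 - s) = ((p : ℝ) / 32) ^ (2 - s) := by
      rw [Real.div_rpow hp0.le (by norm_num), show s - 2 = -(2 - s) by ring,
        Real.rpow_neg (by norm_num : (0 : ℝ) ≤ 32)]
      ring
    rw [e2, e3]
    exact Real.rpow_le_rpow_of_nonpos (by positivity) (by linarith) (by linarith)
  set B := G₀ ^ 2 + E ^ 2 with hBdef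
  have hB0 : 0 ≤ B := by positivity
  have h7 : ∫ x, (u t x - recon ℓ (y t) x) ^ 2 ≤ Q * (μ ^ 2 * B) := by
    have h8 := mul_le_mul_of_nonneg_left (mul_le_mul_of_nonneg_right h6 hB0)
      (by positivity : 0 ≤ 8 * (1 + T))
    rw [h3] at h4
    rw [hQ]
    linarith
  have hBle : B ≤ (G₀ + E) ^ 2 := by
    rw [hBdef, add_sq]
    linarith [mul_nonneg hG₀ hE]
  refine normL2_le hd (by positivity) (h7.trans ?_)
  calc Q * (μ ^ 2 * B) ≤ Q * ((32 ^ (s - 2) * (p : ℝ) ^ (2 - s)) ^ 2 * (G₀ + E) ^ 2) := by gcongr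
    _ = (Real.sqrt Q) ^ 2 * ((32 ^ (s - 2) * (p : ℝ) ^ (2 - s)) ^ 2 * (G₀ + E) ^ 2) := by
        rw [Real.sq_sqrt hQ0]
    _ = _ := by ring

end scheme

end Benjamin
end

noncomputable section

namespace Benjamin

/-! ### The error in terms of the norms of the solution -/

section norms

variable {ℓ : ℝ} {X : ℝ → ℝ → (ℝ → ℝ) → ℝ≥0∞}

lemma HS.mono {s W W' : ℝ} {a : ℕ → ℂ} (h : HS s W a) (hW : 0 ≤ W) (hWW : W ≤ W') : HS s W' a :=
  fun K => (h K).trans (pow_le_pow_left₀ hW hWW 2)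

lemma hs_of_le {s C x : ℝ} {a : ℕ → ℂ} {N : ℝ≥0∞} (hC : 0 < C) (hx : 0 ≤ x)
    (h : ∀ K : ℕ, ENNReal.ofReal (Real.sqrt (∑ k ∈ Finset.range K, (1 + k : ℝ) ^ (2 * s) *
      ‖a k‖ ^ 2) / C) ≤ N) (hN : N ≤ ENNReal.ofReal x) : HS s (C * x) a := fun K => by
  have h1 := (ENNReal.ofReal_le_ofReal_iff hx).1 ((h K).trans hN)
  rw [div_le_iff₀ hC, mul_comm x] at h1
  exact (Real.sqrt_le_iff.1 h1).2

/-- A classical solution with bounded norms, in terms of coefficients. -/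
lemma isCoefSolution_of_normLinfty_le (hℓ : 0 < ℓ) {α β γ δ T s C M : ℝ} (hT : 0 < T) (hs : 1 ≤ s)
    (hC : 0 < C) (hM : 0 ≤ M) (hL : ∀ f, X s (2 * s) f ≠ ⊤ → MemLp f 2 volume)
    (hX : ∀ f : ℝ → ℝ, ∀ K : ℕ, ENNReal.ofReal (Real.sqrt (∑ k ∈ Finset.range K,
      (1 + k : ℝ) ^ (2 * s) * ‖rcoef ℓ f k‖ ^ 2) / C) ≤ X s (2 * s) f) {u v : ℝ → ℝ → ℝ}
    (h : IsClassicalSolution α β γ δ T u v)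
    (hu : normLinfty T (X s (2 * s)) u ≤ ENNReal.ofReal M)
    (hv : normLinfty T (X s (2 * s)) v ≤ ENNReal.ofReal M) :
    IsCoefSolution ℓ α β γ δ T s (C * M) u ∧
      ∀ᵐ t ∂volume.restrict (Icc 0 T), ∀ k, vseq ℓ α β γ δ (u t) k = rcoef ℓ (v t) k := by
  refine isCoefSolution_of_classical hℓ hT hs (by positivity) h ?_
  filter_upwards [ENNReal.ae_le_essSup (μ := volume.restrict (Icc 0 T)) fun t => X s (2 * s) (u t),
    ENNReal.ae_le_essSup (μ := volume.restrict (Icc 0 T)) fun t => X s (2 * s) (v t)] with t h1 h2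
  have h1' := h1.trans hu
  have h2' := h2.trans hv
  exact ⟨hL _ (h1'.trans_lt ENNReal.ofReal_lt_top).ne, hL _ (h2'.trans_lt ENNReal.ofReal_lt_top).ne,
    hs_of_le hC hM (hX _) h1', hs_of_le hC hM (hX _) h2'⟩

/-- Bounds in time by the norms of the solution. -/
lemma hasTimeBound_of_norms {α β γ δ T s C M : ℝ} (hC : 0 < C)
    (hX : ∀ f : ℝ → ℝ, ∀ K : ℕ, ENNReal.ofReal (Real.sqrt (∑ k ∈ Finset.range K,
      (1 + k : ℝ) ^ (2 * s) * ‖rcoef ℓ f k‖ ^ 2) / C) ≤ X s (2 * s) f) {u v : ℝ → ℝ → ℝ}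
    (hu : normLinfty T (X s (2 * s)) u ≤ ENNReal.ofReal M)
    (hv : normLinfty T (X s (2 * s)) v ≤ ENNReal.ofReal M)
    (hvs : ∀ᵐ t ∂volume.restrict (Icc 0 T), ∀ k, vseq ℓ α β γ δ (u t) k = rcoef ℓ (v t) k)
    (h0 : X s (2 * s) (u 0) ≠ ⊤) (h1 : normH1 T (X s (2 * s)) u v ≠ ⊤) :
    HasTimeBound ℓ α β γ δ T s (C * (X s (2 * s) (u 0)).toReal)
      (Real.sqrt 2 * C * (normH1 T (X s (2 * s)) u v).toReal) u := by
  have hae := (ENNReal.ae_le_essSup (μ := volume.restrict (Icc 0 T)) fun t => X s (2 * s) (u t)).and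
    (ENNReal.ae_le_essSup (μ := volume.restrict (Icc 0 T)) fun t => X s (2 * s) (v t))
  have hfin : ∀ᵐ t ∂volume.restrict (Icc 0 T), X s (2 * s) (u t) ≠ ⊤ ∧ X s (2 * s) (v t) ≠ ⊤ := by
    filter_upwards [hae] with t ht
    exact ⟨((ht.1.trans hu).trans_lt ENNReal.ofReal_lt_top).ne,
      ((ht.2.trans hv).trans_lt ENNReal.ofReal_lt_top).ne⟩
  have hHS : ∀ f : ℝ → ℝ, X s (2 * s) f ≠ ⊤ → HS s (C * (X s (2 * s) f).toReal) (rcoef ℓ f) :=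
    fun f hf => hs_of_le hC ENNReal.toReal_nonneg (hX f) (ENNReal.ofReal_toReal hf).ge
  refine ⟨hHS _ h0, fun t => C * ((X s (2 * s) (u t)).toReal + (X s (2 * s) (v t)).toReal),
    fun t => by positivity, ?_, ?_⟩
  · filter_upwards [hfin, hvs] with t ht htv
    have n1 : 0 ≤ (X s (2 * s) (u t)).toReal := ENNReal.toReal_nonneg
    have n2 : 0 ≤ (X s (2 * s) (v t)).toReal := ENNReal.toReal_nonneg
    refine ⟨(hHS _ ht.1).mono (by positivity) ?_, ?_⟩
    · gcongr
      linarith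
    · rw [funext htv]
      refine (hHS _ ht.2).mono (by positivity) ?_
      gcongr
      linarith
  · have hI : ∫⁻ t in Icc 0 T, (X s (2 * s) (u t) ^ 2 + X s (2 * s) (v t) ^ 2)
        = normH1 T (X s (2 * s)) u v ^ 2 := by
      rw [normH1, ← ENNReal.rpow_natCast, ← ENNReal.rpow_mul]
      norm_num
    calc _ ≤ ∫⁻ t in Icc 0 T, ENNReal.ofReal (2 * C ^ 2) *
          (X s (2 * s) (u t) ^ 2 + X s (2 * s) (v t) ^ 2) := by
          refine lintegral_mono_ae (hfin.mono fun t ht => ?_)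
          have e : X s (2 * s) (u t) ^ 2 + X s (2 * s) (v t) ^ 2
              = ENNReal.ofReal ((X s (2 * s) (u t)).toReal ^ 2 + (X s (2 * s) (v t)).toReal ^ 2) := by
            rw [ENNReal.ofReal_add (sq_nonneg _) (sq_nonneg _), ENNReal.ofReal_pow ENNReal.toReal_nonneg,
              ENNReal.ofReal_pow ENNReal.toReal_nonneg, ENNReal.ofReal_toReal ht.1,
              ENNReal.ofReal_toReal ht.2]
          rw [e, ← ENNReal.ofReal_mul (by positivity)]
          refine ENNReal.ofReal_le_ofReal ?_
          rw [mul_pow, mul_comm 2 (C ^ 2), mul_assoc]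
          refine mul_le_mul_of_nonneg_left ?_ (sq_nonneg C)
          exact add_sq_le
      _ = ENNReal.ofReal (2 * C ^ 2) * normH1 T (X s (2 * s)) u v ^ 2 := by
          rw [lintegral_const_mul' _ _ ENNReal.ofReal_ne_top, hI]
      _ = _ := by
          rw [mul_pow, mul_pow, Real.sq_sqrt zero_le_two, ENNReal.ofReal_mul (by positivity : 0 ≤ 2 * C ^ 2),
            ENNReal.ofReal_pow ENNReal.toReal_nonneg, ENNReal.ofReal_toReal h1]

/-- The spare factor p^{1/2+ε} absorbs every constant. The exponent on the right can have either
sign, so the base is compared with ℓp/2 from below or with ℓp from above. -/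
lemma eventually_const_mul_rpow_le (hℓ : 0 < ℓ) {s ε : ℝ} (hε : 0 < ε) (A : ℝ) :
    ∀ᶠ p : ℕ in atTop,
      A * (p : ℝ) ^ (2 - s) ≤ (ℓ * (2 * (p : ℝ) - 1) / 2) ^ (5 / 2 + ε - s) := by
  set e := 5 / 2 + ε - s with he
  set c := min (ℓ ^ e) ((ℓ / 2) ^ e) with hc
  have hc0 : 0 < c := lt_min (by positivity) (by positivity)
  have hlim : Tendsto (fun p : ℕ => c * (p : ℝ) ^ (1 / 2 + ε)) atTop atTop :=
    ((tendsto_rpow_atTop (by linarith : 0 < 1 / 2 + ε)).comp tendsto_natCast_atTop_atTop).const_mul_atTop hc0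
  filter_upwards [hlim.eventually_ge_atTop A, eventually_ge_atTop 1] with p hp hp1
  have hp0 : (1 : ℝ) ≤ p := by exact_mod_cast hp1
  have hpp : (0 : ℝ) < p := by linarith
  have h1 : A * (p : ℝ) ^ (2 - s) ≤ c * (p : ℝ) ^ e := by
    calc A * (p : ℝ) ^ (2 - s) ≤ c * (p : ℝ) ^ (1 / 2 + ε) * (p : ℝ) ^ (2 - s) := by gcongr
      _ = c * (p : ℝ) ^ e := by
        rw [mul_assoc, ← Real.rpow_add hpp]
        congr 2
        rw [he]
        ring
  refine h1.trans ?_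
  have hx1 : ℓ / 2 * p ≤ ℓ * (2 * (p : ℝ) - 1) / 2 := by nlinarith
  have hx2 : ℓ * (2 * (p : ℝ) - 1) / 2 ≤ ℓ * p := by nlinarith
  have hx0 : 0 < ℓ / 2 * p := by positivity
  rcases le_total 0 e with h | h
  · calc c * (p : ℝ) ^ e ≤ (ℓ / 2) ^ e * (p : ℝ) ^ e := by
          gcongr
          exact min_le_right _ _
      _ = (ℓ / 2 * p) ^ e := (Real.mul_rpow (by positivity) hpp.le).symm
      _ ≤ _ := Real.rpow_le_rpow hx0.le hx1 h
  · calc c * (p : ℝ) ^ e ≤ ℓ ^ e * (p : ℝ) ^ e := by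
          gcongr
          exact min_le_left _ _
      _ = (ℓ * p) ^ e := (Real.mul_rpow hℓ.le hpp.le).symm
      _ ≤ _ := Real.rpow_le_rpow_of_nonpos (hx0.trans_le hx1) hx2 h

/-- The error estimate. -/
lemma exists_forall_error_le (hℓ : 0 < ℓ) (α β δ : ℝ) {γ T s ε : ℝ} (hγ : γ ≠ 0) (hT : 0 < T)
    (hs : 5 / 2 < s) (hε : 0 < ε) (M : ℝ)
    (hX : X = weightedSobolevNorm ∨ X = hardyWeightedSobolevNorm) :
    ∃ N : ℕ, ∀ p : ℕ, N ≤ p → ∀ u v : ℝ → ℝ → ℝ, IsClassicalSolution α β γ δ T u v →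
      normLinfty T (X s (2 * s)) u ≤ ENNReal.ofReal M →
      normLinfty T (X s (2 * s)) v ≤ ENNReal.ofReal M →
      (∃ ubar : ℝ → ℝ → ℝ, IsCollocationSolution ℓ p α β γ δ T (u 0) ubar) ∧
      ∀ ubar : ℝ → ℝ → ℝ, IsCollocationSolution ℓ p α β γ δ T (u 0) ubar →
        normLinfty T normL2 (fun t x => u t x - ubar t x) ≤
          ENNReal.ofReal ((ℓ * (2 * (p : ℝ) - 1) / 2) ^ (5 / 2 + ε - s)) *
            (X s (2 * s) (u 0) + normH1 T (X s (2 * s)) u v) := by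
  obtain ⟨hL, C₁, hC₁, hX'⟩ := exists_sum_rcoef_le hℓ (by linarith : 0 ≤ s) hX
  set M' := max M 0 with hM'
  have hM0 : 0 ≤ M' := le_max_right _ _
  obtain ⟨C, hC, N₁, hN₁⟩ := exists_error_bound hℓ α β δ hγ hT hs (mul_nonneg hC₁.le hM0)
  obtain ⟨N₂, hN₂⟩ := eventually_atTop.1
    (eventually_const_mul_rpow_le hℓ (s := s) hε (C * (2 * C₁)))
  refine ⟨max (max N₁ N₂) 1, fun p hp u v h hu hv => ?_⟩
  have hp1 : N₁ ≤ p := (le_max_left _ _).trans ((le_max_left _ _).trans hp)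
  have hp2 : N₂ ≤ p := (le_max_right _ _).trans ((le_max_left _ _).trans hp)
  have hp3 : 1 ≤ p := (le_max_right _ _).trans hp
  have hp0 : (1 : ℝ) ≤ p := by exact_mod_cast hp3
  have hMM : ENNReal.ofReal M ≤ ENNReal.ofReal M' := ENNReal.ofReal_le_ofReal (le_max_left _ _)
  obtain ⟨hcs, hvs⟩ := isCoefSolution_of_normLinfty_le hℓ hT (by linarith) hC₁ hM0 hL hX' h
    (hu.trans hMM) (hv.trans hMM)
  obtain ⟨hex, herr⟩ := hN₁ p hp1 u hcs
  refine ⟨hex, fun ubar hubar => ?_⟩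
  have hpos : 0 < (ℓ * (2 * (p : ℝ) - 1) / 2) ^ (5 / 2 + ε - s) :=
    Real.rpow_pos_of_pos (by nlinarith) _
  have hne : ENNReal.ofReal ((ℓ * (2 * (p : ℝ) - 1) / 2) ^ (5 / 2 + ε - s)) ≠ 0 := by
    rw [Ne, ENNReal.ofReal_eq_zero]
    linarith
  -- The norm of u(0) at the single time 0 need not be finite. If the right side is infinite there
  -- is nothing to prove, because the prefactor is positive.
  rcases eq_or_ne (X s (2 * s) (u 0) + normH1 T (X s (2 * s)) u v) ⊤ with htop | htop
  · rw [htop, ENNReal.mul_top hne]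
    exact le_top
  obtain ⟨h0, h1⟩ := ENNReal.add_ne_top.1 htop
  have hB := hasTimeBound_of_norms hC₁ hX' hu hv hvs h0 h1
  refine (herr ubar hubar _ _ (by positivity) (by positivity) hB).trans ?_
  set x := (X s (2 * s) (u 0)).toReal with hx
  set y := (normH1 T (X s (2 * s)) u v).toReal with hy
  have hx0 : 0 ≤ x := ENNReal.toReal_nonneg
  have hy0 : 0 ≤ y := ENNReal.toReal_nonneg
  have e : X s (2 * s) (u 0) + normH1 T (X s (2 * s)) u v = ENNReal.ofReal (x + y) := by
    rw [ENNReal.ofReal_add hx0 hy0, ENNReal.ofReal_toReal h0, ENNReal.ofReal_toReal h1]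
  rw [e, ← ENNReal.ofReal_mul hpos.le]
  refine ENNReal.ofReal_le_ofReal ?_
  have h2 : C₁ * x + Real.sqrt 2 * C₁ * y ≤ 2 * C₁ * (x + y) := by
    have h3 : Real.sqrt 2 ≤ 2 := by
      rw [Real.sqrt_le_iff]
      norm_num
    have h4 := mul_le_mul_of_nonneg_right h3 (mul_nonneg hC₁.le hy0)
    have h5 := mul_nonneg hC₁.le hx0
    linarith
  calc C * (p : ℝ) ^ (2 - s) * (C₁ * x + Real.sqrt 2 * C₁ * y)
      ≤ C * (p : ℝ) ^ (2 - s) * (2 * C₁ * (x + y)) := by gcongr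
    _ = C * (2 * C₁) * (p : ℝ) ^ (2 - s) * (x + y) := by ring
    _ ≤ _ := mul_le_mul_of_nonneg_right (hN₂ p hp2) (by positivity)

/-- Spectral convergence for smooth and decaying solutions. -/
lemma tendsto_pow_mul_error (hℓ : 0 < ℓ) {α β γ δ T : ℝ} (hγ : γ ≠ 0) (hT : 0 < T)
    (hX : X = weightedSobolevNorm ∨ X = hardyWeightedSobolevNorm) {u v : ℝ → ℝ → ℝ}
    (h : IsClassicalSolution α β γ δ T u v)
    (hfin : ∀ s : ℝ, 11 / 4 < s → normLinfty T (X s (2 * s)) u < ⊤ ∧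
      normLinfty T (X s (2 * s)) v < ⊤) {ubar : ℕ → ℝ → ℝ → ℝ}
    (hubar : ∀ᶠ p in atTop, IsCollocationSolution ℓ p α β γ δ T (u 0) (ubar p)) (k : ℕ) :
    Tendsto (fun p : ℕ => ENNReal.ofReal ((2 * (p : ℝ) - 1) ^ k) *
      normLinfty T normL2 (fun t x => u t x - ubar p t x)) atTop (𝓝 0) := by
  -- With this order the rate p^{2-s} gains exactly one power over n^k, as k + 2 - s = -1, and s ≥ 3
  -- > 11/4.
  set s : ℝ := k + 3 with hs
  have hk0 : (0 : ℝ) ≤ k := Nat.cast_nonneg k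
  obtain ⟨hu, hv⟩ := hfin s (by linarith)
  obtain ⟨hL, C₁, hC₁, hX'⟩ := exists_sum_rcoef_le hℓ (by linarith : 0 ≤ s) hX
  set M := max (normLinfty T (X s (2 * s)) u).toReal (normLinfty T (X s (2 * s)) v).toReal with hM
  have hM0 : 0 ≤ M := ENNReal.toReal_nonneg.trans (le_max_left _ _)
  have hu' : normLinfty T (X s (2 * s)) u ≤ ENNReal.ofReal M := by
    rw [← ENNReal.ofReal_toReal hu.ne]
    exact ENNReal.ofReal_le_ofReal (le_max_left _ _)
  have hv' : normLinfty T (X s (2 * s)) v ≤ ENNReal.ofReal M := by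
    rw [← ENNReal.ofReal_toReal hv.ne]
    exact ENNReal.ofReal_le_ofReal (le_max_right _ _)
  obtain ⟨C, hC, N, hN⟩ := exists_error_bound hℓ α β δ hγ hT (by linarith : 5 / 2 < s)
    (mul_nonneg hC₁.le hM0)
  obtain ⟨hcs, _⟩ := isCoefSolution_of_normLinfty_le hℓ hT (by linarith) hC₁ hM0 hL hX' h hu' hv'
  have hB := hcs.hasTimeBound hT.le (mul_nonneg hC₁.le hM0)
  set B := C₁ * M + Real.sqrt T * (C₁ * M) with hBdef
  have hB0 : 0 ≤ B := by positivity
  have hlim : Tendsto (fun p : ℕ => ENNReal.ofReal (2 ^ k * (C * B) * ((p : ℝ))⁻¹)) atTop (𝓝 0) := by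
    have h1 : Tendsto (fun p : ℕ => 2 ^ k * (C * B) * ((p : ℝ))⁻¹) atTop (𝓝 0) := by
      simpa using (tendsto_inv_atTop_zero.comp tendsto_natCast_atTop_atTop).const_mul (2 ^ k * (C * B))
    simpa using ENNReal.tendsto_ofReal h1
  refine tendsto_of_tendsto_of_tendsto_of_le_of_le' tendsto_const_nhds hlim
    (Eventually.of_forall fun _ => zero_le) ?_
  filter_upwards [hubar, eventually_ge_atTop N, eventually_ge_atTop 1] with p hp hpN hp1
  have hp0 : (1 : ℝ) ≤ p := by exact_mod_cast hp1
  have h2 := (hN p hpN u hcs).2 (ubar p) hp _ _ (by positivity) (by positivity) hB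
  calc _ ≤ ENNReal.ofReal ((2 * (p : ℝ) - 1) ^ k) * ENNReal.ofReal (C * (p : ℝ) ^ (2 - s) * B) := by
        gcongr
    _ = ENNReal.ofReal ((2 * (p : ℝ) - 1) ^ k * (C * (p : ℝ) ^ (2 - s) * B)) := by
        rw [← ENNReal.ofReal_mul (pow_nonneg (by linarith) k)]
    _ ≤ _ := by
        refine ENNReal.ofReal_le_ofReal ?_
        have e : (p : ℝ) ^ k * (p : ℝ) ^ (2 - s) = (p : ℝ)⁻¹ := by
          rw [← Real.rpow_natCast, ← Real.rpow_add (by linarith), ← Real.rpow_neg_one]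
          congr 1
          rw [hs]
          ring
        calc _ ≤ (2 * (p : ℝ)) ^ k * (C * (p : ℝ) ^ (2 - s) * B) := by
              refine mul_le_mul_of_nonneg_right ?_ (by positivity)
              exact pow_le_pow_left₀ (by linarith) (by linarith) k
          _ = 2 ^ k * (C * B) * ((p : ℝ) ^ k * (p : ℝ) ^ (2 - s)) := by ring
          _ = _ := by rw [e]

end norms

end Benjamin
end

theorem corollary4p8 (α β γ δ T : ℝ) (hγ : γ ≠ 0) (hT : 0 < T)
    (X : ℝ → ℝ → (ℝ → ℝ) → ℝ≥0∞)
    (hX : X = Benjamin.weightedSobolevNorm ∨ X = Benjamin.hardyWeightedSobolevNorm) :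
    (∀ s ε : ℝ, 11 / 4 < s → 0 < ε → ∀ M : ℝ, ∃ c : ℝ, 0 < c ∧
      ∀ ℓ : ℝ, 0 < ℓ → ∃ N : ℕ, ∀ p : ℕ, N ≤ p → ∀ u v : ℝ → ℝ → ℝ,
        Benjamin.IsClassicalSolution α β γ δ T u v →
        Benjamin.normLinfty T (X s (2 * s)) u ≤ ENNReal.ofReal M →
        Benjamin.normLinfty T (X s (2 * s)) v ≤ ENNReal.ofReal M →
        (∃ ubar : ℝ → ℝ → ℝ, Benjamin.IsCollocationSolution ℓ p α β γ δ T (u 0) ubar) ∧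
        ∀ ubar : ℝ → ℝ → ℝ, Benjamin.IsCollocationSolution ℓ p α β γ δ T (u 0) ubar →
          Benjamin.normLinfty T Benjamin.normL2 (fun t x => u t x - ubar t x) ≤
            ENNReal.ofReal (c * (ℓ * (2 * (p : ℝ) - 1) / 2) ^ (5 / 2 + ε - s)) *
              (X s (2 * s) (u 0) + X s (2 * s) (u 0) ^ (5 / 3 : ℝ)
                + Benjamin.normH1 T (X s (2 * s)) u v)) ∧
    (∀ u v : ℝ → ℝ → ℝ, Benjamin.IsClassicalSolution α β γ δ T u v →
      (∀ s : ℝ, 11 / 4 < s → Benjamin.normLinfty T (X s (2 * s)) u < ⊤ ∧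
        Benjamin.normLinfty T (X s (2 * s)) v < ⊤) →
      ∀ ℓ : ℝ, 0 < ℓ → ∀ ubar : ℕ → ℝ → ℝ → ℝ,
        (∀ᶠ p in atTop, Benjamin.IsCollocationSolution ℓ p α β γ δ T (u 0) (ubar p)) →
        ∀ k : ℕ, Tendsto
          (fun p : ℕ => ENNReal.ofReal ((2 * (p : ℝ) - 1) ^ k) *
            Benjamin.normLinfty T Benjamin.normL2 (fun t x => u t x - ubar p t x))
          atTop (𝓝 0)) := by
  -- The constant c = 1 is admissible since all constants have been absorbed into the threshold N,
  -- and the term with the power 5/3 is only added to a bound that already holds without it.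
  refine ⟨fun s ε hs hε M => ⟨1, one_pos, fun ℓ hℓ => ?_⟩, fun u v h hfin ℓ hℓ ubar hubar k =>
    Benjamin.tendsto_pow_mul_error hℓ hγ hT hX h hfin hubar k⟩
  obtain ⟨N, hN⟩ := Benjamin.exists_forall_error_le hℓ α β δ hγ hT (by linarith : 5 / 2 < s) hε M hX
  refine ⟨N, fun p hp u v h hu hv => ?_⟩
  obtain ⟨hex, herr⟩ := hN p hp u v h hu hv
  refine ⟨hex, fun ubar hubar => (herr ubar hubar).trans ?_⟩
  rw [one_mul]
  gcongr
  exact le_self_add
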